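/- **Setting.** Let $n\in\{1,2,3\}$, let $\Omega\subset\mathbb R^n$ be a bounded Lipschitz domain, $0\le r\le q$ integers, and let $K:\Omega\to\mathbb R^{n\times n}$ with $K_{ab}\in W^{r+1,\infty}(\Omega)$ be symmetric and uniformly positive definite: $\lambda_1(K)\ge\lambda>0$ and $|K_{ab}|\le B$ a.e. Put $|K|_{W^{r+1,\infty}(\Omega)}=\max_{a,b}|K_{ab}|_{W^{r+1,\infty}(\Omega)}$ and $a(u,v)=\int_\Omega\nabla u^\top K\nabla v\,dx$, $F(v)=\int_\Omega fv\,dx$ with $f\in L^2(\Omega)$. *Meshes.* A macro-mesh $\mathcal T_H$ is a conforming simplicial triangulation of $\overline\Omega$ (so $\overline\Omega$ is the union of the closed macro-elements $T$) with $H=\max_T H_T$, $H_T=\operatorname{diam}T$; it is shape regular with parameter $\kappa$ if each $T$ contains a ball of radius $H_T/\kappa$. For $m\ge 0$, $\mathcal S^m(\mathcal T_H)$ is the mesh obtained by subdividing each $T$ uniformly $m$ times (bisection for $n=1$, four congruent triangles for $n=2$, Bey's eight tetrahedra for $n=3$), and $h=2^{-m}H$. Its vertices are the points of the lattices $T_m$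 (points of $T$ with barycentric coordinates in $2^{-m}\mathbb Z$); $\mathring T_m$ denotes those in the interior of $T$, and $\partial\mathbb X_m$ the set of vertices lying on the boundary of some macro-element. Let $\phi_i$ be the continuous piecewise linear vertex functions and $V_h=\{v\in H^1_0(\Omega): v|_t\in\mathcal P_1(t)\ \forall t\in\mathcal S^m(\mathcal T_H)\}$. *Stencil functions.* For a macro-element $T$ with $\mathring T_m\ne\emptyset$ let $\mathscr D(\mathring T_m)$ be the set of all $x_j-x_i$ such that $x_i\in\mathring T_m$ and $x_i,x_j$ are vertices of a common element of $\mathcal S^m(T)$. Let $\phi(y)=\phi_i(y+x_i)$ for some $x_i\in\mathring T_m$, $\phi_\delta(y)=\phi(y-\delta)$, $\Omega_\delta=\{\phi\ne0\}\cap\{\phi_\delta\neq 0\}$, $T_\delta=\{x\in T: x+y\in T\ \forall y\in\Omega_\delta\}$, where $T$ is the open simplex, and $$\Phi^\delta_T(x)=\int_{\Omega_\delta}\nabla\phi_\delta(y)^\top K(x+y)\nabla\phi(y)\,dy,\qquad x\in\overline T_\delta .$$ Let $\Pi^\delta_T:C^0(\overline T_\delta)\to\mathcal P_q(T_\delta)$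 be linear projections onto the polynomials of degree at most $q$ with $\|\Pi^\delta_T g\|_{L^\infty(T_\delta)}\le c_\Pi\|g\|_{L^\infty(T_\delta)}$ for all $T,\delta$, and with $[\Pi^\delta_T\Phi^\delta_T](x)=[\Pi^{-\delta}_T\Phi^{-\delta}_T](x+\delta)$ for $x\in\overline T_\delta$. *Surrogate.* Write $A_{ij}=a(\phi_j,\phi_i)$ for all vertices $x_i,x_j$. For $i\neq j$ let $\tilde A_{ij}=A_{ij}$ if $x_i,x_j\in\partial\mathbb X_m$; $\tilde A_{ij}=[\Pi^\delta_T\Phi^\delta_T](x_i)$ if $x_i$ or $x_j$ lies in $\mathring T_m$ and $\delta=x_j-x_i\in\mathscr D(\mathring T_m)$; and $\tilde A_{ij}=0$ otherwise. The diagonal is fixed by the zero row sum property $\tilde A_{ii}=-\sum_{j\ne i,\,x_j\in\Omega}\tilde A_{ij}-\sum_{x_j\in\partial\Omega}A_{ij}$. Let $\tilde a$ be the bilinear form on $V_h$ with $\tilde a(\phi_j,\phi_i)=\tilde A_{ij}$ for vertices $x_i,x_j\in\Omega$. **Theorem.** There is a constant $C>0$, depending only on $n,\Omega,q,r,\kappa,c_\Pi,\lambda,B$,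 and, for each such $K$, a number $H_0>0$, depending only on these quantities and $K$, such that for every macro-mesh $\mathcal T_H$ that is shape regular with parameter $\kappa$ and has $H\le H_0$, every $m\ge0$, every family of projections as above and every $f\in L^2(\Omega)$, there is a unique $\tilde u_h\in V_h$ with $\tilde a(\tilde u_h,v)=F(v)$ for all $v\in V_h$. Moreover, if $u\in H^1_0(\Omega)$ is the solution of $a(u,v)=F(v)$ for all $v\in H^1_0(\Omega)$ and $u\in H^2(\Omega)$, then $$\|u-\tilde u_h\|_1\le C\left(h\,|u|_2+H^{r+1}|K|_{W^{r+1,\infty}(\Omega)}|u|_1\right).$$ -/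

import Mathlib

open MeasureTheory
open scoped ContDiff

noncomputable section

namespace SurrogateFEM

/-! ### Sobolev spaces on subsets of `ℝⁿ`, through weak derivatives -/

/-- Euclidean space `ℝⁿ`. -/
abbrev Pt (n : ℕ) : Type := EuclideanSpace ℝ (Fin n)

/-- `ϕ ∈ C_c^∞(Ω)`. -/
def IsTestFunction {n : ℕ} (Ω : Set (Pt n)) (ϕ : Pt n → ℝ) : Prop :=
  ContDiff ℝ ∞ ϕ ∧ HasCompactSupport ϕ ∧ tsupport ϕ ⊆ Ω

/-- The classical partial derivative `∂_{α 0} ⋯ ∂_{α (k-1)} ϕ` of order `k`. -/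
def partialDeriv {n k : ℕ} (α : Fin k → Fin n) (ϕ : Pt n → ℝ) (x : Pt n) : ℝ :=
  iteratedFDeriv ℝ k ϕ x (fun i => EuclideanSpace.single (α i) (1 : ℝ))

/-- `g` is the weak derivative `∂_{α 0} ⋯ ∂_{α (k-1)} v` on the open set `Ω`. -/
def HasWeakDeriv {n k : ℕ} (Ω : Set (Pt n)) (α : Fin k → Fin n) (v g : Pt n → ℝ) : Prop :=
  LocallyIntegrableOn v Ω ∧ LocallyIntegrableOn g Ω ∧
    ∀ ϕ : Pt n → ℝ, IsTestFunction Ω ϕ →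
      ∫ x in Ω, v x * partialDeriv α ϕ x = (-1) ^ k * ∫ x in Ω, g x * ϕ x

open scoped Classical in
/-- A representative of the weak derivative (unique almost everywhere in `Ω`);
`0` if there is none. -/
def weakDeriv {n k : ℕ} (Ω : Set (Pt n)) (α : Fin k → Fin n) (v : Pt n → ℝ) : Pt n → ℝ :=
  if h : ∃ g, HasWeakDeriv Ω α v g then h.choose else 0

/-- `v ∈ W^{k,p}(Ω)`: all weak derivatives of order at most `k` exist and lie in `L^p(Ω)`. -/
def MemSobolev {n : ℕ} (k : ℕ) (p : ENNReal) (Ω : Set (Pt n)) (v : Pt n → ℝ) : Prop :=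
  MemLp v p (volume.restrict Ω) ∧
    ∀ j ≤ k, ∀ α : Fin j → Fin n, ∃ g, HasWeakDeriv Ω α v g ∧ MemLp g p (volume.restrict Ω)

/-- The seminorm `|v|_k` of `H^k(Ω)`: the `L²(Ω)`-norm of the tensor of the weak derivatives
of order `k`. -/
def hSeminorm {n : ℕ} (k : ℕ) (Ω : Set (Pt n)) (v : Pt n → ℝ) : ℝ :=
  Real.sqrt (∑ α : Fin k → Fin n, ∫ x in Ω, weakDeriv Ω α v x ^ 2)

/-- The norm `‖v‖_1` of `H^1(Ω)`. -/
def h1Norm {n : ℕ} (Ω : Set (Pt n)) (v : Pt n → ℝ) : ℝ :=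
  Real.sqrt ((∫ x in Ω, v x ^ 2) + hSeminorm 1 Ω v ^ 2)

/-- `v ∈ H^1_0(Ω)`, the closure of `C_c^∞(Ω)` in `H^1(Ω)`. -/
def MemH10 {n : ℕ} (Ω : Set (Pt n)) (v : Pt n → ℝ) : Prop :=
  MemSobolev 1 2 Ω v ∧
    ∀ ε : ℝ, 0 < ε → ∃ ϕ, IsTestFunction Ω ϕ ∧ h1Norm Ω (fun x => v x - ϕ x) < ε

/-- The seminorm `|K|_{W^{k,∞}(Ω)}` of a tensor field: the maximum over the entries of `K` and
over the derivatives of order `k` of the `L^∞(Ω)`-norm. -/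
def tensorSeminorm {n : ℕ} (k : ℕ) (Ω : Set (Pt n)) (K : Pt n → Matrix (Fin n) (Fin n) ℝ) : ℝ :=
  ⨆ a : Fin n, ⨆ b : Fin n, ⨆ α : Fin k → Fin n,
    (eLpNorm (weakDeriv Ω α (fun x => K x a b)) ⊤ (volume.restrict Ω)).toReal

/-! ### The domain and the variational problem -/

/-- A bounded Lipschitz domain: a bounded connected open set that, near each of its boundary
points, lies above the graph of a Lipschitz function over a hyperplane `eᗮ`. -/
def IsBoundedLipschitzDomain {n : ℕ} (Ω : Set (Pt n)) : Prop :=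
  IsOpen Ω ∧ IsConnected Ω ∧ Bornology.IsBounded Ω ∧
    ∀ x ∈ frontier Ω, ∃ (e : Pt n) (L : NNReal) (γ : Pt n → ℝ) (ρ : ℝ),
      ‖e‖ = 1 ∧ LipschitzWith L γ ∧ 0 < ρ ∧
        ∀ y ∈ Metric.ball x ρ, (y ∈ Ω ↔ γ (y - inner ℝ e y • e) < inner ℝ e y)

/-- `∫_U ∇uᵀ K ∇v dx`, with weak gradients on `U`. -/
def energyForm {n : ℕ} (K : Pt n → Matrix (Fin n) (Fin n) ℝ) (U : Set (Pt n))
    (u v : Pt n → ℝ) : ℝ :=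
  ∫ x in U, ∑ a : Fin n, ∑ b : Fin n, weakDeriv U ![a] u x * K x a b * weakDeriv U ![b] v x

/-- `u ∈ H^1_0(Ω)` is the weak solution of `-div (K ∇u) = f` with zero boundary values. -/
def IsWeakSolution {n : ℕ} (Ω : Set (Pt n)) (K : Pt n → Matrix (Fin n) (Fin n) ℝ)
    (f u : Pt n → ℝ) : Prop :=
  MemH10 Ω u ∧ ∀ v, MemH10 Ω v → energyForm K Ω u v = ∫ x in Ω, f x * v x

/-! ### Simplices, macro-meshes and locally-structured meshes -/

/-- The list of the vertices `y₀, …, yₙ` of a simplex in `ℝⁿ`. -/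
abbrev Simp (n : ℕ) : Type := Fin (n + 1) → Pt n

/-- The closed simplex `[y₀, …, yₙ]`. -/
def hull {n : ℕ} (T : Simp n) : Set (Pt n) := convexHull ℝ (Set.range T)

/-- The open simplex. -/
def openHull {n : ℕ} (T : Simp n) : Set (Pt n) := interior (hull T)

/-- A conforming simplicial triangulation of `Ω` into disjoint (open) macro-simplices. -/
structure IsMacroMesh {n : ℕ} (Ω : Set (Pt n)) (M : Finset (Simp n)) : Prop where
  nondegenerate : ∀ T ∈ M, AffineIndependent ℝ T
  covers : closure Ω = ⋃ T ∈ M, hull T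
  disjoint : ∀ T ∈ M, ∀ T' ∈ M, T ≠ T' → Disjoint (openHull T) (openHull T')
  conforming : ∀ T ∈ M, ∀ T' ∈ M,
    hull T ∩ hull T' = convexHull ℝ (Set.range T ∩ Set.range T')

/-- The mesh size `H = max_T H_T`, where `H_T = diam T`. -/
def meshSize {n : ℕ} (M : Finset (Simp n)) : ℝ := ⨆ T : M, Metric.diam (hull T.1)

/-- Shape regularity with parameter `κ`: each `T` contains a ball of radius `H_T / κ`. -/
def ShapeRegular {n : ℕ} (κ : ℝ) (M : Finset (Simp n)) : Prop :=
  0 < κ ∧ ∀ T ∈ M, ∃ c, Metric.closedBall c (Metric.diam (hull T) / κ) ⊆ hull T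

/-- The children of `[y₀, …, yₙ]` under uniform subdivision, indexed by the subsets `s` of
`{0, …, n-1}`. The child of `s` has the vertices `(y_{a i} + y_{b i}) / 2` for `i = 0, …, n`,
where `(a 0, b 0) = (0, #s)` and in the step from `i` to `i + 1` the index `a` increases by one
if `i ∈ s`, and the index `b` increases by one if `i ∉ s`.

With `y_{ab} = (y_a + y_b) / 2`, for `n = 2` these are the four congruent triangles
`[y₀, y₀₁, y₀₂]`, `[y₀₁, y₁, y₁₂]`, `[y₀₁, y₀₂, y₁₂]`, `[y₀₂, y₁₂, y₂]`, and for `n = 3` they are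
the eight tetrahedra of Bey's regular refinement, with the interior octahedron cut along
`y₀₂ y₁₃`; see `child_two` and `child_three`. -/
def child {n : ℕ} (t : Simp n) (s : Finset (Fin n)) : Simp n := fun i =>
  midpoint ℝ
    (t ⟨(s.filter (fun j => j.1 < i.1)).card, Nat.lt_succ_of_le
      ((Finset.card_filter_le _ _).trans (card_finset_fin_le s))⟩)
    (t ⟨s.card + (sᶜ.filter (fun j => j.1 < i.1)).card, Nat.lt_succ_of_le
      ((Nat.add_le_add_left (Finset.card_filter_le _ _) _).trans
        (by simp [Finset.card_add_card_compl]))⟩)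

theorem child_two (t : Simp 2) :
    child t ∅ = ![t 0, midpoint ℝ (t 0) (t 1), midpoint ℝ (t 0) (t 2)] ∧
    child t {0} = ![midpoint ℝ (t 0) (t 1), t 1, midpoint ℝ (t 1) (t 2)] ∧
    child t {1} = ![midpoint ℝ (t 0) (t 1), midpoint ℝ (t 0) (t 2), midpoint ℝ (t 1) (t 2)] ∧
    child t {0, 1} = ![midpoint ℝ (t 0) (t 2), midpoint ℝ (t 1) (t 2), t 2] := by
  refine ⟨?_, ?_, ?_, ?_⟩ <;> funext i <;> fin_cases i <;>
    first
    | exact congrArg₂ (midpoint ℝ) (congrArg t (by decide)) (congrArg t (by decide))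
    | exact (congrArg₂ (midpoint ℝ) (congrArg t (by decide)) (congrArg t (by decide))).trans
        (midpoint_self ℝ _)

theorem child_three (t : Simp 3) :
    child t ∅ = ![t 0, midpoint ℝ (t 0) (t 1), midpoint ℝ (t 0) (t 2), midpoint ℝ (t 0) (t 3)] ∧
    child t {0} = ![midpoint ℝ (t 0) (t 1), t 1, midpoint ℝ (t 1) (t 2), midpoint ℝ (t 1) (t 3)] ∧
    child t {0, 1} =
      ![midpoint ℝ (t 0) (t 2), midpoint ℝ (t 1) (t 2), t 2, midpoint ℝ (t 2) (t 3)] ∧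
    child t {0, 1, 2} =
      ![midpoint ℝ (t 0) (t 3), midpoint ℝ (t 1) (t 3), midpoint ℝ (t 2) (t 3), t 3] ∧
    child t {2} = ![midpoint ℝ (t 0) (t 1), midpoint ℝ (t 0) (t 2), midpoint ℝ (t 0) (t 3),
      midpoint ℝ (t 1) (t 3)] ∧
    child t {1} = ![midpoint ℝ (t 0) (t 1), midpoint ℝ (t 0) (t 2), midpoint ℝ (t 1) (t 2),
      midpoint ℝ (t 1) (t 3)] ∧
    child t {1, 2} = ![midpoint ℝ (t 0) (t 2), midpoint ℝ (t 0) (t 3), midpoint ℝ (t 1) (t 3),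
      midpoint ℝ (t 2) (t 3)] ∧
    child t {0, 2} = ![midpoint ℝ (t 0) (t 2), midpoint ℝ (t 1) (t 2), midpoint ℝ (t 1) (t 3),
      midpoint ℝ (t 2) (t 3)] := by
  refine ⟨?_, ?_, ?_, ?_, ?_, ?_, ?_, ?_⟩ <;> funext i <;> fin_cases i <;>
    first
    | exact congrArg₂ (midpoint ℝ) (congrArg t (by decide)) (congrArg t (by decide))
    | exact (congrArg₂ (midpoint ℝ) (congrArg t (by decide)) (congrArg t (by decide))).trans
        (midpoint_self ℝ _)

/-- The `m`-fold uniform subdivision `𝒮^m(T)` of a single simplex. -/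
def subdivision {n : ℕ} (T : Simp n) : ℕ → Set (Simp n)
  | 0 => {T}
  | m + 1 => ⋃ t ∈ subdivision T m, Set.range (child t)

/-- The locally-structured mesh `𝒮^m(M)`. -/
def fineMesh {n : ℕ} (M : Finset (Simp n)) (m : ℕ) : Set (Simp n) :=
  ⋃ T ∈ M, subdivision T m

open scoped Classical in
/-- The simplicial lattice `T_m`: the points of `T` with barycentric coordinates in
`2^{-m} ℤ`. -/
def lattice {n : ℕ} (T : Simp n) (m : ℕ) : Finset (Pt n) :=
  (Finset.piAntidiag (Finset.univ : Finset (Fin (n + 1))) (2 ^ m)).image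
    (fun a : Fin (n + 1) → ℕ => ∑ k, ((a k : ℝ) / 2 ^ m) • T k)

/-- The interior lattice points of `T`. -/
def intLattice {n : ℕ} (T : Simp n) (m : ℕ) : Set (Pt n) := {x | x ∈ lattice T m ∧ x ∈ openHull T}

open scoped Classical in
/-- The set `𝕏_m` of all vertices of level `m`. -/
def vertices {n : ℕ} (M : Finset (Simp n)) (m : ℕ) : Finset (Pt n) :=
  M.biUnion (fun T => lattice T m)

open scoped Classical in
/-- The vertices in the interior of `Ω`; they enumerate the basis of `V_h`. -/
def dofs {n : ℕ} (Ω : Set (Pt n)) (M : Finset (Simp n)) (m : ℕ) : Finset (Pt n) :=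
  (vertices M m).filter (fun x => x ∈ Ω)

/-- The set `∂𝕏_m` of the vertices on the boundaries of the macro-elements. -/
def bdryVertices {n : ℕ} (M : Finset (Simp n)) (m : ℕ) : Set (Pt n) :=
  {x | ∃ T ∈ M, x ∈ lattice T m ∧ x ∉ openHull T}

/-! ### The finite element space and the vertex functions -/

open scoped Classical in
/-- The barycentric coordinate of `x` with respect to the `k`-th vertex of `t`. -/
def bary {n : ℕ} (t : Simp n) (k : Fin (n + 1)) (x : Pt n) : ℝ :=
  if h : AffineIndependent ℝ t then
    (⟨t, h, h.affineSpan_eq_top_iff_card_eq_finrank_add_one.2 (by simp)⟩ :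
      AffineBasis (Fin (n + 1)) ℝ (Pt n)).coord k x
  else 0

/-- The vertex function `φ_p` of `𝒮^m(M)`: on each fine element with vertex `p` it is the
barycentric coordinate that belongs to `p`, elsewhere it is `0`. (The set below is empty or,
by conformity, has just one element.) -/
def hat {n : ℕ} (M : Finset (Simp n)) (m : ℕ) (p x : Pt n) : ℝ :=
  sSup {y : ℝ | ∃ t ∈ fineMesh M m, ∃ k, t k = p ∧ x ∈ hull t ∧ y = bary t k x}

/-- `v ∈ V_h`: `v` lies in `H^1_0(Ω)` and is affine on each fine element. Elements of `V_h` are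
represented by continuous functions, extended by zero outside `Ω`. -/
def MemVh {n : ℕ} (Ω : Set (Pt n)) (M : Finset (Simp n)) (m : ℕ) (v : Pt n → ℝ) : Prop :=
  MemH10 Ω v ∧ Continuous v ∧ (∀ x, x ∉ Ω → v x = 0) ∧
    ∀ t ∈ fineMesh M m, ∃ A : Pt n →ᵃ[ℝ] ℝ, ∀ x ∈ hull t, v x = A x

/-- The true stiffness matrix, with rows and columns enumerated by all vertices:
`A_ij = a(φ_j, φ_i)`. -/
def stiffness {n : ℕ} (Ω : Set (Pt n)) (K : Pt n → Matrix (Fin n) (Fin n) ℝ)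
    (M : Finset (Simp n)) (m : ℕ) (xi xj : Pt n) : ℝ :=
  energyForm K Ω (hat M m xj) (hat M m xi)

/-! ### Stencil functions and the surrogate stiffness matrix -/

/-- The set `𝒟` of translations of `T`: all `x_j - x_i` with `x_i` an interior lattice point
of `T` and `x_j` a vertex of a fine element that has `x_i` as a vertex. -/
def translations {n : ℕ} (T : Simp n) (m : ℕ) : Set (Pt n) :=
  {δ | ∃ t ∈ subdivision T m, ∃ k l, t k ∈ intLattice T m ∧ δ = t l - t k}

open scoped Classical in
/-- The test function `φ` of `T`, that is the vertex function of an arbitrary interior lattice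
point of `T`, shifted to the origin. -/
def refHat {n : ℕ} (M : Finset (Simp n)) (m : ℕ) (T : Simp n) : Pt n → ℝ :=
  if h : (intLattice T m).Nonempty then fun y => hat M m h.choose (y + h.choose) else 0

/-- The shifted test function `φ_δ`. -/
def refHatShift {n : ℕ} (M : Finset (Simp n)) (m : ℕ) (T : Simp n) (δ : Pt n) : Pt n → ℝ :=
  fun y => refHat M m T (y - δ)

/-- `Ω_δ = supp φ ∩ supp φ_δ`. -/
def stencilSupport {n : ℕ} (M : Finset (Simp n)) (m : ℕ) (T : Simp n) (δ : Pt n) : Set (Pt n) :=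
  {y | refHat M m T y ≠ 0 ∧ refHatShift M m T δ y ≠ 0}

/-- `T_δ = {x ∈ T : x + y ∈ T for all y ∈ Ω_δ}`, with `T` the open simplex. -/
def stencilDomain {n : ℕ} (M : Finset (Simp n)) (m : ℕ) (T : Simp n) (δ : Pt n) : Set (Pt n) :=
  {x | x ∈ openHull T ∧ ∀ y ∈ stencilSupport M m T δ, x + y ∈ openHull T}

/-- The local stencil function
`Φ_T^δ(x) = ∫_{Ω_δ} ∇φ_δ(y)ᵀ K(x + y) ∇φ(y) dy`. -/
def stencil {n : ℕ} (K : Pt n → Matrix (Fin n) (Fin n) ℝ) (M : Finset (Simp n)) (m : ℕ)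
    (T : Simp n) (δ x : Pt n) : ℝ :=
  energyForm (fun y => K (x + y)) (stencilSupport M m T δ) (refHatShift M m T δ) (refHat M m T)

/-- `P` is a linear projection of `C⁰(S)` onto the polynomials of degree at most `q` on `S` that
is continuous in the maximum norm, with constant `c`. -/
structure IsPolyProjection {n : ℕ} (q : ℕ) (c : ℝ) (S : Set (Pt n))
    (P : (Pt n → ℝ) → (Pt n → ℝ)) : Prop where
  map_poly : ∀ g, ContinuousOn g S → ∃ p : MvPolynomial (Fin n) ℝ, p.totalDegree ≤ q ∧
    ∀ x ∈ S, P g x = MvPolynomial.eval (fun a => x a) p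
  map_add : ∀ g g', ContinuousOn g S → ContinuousOn g' S →
    ∀ x ∈ S, P (fun y => g y + g' y) x = P g x + P g' x
  map_smul : ∀ (s : ℝ) (g), ContinuousOn g S → ∀ x ∈ S, P (fun y => s * g y) x = s * P g x
  proj : ∀ p : MvPolynomial (Fin n) ℝ, p.totalDegree ≤ q →
    ∀ x ∈ S, P (fun y => MvPolynomial.eval (fun a => y a) p) x = MvPolynomial.eval (fun a => x a) p
  bound : ∀ g, ContinuousOn g S → ∀ B : ℝ, (∀ x ∈ S, |g x| ≤ B) → ∀ x ∈ S, |P g x| ≤ c * B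

/-- An admissible family `P T δ = Π_T^δ` of projections of the stencil functions: each is a
projection on `C⁰(closure T_δ)` with continuity constant `c`, and those of opposite directions are
related by `[Π^δ Φ^δ](x) = [Π^{-δ} Φ^{-δ}](x + δ)`. -/
def IsProjectionFamily {n : ℕ} (q : ℕ) (c : ℝ) (K : Pt n → Matrix (Fin n) (Fin n) ℝ)
    (M : Finset (Simp n)) (m : ℕ) (P : Simp n → Pt n → (Pt n → ℝ) → (Pt n → ℝ)) : Prop :=
  ∀ T ∈ M, ∀ δ ∈ translations T m,
    IsPolyProjection q c (closure (stencilDomain M m T δ)) (P T δ) ∧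
    ∀ x ∈ closure (stencilDomain M m T δ),
      P T δ (stencil K M m T δ) x = P T (-δ) (stencil K M m T (-δ)) (x + δ)

open scoped Classical in
/-- The off-diagonal entries of the surrogate matrix. If both vertices lie on boundaries of
macro-elements, the true entry is kept. If one of them is interior to the macro-element `T` and
they differ by a translation `δ` of `T`, the entry is `[Π_T^δ Φ_T^δ](x_i)`. All other entries are
zero. (At most one term of the sum is nonzero.) -/
def surrogateOffDiag {n : ℕ} (Ω : Set (Pt n)) (K : Pt n → Matrix (Fin n) (Fin n) ℝ)
    (M : Finset (Simp n)) (m : ℕ) (P : Simp n → Pt n → (Pt n → ℝ) → (Pt n → ℝ))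
    (xi xj : Pt n) : ℝ :=
  if xi ∈ bdryVertices M m ∧ xj ∈ bdryVertices M m then stiffness Ω K M m xi xj
  else ∑ T ∈ M,
    if (xi ∈ intLattice T m ∨ xj ∈ intLattice T m) ∧ xj - xi ∈ translations T m then
      P T (xj - xi) (stencil K M m T (xj - xi)) xi
    else 0

open scoped Classical in
/-- The surrogate stiffness matrix with the zero row sum property: the diagonal entry is minus the
sum of the other entries of the row extended to all vertices, where the entries of the columns
that belong to vertices on `∂Ω` are the true ones. -/
def surrogate {n : ℕ} (Ω : Set (Pt n)) (K : Pt n → Matrix (Fin n) (Fin n) ℝ)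
    (M : Finset (Simp n)) (m : ℕ) (P : Simp n → Pt n → (Pt n → ℝ) → (Pt n → ℝ))
    (xi xj : Pt n) : ℝ :=
  if xi = xj then
    - ∑ y ∈ (vertices M m).erase xi,
        if y ∈ Ω then surrogateOffDiag Ω K M m P xi y else stiffness Ω K M m xi y
  else surrogateOffDiag Ω K M m P xi xj

/-- The surrogate bilinear form `ã` on `V_h`: `ã(φ_j, φ_i)` is the `(i, j)` entry of the surrogate
matrix. -/
def surrogateForm {n : ℕ} (Ω : Set (Pt n)) (K : Pt n → Matrix (Fin n) (Fin n) ℝ)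
    (M : Finset (Simp n)) (m : ℕ) (P : Simp n → Pt n → (Pt n → ℝ) → (Pt n → ℝ))
    (v w : Pt n → ℝ) : ℝ :=
  ∑ xi ∈ dofs Ω M m, ∑ xj ∈ dofs Ω M m, surrogate Ω K M m P xi xj * v xj * w xi

/-- `ũ ∈ V_h` solves the surrogate problem `ã(ũ, v) = F(v)` for all `v ∈ V_h`. -/
def IsSurrogateSolution {n : ℕ} (Ω : Set (Pt n)) (K : Pt n → Matrix (Fin n) (Fin n) ℝ)
    (M : Finset (Simp n)) (m : ℕ) (P : Simp n → Pt n → (Pt n → ℝ) → (Pt n → ℝ))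
    (f ut : Pt n → ℝ) : Prop :=
  MemVh Ω M m ut ∧
    ∀ v, MemVh Ω M m v → surrogateForm Ω K M m P ut v = ∫ x in Ω, f x * v x

/-- The coefficient is bounded by `B`, symmetric, and uniformly positive definite with smallest
eigenvalue at least `lam`, almost everywhere in `Ω`. -/
def IsEllipticTensor {n : ℕ} (lam B : ℝ) (Ω : Set (Pt n))
    (K : Pt n → Matrix (Fin n) (Fin n) ℝ) : Prop :=
  ∀ᵐ x ∂(volume.restrict Ω), (K x).IsSymm ∧ (∀ a b, |K x a b| ≤ B) ∧
    ∀ ξ : Fin n → ℝ, lam * (∑ a, ξ a ^ 2) ≤ ∑ a, ∑ b, ξ a * K x a b * ξ b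

end SurrogateFEM

end

open MeasureTheory SurrogateFEM

/-! The surrogate form is a small, still coercive perturbation of the energy, and the estimate is
Strang's lemma. Let `D` be the difference between the off-diagonal surrogate entries and the
stiffness entries. Both matrices have zero row sums over all vertices, with the same true entries in
the boundary columns, and both are symmetric, the surrogate one because the projections for `δ` and
`-δ` are linked. Summation by parts therefore gives ã(v,w) - a(v,w) = ½ ∑ D_xy (v_y - v_x)(w_x -
w_y) (`surrogateForm_eq`, `abs_surrogateForm_sub_le`).

Each nonzero D_xy is a projection error. A stiffness entry with a vertex inside `T` is a value of
the stencil function, and Φ(x) = ∫ K(x+y) G(y) dy inherits from K a Taylor polynomial of degree r,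
so |D_xy| ≤ C H^(r+1) |K| ∫ |∇φ_x| |∇φ_y| (`abs_proj_stencil_sub_le`). Keeping this integral avoids
negative powers of h: on a common fine element |v_y - v_x| is at most diameter times gradient, and
diameter times |∇φ| is bounded by shape regularity. Summation over pairs with bounded overlap yields
|ã - a| ≤ C H^(r+1) |K| |v|_1 |w|_1. Once that factor is at most λ/2, ã is coercive
(`surrogateForm_coercive`), so the linear system is uniquely solvable, and
`gradNorm_sub_surrogateSolution_le` reduces the error to the best approximation error plus the
perturbation. Poincaré's inequality turns gradient bounds into H¹ bounds.

The geometry rests on Kuhn triangulations. In the coordinates along the path T 0, T 1, …, T n, every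
simplex of the m-fold subdivision is a unit cube corner plus a permutation, scaled by 2^(-m), and a
vertex function is max(0, 1 - gauge) with a gauge built from interval sums of barycentric
differences (`gauge'_relBary_vertex`, `hat_eq`). The formula is translation invariant, which is why
interior rows are stencils. The gauge depends on the order of the vertices, but on a face with at
most three vertices it is the maximum norm, so for n ≤ 3 the fine meshes of neighbouring
macro-elements match whatever their orderings (`gauge'_face_eq`).

The interpolant of u ∈ H² ∩ H¹₀ is built without pointwise values of u. Smooth approximations on an
element, obtained by averaging towards the interior of a convex set (`exists_smooth_approx`), have
bounded values at the vertices, and a subsequence of these values converges (`exists_nodal_values`).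
The limits are mean-square values of u along cones with apex at the vertex. Such cone values are
unique for H¹₀ functions whose gradient concentrates little at the apex (`IsConeValue.eq`), so
different elements produce the same nodal value, and an exterior cone of the Lipschitz domain forces
the value 0 on the boundary (`exists_interpolant`). -/

namespace SurrogateFEM
open Set Filter Topology

/-! ### Calculus of weak derivatives. -/

section WeakDerivatives

variable {n k : ℕ}

/-- The `a`-th coordinate vector. -/
noncomputable abbrev basisVec (a : Fin n) : Pt n := EuclideanSpace.single a (1 : ℝ)

theorem partialDeriv_zero (α : Fin 0 → Fin n) (ϕ : Pt n → ℝ) : partialDeriv α ϕ = ϕ := by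
  funext x; simp [partialDeriv]

theorem partialDeriv_succ (α : Fin (k + 1) → Fin n) {ϕ : Pt n → ℝ} (hϕ : ContDiff ℝ ∞ ϕ)
    (x : Pt n) :
    partialDeriv α ϕ x = fderiv ℝ (partialDeriv (Fin.tail α) ϕ) x (basisVec (α 0)) := by
  have hd : DifferentiableAt ℝ (iteratedFDeriv ℝ k ϕ) x :=
    (hϕ.differentiable_iteratedFDeriv (by exact_mod_cast WithTop.coe_lt_top k)) x
  unfold partialDeriv
  rw [iteratedFDeriv_succ_apply_left]
  have := (ContinuousMultilinearMap.apply ℝ (fun _ : Fin k => Pt n) ℝ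
    (fun i => basisVec (Fin.tail α i))).hasFDerivAt.comp x hd.hasFDerivAt
  have h2 := this.fderiv
  simp only [Function.comp_def, ContinuousMultilinearMap.apply_apply] at h2
  rw [h2]
  rfl

theorem partialDeriv_one (a : Fin n) (ϕ : Pt n → ℝ) (x : Pt n) :
    partialDeriv ![a] ϕ x = fderiv ℝ ϕ x (basisVec a) := by
  simp [partialDeriv, iteratedFDeriv_one_apply]

theorem partialDeriv_two (a b : Fin n) (ϕ : Pt n → ℝ) (x : Pt n) :
    partialDeriv ![a, b] ϕ x = fderiv ℝ (fderiv ℝ ϕ) x (basisVec a) (basisVec b) := by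
  simp [partialDeriv, iteratedFDeriv_two_apply]

theorem contDiff_partialDeriv (α : Fin k → Fin n) {ϕ : Pt n → ℝ} (hϕ : ContDiff ℝ ∞ ϕ) :
    ContDiff ℝ ∞ (partialDeriv α ϕ) := by
  have h : ContDiff ℝ ∞ (iteratedFDeriv ℝ k ϕ) := hϕ.iteratedFDeriv_right (by
    exact le_of_eq (by rfl))
  exact (ContinuousMultilinearMap.apply ℝ (fun _ : Fin k => Pt n) ℝ
    (fun i => basisVec (α i))).contDiff.comp h

theorem tsupport_partialDeriv_subset (α : Fin k → Fin n) (ϕ : Pt n → ℝ) :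
    tsupport (partialDeriv α ϕ) ⊆ tsupport ϕ := by
  refine closure_minimal (fun x hx => ?_) (isClosed_tsupport _)
  refine tsupport_iteratedFDeriv_subset (𝕜 := ℝ) k (subset_tsupport _ ?_)
  intro h
  exact hx (by simp [partialDeriv, h])

theorem IsTestFunction.integrable_mul {U : Set (Pt n)} {ϕ v : Pt n → ℝ}
    (hϕ : Continuous ϕ) (hc : HasCompactSupport ϕ) (hs : tsupport ϕ ⊆ U)
    (hv : LocallyIntegrableOn v U) : Integrable (fun x => v x * ϕ x) := by
  have h1 : IntegrableOn v (tsupport ϕ) := hv.integrableOn_compact_subset hs hc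
  have h2 : IntegrableOn (fun x => v x * ϕ x) (tsupport ϕ) :=
    h1.mul_continuousOn hϕ.continuousOn hc
  refine (integrableOn_iff_integrable_of_support_subset ?_).1 h2
  intro x hx
  exact subset_tsupport _ (fun h => hx (by simp [h]))

theorem setIntegral_mul_of_tsupport_subset {U : Set (Pt n)} {ϕ v : Pt n → ℝ}
    (hs : tsupport ϕ ⊆ U) : ∫ x in U, v x * ϕ x = ∫ x, v x * ϕ x := by
  refine setIntegral_eq_integral_of_forall_compl_eq_zero fun x hx => ?_
  have : ϕ x = 0 := image_eq_zero_of_notMem_tsupport (fun h => hx (hs h))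
  simp [this]

theorem HasWeakDeriv.ae_unique {U : Set (Pt n)} (hU : IsOpen U) {α : Fin k → Fin n}
    {v g g' : Pt n → ℝ} (h : HasWeakDeriv U α v g) (h' : HasWeakDeriv U α v g') :
    g =ᵐ[volume.restrict U] g' := by
  have key : ∀ᵐ x ∂(volume : Measure (Pt n)), x ∈ U → (g - g') x = 0 := by
    refine hU.ae_eq_zero_of_integral_contDiff_smul_eq_zero (h.2.1.sub h'.2.1) ?_
    intro ϕ h1 h2 h3
    have e1 := h.2.2 ϕ ⟨h1, h2, h3⟩
    have e2 := h'.2.2 ϕ ⟨h1, h2, h3⟩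
    have e3 : ∫ x in U, g x * ϕ x = ∫ x in U, g' x * ϕ x :=
      mul_left_cancel₀ (pow_ne_zero k (by norm_num : (-1 : ℝ) ≠ 0)) (e1.symm.trans e2)
    rw [setIntegral_mul_of_tsupport_subset h3, setIntegral_mul_of_tsupport_subset h3] at e3
    have e4 : ∫ x, (g x * ϕ x - g' x * ϕ x) = 0 := by
      rw [integral_sub (IsTestFunction.integrable_mul h1.continuous h2 h3 h.2.1)
        (IsTestFunction.integrable_mul h1.continuous h2 h3 h'.2.1), e3, sub_self]
    rw [← e4]
    congr 1; funext x; simp; ring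
  rw [Filter.EventuallyEq, ae_restrict_iff' hU.measurableSet]
  filter_upwards [key] with x hx hxU
  have := hx hxU
  simpa [sub_eq_zero] using this

theorem weakDeriv_spec {U : Set (Pt n)} {α : Fin k → Fin n} {v : Pt n → ℝ}
    (h : ∃ g, HasWeakDeriv U α v g) : HasWeakDeriv U α v (weakDeriv U α v) := by
  unfold weakDeriv; rw [dif_pos h]; exact h.choose_spec

theorem HasWeakDeriv.weakDeriv_ae {U : Set (Pt n)} (hU : IsOpen U) {α : Fin k → Fin n}
    {v g : Pt n → ℝ} (h : HasWeakDeriv U α v g) :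
    weakDeriv U α v =ᵐ[volume.restrict U] g :=
  (weakDeriv_spec ⟨g, h⟩).ae_unique hU h

theorem HasWeakDeriv.mono {U V : Set (Pt n)} (hVU : V ⊆ U) {α : Fin k → Fin n}
    {v g : Pt n → ℝ} (h : HasWeakDeriv U α v g) : HasWeakDeriv V α v g := by
  refine ⟨h.1.mono_set hVU, h.2.1.mono_set hVU, fun ϕ hϕ => ?_⟩
  have hd := (tsupport_partialDeriv_subset α ϕ).trans hϕ.2.2
  have := h.2.2 ϕ ⟨hϕ.1, hϕ.2.1, hϕ.2.2.trans hVU⟩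
  rwa [setIntegral_mul_of_tsupport_subset (hd.trans hVU),
    setIntegral_mul_of_tsupport_subset (hϕ.2.2.trans hVU),
    ← setIntegral_mul_of_tsupport_subset hd, ← setIntegral_mul_of_tsupport_subset hϕ.2.2] at this

theorem HasWeakDeriv.lincomb {U : Set (Pt n)} {α : Fin k → Fin n}
    {v g v' g' : Pt n → ℝ} (h : HasWeakDeriv U α v g) (h' : HasWeakDeriv U α v' g') (c c' : ℝ) :
    HasWeakDeriv U α (fun x => c * v x + c' * v' x) (fun x => c * g x + c' * g' x) := by
  refine ⟨(h.1.smul c).add (h'.1.smul c'), (h.2.1.smul c).add (h'.2.1.smul c'), fun ϕ hϕ => ?_⟩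
  have hd := (tsupport_partialDeriv_subset α ϕ).trans hϕ.2.2
  have hdc : Continuous (partialDeriv α ϕ) := (contDiff_partialDeriv α hϕ.1).continuous
  have hdk : HasCompactSupport (partialDeriv α ϕ) :=
    hϕ.2.1.mono' ((subset_tsupport _).trans (tsupport_partialDeriv_subset α ϕ))
  have e1 := h.2.2 ϕ hϕ
  have e2 := h'.2.2 ϕ hϕ
  rw [setIntegral_mul_of_tsupport_subset hd, setIntegral_mul_of_tsupport_subset hϕ.2.2] at e1 e2 ⊢
  have split : ∀ (w w' χ : Pt n → ℝ), Continuous χ → HasCompactSupport χ → tsupport χ ⊆ U →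
      LocallyIntegrableOn w U → LocallyIntegrableOn w' U →
      ∫ x, (c * w x + c' * w' x) * χ x = c * (∫ x, w x * χ x) + c' * ∫ x, w' x * χ x := by
    intro w w' χ c1 c2 c3 hw hw'
    rw [← integral_const_mul, ← integral_const_mul, ← integral_add]
    · congr 1; funext x; ring
    · exact (IsTestFunction.integrable_mul c1 c2 c3 hw).const_mul c
    · exact (IsTestFunction.integrable_mul c1 c2 c3 hw').const_mul c'
  rw [split _ _ _ hdc hdk hd h.1 h'.1, split _ _ _ hϕ.1.continuous hϕ.2.1 hϕ.2.2 h.2.1 h'.2.1,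
    e1, e2]
  ring

theorem HasWeakDeriv.sub {U : Set (Pt n)} {α : Fin k → Fin n}
    {v g v' g' : Pt n → ℝ} (h : HasWeakDeriv U α v g) (h' : HasWeakDeriv U α v' g') :
    HasWeakDeriv U α (fun x => v x - v' x) (fun x => g x - g' x) := by
  have := h.lincomb h' 1 (-1)
  convert this using 2 <;> ring

theorem hasWeakDeriv_zero (U : Set (Pt n)) (α : Fin k → Fin n) :
    HasWeakDeriv U α (fun _ => 0) (fun _ => 0) := by
  refine ⟨locallyIntegrableOn_zero, locallyIntegrableOn_zero, fun ϕ _ => by simp⟩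

theorem HasWeakDeriv.sum {U : Set (Pt n)} {α : Fin k → Fin n} {ι : Type*} (s : Finset ι)
    {v g : ι → Pt n → ℝ} (c : ι → ℝ) (h : ∀ i ∈ s, HasWeakDeriv U α (v i) (g i)) :
    HasWeakDeriv U α (fun x => ∑ i ∈ s, c i * v i x) (fun x => ∑ i ∈ s, c i * g i x) := by
  classical
  induction s using Finset.induction_on with
  | empty => simpa using hasWeakDeriv_zero U α
  | insert i s his ih =>
    have := (h i (Finset.mem_insert_self _ _)).lincomb
      (ih fun j hj => h j (Finset.mem_insert_of_mem hj)) (c i) 1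
    simpa [Finset.sum_insert his] using this

theorem hasWeakDeriv_of_order_zero {U : Set (Pt n)} (α : Fin 0 → Fin n) {v : Pt n → ℝ}
    (hv : LocallyIntegrableOn v U) : HasWeakDeriv U α v v :=
  ⟨hv, hv, fun ϕ _ => by simp [partialDeriv_zero]⟩

/-- A function that is locally Lipschitz on an open set is weakly differentiable there, and the
weak derivatives are the pointwise ones. -/
theorem hasWeakDeriv_of_locallyLipschitzOn {U : Set (Pt n)} (hU : IsOpen U) {v : Pt n → ℝ}
    (hv : LocallyLipschitzOn U v) (a : Fin n) :
    HasWeakDeriv U ![a] v (fun x => fderiv ℝ v x (basisVec a)) := by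
  -- Compactness turns local Lipschitz bounds into one bound on a neighbourhood of a compact set;
  -- the neighbourhood is needed because derivatives are compared, not only values.
  have hcomp : ∀ K ⊆ U, IsCompact K → ∃ (L : NNReal) (δ : ℝ), 0 < δ ∧
      LipschitzOnWith L v (Metric.thickening δ K) := by
    intro K hK hKc
    obtain ⟨δ, hδ, hsub⟩ := hKc.exists_cthickening_subset_open hU hK
    obtain ⟨L, hL⟩ := (hv.mono hsub).exists_lipschitzOnWith_of_compact hKc.cthickening
    exact ⟨L, δ, hδ, hL.mono (Metric.thickening_subset_cthickening δ K)⟩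
  have hmeas : Measurable (fun x => fderiv ℝ v x (basisVec a)) :=
    measurable_fderiv_apply_const ℝ v (basisVec a)
  refine ⟨hv.continuousOn.locallyIntegrableOn hU.measurableSet, ?_, ?_⟩
  · rw [locallyIntegrableOn_iff hU.isLocallyClosed]
    intro K hK hKc
    obtain ⟨L, δ, hδ, hL⟩ := hcomp K hK hKc
    refine Measure.integrableOn_of_bounded (M := L) hKc.measure_lt_top.ne
      hmeas.aestronglyMeasurable ?_
    filter_upwards [ae_restrict_mem hKc.measurableSet] with x hx
    have hnb : Metric.thickening δ K ∈ 𝓝 x :=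
      Metric.isOpen_thickening.mem_nhds (Metric.self_subset_thickening hδ K hx)
    refine ((fderiv ℝ v x).le_opNorm _).trans ?_
    simpa using norm_fderiv_le_of_lipschitzOn ℝ hnb hL
  · intro ϕ hϕ
    obtain ⟨L, δ, hδ, hL⟩ := hcomp _ hϕ.2.2 hϕ.2.1
    -- Integration by parts is available for globally Lipschitz functions. Only a neighbourhood of
    -- the support of `ϕ` is seen, and there the extension `w` has the same values and derivatives
    -- as `v`.
    obtain ⟨w, hw, hvw⟩ := hL.extend_real
    obtain ⟨D, hD⟩ := hϕ.1.lipschitzWith_of_hasCompactSupport hϕ.2.1 (by simp)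
    have key := hw.integral_lineDeriv_mul_eq (μ := (volume : Measure (Pt n))) hD hϕ.2.1 (basisVec a)
    have hd := (tsupport_partialDeriv_subset ![a] ϕ).trans hϕ.2.2
    rw [setIntegral_mul_of_tsupport_subset hd, setIntegral_mul_of_tsupport_subset hϕ.2.2]
    have hthick : tsupport ϕ ⊆ Metric.thickening δ (tsupport ϕ) :=
      Metric.self_subset_thickening hδ _
    have e1 : ∫ x, v x * partialDeriv ![a] ϕ x = - ∫ x, lineDeriv ℝ ϕ x (-basisVec a) * w x := by
      rw [← integral_neg]
      congr 1; funext x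
      have hdf : DifferentiableAt ℝ ϕ x := (hϕ.1.differentiable (by simp)) x
      rw [hdf.lineDeriv_eq_fderiv, partialDeriv_one, map_neg]
      by_cases hx : x ∈ tsupport ϕ
      · rw [hvw (hthick hx)]; ring
      · have : partialDeriv ![a] ϕ x = 0 := image_eq_zero_of_notMem_tsupport
          (fun h => hx (tsupport_partialDeriv_subset _ _ h))
        rw [partialDeriv_one] at this
        rw [this]; ring
    have e2 : ∫ x, fderiv ℝ v x (basisVec a) * ϕ x = ∫ x, lineDeriv ℝ w x (basisVec a) * ϕ x := by
      refine integral_congr_ae ?_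
      filter_upwards [hw.ae_differentiableAt] with x hx
      by_cases hxs : x ∈ tsupport ϕ
      · rw [hx.lineDeriv_eq_fderiv]
        have : v =ᶠ[𝓝 x] w := by
          filter_upwards [Metric.isOpen_thickening.mem_nhds (hthick hxs)] with y hy using hvw hy
        rw [this.fderiv_eq]
      · rw [image_eq_zero_of_notMem_tsupport hxs, mul_zero, mul_zero]
    rw [e1, e2, key]
    simp

end WeakDerivatives

/-! ### Smooth approximation on bounded convex sets. -/

section Smoothing

variable {n k : ℕ}

theorem partialDeriv_comp_smul_add (α : Fin k → Fin n) {f : Pt n → ℝ} (hf : ContDiff ℝ ∞ f)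
    (c : ℝ) (b x : Pt n) :
    partialDeriv α (fun y => f (c • y + b)) x = c ^ k * partialDeriv α f (c • x + b) := by
  induction k generalizing x with
  | zero => simp [partialDeriv_zero]
  | succ k ih =>
    have hs : ContDiff ℝ ∞ (fun y : Pt n => f (c • y + b)) :=
      hf.comp ((contDiff_const_smul c).add contDiff_const)
    rw [partialDeriv_succ α hs, partialDeriv_succ α hf]
    have e : partialDeriv (Fin.tail α) (fun y => f (c • y + b)) =
        fun y => c ^ k * partialDeriv (Fin.tail α) f (c • y + b) := by
      funext y; exact ih (Fin.tail α) y
    have hd : DifferentiableAt ℝ (partialDeriv (Fin.tail α) f) (c • x + b) :=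
      ((contDiff_partialDeriv (Fin.tail α) hf).differentiable (by simp)) _
    have hin : HasFDerivAt (fun y : Pt n => c • y + b) (c • ContinuousLinearMap.id ℝ (Pt n)) x :=
      ((hasFDerivAt_id x).const_smul c).add_const b
    have h1 := (hd.hasFDerivAt.comp x hin).const_mul (c ^ k)
    rw [e]
    have h2 := h1.fderiv
    simp only [Function.comp_def] at h2
    rw [h2]
    simp [pow_succ]
    ring

theorem partialDeriv_convolution (α : Fin k → Fin n) {f κ : Pt n → ℝ}
    (hf : LocallyIntegrable f) (hκ : ContDiff ℝ ∞ κ) (hc : HasCompactSupport κ) (x : Pt n) :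
    partialDeriv α (fun X => ∫ y, f y * κ (X - y)) x = ∫ y, f y * partialDeriv α κ (x - y) := by
  induction k generalizing x with
  | zero => simp [partialDeriv_zero]
  | succ k ih =>
    have conv_eq : ∀ χ : Pt n → ℝ, (fun X => ∫ y, f y * χ (X - y)) =
        convolution f χ (ContinuousLinearMap.mul ℝ ℝ) volume := fun χ => rfl
    have hs : ContDiff ℝ ∞ (fun X => ∫ y, f y * κ (X - y)) := by
      rw [conv_eq]; exact hc.contDiff_convolution_right _ hf hκ
    rw [partialDeriv_succ α hs]
    have e : partialDeriv (Fin.tail α) (fun X => ∫ y, f y * κ (X - y)) =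
        fun X => ∫ y, f y * partialDeriv (Fin.tail α) κ (X - y) := by
      funext y; exact ih (Fin.tail α) y
    have hc' : HasCompactSupport (partialDeriv (Fin.tail α) κ) :=
      hc.mono' ((subset_tsupport _).trans (tsupport_partialDeriv_subset _ κ))
    have hκ' := contDiff_partialDeriv (Fin.tail α) hκ
    rw [e, conv_eq, (hc'.hasFDerivAt_convolution_right (ContinuousLinearMap.mul ℝ ℝ) hf
      (hκ'.of_le (by simp)) x).fderiv,
      convolution_precompR_apply _ hf (hc'.fderiv ℝ) (hκ'.continuous_fderiv (by simp))]
    have : (fun a => fderiv ℝ (partialDeriv (Fin.tail α) κ) a (basisVec (α 0))) =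
        partialDeriv α κ := by
      funext a; rw [partialDeriv_succ α hκ]
    rw [this]
    rfl

theorem contDiff_convolution_kernel {f κ : Pt n → ℝ}
    (hf : LocallyIntegrable f) (hκ : ContDiff ℝ ∞ κ) (hc : HasCompactSupport κ) :
    ContDiff ℝ ∞ (fun X => ∫ y, f y * κ (X - y)) :=
  hc.contDiff_convolution_right (ContinuousLinearMap.mul ℝ ℝ) hf hκ

theorem integral_lincomb₃ {X : Type*} [MeasurableSpace X] {μ : Measure X} {f g h : X → ℝ}
    (hf : Integrable f μ) (hg : Integrable g μ) (hh : Integrable h μ) (a b c : ℝ) :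
    Integrable (fun x => a * f x + b * g x + c * h x) μ ∧
      ∫ x, (a * f x + b * g x + c * h x) ∂μ =
        a * (∫ x, f x ∂μ) + b * (∫ x, g x ∂μ) + c * ∫ x, h x ∂μ := by
  have h1 : Integrable (fun x => a * f x + b * g x) μ := (hf.const_mul a).add (hg.const_mul b)
  refine ⟨h1.add (hh.const_mul c), ?_⟩
  rw [integral_add h1 (hh.const_mul c), integral_add (hf.const_mul a) (hg.const_mul b),
    integral_const_mul, integral_const_mul, integral_const_mul]

/-- Jensen's inequality for a density of mass at most one: the second moment about the mean `m` is
nonnegative, and its term m²∫κ is at most m². -/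
theorem sq_integral_mul_le {X : Type*} [MeasurableSpace X] {μ : Measure X} {g κ : X → ℝ}
    (hκ : ∀ x, 0 ≤ κ x) (hκi : Integrable κ μ) (hκ1 : ∫ x, κ x ∂μ ≤ 1)
    (h1 : Integrable (fun x => g x * κ x) μ) (h2 : Integrable (fun x => g x ^ 2 * κ x) μ) :
    (∫ x, g x * κ x ∂μ) ^ 2 ≤ ∫ x, g x ^ 2 * κ x ∂μ := by
  set m := ∫ x, g x * κ x ∂μ with hm
  have h0 : 0 ≤ ∫ x, (g x - m) ^ 2 * κ x ∂μ :=
    integral_nonneg fun x => mul_nonneg (sq_nonneg _) (hκ x)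
  have e : ∫ x, (g x - m) ^ 2 * κ x ∂μ =
      (∫ x, g x ^ 2 * κ x ∂μ) - 2 * m * m + m ^ 2 * ∫ x, κ x ∂μ := by
    have e1 := (integral_lincomb₃ h2 h1 hκi 1 (-(2 * m)) (m ^ 2)).2
    rw [← hm] at e1
    rw [show (∫ x, g x ^ 2 * κ x ∂μ) - 2 * m * m + m ^ 2 * ∫ x, κ x ∂μ =
      1 * (∫ x, g x ^ 2 * κ x ∂μ) + -(2 * m) * m + m ^ 2 * ∫ x, κ x ∂μ by ring, ← e1]
    congr 1; funext x; ring
  nlinarith [sq_nonneg m, mul_le_mul_of_nonneg_left hκ1 (sq_nonneg m)]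

/-- Schur's test for a bounded continuous kernel. -/
theorem integral_sq_integral_mul_le {U : Set (Pt n)} (hUf : volume U ≠ ⊤)
    {k : Pt n → Pt n → ℝ} (hk : Continuous (Function.uncurry k)) {B c : ℝ}
    (hk0 : ∀ x y, 0 ≤ k x y) (hkB : ∀ x y, k x y ≤ B)
    (hy : ∀ x, ∫ y in U, k x y ≤ 1) (hx : ∀ y, ∫ x in U, k x y ≤ c)
    {g : Pt n → ℝ} (hg : MemLp g 2 (volume.restrict U)) :
    ∫ x in U, (∫ y in U, g y * k x y) ^ 2 ≤ c * ∫ y in U, g y ^ 2 := by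
  have : IsFiniteMeasure (volume.restrict U) := ⟨by simpa using hUf.lt_top⟩
  have hkx : ∀ x, Continuous (k x) := fun x => by
    have := hk.comp (Continuous.prodMk_right x); exact this
  have hky : ∀ y, Continuous (fun x => k x y) := fun y => by
    have := hk.comp (Continuous.prodMk_left y); exact this
  have hbx : ∀ x, ∀ᵐ y ∂(volume.restrict U), ‖k x y‖ ≤ B := fun x =>
    Eventually.of_forall fun y => by rw [Real.norm_of_nonneg (hk0 x y)]; exact hkB x y
  have hg1 : Integrable g (volume.restrict U) := hg.integrable (by norm_num)
  have hg2 : Integrable (fun y => g y ^ 2) (volume.restrict U) := hg.integrable_sq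
  have hpt : ∀ x, (∫ y in U, g y * k x y) ^ 2 ≤ ∫ y in U, g y ^ 2 * k x y := fun x =>
    sq_integral_mul_le (hk0 x) ((integrable_const B).mono' (hkx x).aestronglyMeasurable (hbx x))
      (hy x) (hg1.mul_bdd (c := B) (hkx x).aestronglyMeasurable (hbx x))
      (hg2.mul_bdd (c := B) (hkx x).aestronglyMeasurable (hbx x))
  have hprod : Integrable (fun z : Pt n × Pt n => g z.2 ^ 2 * k z.1 z.2)
      ((volume.restrict U).prod (volume.restrict U)) := by
    refine (hg2.comp_snd (volume.restrict U)).mul_bdd (c := B) hk.aestronglyMeasurable ?_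
    exact Eventually.of_forall fun z => by
      rw [Real.norm_of_nonneg (hk0 _ _)]; exact hkB _ _
  calc ∫ x in U, (∫ y in U, g y * k x y) ^ 2
      ≤ ∫ x in U, ∫ y in U, g y ^ 2 * k x y := by
        refine integral_mono_of_nonneg (Eventually.of_forall fun x => sq_nonneg _)
          hprod.integral_prod_left (Eventually.of_forall hpt)
    _ = ∫ y in U, ∫ x in U, g y ^ 2 * k x y := integral_integral_swap hprod
    _ ≤ ∫ y in U, c * g y ^ 2 := by
        refine integral_mono hprod.integral_prod_right (hg2.const_mul c) fun y => ?_
        simp only [integral_const_mul]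
        rw [mul_comm c]
        exact mul_le_mul_of_nonneg_left (hx y) (sq_nonneg _)
    _ = c * ∫ y in U, g y ^ 2 := integral_const_mul _ _

/-- The kernel `ε⁻ⁿ ψ((y - (1 - ε) x) / ε)`, which averages over the points `(1 - ε) x + ε w`
with respect to the density `ψ` of `w`. -/
noncomputable def avgKernel (ψ : Pt n → ℝ) (ε : ℝ) (x y : Pt n) : ℝ :=
  (ε ^ n)⁻¹ * ψ (ε⁻¹ • (y - (1 - ε) • x))

theorem avgKernel_integral_right {ψ : Pt n → ℝ} (h1 : ∫ x, ψ x = 1) {ε : ℝ} (hε : 0 < ε)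
    (x : Pt n) : ∫ y, avgKernel ψ ε x y = 1 := by
  unfold avgKernel
  rw [integral_const_mul, integral_sub_right_eq_self (fun y => ψ (ε⁻¹ • y)),
    Measure.integral_comp_smul, h1]
  have : 0 < ε ^ n := by positivity
  simp only [finrank_euclideanSpace, Fintype.card_fin, inv_pow, inv_inv, smul_eq_mul, mul_one]
  rw [abs_of_pos this]
  field_simp

/-- As a function of `x` the kernel is scaled by (1-ε)/ε instead of 1/ε. The mass stays below 2^n
for ε ≤ 1/2, which is the second half of Schur's test. -/
theorem avgKernel_integral_left {ψ : Pt n → ℝ} (h1 : ∫ x, ψ x = 1) {ε : ℝ} (hε : 0 < ε)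
    (hε1 : ε < 1) (y : Pt n) : ∫ x, avgKernel ψ ε x y = ((1 - ε) ^ n)⁻¹ := by
  unfold avgKernel
  have e : ∀ x : Pt n, ε⁻¹ • (y - (1 - ε) • x) = (-(ε⁻¹ * (1 - ε))) • (x - (1 - ε)⁻¹ • y) := by
    intro x
    have : (1 - ε) ≠ 0 := by linarith
    rw [smul_sub, smul_sub, smul_smul, smul_smul, neg_mul, mul_assoc, mul_inv_cancel₀ this]
    module
  simp_rw [e]
  rw [integral_const_mul,
    integral_sub_right_eq_self (fun x => ψ ((-(ε⁻¹ * (1 - ε))) • x)),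
    Measure.integral_comp_smul, h1]
  have h3 : 0 < ε ^ n := by positivity
  have h4 : 0 < (1 - ε) ^ n := pow_pos (by linarith) n
  simp only [finrank_euclideanSpace, Fintype.card_fin, smul_eq_mul, mul_one, abs_inv, abs_pow,
    abs_neg, abs_mul]
  rw [abs_of_pos (by linarith : 0 < 1 - ε), abs_of_pos hε, mul_pow, inv_pow]
  field_simp

theorem continuous_avgKernel {ψ : Pt n → ℝ} (hψ : Continuous ψ) (ε : ℝ) :
    Continuous (Function.uncurry (avgKernel ψ ε)) := by
  unfold avgKernel Function.uncurry
  fun_prop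

theorem avgKernel_ne_zero {ψ : Pt n → ℝ} {ε : ℝ} (hε : 0 < ε) {x y : Pt n}
    (h : avgKernel ψ ε x y ≠ 0) : ∃ w, ψ w ≠ 0 ∧ y = (1 - ε) • x + ε • w := by
  refine ⟨ε⁻¹ • (y - (1 - ε) • x), fun h0 => h (by simp [avgKernel, h0]), ?_⟩
  rw [smul_smul, mul_inv_cancel₀ hε.ne']; module

theorem avgKernel_nonneg {ψ : Pt n → ℝ} (h0 : ∀ x, 0 ≤ ψ x) {ε : ℝ} (hε : 0 < ε) (x y : Pt n) :
    0 ≤ avgKernel ψ ε x y := mul_nonneg (by positivity) (h0 _)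

theorem avgKernel_setIntegral {ψ : Pt n → ℝ} (h1 : ∫ x, ψ x = 1) {ε : ℝ} (hε : 0 < ε)
    (hε1 : ε < 1) {U : Set (Pt n)} (hc : Convex ℝ U) (hs : tsupport ψ ⊆ U) {x : Pt n}
    (hx : x ∈ U) : ∫ y in U, avgKernel ψ ε x y = 1 := by
  rw [← avgKernel_integral_right h1 hε x]
  refine setIntegral_eq_integral_of_forall_compl_eq_zero fun y hy => ?_
  by_contra h
  obtain ⟨w, hw, rfl⟩ := avgKernel_ne_zero hε h
  exact hy (hc hx (hs (subset_tsupport _ hw)) (by linarith) hε.le (by ring))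

/-- By Schur's test the averages are bounded on L²(U) uniformly in ε, so it suffices to treat a
continuous function of compact support. For it they converge uniformly, since (1-ε)x + εw differs
from x by at most 2Rε. -/
theorem tendsto_integral_avgKernel {U : Set (Pt n)} (hU : IsOpen U) (hc : Convex ℝ U)
    (hb : Bornology.IsBounded U) {ψ : Pt n → ℝ} (hψ : ContDiff ℝ ∞ ψ) (h0 : ∀ x, 0 ≤ ψ x)
    (hs : tsupport ψ ⊆ U) (hcs : HasCompactSupport ψ) (h1 : ∫ x, ψ x = 1)
    {ε : ℕ → ℝ} (hε : ∀ j, 0 < ε j) (hε2 : ∀ j, ε j ≤ 1 / 2) (hεt : Tendsto ε atTop (𝓝 0))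
    {g : Pt n → ℝ} (hg : MemLp g 2 (volume.restrict U)) :
    Tendsto (fun j => ∫ x in U, ((∫ y in U, g y * avgKernel ψ (ε j) x y) - g x) ^ 2)
      atTop (𝓝 0) := by
  have hUf : volume U ≠ ⊤ := hb.measure_lt_top.ne
  have : IsFiniteMeasure (volume.restrict U) := ⟨by simpa using hUf.lt_top⟩
  obtain ⟨Bψ, hBψ⟩ : ∃ B, ∀ x, ψ x ≤ B := by
    obtain ⟨B, hB⟩ := hcs.exists_bound_of_continuous hψ.continuous
    exact ⟨B, fun x => (le_abs_self _).trans (hB x)⟩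
  have hkB : ∀ j x y, avgKernel ψ (ε j) x y ≤ ((ε j) ^ n)⁻¹ * Bψ := fun j x y =>
    mul_le_mul_of_nonneg_left (hBψ _) (by have := hε j; positivity)
  have hk0 : ∀ j x y, 0 ≤ avgKernel ψ (ε j) x y := fun j => avgKernel_nonneg h0 (hε j)
  have hkc : ∀ j, Continuous (Function.uncurry (avgKernel ψ (ε j))) := fun j =>
    continuous_avgKernel hψ.continuous _
  have hkx : ∀ j x, Continuous (avgKernel ψ (ε j) x) := fun j x =>
    (hkc j).comp (Continuous.prodMk_right x)
  have hkyi : ∀ j y, Integrable (fun x => avgKernel ψ (ε j) x y) := by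
    intro j y
    by_contra hni
    have := avgKernel_integral_left h1 (hε j) (by linarith [hε2 j]) y
    rw [integral_undef hni] at this
    have h4 : 0 < ((1 - ε j) ^ n)⁻¹ := inv_pos.2 (pow_pos (by linarith [hε2 j]) n)
    linarith
  have hkxi : ∀ j x, Integrable (avgKernel ψ (ε j) x) := by
    intro j x
    by_contra hni
    have := avgKernel_integral_right h1 (hε j) x
    rw [integral_undef hni] at this
    norm_num at this
  have schur : ∀ j (f : Pt n → ℝ), MemLp f 2 (volume.restrict U) →
      ∫ x in U, (∫ y in U, f y * avgKernel ψ (ε j) x y) ^ 2 ≤ 2 ^ n * ∫ y in U, f y ^ 2 := by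
    intro j f hf
    refine integral_sq_integral_mul_le hUf (hkc j) (hk0 j) (hkB j) ?_ ?_ hf
    · intro x
      rw [← avgKernel_integral_right h1 (hε j) x]
      exact setIntegral_le_integral (hkxi j x) (Eventually.of_forall (hk0 j x))
    · intro y
      refine (setIntegral_le_integral (hkyi j y) (Eventually.of_forall fun x => hk0 j x y)).trans ?_
      rw [avgKernel_integral_left h1 (hε j) (by linarith [hε2 j]) y, ← inv_pow]
      refine pow_le_pow_left₀ (inv_nonneg.2 (by linarith [hε2 j])) ?_ n
      rw [inv_le_comm₀ (by linarith [hε2 j]) (by norm_num)]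
      linarith [hε2 j]
  have hint : ∀ j x (f : Pt n → ℝ), MemLp f 2 (volume.restrict U) →
      Integrable (fun y => f y * avgKernel ψ (ε j) x y) (volume.restrict U) := fun j x f hf =>
    (hf.integrable (by norm_num)).mul_bdd (c := ((ε j) ^ n)⁻¹ * Bψ) (hkx j x).aestronglyMeasurable
      (Eventually.of_forall fun y => by rw [Real.norm_of_nonneg (hk0 j x y)]; exact hkB j x y)
  rw [Metric.tendsto_atTop]
  intro τ hτ
  obtain ⟨R, hR⟩ := hb.exists_norm_le
  have hVpos : 0 ≤ (volume U).toReal := ENNReal.toReal_nonneg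
  -- The L² tolerance `δ` enters with the factor 3(2^n + 1), the uniform tolerance `σ` below with 3
  -- vol(U); together they use at most 3τ/4.
  set δ : ℝ := τ / (6 * (2 ^ n + 1)) with hδ
  have hδpos : 0 < δ := by positivity
  have : (volume.restrict U).Regular := Measure.Regular.restrict_of_measure_ne_top hUf
  obtain ⟨φ, hφcs, hφ, hφc, hφm⟩ := MemLp.exists_hasCompactSupport_integral_rpow_sub_le
    (p := 2) (by norm_num) (f := g) (μ := volume.restrict U) (by simpa using hg) hδpos
  norm_num at hφ hφm
  have hφu : UniformContinuous φ := hφcs.uniformContinuous_of_continuous hφc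
  set σ : ℝ := τ / (12 * ((volume U).toReal + 1)) with hσ
  have hσpos : 0 < σ := by positivity
  obtain ⟨η, hη, hφη⟩ := Metric.uniformContinuous_iff.1 hφu (Real.sqrt σ) (Real.sqrt_pos.2 hσpos)
  have hev : ∀ᶠ j in atTop, ε j * (2 * R + 1) < η := by
    have : Tendsto (fun j => ε j * (2 * R + 1)) atTop (𝓝 0) := by
      simpa using hεt.mul_const (2 * R + 1)
    exact this.eventually (gt_mem_nhds hη)
  obtain ⟨N, hN⟩ := eventually_atTop.1 hev
  refine ⟨N, fun j hj => ?_⟩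
  have hRj := hN j hj
  have hgφ : MemLp (fun y => g y - φ y) 2 (volume.restrict U) := hg.sub hφm
  have hI2 : IntegrableOn (fun x => (g x - φ x) ^ 2) U := hgφ.integrable_sq
  have hpt : ∀ x ∈ U, ((∫ y in U, g y * avgKernel ψ (ε j) x y) - g x) ^ 2 ≤
      3 * (∫ y in U, (g y - φ y) * avgKernel ψ (ε j) x y) ^ 2 + 3 * σ + 3 * (g x - φ x) ^ 2 := by
    intro x hx
    have e1 : ∫ y in U, g y * avgKernel ψ (ε j) x y =
        (∫ y in U, (g y - φ y) * avgKernel ψ (ε j) x y) +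
          ∫ y in U, φ y * avgKernel ψ (ε j) x y := by
      rw [← integral_add (hint j x _ hgφ) (hint j x _ hφm)]
      congr 1; funext y; ring
    have e2 : (∫ y in U, φ y * avgKernel ψ (ε j) x y) - φ x =
        ∫ y in U, (φ y - φ x) * avgKernel ψ (ε j) x y := by
      have e3 : φ x = ∫ y in U, φ x * avgKernel ψ (ε j) x y := by
        rw [integral_const_mul, avgKernel_setIntegral h1 (hε j) (by linarith [hε2 j]) hc hs hx,
          mul_one]
      conv_lhs => rw [e3]
      rw [← integral_sub (hint j x _ hφm) ((hkxi j x).integrableOn.const_mul _)]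
      congr 1; funext y; ring
    have e4 : |(∫ y in U, φ y * avgKernel ψ (ε j) x y) - φ x| ≤ Real.sqrt σ := by
      rw [e2, ← Real.norm_eq_abs]
      refine (norm_integral_le_integral_norm _).trans ?_
      calc ∫ y in U, ‖(φ y - φ x) * avgKernel ψ (ε j) x y‖
          ≤ ∫ y in U, Real.sqrt σ * avgKernel ψ (ε j) x y := by
            refine integral_mono_of_nonneg (Eventually.of_forall fun y => norm_nonneg _)
              ((hkxi j x).integrableOn.const_mul _) (Eventually.of_forall fun y => ?_)
            simp only [norm_mul]
            rw [Real.norm_of_nonneg (hk0 j x y)]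
            by_cases hz : avgKernel ψ (ε j) x y = 0
            · simp [hz]
            · refine mul_le_mul_of_nonneg_right ?_ (hk0 j x y)
              obtain ⟨w, hw, rfl⟩ := avgKernel_ne_zero (hε j) hz
              rw [← dist_eq_norm]
              refine (hφη ?_).le
              rw [dist_eq_norm]
              have : (1 - ε j) • x + ε j • w - x = ε j • (w - x) := by module
              rw [this, norm_smul, Real.norm_of_nonneg (hε j).le]
              refine lt_of_le_of_lt (mul_le_mul_of_nonneg_left ?_ (hε j).le) hRj
              refine (norm_sub_le _ _).trans ?_
              linarith [hR x hx, hR w (hs (subset_tsupport _ hw))]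
        _ = Real.sqrt σ := by
            rw [integral_const_mul,
              avgKernel_setIntegral h1 (hε j) (by linarith [hε2 j]) hc hs hx, mul_one]
    have e5 : ((∫ y in U, φ y * avgKernel ψ (ε j) x y) - φ x) ^ 2 ≤ σ := by
      rw [← Real.sq_sqrt hσpos.le]
      exact sq_le_sq' (by linarith [abs_le.1 e4]) (abs_le.1 e4).2
    rw [e1]
    set A := ∫ y in U, (g y - φ y) * avgKernel ψ (ε j) x y
    set P := ∫ y in U, φ y * avgKernel ψ (ε j) x y
    nlinarith [sq_nonneg (A - (P - φ x)), sq_nonneg (A + (g x - φ x)),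
      sq_nonneg ((P - φ x) + (g x - φ x))]
  have hAi : Integrable (fun x => (∫ y in U, (g y - φ y) * avgKernel ψ (ε j) x y) ^ 2)
      (volume.restrict U) := by
    have hcont : Continuous (fun x => ∫ y in U, (g y - φ y) * avgKernel ψ (ε j) x y) := by
      refine continuous_of_dominated (bound := fun y => |g y - φ y| * (((ε j) ^ n)⁻¹ * Bψ)) ?_ ?_ ?_ ?_
      · intro x; exact (hint j x _ hgφ).aestronglyMeasurable
      · intro x
        refine Eventually.of_forall fun y => ?_
        rw [norm_mul, Real.norm_of_nonneg (hk0 j x y)]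
        exact mul_le_mul_of_nonneg_left (hkB j x y) (norm_nonneg _)
      · exact ((hgφ.integrable (by norm_num)).abs).mul_const _
      · refine Eventually.of_forall fun y => ?_
        exact continuous_const.mul ((hkc j).comp (Continuous.prodMk_left y))
    obtain ⟨R', hR'⟩ := hb.subset_closedBall 0
    exact ((hcont.pow 2).continuousOn.integrableOn_compact
      (isCompact_closedBall (0 : Pt n) R')).mono_set hR'
  rw [dist_zero_right, Real.norm_of_nonneg (integral_nonneg fun x => sq_nonneg _)]
  calc ∫ x in U, ((∫ y in U, g y * avgKernel ψ (ε j) x y) - g x) ^ 2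
      ≤ ∫ x in U, (3 * (∫ y in U, (g y - φ y) * avgKernel ψ (ε j) x y) ^ 2 + 3 * σ +
          3 * (g x - φ x) ^ 2) := by
        refine integral_mono_of_nonneg (Eventually.of_forall fun x => sq_nonneg _)
          (integral_lincomb₃ hAi (integrable_const σ) hI2 3 3 3).1 ?_
        filter_upwards [ae_restrict_mem hU.measurableSet] with x hx using hpt x hx
    _ = 3 * (∫ x in U, (∫ y in U, (g y - φ y) * avgKernel ψ (ε j) x y) ^ 2) +
          3 * σ * (volume U).toReal + 3 * ∫ x in U, (g x - φ x) ^ 2 := by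
        rw [(integral_lincomb₃ hAi (integrable_const σ) hI2 3 3 3).2]
        simp [Measure.real]
        ring
    _ ≤ 3 * (2 ^ n * δ) + 3 * σ * (volume U).toReal + 3 * δ := by
        have hq := schur j _ hgφ
        have h2 : (2 : ℝ) ^ n * ∫ x in U, (g x - φ x) ^ 2 ≤ 2 ^ n * δ :=
          mul_le_mul_of_nonneg_left hφ (by positivity)
        linarith
    _ < τ := by
        have a1 : 3 * (2 ^ n * δ) + 3 * δ = τ / 2 := by
          rw [hδ]; field_simp; ring
        have a2 : 3 * σ * (volume U).toReal ≤ τ / 4 := by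
          rw [hσ]
          rw [show 3 * (τ / (12 * ((volume U).toReal + 1))) * (volume U).toReal =
            τ / 4 * ((volume U).toReal / ((volume U).toReal + 1)) by field_simp; ring]
          refine mul_le_of_le_one_right (by positivity) ?_
          rw [div_le_one (by positivity)]; linarith
        linarith

/-- Smooth approximation, together with all its weak derivatives, of a function on a convex set. -/
theorem exists_smooth_approx {U : Set (Pt n)} (hU : IsOpen U) (hc : Convex ℝ U)
    (hb : Bornology.IsBounded U) (hne : U.Nonempty) {v : Pt n → ℝ}
    (hv : MemLp v 2 (volume.restrict U)) :
    ∃ w : ℕ → Pt n → ℝ, (∀ j, ContDiff ℝ ∞ (w j)) ∧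
      (∀ (k : ℕ) (α : Fin k → Fin n) (g : Pt n → ℝ), HasWeakDeriv U α v g →
        MemLp g 2 (volume.restrict U) →
        Tendsto (fun j => ∫ x in U, (partialDeriv α (w j) x - g x) ^ 2) atTop (𝓝 0)) ∧
      (∀ (k : ℕ) (α : Fin k → Fin n) (g : Pt n → ℝ) (C : ℝ), HasWeakDeriv U α v g →
        (∀ᵐ x ∂(volume.restrict U), |g x| ≤ C) → ∀ j, ∀ x ∈ U, |partialDeriv α (w j) x| ≤ C) ∧
      ∀ η : ℝ, 0 < η → ∀ᶠ j in atTop, ∀ x, w j x ≠ 0 → ∃ y ∈ U, v y ≠ 0 ∧ dist x y < η := by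
  have hUf : volume U ≠ ⊤ := hb.measure_lt_top.ne
  have : IsFiniteMeasure (volume.restrict U) := ⟨by simpa using hUf.lt_top⟩
  obtain ⟨z, hz⟩ := hne
  obtain ⟨ρ, hρ, hρU⟩ := Metric.nhds_basis_closedBall.mem_iff.1 (hU.mem_nhds hz)
  let ψ₀ : ContDiffBump z := ⟨ρ / 2, ρ, by linarith, by linarith⟩
  set ψ : Pt n → ℝ := ψ₀.normed volume with hψdef
  have hψ : ContDiff ℝ ∞ ψ := ψ₀.contDiff_normed
  have h0 : ∀ x, 0 ≤ ψ x := fun x => ψ₀.nonneg_normed x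
  have h1 : ∫ x, ψ x = 1 := ψ₀.integral_normed
  have hcs : HasCompactSupport ψ := ψ₀.hasCompactSupport_normed
  have hs : tsupport ψ ⊆ U := by rw [hψdef, ψ₀.tsupport_normed_eq]; exact hρU
  set ε : ℕ → ℝ := fun j => 1 / ((j : ℝ) + 2) with hεdef
  have hε : ∀ j, 0 < ε j := fun j => by simp only [hεdef]; positivity
  have hε2 : ∀ j, ε j ≤ 1 / 2 := fun j => by
    simp only [hεdef]
    exact one_div_le_one_div_of_le (by norm_num) (by linarith [(Nat.cast_nonneg j : (0:ℝ) ≤ j)])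
  have hεt : Tendsto ε atTop (𝓝 0) := by
    have := (tendsto_one_div_add_atTop_nhds_zero_nat (𝕜 := ℝ)).comp (tendsto_add_atTop_nat 1)
    refine this.congr fun j => ?_
    simp [hεdef]; ring
  set f : Pt n → ℝ := U.indicator v with hfdef
  have hf : LocallyIntegrable f :=
    ((integrable_indicator_iff hU.measurableSet).2 (hv.integrable (by norm_num))).locallyIntegrable
  -- The kernel is reflected so that convolving the zero extension with it and evaluating at (1-ε)x
  -- produces exactly the averages over (1-ε)x + εw.
  set κ : ℕ → Pt n → ℝ := fun j u => ((ε j) ^ n)⁻¹ * ψ ((-(ε j)⁻¹) • u) with hκdef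
  have hκ : ∀ j, ContDiff ℝ ∞ (κ j) := fun j =>
    contDiff_const.mul (hψ.comp (contDiff_const_smul _))
  have hκc : ∀ j, HasCompactSupport (κ j) := fun j =>
    (hcs.comp_smul (neg_ne_zero.2 (inv_ne_zero (hε j).ne'))).mul_left
  have hκa : ∀ j x y, κ j ((1 - ε j) • x - y) = avgKernel ψ (ε j) x y := by
    intro j x y
    simp only [hκdef, avgKernel]
    congr 2; module
  -- Averaging towards the interior keeps the kernel inside the convex set `U`, so no neighbourhood
  -- of the boundary is lost and the kernel itself is an admissible test function in `y`.
  have htest : ∀ j, ∀ x ∈ U, IsTestFunction U (fun y => κ j ((-1 : ℝ) • y + (1 - ε j) • x)) := by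
    intro j x hx
    have hsub : tsupport (fun y => κ j ((-1 : ℝ) • y + (1 - ε j) • x)) ⊆
        (fun w => (1 - ε j) • x + ε j • w) '' tsupport ψ := by
      refine closure_minimal (fun y hy => ?_) ?_
      · have : avgKernel ψ (ε j) x y ≠ 0 := by
          rw [← hκa]
          have e : (1 - ε j) • x - y = (-1 : ℝ) • y + (1 - ε j) • x := by module
          rw [e]; exact hy
        obtain ⟨w, hw, rfl⟩ := avgKernel_ne_zero (hε j) this
        exact ⟨w, subset_tsupport _ hw, rfl⟩
      · exact (hcs.isCompact.image (by fun_prop)).isClosed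
    refine ⟨(hκ j).comp ((contDiff_const_smul _).add contDiff_const), ?_, hsub.trans ?_⟩
    · exact (hcs.isCompact.image (by fun_prop)).of_isClosed_subset (isClosed_tsupport _) hsub
    · rintro _ ⟨w, hw, rfl⟩
      exact hc hx (hs hw) (by linarith [hε2 j]) (hε j).le (by ring)
  set F : ℕ → Pt n → ℝ := fun j X => ∫ y, f y * κ j (X - y) with hFdef
  have hF : ∀ j, ContDiff ℝ ∞ (F j) := fun j => contDiff_convolution_kernel hf (hκ j) (hκc j)
  -- The smoothed function has the averaged weak derivative as its derivative. The factor (1-ε)^k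
  -- comes from the dilation; the sign (-1)^k of the weak derivative cancels against that of the
  -- reflection y ↦ -y.
  have hfor : ∀ j k (α : Fin k → Fin n) g, HasWeakDeriv U α v g → ∀ x ∈ U,
      partialDeriv α (fun y => F j ((1 - ε j) • y + 0)) x =
        (1 - ε j) ^ k * ∫ y in U, g y * avgKernel ψ (ε j) x y := by
    intro j k α g hg x hx
    rw [partialDeriv_comp_smul_add α (hF j), partialDeriv_convolution α hf (hκ j) (hκc j)]
    congr 1
    have e := hg.2.2 _ (htest j x hx)
    simp_rw [partialDeriv_comp_smul_add α (hκ j)] at e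
    have e1 : ∀ y : Pt n, (-1 : ℝ) • y + (1 - ε j) • x = (1 - ε j) • x - y := fun y => by module
    simp_rw [e1, hκa] at e
    have e2 : ∫ y, f y * partialDeriv α (κ j) ((1 - ε j) • x + 0 - y) =
        ∫ y in U, v y * partialDeriv α (κ j) ((1 - ε j) • x - y) := by
      rw [← integral_indicator hU.measurableSet]
      congr 1; funext y
      by_cases hy : y ∈ U <;> simp [hfdef, hy]
    rw [e2]
    have e3 : ∫ y in U, v y * ((-1) ^ k * partialDeriv α (κ j) ((1 - ε j) • x - y)) =
        (-1) ^ k * ∫ y in U, v y * partialDeriv α (κ j) ((1 - ε j) • x - y) := by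
      rw [← integral_const_mul]; congr 1; funext y; ring
    rw [e3] at e
    exact mul_left_cancel₀ (pow_ne_zero k (by norm_num : (-1 : ℝ) ≠ 0)) e
  have hk0 : ∀ j x y, 0 ≤ avgKernel ψ (ε j) x y := fun j => avgKernel_nonneg h0 (hε j)
  refine ⟨fun j y => F j ((1 - ε j) • y + 0), fun j => ?_, ?_, ?_, ?_⟩
  · exact (hF j).comp ((contDiff_const_smul _).add contDiff_const)
  · intro k α g hg hg2
    have hA := tendsto_integral_avgKernel hU hc hb hψ h0 hs hcs h1 hε hε2 hεt hg2
    have hB : Tendsto (fun j => 2 * (∫ x in U, ((∫ y in U, g y * avgKernel ψ (ε j) x y) - g x) ^ 2)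
        + 2 * (1 - (1 - ε j) ^ k) ^ 2 * ∫ x in U, g x ^ 2) atTop (𝓝 0) := by
      have h3 : Tendsto (fun j => (1 - (1 - ε j) ^ k)) atTop (𝓝 0) := by
        have := (tendsto_const_nhds (x := (1 : ℝ))).sub
          (((tendsto_const_nhds (x := (1 : ℝ))).sub hεt).pow k)
        simpa using this
      have := (hA.const_mul 2).add (((h3.pow 2).const_mul 2).mul_const (∫ x in U, g x ^ 2))
      simpa using this
    refine squeeze_zero (fun j => integral_nonneg fun x => sq_nonneg _) (fun j => ?_) hB
    have hcont : Continuous (fun x => partialDeriv α (fun y => F j ((1 - ε j) • y + 0)) x) :=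
      (contDiff_partialDeriv α ((hF j).comp
        ((contDiff_const_smul _).add contDiff_const))).continuous
    have hpos : 0 < (1 - ε j) ^ k := pow_pos (by linarith [hε2 j]) k
    have hle1 : (1 - ε j) ^ k ≤ 1 := pow_le_one₀ (by linarith [hε2 j]) (by linarith [hε j])
    have hJm : AEStronglyMeasurable (fun x => (1 - ε j) ^ k * ∫ y in U, g y * avgKernel ψ (ε j) x y)
        (volume.restrict U) := by
      refine hcont.aestronglyMeasurable.congr ?_
      filter_upwards [ae_restrict_mem hU.measurableSet] with x hx using hfor j k α g hg x hx
    have hJ2 : MemLp (fun x => (∫ y in U, g y * avgKernel ψ (ε j) x y) - g x) 2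
        (volume.restrict U) := by
      have hJc : MemLp (fun x => ((1 - ε j) ^ k)⁻¹ *
          partialDeriv α (fun y => F j ((1 - ε j) • y + 0)) x) 2 (volume.restrict U) := by
        obtain ⟨R', hR'⟩ := hb.subset_closedBall 0
        obtain ⟨B, hB⟩ := (isCompact_closedBall (0 : Pt n) R').exists_bound_of_continuousOn
          (continuous_const.mul hcont : Continuous (fun x => ((1 - ε j) ^ k)⁻¹ *
          partialDeriv α (fun y => F j ((1 - ε j) • y + 0)) x)).continuousOn
        refine MemLp.of_bound (continuous_const.mul hcont).aestronglyMeasurable B ?_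
        filter_upwards [ae_restrict_mem hU.measurableSet] with x hx using hB x (hR' hx)
      refine (hJc.sub hg2).ae_eq ?_
      filter_upwards [ae_restrict_mem hU.measurableSet] with x hx
      simp only [Pi.sub_apply]
      rw [hfor j k α g hg x hx]
      field_simp
    rw [show 2 * (∫ x in U, ((∫ y in U, g y * avgKernel ψ (ε j) x y) - g x) ^ 2)
        + 2 * (1 - (1 - ε j) ^ k) ^ 2 * ∫ x in U, g x ^ 2 =
        2 * (∫ x in U, ((∫ y in U, g y * avgKernel ψ (ε j) x y) - g x) ^ 2)
        + 2 * (1 - (1 - ε j) ^ k) ^ 2 * (∫ x in U, g x ^ 2) + 0 * ∫ x in U, g x ^ 2 by ring,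
      ← (integral_lincomb₃ hJ2.integrable_sq hg2.integrable_sq hg2.integrable_sq _ _ _).2]
    refine integral_mono_of_nonneg (Eventually.of_forall fun x => sq_nonneg _)
      (integral_lincomb₃ hJ2.integrable_sq hg2.integrable_sq hg2.integrable_sq _ _ _).1 ?_
    filter_upwards [ae_restrict_mem hU.measurableSet] with x hx
    rw [hfor j k α g hg x hx]
    set J := ∫ y in U, g y * avgKernel ψ (ε j) x y
    set c := (1 - ε j) ^ k
    have hid : c * J - g x = c * (J - g x) - (1 - c) * g x := by ring
    have hc2 : (c * (J - g x)) ^ 2 ≤ (J - g x) ^ 2 := by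
      rw [mul_pow]
      exact mul_le_of_le_one_left (sq_nonneg _) (pow_le_one₀ hpos.le hle1)
    rw [hid]
    nlinarith [sq_nonneg (c * (J - g x) + (1 - c) * g x)]
  · intro k α g C hg hgC j x hx
    rw [hfor j k α g hg x hx, abs_mul]
    have hpos : 0 < (1 - ε j) ^ k := pow_pos (by linarith [hε2 j]) k
    have hle1 : (1 - ε j) ^ k ≤ 1 := pow_le_one₀ (by linarith [hε2 j]) (by linarith [hε j])
    have hi : IntegrableOn (avgKernel ψ (ε j) x) U := by
      by_contra hni
      have := avgKernel_setIntegral h1 (hε j) (by linarith [hε2 j]) hc hs hx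
      rw [integral_undef hni] at this
      norm_num at this
    have hJ : |∫ y in U, g y * avgKernel ψ (ε j) x y| ≤ C := by
      rw [← Real.norm_eq_abs]
      refine (norm_integral_le_integral_norm _).trans ?_
      calc ∫ y in U, ‖g y * avgKernel ψ (ε j) x y‖ ≤ ∫ y in U, C * avgKernel ψ (ε j) x y := by
            refine integral_mono_of_nonneg (Eventually.of_forall fun y => norm_nonneg _)
              (hi.const_mul C) ?_
            filter_upwards [hgC] with y hy
            rw [norm_mul, Real.norm_of_nonneg (hk0 j x y)]
            exact mul_le_mul_of_nonneg_right hy (hk0 j x y)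
        _ = C := by
            rw [integral_const_mul, avgKernel_setIntegral h1 (hε j) (by linarith [hε2 j]) hc hs hx,
              mul_one]
    rw [abs_of_pos hpos]
    exact (mul_le_of_le_one_left (abs_nonneg _) hle1).trans hJ
  · intro η hη
    obtain ⟨R, hR⟩ := hb.exists_norm_le
    have hR0 : 0 ≤ R := (norm_nonneg z).trans (hR z hz)
    -- The averaged point `y` satisfies x - y = ε(x - w). Since (1-ε)x = y - εw and ε ≤ 1/2, ‖x‖ ≤
    -- 3R, so the displacement is at most 4Rε.
    have hev : ∀ᶠ j in atTop, ε j * (4 * R + 1) < η := by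
      have : Tendsto (fun j => ε j * (4 * R + 1)) atTop (𝓝 0) := by
        simpa using hεt.mul_const (4 * R + 1)
      exact this.eventually (gt_mem_nhds hη)
    filter_upwards [hev] with j hj x hx
    have : ∃ y, f y * κ j ((1 - ε j) • x + 0 - y) ≠ 0 := by
      by_contra hcon
      push Not at hcon
      exact hx ((integral_congr_ae (Eventually.of_forall hcon)).trans (integral_zero _ _))
    obtain ⟨y, hy⟩ := this
    rw [add_zero, hκa] at hy
    have hyU : y ∈ U := by
      by_contra h
      exact hy (by simp [hfdef, h])
    refine ⟨y, hyU, fun h => hy (by simp [hfdef, hyU, h]), ?_⟩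
    obtain ⟨w, hw, hyw⟩ := avgKernel_ne_zero (hε j) (right_ne_zero_of_mul hy)
    have hwR := hR w (hs (subset_tsupport _ hw))
    have hyR := hR y hyU
    have hxR : ‖x‖ ≤ 2 * R + R := by
      have e : (1 - ε j) • x = y - ε j • w := by rw [hyw]; module
      have h2 : (1 - ε j) * ‖x‖ ≤ R + ε j * R := by
        have := congrArg norm e
        rw [norm_smul, Real.norm_of_nonneg (by linarith [hε2 j])] at this
        rw [this]
        refine (norm_sub_le _ _).trans (add_le_add hyR ?_)
        rw [norm_smul, Real.norm_of_nonneg (hε j).le]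
        exact mul_le_mul_of_nonneg_left hwR (hε j).le
      nlinarith [hε2 j, hε j, norm_nonneg x]
    rw [dist_eq_norm]
    have e : x - y = ε j • (x - w) := by rw [hyw]; module
    rw [e, norm_smul, Real.norm_of_nonneg (hε j).le]
    refine lt_of_le_of_lt (mul_le_mul_of_nonneg_left ?_ (hε j).le) hj
    refine (norm_sub_le _ _).trans ?_
    linarith

end Smoothing

/-! ### Barycentric coordinates and coordinates along the vertex path of a simplex. -/

section Barycentric

variable {n : ℕ} {T t : Simp n}

/-- The affine basis given by the vertices of a nondegenerate simplex. -/
noncomputable def simpBasis (h : AffineIndependent ℝ T) : AffineBasis (Fin (n + 1)) ℝ (Pt n) :=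
  ⟨T, h, h.affineSpan_eq_top_iff_card_eq_finrank_add_one.2 (by simp)⟩

theorem bary_eq_coord (h : AffineIndependent ℝ T) (k : Fin (n + 1)) (x : Pt n) :
    bary T k x = (simpBasis h).coord k x := by
  unfold bary simpBasis; rw [dif_pos h]

theorem bary_vertex (h : AffineIndependent ℝ T) (k l : Fin (n + 1)) :
    bary T k (T l) = if k = l then 1 else 0 := by
  rw [bary_eq_coord h]; exact (simpBasis h).coord_apply k l

theorem sum_bary (h : AffineIndependent ℝ T) (x : Pt n) : ∑ k, bary T k x = 1 := by
  simp_rw [bary_eq_coord h]; exact (simpBasis h).sum_coord_apply_eq_one x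

theorem sum_bary_smul (h : AffineIndependent ℝ T) (x : Pt n) : ∑ k, bary T k x • T k = x := by
  simp_rw [bary_eq_coord h]; exact (simpBasis h).linear_combination_coord_eq_self x

theorem mem_hull_iff (h : AffineIndependent ℝ T) {x : Pt n} :
    x ∈ hull T ↔ ∀ k, 0 ≤ bary T k x := by
  have := (simpBasis h).convexHull_eq_nonneg_coord
  simp_rw [bary_eq_coord h]
  unfold hull
  rw [show range T = range (simpBasis h) from rfl, this]; rfl

theorem mem_openHull_iff (h : AffineIndependent ℝ T) {x : Pt n} :
    x ∈ openHull T ↔ ∀ k, 0 < bary T k x := by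
  have := (simpBasis h).interior_convexHull
  simp_rw [bary_eq_coord h]
  unfold openHull hull
  rw [show range T = range (simpBasis h) from rfl, this]; rfl

theorem affineMap_apply_eq (A : Pt n →ᵃ[ℝ] ℝ) (y : Pt n) : A y = A.linear y + A 0 := by
  have := A.map_vadd 0 y
  simpa using this

/-- The linear part of a barycentric coordinate. -/
noncomputable def baryLin (T : Simp n) (k : Fin (n + 1)) : Pt n →ₗ[ℝ] ℝ :=
  open scoped Classical in
  if h : AffineIndependent ℝ T then ((simpBasis h).coord k).linear else 0

theorem bary_sub (h : AffineIndependent ℝ T) (k : Fin (n + 1)) (x y : Pt n) :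
    bary T k x - bary T k y = baryLin T k (x - y) := by
  rw [bary_eq_coord h, bary_eq_coord h, baryLin, dif_pos h]
  exact (((simpBasis h).coord k).linearMap_vsub x y).symm

theorem bary_add (h : AffineIndependent ℝ T) (k : Fin (n + 1)) (x y : Pt n) :
    bary T k (x + y) = bary T k x + baryLin T k y := by
  have := bary_sub h k (x + y) x
  rw [add_sub_cancel_left] at this; linarith

theorem bary_affineMap (h : AffineIndependent ℝ T) (k : Fin (n + 1)) :
    ∃ A : Pt n →ᵃ[ℝ] ℝ, ∀ x, bary T k x = A x :=
  ⟨(simpBasis h).coord k, bary_eq_coord h k⟩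

theorem affineMap_eq_sum_bary (h : AffineIndependent ℝ T) (A : Pt n →ᵃ[ℝ] ℝ) (x : Pt n) :
    A x = ∑ k, bary T k x * A (T k) := by
  have hA := affineMap_apply_eq A
  conv_lhs => rw [hA, ← sum_bary_smul h x, map_sum]
  simp_rw [map_smul, smul_eq_mul]
  have : A 0 = ∑ k, bary T k x * A 0 := by rw [← Finset.sum_mul, sum_bary h, one_mul]
  rw [this, ← Finset.sum_add_distrib]
  refine Finset.sum_congr rfl fun k _ => ?_
  rw [hA (T k)]; ring

theorem sum_baryLin (h : AffineIndependent ℝ T) (y : Pt n) : ∑ k, baryLin T k y = 0 := by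
  have h1 := sum_bary h y
  have h2 := sum_bary h (0 : Pt n)
  have : ∑ k, (bary T k y - bary T k 0) = 0 := by rw [Finset.sum_sub_distrib, h1, h2, sub_self]
  simpa [bary_sub h] using this

theorem sum_baryLin_smul (h : AffineIndependent ℝ T) (y : Pt n) :
    ∑ k, baryLin T k y • T k = y := by
  have h1 := sum_bary_smul h y
  have h2 := sum_bary_smul h (0 : Pt n)
  have : ∑ k, (bary T k y - bary T k 0) • T k = y := by
    simp_rw [sub_smul]; rw [Finset.sum_sub_distrib, h1, h2, sub_zero]
  simpa [bary_sub h] using this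

theorem bary_continuous (h : AffineIndependent ℝ T) (k : Fin (n + 1)) :
    Continuous (bary T k) := by
  have : bary T k = fun x => (simpBasis h).coord k x := funext (bary_eq_coord h k)
  rw [this]; exact ((simpBasis h).coord k).continuous_of_finiteDimensional

theorem bary_eq_of_sum (h : AffineIndependent ℝ T) {w : Fin (n + 1) → ℝ} (hw : ∑ k, w k = 1)
    {x : Pt n} (hx : x = ∑ k, w k • T k) (k : Fin (n + 1)) : bary T k x = w k := by
  obtain ⟨A, hA⟩ := bary_affineMap h k
  have hA' := affineMap_apply_eq A
  rw [hA, hA', hx, map_sum]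
  simp_rw [map_smul, smul_eq_mul]
  have : A 0 = ∑ k, w k * A 0 := by rw [← Finset.sum_mul, hw, one_mul]
  rw [this, ← Finset.sum_add_distrib]
  have e : ∀ j, w j * A.linear (T j) + w j * A 0 = w j * (if k = j then 1 else 0) := by
    intro j
    rw [← mul_add, ← hA', ← hA, bary_vertex h]
  rw [Finset.sum_congr rfl fun j _ => e j]
  simp

theorem isCompact_hull (T : Simp n) : IsCompact (hull T) :=
  (Set.finite_range T).isCompact_convexHull ℝ

theorem convex_hull' (T : Simp n) : Convex ℝ (hull T) := convex_convexHull ℝ _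

theorem vertex_mem_hull (T : Simp n) (k : Fin (n + 1)) : T k ∈ hull T :=
  subset_convexHull ℝ _ (mem_range_self k)

/-- Applying the dual functions to a vanishing combination with weights of sum zero isolates the
single weights. -/
theorem affineIndependent_of_dual (f : Fin (n + 1) → (Pt n →ᵃ[ℝ] ℝ))
    (hf : ∀ l k, f l (t k) = if l = k then 1 else 0) : AffineIndependent ℝ t := by
  rw [affineIndependent_iff]
  intro s w hw hs
  have key : ∀ l ∈ s, w l = 0 := by
    intro l hl
    have hA' := affineMap_apply_eq (f l)
    have h1 : ∑ k ∈ s, w k * f l (t k) = 0 := by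
      have e : ∀ k, w k * f l (t k) = w k * (f l).linear (t k) + w k * f l 0 := fun k => by
        rw [← mul_add, ← hA']
      rw [Finset.sum_congr rfl fun k _ => e k]
      rw [Finset.sum_add_distrib, ← Finset.sum_mul, hw, zero_mul, add_zero]
      have := congrArg (f l).linear hs
      simpa [map_sum] using this
    simp_rw [hf] at h1
    simpa [hl] using h1
  exact key

/-- The coordinates of `x` along the path `T 0, T 1, …, T n`. -/
noncomputable def pathCoord (T : Simp n) (i : Fin n) (x : Pt n) : ℝ :=
  ∑ k : Fin (n + 1), if (i : ℕ) < k then bary T k x else 0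

theorem pathCoord_affineMap (h : AffineIndependent ℝ T) (i : Fin n) :
    ∃ A : Pt n →ᵃ[ℝ] ℝ, ∀ x, pathCoord T i x = A x := by
  refine ⟨∑ k : Fin (n + 1), if (i : ℕ) < k then (simpBasis h).coord k else 0, fun x => ?_⟩
  have : ∀ (s : Finset (Fin (n + 1))) (f : Fin (n + 1) → (Pt n →ᵃ[ℝ] ℝ)),
      (∑ k ∈ s, f k) x = ∑ k ∈ s, f k x := by
    intro s f
    induction s using Finset.induction_on with
    | empty => simp
    | insert a s ha ih => simp [Finset.sum_insert ha, ih]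
  rw [this]
  unfold pathCoord
  refine Finset.sum_congr rfl fun k _ => ?_
  split_ifs
  · exact bary_eq_coord h k x
  · rfl

theorem pathCoord_vertex (h : AffineIndependent ℝ T) (i : Fin n) (l : Fin (n + 1)) :
    pathCoord T i (T l) = if (i : ℕ) < l then 1 else 0 := by
  unfold pathCoord
  simp_rw [bary_vertex h]
  rw [Finset.sum_eq_single l]
  · simp
  · intro b _ hb; simp [hb]
  · simp

/-- The point with the coordinates `c` along the path `T 0, T 1, …, T n`. -/
noncomputable def pathPoint (T : Simp n) (c : Fin n → ℝ) : Pt n :=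
  T 0 + ∑ i : Fin n, c i • (T i.succ - T i.castSucc)

theorem vertex_eq_pathPoint (T : Simp n) (k : Fin (n + 1)) :
    T k = pathPoint T (fun i => if (i : ℕ) < k then 1 else 0) := by
  unfold pathPoint
  induction k using Fin.induction with
  | zero => simp
  | succ k ih =>
    have e : ∀ i : Fin n, (if (i : ℕ) < (k.succ : Fin (n + 1)) then (1 : ℝ) else 0) =
        (if (i : ℕ) < (k.castSucc : Fin (n + 1)) then (1 : ℝ) else 0) + if i = k then 1 else 0 := by
      intro i
      simp only [Fin.val_succ, Fin.val_castSucc]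
      by_cases h : i = k
      · simp [h]
      · have : (i : ℕ) ≠ k := fun hh => h (Fin.ext hh)
        have h3 : ((i : ℕ) < k + 1) ↔ ((i : ℕ) < k) := by omega
        simp [h, h3]
    simp_rw [e, add_smul]
    rw [Finset.sum_add_distrib, ← add_assoc, ← ih]
    simp

theorem pathCoord_pathPoint (h : AffineIndependent ℝ T) (c : Fin n → ℝ) (i : Fin n) :
    pathCoord T i (pathPoint T c) = c i := by
  obtain ⟨A, hA⟩ := pathCoord_affineMap h i
  have hA' := affineMap_apply_eq A
  have h0 : A (T 0) = 0 := by rw [← hA, pathCoord_vertex h]; simp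
  have hd : ∀ j : Fin n, A.linear (T j.succ - T j.castSucc) = if i = j then 1 else 0 := by
    intro j
    have e : A.linear (T j.succ - T j.castSucc) = A (T j.succ) - A (T j.castSucc) := by
      rw [hA' (T j.succ), hA' (T j.castSucc), map_sub]; ring
    rw [e, ← hA, ← hA, pathCoord_vertex h, pathCoord_vertex h]
    simp only [Fin.val_succ, Fin.val_castSucc]
    by_cases hij : i = j
    · simp [hij]
    · have : (i : ℕ) ≠ j := fun hh => hij (Fin.ext hh)
      have h3 : ((i : ℕ) < j + 1) ↔ ((i : ℕ) < j) := by omega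
      simp [hij, h3]
  rw [hA, pathPoint, add_comm]
  have := A.map_vadd (T 0) (∑ i : Fin n, c i • (T i.succ - T i.castSucc))
  rw [vadd_eq_add, vadd_eq_add] at this
  rw [this, h0, map_sum]
  simp [hd]

/-- Abel summation: path coordinates are the tail sums of the barycentric weights. -/
theorem sum_mul_tail {w : Fin (n + 1) → ℝ} (hw : ∑ k, w k = 1) (T : Simp n) :
    ∑ k, w k • T k = pathPoint T (fun i => ∑ k, if (i : ℕ) < (k : Fin (n + 1)) then w k else 0) := by
  conv_lhs => enter [2, k]; rw [vertex_eq_pathPoint T k]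
  unfold pathPoint
  simp_rw [smul_add, Finset.smul_sum]
  rw [Finset.sum_add_distrib, ← Finset.sum_smul, hw, one_smul, Finset.sum_comm]
  congr 1
  refine Finset.sum_congr rfl fun i _ => ?_
  rw [Finset.sum_smul]
  refine Finset.sum_congr rfl fun k _ => ?_
  split_ifs <;> simp

theorem pathPoint_pathCoord (h : AffineIndependent ℝ T) (x : Pt n) :
    pathPoint T (fun i => pathCoord T i x) = x := by
  have := sum_mul_tail (sum_bary h x) T
  rw [sum_bary_smul h] at this
  exact this.symm

/-- `1, c 0, …, c (n - 1), 0, 0, …` -/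
noncomputable def pathSeq (c : Fin n → ℝ) (j : ℕ) : ℝ :=
  if j = 0 then 1 else if h : j - 1 < n then c ⟨j - 1, h⟩ else 0

/-- The weights whose tail sums are `c`. -/
noncomputable def pathWeight (c : Fin n → ℝ) (k : Fin (n + 1)) : ℝ :=
  pathSeq c k - pathSeq c (k + 1)

theorem sum_tail_sub (f : ℕ → ℝ) (j : ℕ) (hj : j ≤ n + 1) :
    ∑ k : Fin (n + 1), (if j ≤ k then f k - f (k + 1) else 0) = f j - f (n + 1) := by
  rw [Fin.sum_univ_eq_sum_range (fun k => if j ≤ k then f k - f (k + 1) else 0)]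
  rw [← Finset.sum_filter]
  have : (Finset.range (n + 1)).filter (fun k => j ≤ k) = Finset.Ico j (n + 1) := by
    ext k; simp; omega
  rw [this, Finset.sum_Ico_eq_sub _ hj]
  rw [Finset.sum_range_sub', Finset.sum_range_sub']
  ring

theorem sum_pathWeight (c : Fin n → ℝ) : ∑ k, pathWeight c k = 1 := by
  have := sum_tail_sub (n := n) (pathSeq c) 0 (by omega)
  simp only [Nat.zero_le, if_true] at this
  unfold pathWeight
  rw [this]; simp [pathSeq]

theorem tail_pathWeight (c : Fin n → ℝ) (i : Fin n) :
    ∑ k : Fin (n + 1), (if (i : ℕ) < k then pathWeight c k else 0) = c i := by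
  have := sum_tail_sub (n := n) (pathSeq c) (i + 1) (by omega)
  unfold pathWeight
  simp only [Nat.succ_le_iff] at this
  rw [this]; simp [pathSeq]

/-- In path coordinates a simplex is the set 1 ≥ c 0 ≥ … ≥ c (n - 1) ≥ 0, and the barycentric
coordinates are the successive gaps in this chain. -/
theorem pathWeight_nonneg {c : Fin n → ℝ} (hc : Antitone c) (h0 : ∀ i, 0 ≤ c i)
    (h1 : ∀ i, c i ≤ 1) (k : Fin (n + 1)) : 0 ≤ pathWeight c k := by
  rw [pathWeight, sub_nonneg]
  unfold pathSeq
  rcases Nat.eq_zero_or_pos (k : ℕ) with hk | hk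
  · simp only [hk]
    split_ifs <;> simp [h1] at *
  · have hk' : ¬ (k : ℕ) = 0 := by omega
    have hlt : (k : ℕ) - 1 < n := by omega
    rw [if_neg hk', dif_pos hlt, if_neg (by omega)]
    split_ifs with h3
    · exact hc (Fin.le_def.2 (by simp))
    · exact h0 _

end Barycentric

/-! ### Uniform subdivision as a Kuhn triangulation. -/

section Kuhn

variable {n : ℕ} {T t : Simp n}

theorem mem_iff_lt_card_of_lower {p : ℕ} {S : Finset (Fin p)}
    (h : ∀ i ∈ S, ∀ j ≤ i, j ∈ S) (j : Fin p) : j ∈ S ↔ (j : ℕ) < S.card := by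
  constructor
  · intro hj
    have : Finset.Iic j ⊆ S := fun i hi => h j hj i (Finset.mem_Iic.1 hi)
    have := Finset.card_le_card this
    rw [Fin.card_Iic] at this; omega
  · intro hj
    by_contra hn
    have : S ⊆ Finset.Iio j := fun i hi => by
      rw [Finset.mem_Iio]
      by_contra hle
      exact hn (h i hi j (not_lt.1 hle))
    have := Finset.card_le_card this
    rw [Fin.card_Iio] at this; omega

/-- This translates the cardinalities in the definition of `child` into the position at which a
single edge vector is switched on. -/
theorem orderEmbOfFin_lt_iff (s : Finset (Fin n)) (j : Fin s.card) (k : ℕ) :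
    (s.orderEmbOfFin rfl j : ℕ) < k ↔ (j : ℕ) < (s.filter (fun i => i.1 < k)).card := by
  classical
  set S : Finset (Fin s.card) := Finset.univ.filter (fun j => (s.orderEmbOfFin rfl j : ℕ) < k)
  have hS : S.card = (s.filter (fun i => i.1 < k)).card := by
    refine Finset.card_bij (fun j _ => s.orderEmbOfFin rfl j) ?_ ?_ ?_
    · intro a ha
      simp only [S, Finset.mem_filter, Finset.mem_univ, true_and] at ha
      exact Finset.mem_filter.2 ⟨Finset.orderEmbOfFin_mem _ _ _, ha⟩
    · intro a _ b _ hab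
      exact (s.orderEmbOfFin rfl).injective hab
    · intro b hb
      rw [Finset.mem_filter] at hb
      have : b ∈ Set.range (s.orderEmbOfFin rfl) := by
        rw [Finset.range_orderEmbOfFin]; exact hb.1
      obtain ⟨a, rfl⟩ := this
      exact ⟨a, by simp [S, hb.2], rfl⟩
  rw [← hS, ← mem_iff_lt_card_of_lower]
  · simp [S]
  · intro i hi j hj
    simp only [S, Finset.mem_filter, Finset.mem_univ, true_and] at hi ⊢
    exact lt_of_le_of_lt (Fin.le_def.1 ((s.orderEmbOfFin rfl).monotone hj)) hi

/-- The position in the path of the child of `s` at which the `j`-th edge vector of the path of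
the parent is added. -/
noncomputable def childPerm (s : Finset (Fin n)) : Equiv.Perm (Fin n) :=
  ((finCongr (show n = s.card + sᶜ.card by simp [Finset.card_add_card_compl])).trans
    finSumFinEquiv.symm).trans (finSumEquivOfFinset rfl rfl)

theorem childPerm_of_lt (s : Finset (Fin n)) (j : Fin n) (h : (j : ℕ) < s.card) :
    childPerm s j = s.orderEmbOfFin rfl ⟨j, h⟩ := by
  have : (finCongr (show n = s.card + sᶜ.card by simp [Finset.card_add_card_compl])) j =
      Fin.castAdd _ ⟨j, h⟩ := by ext; simp
  simp only [childPerm, Equiv.trans_apply, this, finSumFinEquiv_symm_apply_castAdd]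
  rfl

theorem childPerm_of_le (s : Finset (Fin n)) (j : Fin n) (h : s.card ≤ (j : ℕ)) :
    childPerm s j = sᶜ.orderEmbOfFin rfl ⟨j - s.card, by
      have := Finset.card_add_card_compl s
      rw [Fintype.card_fin] at this; omega⟩ := by
  have hlt : (j : ℕ) - s.card < sᶜ.card := by
      have := Finset.card_add_card_compl s
      rw [Fintype.card_fin] at this; omega
  have : (finCongr (show n = s.card + sᶜ.card by simp [Finset.card_add_card_compl])) j =
      Fin.natAdd _ ⟨j - s.card, hlt⟩ := by ext; simp; omega
  simp only [childPerm, Equiv.trans_apply, this, finSumFinEquiv_symm_apply_natAdd]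
  rfl

/-- A child of a Kuhn simplex is a Kuhn simplex of half the width. The indices a ≤ #s ≤ b of the two
averaged vertices satisfy [ρ<a] + [ρ<b] = [ρ<#s] + [position<k]: if ρ<#s the second bracket is
always 1, otherwise the first is always 0, and the remaining one switches at the position given by
`childPerm`. -/
theorem child_eq_pathPoint (T : Simp n) (z : Fin n → ℝ) (ρ : Equiv.Perm (Fin n)) (c : ℝ)
    (ht : ∀ k : Fin (n + 1), t k = pathPoint T (fun i => (z i + if (ρ i : ℕ) < k then 1 else 0) / c))
    (s : Finset (Fin n)) (k : Fin (n + 1)) :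
    child t s k = pathPoint T (fun i => (2 * z i + (if (ρ i : ℕ) < s.card then 1 else 0) +
      if (childPerm s (ρ i) : ℕ) < k then 1 else 0) / (2 * c)) := by
  unfold child
  rw [ht, ht, midpoint_eq_smul_add]
  unfold pathPoint
  rw [add_add_add_comm, smul_add, ← two_smul ℝ (T 0), smul_smul, ← Finset.sum_add_distrib,
    Finset.smul_sum]
  simp only [invOf_eq_inv, inv_mul_cancel₀ (two_ne_zero' ℝ), one_smul]
  congr 1
  refine Finset.sum_congr rfl fun i _ => ?_
  rw [← add_smul, smul_smul]
  congr 1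
  have key : ∀ A B C D : ℝ, A + B = C + D →
      2⁻¹ * ((z i + A) / c + (z i + B) / c) = (2 * z i + C + D) / (2 * c) := by
    intro A B C D h
    rw [← add_div, show z i + A + (z i + B) = 2 * z i + (C + D) by linarith, ← add_assoc,
      mul_comm, ← div_eq_mul_inv, div_div, mul_comm c]
  refine key _ _ _ _ ?_
  have hcs : (s.filter (fun j => j.1 < k.1)).card ≤ s.card := Finset.card_filter_le _ _
  by_cases h : (ρ i : ℕ) < s.card
  · rw [childPerm_of_lt s _ h]
    have h1 := orderEmbOfFin_lt_iff s ⟨ρ i, h⟩ k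
    have h2 : (ρ i : ℕ) < s.card + (sᶜ.filter (fun j => j.1 < k.1)).card := by omega
    simp only [h, h1, h2, if_true]
    ring
  · rw [childPerm_of_le s _ (not_lt.1 h)]
    have h1 := orderEmbOfFin_lt_iff sᶜ ⟨ρ i - s.card, by
      have := Finset.card_add_card_compl s
      rw [Fintype.card_fin] at this; omega⟩ k
    have h2 : ¬ (ρ i : ℕ) < (s.filter (fun j => j.1 < k.1)).card := by omega
    have h3 : ((ρ i : ℕ) < s.card + (sᶜ.filter (fun j => j.1 < k.1)).card) ↔
        ((ρ i : ℕ) - s.card < (sᶜ.filter (fun j => j.1 < k.1)).card) := by omega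
    simp only [h, h1, h2, h3, if_false]

/-- `t` is a simplex of the Kuhn triangulation of mesh width `2^{-m}` in the path coordinates
of `T`. -/
def IsKuhn (T : Simp n) (m : ℕ) (t : Simp n) : Prop :=
  ∃ (z : Fin n → ℤ) (ρ : Equiv.Perm (Fin n)), ∀ k : Fin (n + 1),
    t k = pathPoint T (fun i => ((z i : ℝ) + if (ρ i : ℕ) < k then 1 else 0) / 2 ^ m)

theorem isKuhn_of_mem_subdivision {m : ℕ} (ht : t ∈ subdivision T m) : IsKuhn T m t := by
  induction m generalizing t with
  | zero =>
    rw [subdivision, mem_singleton_iff] at ht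
    subst ht
    refine ⟨0, Equiv.refl _, fun k => ?_⟩
    rw [vertex_eq_pathPoint t k]
    congr 1; funext i
    by_cases hik : (i : ℕ) < k <;> simp [hik]
  | succ m ih =>
    simp only [subdivision, mem_iUnion, mem_range] at ht
    obtain ⟨t', ht', s, rfl⟩ := ht
    obtain ⟨z, ρ, h⟩ := ih ht'
    refine ⟨fun i => 2 * z i + if (ρ i : ℕ) < s.card then 1 else 0,
      ρ.trans (childPerm s), fun k => ?_⟩
    rw [child_eq_pathPoint T (fun i => (z i : ℝ)) ρ _ h s k]
    congr 1; funext i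
    rw [pow_succ']
    push_cast
    rfl

theorem isKuhn_pathCoord (h : AffineIndependent ℝ T) {m : ℕ} {z : Fin n → ℤ}
    {ρ : Equiv.Perm (Fin n)} (ht : ∀ k : Fin (n + 1),
    t k = pathPoint T (fun i => ((z i : ℝ) + if (ρ i : ℕ) < k then 1 else 0) / 2 ^ m))
    (i : Fin n) (k : Fin (n + 1)) :
    2 ^ m * pathCoord T i (t k) = z i + if (ρ i : ℕ) < k then 1 else 0 := by
  rw [ht, pathCoord_pathPoint h]
  field_simp

/-- After rescaling, the path coordinates of `T` in the order of `ρ` take the values [j < k] at the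
vertices t k. Consecutive differences of them are dual to the vertices. -/
theorem IsKuhn.affineIndependent (h : AffineIndependent ℝ T) {m : ℕ} (ht : IsKuhn T m t) :
    AffineIndependent ℝ t := by
  obtain ⟨z, ρ, ht⟩ := ht
  choose A hA using fun i => pathCoord_affineMap h i
  let D : Fin n → (Pt n →ᵃ[ℝ] ℝ) := fun j =>
    (2 : ℝ) ^ m • A (ρ.symm j) - AffineMap.const ℝ (Pt n) (z (ρ.symm j) : ℝ)
  have hD : ∀ j k, D j (t k) = if (j : ℕ) < (k : Fin (n + 1)) then 1 else 0 := by
    intro j k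
    have := isKuhn_pathCoord h ht (ρ.symm j) k
    simp only [D, AffineMap.coe_sub, AffineMap.coe_smul, AffineMap.coe_const, Pi.sub_apply,
      Pi.smul_apply, Function.const_apply, smul_eq_mul]
    rw [← hA, this]
    simp
  -- The index is shifted by one so that the constants 1 and 0 close the chain at both ends: `E j`
  -- is [j ≤ k] at t k for all j.
  let E : ℕ → (Pt n →ᵃ[ℝ] ℝ) := fun j =>
    if j = 0 then AffineMap.const ℝ (Pt n) 1 else if hj : j - 1 < n then D ⟨j - 1, hj⟩ else 0
  have hE : ∀ (j : ℕ) (k : Fin (n + 1)), E j (t k) = if j ≤ (k : ℕ) then 1 else 0 := by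
    intro j k
    simp only [E]
    split_ifs with h1 h2 h3 h4 h5
    · simp
    · omega
    · rw [hD]; simp; omega
    · rw [hD]; simp; omega
    · omega
    · simp
  refine affineIndependent_of_dual (fun l => E l - E (l + 1)) fun l k => ?_
  rw [AffineMap.coe_sub, Pi.sub_apply, hE, hE]
  by_cases hlk : l = k
  · simp [hlk]
  · have : (l : ℕ) ≠ k := fun hh => hlk (Fin.ext hh)
    have h3 : ((l : ℕ) + 1 ≤ k) ↔ ((l : ℕ) ≤ k) := by omega
    simp [hlk, h3]

theorem affineIndependent_of_mem_subdivision (h : AffineIndependent ℝ T) {m : ℕ}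
    (ht : t ∈ subdivision T m) : AffineIndependent ℝ t :=
  (isKuhn_of_mem_subdivision ht).affineIndependent h

/-- Every point of a simplex lies in one of its children. -/
theorem exists_mem_hull_child (h : AffineIndependent ℝ t) {x : Pt n} (hx : x ∈ hull t) :
    ∃ s, x ∈ hull (child t s) := by
  classical
  rw [mem_hull_iff h] at hx
  set c : Fin n → ℝ := fun i => pathCoord t i x with hcdef
  have hanti : Antitone c := by
    intro i j hij
    simp only [hcdef, pathCoord]
    refine Finset.sum_le_sum fun k _ => ?_
    have := Fin.le_def.1 hij
    split_ifs with h1 h2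
    · exact le_rfl
    · omega
    · exact hx k
    · exact le_rfl
  have hc0 : ∀ i, 0 ≤ c i := fun i => Finset.sum_nonneg fun k _ => by
    split_ifs
    · exact hx k
    · exact le_rfl
  have hc1 : ∀ i, c i ≤ 1 := fun i => by
    rw [← sum_bary h x]
    refine Finset.sum_le_sum fun k _ => ?_
    split_ifs
    · exact le_rfl
    · exact hx k
  -- The path coordinates decrease, so those that are at least 1/2 form an initial block. It selects
  -- the corner of the half-size cube that contains `x`, and `c'` below are the doubled coordinates
  -- relative to this corner.
  set S : Finset (Fin n) := Finset.univ.filter (fun j => 1 / 2 ≤ c j) with hSdef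
  have hSlow : ∀ j, j ∈ S ↔ (j : ℕ) < S.card := mem_iff_lt_card_of_lower (by
    intro i hi j hj
    simp only [hSdef, Finset.mem_filter, Finset.mem_univ, true_and] at hi ⊢
    exact hi.trans (hanti hj))
  have hSc : ∀ j : Fin n, (j : ℕ) < S.card ↔ 1 / 2 ≤ c j := fun j => by
    rw [← hSlow]; simp [hSdef]
  set c' : Fin n → ℝ := fun j => 2 * c j - if (j : ℕ) < S.card then 1 else 0 with hc'def
  have hc'0 : ∀ j, 0 ≤ c' j := fun j => by
    simp only [hc'def]
    split_ifs with hj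
    · have := (hSc j).1 hj; linarith
    · linarith [hc0 j]
  have hc'1 : ∀ j, c' j ≤ 1 := fun j => by
    simp only [hc'def]
    split_ifs with hj
    · linarith [hc1 j]
    · have := (hSc j).not.1 hj; linarith
  -- Sorting `c'` in decreasing order determines the simplex inside the cube. Ties are broken by the
  -- index so that the sort preserves the order within both blocks, as `childPerm` does.
  let key : Fin n → ℝ ×ₗ Fin n := fun j => toLex (-c' j, j)
  have hinj : Function.Injective key := fun a b hab => by
    have := congrArg (fun p => (ofLex p).2) hab
    simpa [key] using this
  set τ := Tuple.sort key with hτdef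
  have hτ : StrictMono (key ∘ τ) :=
    (Tuple.monotone_sort key).strictMono_of_injective (hinj.comp τ.injective)
  have hτs : ∀ i j, key i < key j → τ.symm i < τ.symm j := by
    intro i j hij
    have := hτ.lt_iff_lt (a := τ.symm i) (b := τ.symm j)
    simp only [Function.comp_apply, Equiv.apply_symm_apply] at this
    exact this.1 hij
  have hblock : ∀ i j : Fin n, i < j → ((i : ℕ) < S.card ↔ (j : ℕ) < S.card) →
      τ.symm i < τ.symm j := by
    intro i j hij hb
    apply hτs
    have h1 : c' j ≤ c' i := by
      simp only [hc'def, hb]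
      linarith [hanti hij.le]
    rw [Prod.Lex.lt_iff]
    simp only [key, ofLex_toLex]
    rcases lt_or_eq_of_le h1 with h2 | h2
    · left; linarith
    · right; exact ⟨by rw [h2], hij⟩
  -- The child is labelled by the positions that the first block occupies in the sorted order;
  -- `childPerm s` is then the inverse of the sorting permutation.
  set s : Finset (Fin n) := Finset.univ.filter (fun i => (τ i : ℕ) < S.card) with hsdef
  have hsS : s.card = S.card := by
    refine Finset.card_bij (fun i _ => τ i) ?_ ?_ ?_
    · intro a ha
      rw [hSlow]; simpa [hsdef] using ha
    · intro a _ b _ hab; exact τ.injective hab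
    · intro b hb
      rw [hSlow] at hb
      exact ⟨τ.symm b, by simp [hsdef, hb], by simp⟩
  have hperm : ∀ j, childPerm s j = τ.symm j := by
    intro j
    by_cases hj : (j : ℕ) < s.card
    · rw [childPerm_of_lt s j hj]
      have hn : ∀ i : Fin s.card, (i : ℕ) < n := fun i =>
        lt_of_lt_of_le i.2 (card_finset_fin_le s)
      have := Finset.orderEmbOfFin_unique (s := s) rfl
        (f := fun i : Fin s.card => τ.symm ⟨i, hn i⟩) (fun i => by
          refine Finset.mem_filter.2 ⟨Finset.mem_univ _, ?_⟩
          rw [Equiv.apply_symm_apply]; exact hsS ▸ i.2) (fun i i' hii => hblock _ _ hii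
            (iff_of_true (hsS ▸ i.2) (hsS ▸ i'.2)))
      exact (congrFun this ⟨j, hj⟩).symm
    · rw [childPerm_of_le s j (not_lt.1 hj)]
      have hcc := Finset.card_add_card_compl s
      simp only [Fintype.card_fin] at hcc
      have hn : ∀ i : Fin sᶜ.card, s.card + (i : ℕ) < n := fun i => by have := i.2; omega
      have := Finset.orderEmbOfFin_unique (s := sᶜ) rfl
        (f := fun i : Fin sᶜ.card => τ.symm ⟨s.card + i, hn i⟩) (fun i => by
          rw [Finset.mem_compl, Finset.mem_filter, Equiv.apply_symm_apply]
          have : ¬ s.card + (i : ℕ) < S.card := by omega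
          exact fun hh => this hh.2) (fun i i' hii => hblock _ _ (by
            have := Fin.lt_def.1 hii
            exact Fin.lt_def.2 (by simp only; omega))
            (iff_of_false (by simp only; omega) (by simp only; omega)))
      have h2 := (congrFun this ⟨j - s.card, by omega⟩).symm
      rw [h2]
      congr 1
      ext; simp; omega
  refine ⟨s, ?_⟩
  have hself : ∀ k : Fin (n + 1), t k = pathPoint t
      (fun i => ((0 : ℝ) + if ((Equiv.refl (Fin n)) i : ℕ) < k then 1 else 0) / 1) := by
    intro k
    conv_lhs => rw [vertex_eq_pathPoint t k]
    congr 1; funext i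
    by_cases hik : (i : ℕ) < k <;> simp [hik]
  have hch := child_eq_pathPoint t (fun _ => 0) (Equiv.refl _) 1 hself s
  -- The sorted coordinates are the path coordinates of `x` in the child. They decrease and lie in
  -- [0,1], so the weights below are convex.
  set d : Fin n → ℝ := c' ∘ τ with hddef
  have hd : Antitone d := by
    intro i j hij
    have := hτ.monotone hij
    have h2 := Prod.Lex.monotone_fst _ _ this
    simp only [Function.comp_apply, key, ofLex_toLex] at h2
    simp only [hddef, Function.comp_apply]
    linarith
  have hxs : x = ∑ k, pathWeight d k • child t s k := by
    have e1 : ∀ k, child t s k = pathPoint t (fun i => ((if (i : ℕ) < S.card then 1 else 0) +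
        if (τ.symm i : ℕ) < (k : Fin (n + 1)) then 1 else 0) / 2) := by
      intro k
      rw [hch]
      congr 1; funext i
      simp [hperm, hsS]
    simp_rw [e1]
    unfold pathPoint
    simp_rw [smul_add, Finset.smul_sum]
    rw [Finset.sum_add_distrib, ← Finset.sum_smul, sum_pathWeight, one_smul, Finset.sum_comm]
    conv_lhs => rw [← pathPoint_pathCoord h x]
    unfold pathPoint
    congr 1
    refine Finset.sum_congr rfl fun i _ => ?_
    simp_rw [smul_smul]
    rw [← Finset.sum_smul]
    congr 1
    have h1 : ∀ k : Fin (n + 1), pathWeight d k * (((if (i : ℕ) < S.card then 1 else 0) +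
        if (τ.symm i : ℕ) < (k : Fin (n + 1)) then 1 else 0) / 2) =
        (if (i : ℕ) < S.card then 1 else 0) / 2 * pathWeight d k +
        1 / 2 * (if (τ.symm i : ℕ) < (k : Fin (n + 1)) then pathWeight d k else 0) := by
      intro k; split_ifs <;> ring
    rw [Finset.sum_congr rfl fun k _ => h1 k, Finset.sum_add_distrib, ← Finset.mul_sum,
      ← Finset.mul_sum, sum_pathWeight, tail_pathWeight]
    simp only [hddef, Function.comp_apply, Equiv.apply_symm_apply, hc'def, hcdef]
    ring
  rw [hxs]
  exact (convex_hull' _).sum_mem (fun k _ => pathWeight_nonneg hd (fun i => hc'0 _)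
    (fun i => hc'1 _) k) (sum_pathWeight d) (fun k _ => vertex_mem_hull _ k)

theorem hull_child_subset (t : Simp n) (s : Finset (Fin n)) : hull (child t s) ⊆ hull t := by
  refine convexHull_min ?_ (convex_hull' t)
  rintro _ ⟨k, rfl⟩
  exact (convex_hull' t).midpoint_mem (vertex_mem_hull _ _) (vertex_mem_hull _ _)

theorem hull_subset_of_mem_subdivision {m : ℕ} (ht : t ∈ subdivision T m) : hull t ⊆ hull T := by
  induction m generalizing t with
  | zero => rw [subdivision, mem_singleton_iff] at ht; rw [ht]
  | succ m ih =>
    simp only [subdivision, mem_iUnion, mem_range] at ht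
    obtain ⟨t', ht', s, rfl⟩ := ht
    exact (hull_child_subset t' s).trans (ih ht')

theorem exists_mem_subdivision (h : AffineIndependent ℝ T) (m : ℕ) {x : Pt n} (hx : x ∈ hull T) :
    ∃ t ∈ subdivision T m, x ∈ hull t := by
  induction m with
  | zero => exact ⟨T, rfl, hx⟩
  | succ m ih =>
    obtain ⟨t, ht, hxt⟩ := ih
    obtain ⟨s, hs⟩ := exists_mem_hull_child (affineIndependent_of_mem_subdivision h ht) hxt
    exact ⟨child t s, by
      simp only [subdivision, mem_iUnion, mem_range]
      exact ⟨t, ht, s, rfl⟩, hs⟩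

theorem finite_subdivision (T : Simp n) (m : ℕ) : (subdivision T m).Finite := by
  induction m with
  | zero => exact finite_singleton T
  | succ m ih => exact ih.biUnion fun t _ => finite_range _

end Kuhn

/-! ### The gauge that describes vertex functions, and its symmetry on small faces. -/

section Gauge

variable {n : ℕ} {T t : Simp n}

/-- The largest modulus of a sum of `μ` over an interval of indices. In terms of differences of
barycentric coordinates this is the gauge of the support of a vertex function of the Kuhn
triangulation. -/
noncomputable def gauge' (μ : Fin (n + 1) → ℝ) : ℝ :=
  Finset.univ.sup' ⟨((0 : Fin (n + 1)), (0 : Fin (n + 1))), Finset.mem_univ _⟩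
    (fun ij => |∑ k ∈ Finset.Ico ij.1 ij.2, μ k|)

theorem le_gauge' (μ : Fin (n + 1) → ℝ) (i j : Fin (n + 1)) :
    |∑ k ∈ Finset.Ico i j, μ k| ≤ gauge' μ :=
  Finset.le_sup' (fun ij : Fin (n + 1) × Fin (n + 1) => |∑ k ∈ Finset.Ico ij.1 ij.2, μ k|)
    (Finset.mem_univ (i, j))

theorem gauge'_le {μ : Fin (n + 1) → ℝ} {c : ℝ}
    (h : ∀ i j, |∑ k ∈ Finset.Ico i j, μ k| ≤ c) : gauge' μ ≤ c :=
  Finset.sup'_le _ _ fun ij _ => h ij.1 ij.2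

theorem gauge'_nonneg (μ : Fin (n + 1) → ℝ) : 0 ≤ gauge' μ :=
  (abs_nonneg _).trans (le_gauge' μ 0 0)

theorem gauge'_smul (c : ℝ) (hc : 0 ≤ c) (μ : Fin (n + 1) → ℝ) :
    gauge' (fun k => c * μ k) = c * gauge' μ := by
  have h : ∀ i j : Fin (n + 1), |∑ k ∈ Finset.Ico i j, c * μ k| =
      c * |∑ k ∈ Finset.Ico i j, μ k| := fun i j => by
    rw [← Finset.mul_sum, abs_mul, abs_of_nonneg hc]
  refine le_antisymm (gauge'_le fun i j => ?_) ?_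
  · rw [h]; exact mul_le_mul_of_nonneg_left (le_gauge' μ i j) hc
  · rcases hc.eq_or_lt with h0 | h0
    · rw [← h0, zero_mul]; exact gauge'_nonneg _
    · rw [← le_div_iff₀' h0]
      refine gauge'_le fun i j => ?_
      rw [le_div_iff₀' h0, ← h]; exact le_gauge' _ i j

theorem gauge'_neg (μ : Fin (n + 1) → ℝ) : gauge' (fun k => -μ k) = gauge' μ := by
  unfold gauge'
  congr 1; funext ij
  rw [Finset.sum_neg_distrib, abs_neg]

/-- The sum of the entries of `μ` from index `i` on. -/
def tailSum (μ : Fin (n + 1) → ℝ) (i : Fin (n + 1)) : ℝ := ∑ k, if i ≤ k then μ k else 0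

theorem sum_Ico_eq_tailSum (μ : Fin (n + 1) → ℝ) {i j : Fin (n + 1)} (hij : i ≤ j) :
    ∑ k ∈ Finset.Ico i j, μ k = tailSum μ i - tailSum μ j := by
  unfold tailSum
  rw [← Finset.sum_sub_distrib]
  have : Finset.Ico i j = Finset.univ.filter (fun k => i ≤ k ∧ k < j) := by
    ext k; simp
  rw [this, Finset.sum_filter]
  refine Finset.sum_congr rfl fun k _ => ?_
  by_cases h1 : i ≤ k <;> by_cases h2 : j ≤ k <;> simp [h1, h2]
  exact absurd (hij.trans h2) h1

theorem abs_tailSum_sub_le (μ : Fin (n + 1) → ℝ) (i j : Fin (n + 1)) :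
    |tailSum μ i - tailSum μ j| ≤ gauge' μ := by
  rcases le_total i j with h | h
  · rw [← sum_Ico_eq_tailSum μ h]; exact le_gauge' _ _ _
  · rw [abs_sub_comm, ← sum_Ico_eq_tailSum μ h]; exact le_gauge' _ _ _

theorem gauge'_le_of_tailSum {μ : Fin (n + 1) → ℝ} {c : ℝ}
    (h : ∀ i j, |tailSum μ i - tailSum μ j| ≤ c) : gauge' μ ≤ c := by
  refine gauge'_le fun i j => ?_
  rcases le_total i j with hij | hij
  · rw [sum_Ico_eq_tailSum μ hij]; exact h i j
  · rw [Finset.Ico_eq_empty (not_lt.2 hij)]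
    simpa using (abs_nonneg _).trans (h i j)

theorem abs_le_gauge' {μ : Fin (n + 1) → ℝ} (hμ : ∑ k, μ k = 0) (k : Fin (n + 1)) :
    |μ k| ≤ gauge' μ := by
  have h0 : tailSum μ 0 = 0 := by simpa [tailSum] using hμ
  refine Fin.lastCases ?_ (fun i => ?_) k
  -- No half-open interval of indices contains the last one, so its entry is obtained as a
  -- difference of tail sums, using that the total sum vanishes.
  · have : tailSum μ (Fin.last n) = μ (Fin.last n) := by
      unfold tailSum
      rw [Finset.sum_eq_single (Fin.last n)]
      · simp
      · intro b _ hb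
        rw [if_neg]
        exact fun h => hb (le_antisymm (Fin.le_last _) h)
      · simp
    rw [← this, ← sub_zero (tailSum μ (Fin.last n)), ← h0]
    exact abs_tailSum_sub_le μ _ _
  · have := le_gauge' μ i.castSucc i.succ
    have e : Finset.Ico i.castSucc i.succ = {i.castSucc} := by
      ext k
      simp only [Finset.mem_Ico, Finset.mem_singleton, Fin.le_def, Fin.lt_def, Fin.ext_iff,
        Fin.val_castSucc, Fin.val_succ]
      omega
    rwa [e, Finset.sum_singleton] at this

/-- Of three entries with sum zero, a partial sum consists of at most one entry or is minus the one
entry left out. On such vectors the gauge is the maximum norm and does not see the order of the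
indices, which is how n ≤ 3 enters the conformity of the fine mesh. -/
theorem gauge'_le_of_support {μ : Fin (n + 1) → ℝ} (hμ : ∑ k, μ k = 0)
    {S : Finset (Fin (n + 1))} (hS : S.card ≤ 3) (h0 : ∀ k ∉ S, μ k = 0) {c : ℝ}
    (hc : ∀ k, |μ k| ≤ c) : gauge' μ ≤ c := by
  classical
  have hc0 : 0 ≤ c := (abs_nonneg _).trans (hc 0)
  have small : ∀ A : Finset (Fin (n + 1)), A.card ≤ 1 → |∑ k ∈ A, μ k| ≤ c := by
    intro A hA
    rcases Finset.card_le_one_iff_subset_singleton.1 hA with ⟨a, ha⟩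
    rcases Finset.subset_singleton_iff.1 ha with rfl | rfl
    · simpa using hc0
    · simpa using hc a
  refine gauge'_le fun i j => ?_
  set A := Finset.Ico i j
  have e1 : ∑ k ∈ A, μ k = ∑ k ∈ S ∩ A, μ k := by
    symm
    refine Finset.sum_subset Finset.inter_subset_right fun k hk hk' => h0 k fun hS => hk' ?_
    exact Finset.mem_inter.2 ⟨hS, hk⟩
  have e2 : ∑ k ∈ S, μ k = 0 := by
    rw [← hμ]
    exact Finset.sum_subset (Finset.subset_univ _) fun k _ hk => h0 k hk
  have e3 := Finset.sum_inter_add_sum_sdiff S A μ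
  have e4 := Finset.card_inter_add_card_sdiff S A
  rcases Nat.lt_or_ge 1 (S ∩ A).card with h | h
  · have : (S \ A).card ≤ 1 := by omega
    have h5 := small _ this
    rw [e1]
    have : ∑ k ∈ S ∩ A, μ k = - ∑ k ∈ S \ A, μ k := by linarith
    rwa [this, abs_neg]
  · rw [e1]; exact small _ h

/-- Scaled differences of barycentric coordinates. -/
noncomputable def relBary (T : Simp n) (m : ℕ) (p x : Pt n) (k : Fin (n + 1)) : ℝ :=
  2 ^ m * (bary T k x - bary T k p)

theorem sum_relBary (h : AffineIndependent ℝ T) (m : ℕ) (p x : Pt n) :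
    ∑ k, relBary T m p x k = 0 := by
  unfold relBary
  rw [← Finset.mul_sum, Finset.sum_sub_distrib, sum_bary h, sum_bary h, sub_self, mul_zero]

theorem relBary_eq_baryLin (h : AffineIndependent ℝ T) (m : ℕ) (p x : Pt n) (k : Fin (n + 1)) :
    relBary T m p x k = 2 ^ m * baryLin T k (x - p) := by
  rw [relBary, bary_sub h]

theorem tailSum_relBary_zero (h : AffineIndependent ℝ T) (m : ℕ) (p x : Pt n) :
    tailSum (relBary T m p x) 0 = 0 := by
  simpa [tailSum] using sum_relBary h m p x

theorem tailSum_relBary_succ (m : ℕ) (p x : Pt n) (i : Fin n) :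
    tailSum (relBary T m p x) i.succ = 2 ^ m * (pathCoord T i x - pathCoord T i p) := by
  unfold tailSum relBary pathCoord
  rw [← Finset.sum_sub_distrib, Finset.mul_sum]
  refine Finset.sum_congr rfl fun k _ => ?_
  have : i.succ ≤ k ↔ (i : ℕ) < k := by
    rw [Fin.le_def, Fin.val_succ]; omega
  by_cases hk : (i : ℕ) < k <;> simp [this, hk]

/-- Both sides are affine in `x` and agree at the vertices of `t`. -/
theorem isKuhn_pathCoord_eq (h : AffineIndependent ℝ T) (h' : AffineIndependent ℝ t) {m : ℕ}
    {z : Fin n → ℤ} {ρ : Equiv.Perm (Fin n)} (ht : ∀ k : Fin (n + 1),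
    t k = pathPoint T (fun i => ((z i : ℝ) + if (ρ i : ℕ) < k then 1 else 0) / 2 ^ m))
    (i : Fin n) (x : Pt n) : 2 ^ m * pathCoord T i x = z i + pathCoord t (ρ i) x := by
  obtain ⟨A, hA⟩ := pathCoord_affineMap h i
  rw [hA, affineMap_eq_sum_bary h' A, Finset.mul_sum]
  have : ∀ k, 2 ^ m * (bary t k x * A (t k)) = z i * bary t k x +
      if (ρ i : ℕ) < (k : Fin (n + 1)) then bary t k x else 0 := by
    intro k
    have := isKuhn_pathCoord h ht i k
    rw [hA] at this
    rw [mul_left_comm, this]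
    split_ifs <;> ring
  rw [Finset.sum_congr rfl fun k _ => this k, Finset.sum_add_distrib, ← Finset.mul_sum,
    sum_bary h', mul_one]
  rfl

theorem pathCoord_nonneg (h : AffineIndependent ℝ t) {x : Pt n} (hx : x ∈ hull t) (i : Fin n) :
    0 ≤ pathCoord t i x := by
  rw [mem_hull_iff h] at hx
  refine Finset.sum_nonneg fun k _ => ?_
  split_ifs
  · exact hx k
  · exact le_rfl

/-- In a Kuhn simplex the gauge determines the barycentric coordinates. -/
theorem gauge'_relBary_vertex (h : AffineIndependent ℝ T) {m : ℕ} (hk : IsKuhn T m t)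
    {x : Pt n} (hx : x ∈ hull t) (l : Fin (n + 1)) :
    gauge' (relBary T m (t l) x) = 1 - bary t l x := by
  have h' := hk.affineIndependent h
  obtain ⟨z, ρ, ht⟩ := hk
  have hx' := (mem_hull_iff h').1 hx
  set μ := relBary T m (t l) x with hμ
  have hE : ∀ i : Fin n, tailSum μ i.succ =
      pathCoord t (ρ i) x - if (ρ i : ℕ) < l then 1 else 0 := by
    intro i
    rw [hμ, tailSum_relBary_succ, mul_sub, isKuhn_pathCoord_eq h h' ht, isKuhn_pathCoord h ht]
    ring
  have hE0 : tailSum μ 0 = 0 := tailSum_relBary_zero h m _ x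
  -- With λ = bary t l x, all tail sums of `μ` lie in the interval from A + λ - 1 to A, of length 1
  -- - λ, and both ends are attained. The gauge is the largest difference of two tail sums.
  set A : ℝ := ∑ k : Fin (n + 1), if l < k then bary t k x else 0 with hA
  have hAB : A + bary t l x = ∑ k : Fin (n + 1), if l ≤ k then bary t k x else 0 := by
    have : ∀ k : Fin (n + 1), (if l ≤ k then bary t k x else 0) =
        (if l < k then bary t k x else 0) + if k = l then bary t k x else 0 := by
      intro k
      rcases lt_trichotomy l k with h1 | h1 | h1
      · simp [h1, h1.le, h1.ne']
      · simp [h1]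
      · simp [not_le.2 h1, not_lt.2 h1.le, h1.ne]
    rw [Finset.sum_congr rfl fun k _ => this k, Finset.sum_add_distrib]
    simp [hA]
  have hA0 : 0 ≤ A := Finset.sum_nonneg fun k _ => by
    split_ifs
    · exact hx' k
    · exact le_rfl
  have hB1 : A + bary t l x ≤ 1 := by
    rw [hAB, ← sum_bary h' x]
    refine Finset.sum_le_sum fun k _ => ?_
    split_ifs
    · exact le_rfl
    · exact hx' k
  have mono : ∀ (P Q : Fin (n + 1) → Prop) [DecidablePred P] [DecidablePred Q],
      (∀ k, P k → Q k) → (∑ k, if P k then bary t k x else 0) ≤ ∑ k, if Q k then bary t k x else 0 := by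
    intro P Q _ _ hPQ
    refine Finset.sum_le_sum fun k _ => ?_
    by_cases hp : P k
    · simp [hp, hPQ k hp]
    · by_cases hq : Q k
      · simp [hp, hq, hx' k]
      · simp [hp, hq]
  have hle1 : ∀ j : Fin n, pathCoord t j x ≤ 1 := fun j => by
    rw [← sum_bary h' x]
    have := mono (fun k => (j : ℕ) < k) (fun _ => True) (fun _ _ => trivial)
    simpa [pathCoord] using this
  have hrange : ∀ i, A + bary t l x - 1 ≤ tailSum μ i ∧ tailSum μ i ≤ A := by
    intro i
    refine Fin.cases ?_ (fun i => ?_) i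
    · rw [hE0]; exact ⟨by linarith, hA0⟩
    · rw [hE]
      split_ifs with hi
      · have : A + bary t l x ≤ pathCoord t (ρ i) x := by
          rw [hAB]
          exact mono _ _ fun k hk => lt_of_lt_of_le hi (Fin.le_def.1 hk)
        exact ⟨by linarith, by linarith [hle1 (ρ i)]⟩
      · have : pathCoord t (ρ i) x ≤ A := mono _ _ fun k hk => Fin.lt_def.2 (by omega)
        exact ⟨by linarith [pathCoord_nonneg h' hx (ρ i)], by linarith⟩
  refine le_antisymm (gauge'_le_of_tailSum fun i j => ?_) ?_
  · have h1 := hrange i; have h2 := hrange j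
    rw [abs_le]; constructor <;> linarith [h1.1, h1.2, h2.1, h2.2]
  -- The upper end belongs to the step of the path that leaves t l, the lower end to the step that
  -- arrives there. If t l is the last or the first vertex, the tail sum at 0, which vanishes, takes
  -- the role of the missing step.
  · have hi : ∃ i, tailSum μ i = A := by
      by_cases hl : (l : ℕ) < n
      · refine ⟨(ρ.symm ⟨l, hl⟩).succ, ?_⟩
        rw [hE, Equiv.apply_symm_apply, if_neg (lt_irrefl _), sub_zero]
        rfl
      · refine ⟨0, ?_⟩
        rw [hE0, hA]; symm
        refine Finset.sum_eq_zero fun k _ => if_neg ?_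
        rw [Fin.lt_def]; omega
    have hj : ∃ j, tailSum μ j = A + bary t l x - 1 := by
      by_cases hl : (l : ℕ) = 0
      · refine ⟨0, ?_⟩
        rw [hE0, hAB]
        have : ∀ k : Fin (n + 1), l ≤ k := fun k => Fin.le_def.2 (by omega)
        simp [this, sum_bary h']
      · have hl' : (l : ℕ) - 1 < n := by omega
        refine ⟨(ρ.symm ⟨l - 1, hl'⟩).succ, ?_⟩
        rw [hE, hAB]
        have h1 : (l : ℕ) - 1 < l := by omega
        have h2 : ∀ k : Fin (n + 1), ((l : ℕ) - 1 < k) ↔ l ≤ k := fun k => by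
          rw [Fin.le_def]; omega
        simp [pathCoord, h1, h2]
    obtain ⟨i, hi⟩ := hi
    obtain ⟨j, hj⟩ := hj
    have := abs_tailSum_sub_le μ i j
    rw [hi, hj] at this
    have h3 := (abs_le.1 this).2
    linarith

/-- A lattice point at gauge distance less than one from a point of a Kuhn simplex is a vertex. -/
theorem exists_vertex_of_gauge'_lt (h : AffineIndependent ℝ T) {m : ℕ} (hk : IsKuhn T m t)
    {x p : Pt n} (hx : x ∈ hull t) (hp : ∀ i, ∃ a : ℤ, 2 ^ m * pathCoord T i p = a)
    (hg : gauge' (relBary T m p x) < 1) : ∃ l, p = t l := by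
  classical
  have h' := hk.affineIndependent h
  obtain ⟨z, ρ, ht⟩ := hk
  have hx' := (mem_hull_iff h').1 hx
  choose a ha using hp
  set μ := relBary T m p x with hμ
  have hE : ∀ i : Fin n, tailSum μ i.succ = pathCoord t (ρ i) x - ((a i - z i : ℤ) : ℝ) := by
    intro i
    rw [hμ, tailSum_relBary_succ, mul_sub, isKuhn_pathCoord_eq h h' ht, ha]
    push_cast; ring
  have hE0 : tailSum μ 0 = 0 := tailSum_relBary_zero h m _ x
  have hd : ∀ i j, |tailSum μ i - tailSum μ j| < 1 := fun i j =>
    lt_of_le_of_lt (abs_tailSum_sub_le μ i j) hg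
  have hle1 : ∀ j : Fin n, pathCoord t j x ≤ 1 := fun j => by
    rw [← sum_bary h' x]
    refine Finset.sum_le_sum fun k _ => ?_
    split_ifs
    · exact le_rfl
    · exact hx' k
  -- These integers lie strictly between -1 and 2, since the path coordinates of `x` in `t` are in
  -- [0,1] and the gauge is less than one.
  have h01 : ∀ i, a i - z i = 0 ∨ a i - z i = 1 := by
    intro i
    have h1 := hd i.succ 0
    rw [hE0, hE, sub_zero, abs_lt] at h1
    have h2 := pathCoord_nonneg h' hx (ρ i)
    have h3 := hle1 (ρ i)
    have h4 : ((a i - z i : ℤ) : ℝ) < (2 : ℤ) := by push_cast at h1 ⊢; linarith [h1.1]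
    have h5 : ((-1 : ℤ) : ℝ) < ((a i - z i : ℤ) : ℝ) := by push_cast at h1 ⊢; linarith [h1.2]
    have h6 := Int.cast_lt.1 h4
    have h7 := Int.cast_lt.1 h5
    omega
  -- Comparing two tail sums shows that coordinates with offset 1 precede those with offset 0 in the
  -- order of `ρ`. Hence `p` is the vertex of `t` whose index is the number of offsets equal to 1.
  have hord : ∀ i j, a i - z i = 1 → a j - z j = 0 → ρ i < ρ j := by
    intro i j hi hj
    have h1 := hd j.succ i.succ
    rw [hE, hE, hi, hj, abs_lt] at h1
    have h2 : pathCoord t (ρ j) x < pathCoord t (ρ i) x := by push_cast at h1; linarith [h1.2]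
    by_contra hle
    have hle' := Fin.le_def.1 (not_lt.1 hle)
    refine absurd h2 (not_lt.2 ?_)
    refine Finset.sum_le_sum fun k _ => ?_
    by_cases h3 : (ρ i : ℕ) < k
    · rw [if_pos h3, if_pos (by omega)]
    · rw [if_neg h3]; split_ifs
      · exact hx' k
      · exact le_rfl
  set S : Finset (Fin n) := (Finset.univ.filter (fun i => a i - z i = 1)).image ρ with hS
  have hSm : ∀ i, ρ i ∈ S ↔ a i - z i = 1 := fun i => by simp [hS]
  have hlow : ∀ j, j ∈ S ↔ (j : ℕ) < S.card := mem_iff_lt_card_of_lower (by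
    intro j hj k hkj
    obtain ⟨i, rfl⟩ := ρ.surjective j
    obtain ⟨i', rfl⟩ := ρ.surjective k
    rw [hSm] at hj ⊢
    rcases h01 i' with h0 | h1
    · exact absurd (hord i i' hj h0) (not_lt.2 hkj)
    · exact h1)
  refine ⟨⟨S.card, Nat.lt_succ_of_le (card_finset_fin_le S)⟩, ?_⟩
  rw [ht, ← pathPoint_pathCoord h p]
  congr 1; funext i
  rw [eq_div_iff (by positivity), mul_comm, ha]
  have h8 := hlow (ρ i)
  rw [hSm] at h8
  rcases h01 i with h0 | h1
  · have : ¬ ((ρ i : ℕ) < S.card) := fun hh => by have := h8.2 hh; omega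
    simp only [this, if_false, add_zero]
    have : a i = z i := by omega
    rw [this]
  · simp only [h8.1 h1, if_true]
    have : a i = z i + 1 := by omega
    rw [this]; push_cast; ring

theorem bary_eq_pathWeight (h : AffineIndependent ℝ T) (x : Pt n) (k : Fin (n + 1)) :
    bary T k x = pathWeight (fun i => pathCoord T i x) k := by
  refine bary_eq_of_sum h (sum_pathWeight _) ?_ k
  rw [sum_mul_tail (sum_pathWeight _)]
  simp_rw [tail_pathWeight]
  exact (pathPoint_pathCoord h x).symm

theorem int_pathCoord_of_bary {m : ℕ} {p : Pt n}
    (hp : ∀ k, ∃ a : ℤ, 2 ^ m * bary T k p = a) (i : Fin n) :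
    ∃ a : ℤ, 2 ^ m * pathCoord T i p = a := by
  choose a ha using hp
  refine ⟨∑ k : Fin (n + 1), if (i : ℕ) < k then a k else 0, ?_⟩
  unfold pathCoord
  rw [Finset.mul_sum]
  push_cast
  refine Finset.sum_congr rfl fun k _ => ?_
  split_ifs
  · exact ha k
  · simp

theorem int_bary_of_pathCoord (h : AffineIndependent ℝ T) {m : ℕ} {p : Pt n}
    (hp : ∀ i, ∃ a : ℤ, 2 ^ m * pathCoord T i p = a) (k : Fin (n + 1)) :
    ∃ a : ℤ, 2 ^ m * bary T k p = a := by
  choose a ha using hp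
  have : ∀ j : ℕ, ∃ b : ℤ, 2 ^ m * pathSeq (fun i => pathCoord T i p) j = b := by
    intro j
    unfold pathSeq
    split_ifs with h1 h2
    · exact ⟨2 ^ m, by push_cast; ring⟩
    · exact ⟨_, ha _⟩
    · exact ⟨0, by simp⟩
  obtain ⟨b, hb⟩ := this k
  obtain ⟨c, hc⟩ := this (k + 1)
  refine ⟨b - c, ?_⟩
  rw [bary_eq_pathWeight h, pathWeight, mul_sub, hb, hc]
  push_cast; ring

theorem mem_lattice_iff (h : AffineIndependent ℝ T) {m : ℕ} {p : Pt n} :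
    p ∈ lattice T m ↔ p ∈ hull T ∧ ∀ k, ∃ a : ℤ, 2 ^ m * bary T k p = a := by
  classical
  unfold lattice
  rw [Finset.mem_image]
  constructor
  · rintro ⟨a, ha, rfl⟩
    rw [Finset.mem_piAntidiag] at ha
    have hb : ∀ k, bary T k (∑ k, ((a k : ℝ) / 2 ^ m) • T k) = (a k : ℝ) / 2 ^ m := by
      refine bary_eq_of_sum h ?_ rfl
      rw [← Finset.sum_div, div_eq_one_iff_eq (by positivity)]
      exact_mod_cast ha.1
    rw [mem_hull_iff h]
    refine ⟨fun k => by rw [hb]; positivity, fun k => ⟨a k, ?_⟩⟩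
    rw [hb]; push_cast; field_simp
  · rintro ⟨hp, hk⟩
    rw [mem_hull_iff h] at hp
    choose a ha using hk
    have ha0 : ∀ k, 0 ≤ a k := fun k => by
      have : (0 : ℝ) ≤ a k := by rw [← ha]; exact mul_nonneg (by positivity) (hp k)
      exact_mod_cast this
    have hcast : ∀ k, (((a k).toNat : ℕ) : ℝ) = a k := fun k => by
      have := Int.toNat_of_nonneg (ha0 k)
      exact_mod_cast this
    refine ⟨fun k => (a k).toNat, ?_, ?_⟩
    · rw [Finset.mem_piAntidiag]
      refine ⟨?_, fun _ _ => Finset.mem_univ _⟩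
      have : (∑ k, (((a k).toNat : ℕ) : ℝ)) = 2 ^ m := by
        simp_rw [hcast, ← ha]
        rw [← Finset.mul_sum, sum_bary h, mul_one]
      exact_mod_cast this
    · conv_rhs => rw [← sum_bary_smul h p]
      refine Finset.sum_congr rfl fun k _ => ?_
      rw [hcast, ← ha]
      congr 1; field_simp

theorem vertex_mem_lattice (h : AffineIndependent ℝ T) {m : ℕ} (ht : t ∈ subdivision T m)
    (k : Fin (n + 1)) : t k ∈ lattice T m := by
  rw [mem_lattice_iff h]
  refine ⟨hull_subset_of_mem_subdivision ht (vertex_mem_hull t k), ?_⟩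
  obtain ⟨z, ρ, hz⟩ := isKuhn_of_mem_subdivision ht
  refine int_bary_of_pathCoord h fun i => ⟨z i + if (ρ i : ℕ) < k then 1 else 0, ?_⟩
  rw [isKuhn_pathCoord h hz]
  push_cast
  rfl

end Gauge

/-! ### Vertex functions and conformity across macro-faces. -/

section Hat

variable {n : ℕ} {T T' t : Simp n} {Ω : Set (Pt n)} {M : Finset (Simp n)} {m : ℕ}

theorem bary_eq_zero_of_mem_face (h : AffineIndependent ℝ T) {S : Set (Pt n)} {x : Pt n}
    (hx : x ∈ convexHull ℝ (range T ∩ S)) {k : Fin (n + 1)} (hk : T k ∉ S) : bary T k x = 0 := by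
  obtain ⟨A, hA⟩ := bary_affineMap h k
  have hconv : Convex ℝ {y | bary T k y = 0} := by
    have : {y | bary T k y = 0} = A ⁻¹' {0} := by ext y; simp [hA]
    rw [this]; exact (convex_singleton (0 : ℝ)).affine_preimage A
  refine convexHull_min ?_ hconv hx
  rintro _ ⟨⟨l, rfl⟩, hl⟩
  have : k ≠ l := fun hh => hk (hh ▸ hl)
  simp [bary_vertex h, this]

theorem bary_eq_of_mem_face (h : AffineIndependent ℝ T) (h' : AffineIndependent ℝ T')
    {x : Pt n} (hx : x ∈ convexHull ℝ (range T ∩ range T')) {k k' : Fin (n + 1)}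
    (hk : T k = T' k') : bary T k x = bary T' k' x := by
  obtain ⟨A, hA⟩ := bary_affineMap h k
  obtain ⟨A', hA'⟩ := bary_affineMap h' k'
  have hconv : Convex ℝ {y | bary T k y = bary T' k' y} := by
    have : {y | bary T k y = bary T' k' y} = (A - A') ⁻¹' {0} := by
      ext y; simp [hA, hA', sub_eq_zero]
    rw [this]; exact (convex_singleton (0 : ℝ)).affine_preimage _
  refine convexHull_min ?_ hconv hx
  rintro _ ⟨⟨l, rfl⟩, ⟨l', hl'⟩⟩
  have : k = l ↔ k' = l' := by
    rw [← h.injective.eq_iff, ← h'.injective.eq_iff, hk, hl']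
  simp only [mem_ofPred_eq]
  rw [bary_vertex h, ← hl', bary_vertex h']
  simp [this]

theorem openHull_nonempty (h : AffineIndependent ℝ T) : (openHull T).Nonempty := by
  refine ⟨∑ k, (1 / ((n : ℝ) + 1)) • T k, ?_⟩
  rw [mem_openHull_iff h]
  intro k
  rw [bary_eq_of_sum h (w := fun _ => 1 / ((n : ℝ) + 1)) (by simp; field_simp) rfl]
  positivity

theorem convex_openHull (T : Simp n) : Convex ℝ (openHull T) := (convex_hull' T).interior

theorem closure_openHull (h : AffineIndependent ℝ T) : closure (openHull T) = hull T := by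
  have := (convex_hull' T).closure_interior_eq_closure_of_nonempty_interior (openHull_nonempty h)
  rw [openHull, this, (isCompact_hull T).isClosed.closure_eq]

theorem openHull_subset_hull (T : Simp n) : openHull T ⊆ hull T := interior_subset

theorem isOpen_openHull (T : Simp n) : IsOpen (openHull T) := isOpen_interior

namespace IsMacroMesh

variable (hM : IsMacroMesh Ω M)
include hM

theorem eq_of_mem_openHull (hT : T ∈ M) (hT' : T' ∈ M) {x : Pt n} (hx : x ∈ openHull T)
    (hx' : x ∈ hull T') : T = T' := by
  by_contra hne
  rw [← closure_openHull (hM.nondegenerate T' hT')] at hx'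
  obtain ⟨y, hy, hy'⟩ := mem_closure_iff.1 hx' _ (isOpen_openHull T) hx
  exact Set.disjoint_left.1 (hM.disjoint T hT T' hT' hne) hy hy'

/-- If all n + 1 vertices were shared, one element would contain the other, against the disjointness
of the interiors. -/
theorem card_face_le (hT : T ∈ M) (hT' : T' ∈ M) (hne : T ≠ T') :
    open scoped Classical in
    (Finset.univ.filter (fun k => T k ∈ range T')).card ≤ n := by
  classical
  by_contra hlt
  have hall : (Finset.univ.filter (fun k => T k ∈ range T')) = Finset.univ := by
    apply Finset.eq_univ_of_card
    have := Finset.card_le_univ (Finset.univ.filter (fun k => T k ∈ range T'))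
    simp only [Fintype.card_fin] at this ⊢
    omega
  have hsub : hull T ⊆ hull T' := by
    refine convexHull_mono ?_
    rintro _ ⟨k, rfl⟩
    have : k ∈ (Finset.univ.filter (fun k => T k ∈ range T')) := by rw [hall]; simp
    simpa using this
  obtain ⟨x, hx⟩ := openHull_nonempty (hM.nondegenerate T hT)
  exact hne (hM.eq_of_mem_openHull hT hT' hx (hsub (openHull_subset_hull T hx)))

theorem mem_face (hT : T ∈ M) (hT' : T' ∈ M) {x : Pt n} (hx : x ∈ hull T) (hx' : x ∈ hull T') :
    x ∈ convexHull ℝ (range T ∩ range T') := by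
  rw [← hM.conforming T hT T' hT']; exact ⟨hx, hx'⟩

/-- On the common face the coordinates of unshared vertices vanish and those of shared vertices
agree. At most n ≤ 3 entries are left, so the gauge of one side is bounded by their maximum modulus,
and every entry is bounded by the gauge of the other side. -/
theorem gauge'_face_le (hn : n ≤ 3) (hT : T ∈ M) (hT' : T' ∈ M) {p x : Pt n}
    (hp : p ∈ hull T) (hp' : p ∈ hull T') (hx : x ∈ hull T) (hx' : x ∈ hull T') :
    gauge' (relBary T m p x) ≤ gauge' (relBary T' m p x) := by
  classical
  by_cases hne : T = T'
  · rw [hne]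
  have h := hM.nondegenerate T hT
  have h' := hM.nondegenerate T' hT'
  have hpf := hM.mem_face hT hT' hp hp'
  have hxf := hM.mem_face hT hT' hx hx'
  have hz : ∀ k, T k ∉ range T' → relBary T m p x k = 0 := fun k hk => by
    rw [relBary, bary_eq_zero_of_mem_face h hpf hk, bary_eq_zero_of_mem_face h hxf hk]; simp
  refine gauge'_le_of_support (sum_relBary h m p x)
    (S := Finset.univ.filter (fun k => T k ∈ range T'))
    ((hM.card_face_le hT hT' hne).trans hn) (fun k hk => hz k (by simpa using hk)) fun k => ?_
  by_cases hk : T k ∈ range T'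
  · obtain ⟨k', hk'⟩ := hk
    have : relBary T m p x k = relBary T' m p x k' := by
      rw [relBary, relBary, bary_eq_of_mem_face h h' hpf hk'.symm,
        bary_eq_of_mem_face h h' hxf hk'.symm]
    rw [this]
    exact abs_le_gauge' (sum_relBary h' m p x) k'
  · rw [hz k hk, abs_zero]; exact gauge'_nonneg _

theorem gauge'_face_eq (hn : n ≤ 3) (hT : T ∈ M) (hT' : T' ∈ M) {p x : Pt n}
    (hp : p ∈ hull T) (hp' : p ∈ hull T') (hx : x ∈ hull T) (hx' : x ∈ hull T') :
    gauge' (relBary T m p x) = gauge' (relBary T' m p x) :=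
  le_antisymm (hM.gauge'_face_le hn hT hT' hp hp' hx hx')
    (hM.gauge'_face_le hn hT' hT hp' hp hx' hx)

theorem mem_lattice_of_mem_hull (hT : T ∈ M) (hT' : T' ∈ M) {p : Pt n}
    (hp : p ∈ lattice T m) (hp' : p ∈ hull T') : p ∈ lattice T' m := by
  have h := hM.nondegenerate T hT
  have h' := hM.nondegenerate T' hT'
  rw [mem_lattice_iff h] at hp
  rw [mem_lattice_iff h']
  refine ⟨hp', fun k' => ?_⟩
  have hpf := hM.mem_face hT' hT hp' hp.1
  by_cases hk : T' k' ∈ range T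
  · obtain ⟨k, hk⟩ := hk
    rw [bary_eq_of_mem_face h' h hpf hk.symm]
    exact hp.2 k
  · exact ⟨0, by rw [bary_eq_zero_of_mem_face h' hpf hk]; simp⟩

/-- Some vertex of `T` outside of `T'` has a nonzero coordinate at `p`, hence one of at least
2^(-m), while this coordinate vanishes at `x` on the common face. -/
theorem one_le_gauge'_of_notMem (hT : T ∈ M) (hT' : T' ∈ M) {p x : Pt n}
    (hp : p ∈ lattice T m) (hx : x ∈ hull T) (hx' : x ∈ hull T') (hp' : p ∉ hull T') :
    1 ≤ gauge' (relBary T m p x) := by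
  have h := hM.nondegenerate T hT
  rw [mem_lattice_iff h] at hp
  obtain ⟨k, hk, hk0⟩ : ∃ k, T k ∉ range T' ∧ bary T k p ≠ 0 := by
    by_contra hcon
    push Not at hcon
    apply hp'
    rw [← sum_bary_smul h p]
    have hpos := (mem_hull_iff h).1 hp.1
    classical
    have e : ∑ k, bary T k p • T k =
        ∑ k ∈ Finset.univ.filter (fun k => T k ∈ range T'), bary T k p • T k := by
      rw [Finset.sum_filter]
      refine Finset.sum_congr rfl fun k _ => ?_
      split_ifs with hk
      · rfl
      · rw [hcon k hk, zero_smul]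
    have e' : ∑ k, bary T k p =
        ∑ k ∈ Finset.univ.filter (fun k => T k ∈ range T'), bary T k p := by
      rw [Finset.sum_filter]
      refine Finset.sum_congr rfl fun k _ => ?_
      split_ifs with hk
      · rfl
      · rw [hcon k hk]
    rw [e]
    refine (convex_hull' T').sum_mem (fun k _ => hpos k) (by rw [← e', sum_bary h]) ?_
    intro k hk
    exact subset_convexHull ℝ _ (by simpa using hk)
  have hx0 := bary_eq_zero_of_mem_face h (hM.mem_face hT hT' hx hx') hk
  obtain ⟨a, ha⟩ := hp.2 k
  have hpos : 0 < bary T k p := lt_of_le_of_ne ((mem_hull_iff h).1 hp.1 k) (Ne.symm hk0)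
  have ha1 : (1 : ℝ) ≤ a := by
    have : (0 : ℝ) < a := by rw [← ha]; positivity
    have h1 : (0 : ℤ) < a := by exact_mod_cast this
    exact_mod_cast h1
  refine le_trans ?_ (abs_le_gauge' (sum_relBary h m p x) k)
  rw [relBary, hx0, zero_sub, mul_neg, ha, abs_neg]
  exact ha1.trans (le_abs_self _)

/-- On a macro-element that contains `p`, the vertex function of `p` is given by the gauge. -/
theorem hat_eq (hn : n ≤ 3) (hT : T ∈ M) {p x : Pt n} (hp : p ∈ lattice T m) (hx : x ∈ hull T) :
    hat M m p x = max 0 (1 - gauge' (relBary T m p x)) := by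
  have h := hM.nondegenerate T hT
  have hpT := ((mem_lattice_iff h).1 hp).1
  unfold hat
  set Y := {y : ℝ | ∃ t ∈ fineMesh M m, ∃ k, t k = p ∧ x ∈ hull t ∧ y = bary t k x} with hY
  -- An element with vertex `p` may belong to another macro-element; the gauges agree on the common
  -- face, so the value is the same.
  have hval : ∀ y ∈ Y, y = max 0 (1 - gauge' (relBary T m p x)) := by
    rintro y ⟨t, ht, k, rfl, hxt, rfl⟩
    simp only [fineMesh, mem_iUnion] at ht
    obtain ⟨T', hT', ht⟩ := ht
    have h' := hM.nondegenerate T' hT'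
    have hsub := hull_subset_of_mem_subdivision ht
    have hti := affineIndependent_of_mem_subdivision h' ht
    rw [hM.gauge'_face_eq hn hT hT' hpT (hsub (vertex_mem_hull t k)) hx (hsub hxt),
      gauge'_relBary_vertex h' (isKuhn_of_mem_subdivision ht) hxt k, sub_sub_cancel,
      max_eq_right ((mem_hull_iff hti).1 hxt k)]
  rcases Y.eq_empty_or_nonempty with h0 | ⟨y, hy⟩
  -- The supremum of the empty set is 0, which is the right value: a gauge below one would make `p`
  -- a vertex of the fine element of `T` that contains `x`.
  · rw [h0, Real.sSup_empty]
    obtain ⟨t, ht, hxt⟩ := exists_mem_subdivision h m hx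
    have hg : 1 ≤ gauge' (relBary T m p x) := by
      by_contra hlt
      obtain ⟨l, hl⟩ := exists_vertex_of_gauge'_lt h (isKuhn_of_mem_subdivision ht) hxt
        (int_pathCoord_of_bary ((mem_lattice_iff h).1 hp).2) (not_le.1 hlt)
      have : bary t l x ∈ Y := ⟨t, by
        simp only [fineMesh, mem_iUnion]; exact ⟨T, hT, ht⟩, l, hl.symm, hxt, rfl⟩
      rw [h0] at this; exact this
    rw [max_eq_left (by linarith)]
  · have : Y = {max 0 (1 - gauge' (relBary T m p x))} := by
      ext z; constructor
      · intro hz; exact hval z hz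
      · intro hz
        rw [mem_singleton_iff] at hz
        rw [hz, ← hval y hy]; exact hy
    rw [this, csSup_singleton]

/-- A fine element that contains `x` and has `p` as a vertex lies in a macro-element that meets `T`
at `x`. Its gauge distance from `p` to `x` is at least one, so the barycentric coordinate is zero.
-/
theorem hat_eq_zero_of_notMem (hT : T ∈ M) {p x : Pt n} (hx : x ∈ hull T) (hpT : p ∉ hull T) : hat M m p x = 0 := by
  unfold hat
  set Y := {y : ℝ | ∃ t ∈ fineMesh M m, ∃ k, t k = p ∧ x ∈ hull t ∧ y = bary t k x} with hY
  have hval : ∀ y ∈ Y, y = 0 := by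
    rintro y ⟨t, ht, k, rfl, hxt, rfl⟩
    simp only [fineMesh, mem_iUnion] at ht
    obtain ⟨T₁, hT₁, ht⟩ := ht
    have h₁ := hM.nondegenerate T₁ hT₁
    have hsub := hull_subset_of_mem_subdivision ht
    have hti := affineIndependent_of_mem_subdivision h₁ ht
    have := hM.one_le_gauge'_of_notMem hT₁ hT (vertex_mem_lattice h₁ ht k) (hsub hxt) hx hpT
    rw [gauge'_relBary_vertex h₁ (isKuhn_of_mem_subdivision ht) hxt k] at this
    have h0 := (mem_hull_iff hti).1 hxt k
    linarith
  rcases Y.eq_empty_or_nonempty with h0 | ⟨y, hy⟩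
  · rw [h0, Real.sSup_empty]
  · have : Y = {0} := by
      ext z; constructor
      · intro hz; exact hval z hz
      · intro hz
        rw [mem_singleton_iff] at hz
        rw [hz, ← hval y hy]; exact hy
    rw [this, csSup_singleton]

end IsMacroMesh

theorem mem_fineMesh_iff : t ∈ fineMesh M m ↔ ∃ T ∈ M, t ∈ subdivision T m := by
  simp [fineMesh]

theorem mem_vertices_iff {p : Pt n} : p ∈ vertices M m ↔ ∃ T ∈ M, p ∈ lattice T m := by
  classical
  unfold vertices; rw [Finset.mem_biUnion]

theorem finite_fineMesh (M : Finset (Simp n)) (m : ℕ) : (fineMesh M m).Finite :=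
  M.finite_toSet.biUnion fun T _ => finite_subdivision T m

namespace IsMacroMesh

variable (hM : IsMacroMesh Ω M)
include hM

theorem fine_affineIndependent (ht : t ∈ fineMesh M m) : AffineIndependent ℝ t := by
  obtain ⟨T, hT, ht⟩ := mem_fineMesh_iff.1 ht
  exact affineIndependent_of_mem_subdivision (hM.nondegenerate T hT) ht

theorem fine_vertex_mem (ht : t ∈ fineMesh M m) (k : Fin (n + 1)) : t k ∈ vertices M m := by
  obtain ⟨T, hT, ht⟩ := mem_fineMesh_iff.1 ht
  exact mem_vertices_iff.2 ⟨T, hT, vertex_mem_lattice (hM.nondegenerate T hT) ht k⟩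

theorem hull_subset_closure (hT : T ∈ M) : hull T ⊆ closure Ω := by
  rw [hM.covers]; exact subset_biUnion_of_mem (u := fun T => hull T) hT

theorem fine_hull_subset (ht : t ∈ fineMesh M m) : hull t ⊆ closure Ω := by
  obtain ⟨T, hT, ht⟩ := mem_fineMesh_iff.1 ht
  exact (hull_subset_of_mem_subdivision ht).trans (hM.hull_subset_closure hT)

theorem exists_fine_mem {x : Pt n} (hx : x ∈ closure Ω) : ∃ t ∈ fineMesh M m, x ∈ hull t := by
  rw [hM.covers] at hx
  simp only [mem_iUnion] at hx
  obtain ⟨T, hT, hx⟩ := hx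
  obtain ⟨t, ht, hxt⟩ := exists_mem_subdivision (hM.nondegenerate T hT) m hx
  exact ⟨t, mem_fineMesh_iff.2 ⟨T, hT, ht⟩, hxt⟩

theorem hat_vertex (hn : n ≤ 3) (ht : t ∈ fineMesh M m) {x : Pt n} (hx : x ∈ hull t)
    (k : Fin (n + 1)) : hat M m (t k) x = bary t k x := by
  have hti := hM.fine_affineIndependent ht
  obtain ⟨T, hT, ht⟩ := mem_fineMesh_iff.1 ht
  have h := hM.nondegenerate T hT
  rw [hM.hat_eq hn hT (vertex_mem_lattice h ht k) (hull_subset_of_mem_subdivision ht hx),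
    gauge'_relBary_vertex h (isKuhn_of_mem_subdivision ht) hx k, sub_sub_cancel,
    max_eq_right ((mem_hull_iff hti).1 hx k)]

theorem hat_eq_zero (hn : n ≤ 3) (ht : t ∈ fineMesh M m) {p x : Pt n} (hp : p ∈ vertices M m)
    (hpt : p ∉ range t) (hx : x ∈ hull t) : hat M m p x = 0 := by
  obtain ⟨T, hT, ht⟩ := mem_fineMesh_iff.1 ht
  obtain ⟨T', hT', hp'⟩ := mem_vertices_iff.1 hp
  have h := hM.nondegenerate T hT
  have hxT := hull_subset_of_mem_subdivision ht hx
  by_cases hpT : p ∈ hull T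
  · have hpl := hM.mem_lattice_of_mem_hull hT' hT hp' hpT
    rw [hM.hat_eq hn hT hpl hxT]
    refine max_eq_left ?_
    by_contra hlt
    obtain ⟨l, hl⟩ := exists_vertex_of_gauge'_lt h (isKuhn_of_mem_subdivision ht) hx
        (int_pathCoord_of_bary ((mem_lattice_iff h).1 hpl).2) (by linarith)
    exact hpt ⟨l, hl.symm⟩
  · exact hM.hat_eq_zero_of_notMem hT hxT hpT

theorem hat_eq_zero_of_notMem_closure {p x : Pt n} (hx : x ∉ closure Ω) : hat M m p x = 0 := by
  unfold hat
  have : {y : ℝ | ∃ t ∈ fineMesh M m, ∃ k, t k = p ∧ x ∈ hull t ∧ y = bary t k x} = ∅ := by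
    ext y
    simp only [mem_ofPred_eq, mem_empty_iff_false, iff_false]
    rintro ⟨t, ht, k, _, hxt, _⟩
    exact hx (hM.fine_hull_subset ht hxt)
  rw [this, Real.sSup_empty]

theorem hat_nonneg (hn : n ≤ 3) {p : Pt n} (hp : p ∈ vertices M m) (x : Pt n) :
    0 ≤ hat M m p x := by
  by_cases hx : x ∈ closure Ω
  · obtain ⟨t, ht, hxt⟩ := hM.exists_fine_mem (m := m) hx
    by_cases hpt : p ∈ range t
    · obtain ⟨k, rfl⟩ := hpt
      rw [hM.hat_vertex hn ht hxt]
      exact (mem_hull_iff (hM.fine_affineIndependent ht)).1 hxt k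
    · rw [hM.hat_eq_zero hn ht hp hpt hxt]
  · rw [hM.hat_eq_zero_of_notMem_closure hx]

theorem hat_self (hn : n ≤ 3) {p : Pt n} (hp : p ∈ vertices M m) : hat M m p p = 1 := by
  obtain ⟨T, hT, hp⟩ := mem_vertices_iff.1 hp
  have h := hM.nondegenerate T hT
  rw [hM.hat_eq hn hT hp ((mem_lattice_iff h).1 hp).1]
  have : relBary T m p p = fun _ => 0 := by funext k; simp [relBary]
  rw [this]
  have h0 : gauge' (fun _ : Fin (n + 1) => (0 : ℝ)) = 0 :=
    le_antisymm (gauge'_le fun i j => by simp) (gauge'_nonneg _)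
  rw [h0]; norm_num

/-- Expansion with respect to the vertex functions on a fine element. -/
theorem sum_hat_eq (hn : n ≤ 3) (ht : t ∈ fineMesh M m) {x : Pt n} (hx : x ∈ hull t)
    (c : Pt n → ℝ) : ∑ p ∈ vertices M m, c p * hat M m p x = ∑ k, c (t k) * bary t k x := by
  classical
  have hti := hM.fine_affineIndependent ht
  have hsub : Finset.univ.image t ⊆ vertices M m := by
    intro p hp
    obtain ⟨k, _, rfl⟩ := Finset.mem_image.1 hp
    exact hM.fine_vertex_mem ht k
  rw [← Finset.sum_subset hsub, Finset.sum_image fun a _ b _ hab => hti.injective hab]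
  · exact Finset.sum_congr rfl fun k _ => by rw [hM.hat_vertex hn ht hx]
  · intro p hp hpt
    rw [hM.hat_eq_zero hn ht hp _ hx, mul_zero]
    rintro ⟨k, rfl⟩
    exact hpt (Finset.mem_image_of_mem _ (Finset.mem_univ k))

theorem mem_range_of_hat_ne_zero (hn : n ≤ 3) (ht : t ∈ fineMesh M m) {p x : Pt n}
    (hp : p ∈ vertices M m) (hx : x ∈ hull t) (h : hat M m p x ≠ 0) : p ∈ range t := by
  by_contra hpt
  exact h (hM.hat_eq_zero hn ht hp hpt hx)

end IsMacroMesh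

end Hat

/-! ### Exterior cones of Lipschitz domains. -/

section Domain

variable {n : ℕ} {Ω : Set (Pt n)}

/-- The boundary point lies on or below the graph. Going down by s(w - e) loses height at least s(1
- r) and lowers the graph by at most 2Lrs, so for narrow cones the point stays on or below it. -/
theorem IsBoundedLipschitzDomain.exterior_cone (hΩ : IsBoundedLipschitzDomain Ω) {p : Pt n}
    (hp : p ∈ frontier Ω) : ∃ (e : Pt n) (ρ₁ ρ₂ : ℝ), ‖e‖ = 1 ∧ 0 < ρ₁ ∧ 0 < ρ₂ ∧
      ∀ s, 0 < s → s ≤ ρ₂ → ∀ w : Pt n, ‖w‖ ≤ ρ₁ → p + s • (w - e) ∉ Ω := by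
  obtain ⟨e, L, γ, ρ, he, hγ, hρ, hg⟩ := hΩ.2.2.2 p hp
  have hpΩ : p ∉ Ω := fun h => by
    rw [hΩ.1.frontier_eq] at hp; exact hp.2 h
  have hp0 : inner ℝ e p ≤ γ (p - inner ℝ e p • e) := by
    by_contra hlt
    exact hpΩ ((hg p (Metric.mem_ball_self hρ)).2 (not_le.1 hlt))
  -- The largest opening for which the two effects balance: r(2L + 1) = 1. The contradiction then
  -- comes from the strict inequality that describes `Ω`.
  set r : ℝ := 1 / (2 * (L : ℝ) + 1) with hr
  have hL : (0 : ℝ) ≤ L := L.2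
  have hr0 : 0 < r := by positivity
  have hr1 : r ≤ 1 := by
    rw [hr, div_le_one (by positivity)]; linarith
  refine ⟨e, r, ρ / 4, he, hr0, by linarith, fun s hs hs2 w hw hmem => ?_⟩
  have hball : p + s • (w - e) ∈ Metric.ball p ρ := by
    rw [Metric.mem_ball, dist_eq_norm, add_sub_cancel_left, norm_smul, Real.norm_of_nonneg hs.le]
    have : ‖w - e‖ ≤ 2 := (norm_sub_le _ _).trans (by rw [he]; linarith)
    nlinarith [norm_nonneg (w - e)]
  have h1 := (hg _ hball).1 hmem
  have hee : inner ℝ e e = (1 : ℝ) := by rw [real_inner_self_eq_norm_sq, he]; norm_num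
  have hin : inner ℝ e (p + s • (w - e)) = inner ℝ e p + s * (inner ℝ e w - 1) := by
    rw [inner_add_right, inner_smul_right, inner_sub_right, hee]
  rw [hin] at h1
  have hdist : dist (γ (p - inner ℝ e p • e))
      (γ (p + s • (w - e) - (inner ℝ e p + s * (inner ℝ e w - 1)) • e)) ≤ L * (s * (2 * r)) := by
    refine (hγ.dist_le_mul _ _).trans (mul_le_mul_of_nonneg_left ?_ hL)
    rw [dist_eq_norm]
    have : p - inner ℝ e p • e - (p + s • (w - e) -
        (inner ℝ e p + s * (inner ℝ e w - 1)) • e) = s • ((inner ℝ e w : ℝ) • e - w) := by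
      module
    rw [this, norm_smul, Real.norm_of_nonneg hs.le]
    refine mul_le_mul_of_nonneg_left ?_ hs.le
    refine (norm_sub_le _ _).trans ?_
    rw [norm_smul, he, mul_one, Real.norm_eq_abs]
    have := abs_real_inner_le_norm e w
    rw [he, one_mul] at this
    linarith
  rw [Real.dist_eq] at hdist
  have h2 := (abs_le.1 hdist).2
  have h3 : inner ℝ e w ≤ r := by
    have := (abs_le.1 (abs_real_inner_le_norm e w)).2
    rw [he, one_mul] at this; linarith
  have h4 : r * (2 * L + 1) = 1 := by rw [hr]; field_simp
  nlinarith

/-- Slits are excluded: a boundary point interior to the closure would have points of `Ω` in its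
exterior cone. It follows that the open simplices of the mesh lie in `Ω`. -/
theorem IsBoundedLipschitzDomain.interior_closure (hΩ : IsBoundedLipschitzDomain Ω) :
    interior (closure Ω) = Ω := by
  refine Subset.antisymm (fun x hx => ?_) (interior_maximal subset_closure hΩ.1)
  by_contra hxΩ
  have hfr : x ∈ frontier Ω := by
    rw [hΩ.1.frontier_eq]; exact ⟨interior_subset hx, hxΩ⟩
  obtain ⟨e, ρ₁, ρ₂, he, h1, h2, hcone⟩ := hΩ.exterior_cone hfr
  obtain ⟨r, hr, hrs⟩ := Metric.mem_nhds_iff.1 (isOpen_interior.mem_nhds hx)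
  set s := min ρ₂ (r / 2) with hs
  have hs0 : 0 < s := lt_min h2 (by linarith)
  have hy : x + s • (-e) ∈ closure Ω := by
    refine interior_subset (hrs ?_)
    rw [Metric.mem_ball, dist_eq_norm, add_sub_cancel_left, norm_smul, norm_neg, he,
      Real.norm_of_nonneg hs0.le]
    linarith [min_le_right ρ₂ (r / 2)]
  obtain ⟨y, hyb, hyΩ⟩ := mem_closure_iff.1 hy (Metric.ball (x + s • (-e)) (s * ρ₁))
    Metric.isOpen_ball (Metric.mem_ball_self (by positivity))
  refine hcone s hs0 (min_le_left _ _) (s⁻¹ • (y - (x + s • (-e)))) ?_ ?_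
  · rw [norm_smul, norm_inv, Real.norm_of_nonneg hs0.le, ← dist_eq_norm, inv_mul_le_iff₀ hs0]
    exact (Metric.mem_ball.1 hyb).le
  · have : x + s • (s⁻¹ • (y - (x + s • (-e))) - e) = y := by
      rw [smul_sub, smul_smul, mul_inv_cancel₀ hs0.ne']; module
    rw [this]; exact hyΩ

end Domain

/-! ### Lipschitz bounds from a finite closed cover. -/

section PiecewiseLipschitz

variable {n : ℕ}

/-- A continuous function on a segment that is covered by finitely many closed sets on each of
which the function is Lipschitz. -/
theorem abs_sub_le_of_finite_closed_cover {ι : Type*} [Finite ι] {F : ι → Set (Pt n)}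
    (hF : ∀ i, IsClosed (F i)) {f : Pt n → ℝ} {L : ℝ} {x y : Pt n}
    (hf : ContinuousOn f (segment ℝ x y)) (hcov : segment ℝ x y ⊆ ⋃ i, F i)
    (hlip : ∀ i, ∀ a ∈ F i, ∀ b ∈ F i, |f a - f b| ≤ L * ‖a - b‖) :
    |f y - f x| ≤ L * ‖y - x‖ := by
  set c : ℝ → Pt n := fun s => x + s • (y - x) with hc
  have hcc : Continuous c := by fun_prop
  have hcs : ∀ s ∈ Icc (0 : ℝ) 1, c s ∈ segment ℝ x y := fun s hs => by
    rw [segment_eq_image']; exact ⟨s, hs, rfl⟩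
  set g : ℝ → ℝ := fun s => f (c s) - f x with hg
  have hgc : ContinuousOn g (Icc 0 1) :=
    (hf.comp hcc.continuousOn hcs).sub continuousOn_const
  set L' := L * ‖y - x‖ with hL'
  -- The growth comparison needs a strict bound on right slopes, so `L'` is enlarged by `ε` and `ε`
  -- tends to 0 at the end.
  have key : ∀ ε : ℝ, 0 < ε → |f y - f x| ≤ L' + ε := by
    intro ε hε
    have := image_norm_le_of_liminf_right_slope_norm_lt_deriv_boundary (f := g)
      (f' := fun _ => L') (B := fun s => (L' + ε) * s) (B' := fun _ => L' + ε) (a := 0) (b := 1) hgc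
      ?_ (by simp [hg, hc]) (by fun_prop) (fun s _ => by
        simpa using ((hasDerivAt_id s).const_mul (L' + ε)).hasDerivWithinAt) (fun s _ _ => by linarith)
      (right_mem_Icc.2 zero_le_one)
    · simpa [hg, hc] using this
    · intro s hs r hr
      have hev : ∀ᶠ z in 𝓝[>] s, ∃ i, c z ∈ F i := by
        have : Ioo s 1 ∈ 𝓝[>] s := Ioo_mem_nhdsGT hs.2
        filter_upwards [this] with z hz
        have := hcov (hcs z ⟨hs.1.trans hz.1.le, hz.2.le⟩)
        simpa using this
      -- One of the finitely many pieces is visited arbitrarily close to the right of `s`. It is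
      -- closed, so it contains `c s` too, and the slope along these visits is at most `L'`.
      obtain ⟨i, hi⟩ : ∃ i, ∃ᶠ z in 𝓝[>] s, c z ∈ F i := by
        by_contra hcon
        push Not at hcon
        have hall : ∀ᶠ z in 𝓝[>] s, ∀ i, c z ∉ F i := eventually_all.2 fun i =>
          hcon i
        obtain ⟨z, hz1, hz2⟩ := (hev.and hall).exists
        obtain ⟨i, hi⟩ := hz1
        exact hz2 i hi
      have hsi : c s ∈ F i := by
        refine (hF i).mem_of_frequently_of_tendsto hi ?_
        exact (hcc.tendsto s).mono_left nhdsWithin_le_nhds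
      refine (hi.and_eventually self_mem_nhdsWithin).mono ?_
      rintro z ⟨hz, hzs⟩
      have hzs' : 0 < z - s := sub_pos.2 hzs
      rw [slope_def_field]
      refine lt_of_le_of_lt ?_ hr
      rw [div_le_iff₀ hzs']
      simp only [Function.comp_apply, Real.norm_eq_abs]
      have h1 := abs_sub_abs_le_abs_sub (g z) (g s)
      have h2 := hlip i _ hz _ hsi
      have h3 : g z - g s = f (c z) - f (c s) := by simp [hg]
      have h4 : c z - c s = (z - s) • (y - x) := by simp only [hc]; module
      rw [h4, norm_smul, Real.norm_of_nonneg hzs'.le] at h2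
      rw [h3] at h1
      calc _ ≤ _ := h1
        _ ≤ _ := h2
        _ = L' * (z - s) := by rw [hL']; ring
  exact le_of_forall_pos_le_add fun ε hε => key ε hε

end PiecewiseLipschitz

/-! ### Size of fine elements and regularity of the vertex functions. -/

section MeshAnalysis

variable {n : ℕ} {T t : Simp n} {Ω : Set (Pt n)} {M : Finset (Simp n)} {m : ℕ}

theorem abs_baryLin_le_norm (T : Simp n) : ∃ L : ℝ, 0 ≤ L ∧ ∀ k y, |baryLin T k y| ≤ L * ‖y‖ := by
  refine ⟨∑ k, ‖(baryLin T k).toContinuousLinearMap‖,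
    Finset.sum_nonneg fun k _ => norm_nonneg _, fun k y => ?_⟩
  refine ((baryLin T k).toContinuousLinearMap.le_opNorm y).trans ?_
  refine mul_le_mul_of_nonneg_right ?_ (norm_nonneg _)
  exact Finset.single_le_sum (f := fun k => ‖(baryLin T k).toContinuousLinearMap‖)
    (fun k _ => norm_nonneg _) (Finset.mem_univ k)

/-- Barycentric coordinates stay in [0,1] on the ball, so moving from its centre by a vector of
length r changes them by at most one. -/
theorem abs_baryLin_le_of_closedBall (h : AffineIndependent ℝ T) {c : Pt n} {r : ℝ} (hr : 0 < r)
    (hb : Metric.closedBall c r ⊆ hull T) (k : Fin (n + 1)) (y : Pt n) :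
    |baryLin T k y| ≤ r⁻¹ * ‖y‖ := by
  by_cases hy : y = 0
  · simp [hy]
  have hy0 : 0 < ‖y‖ := norm_pos_iff.2 hy
  set z : Pt n := (r / ‖y‖) • y with hz
  have hzn : ‖z‖ = r := by
    rw [hz, norm_smul, Real.norm_of_nonneg (by positivity)]; field_simp
  have h1 : ∀ w ∈ hull T, 0 ≤ bary T k w ∧ bary T k w ≤ 1 := fun w hw => by
    have hw' := (mem_hull_iff h).1 hw
    refine ⟨hw' k, ?_⟩
    rw [← sum_bary h w]
    exact Finset.single_le_sum (fun j _ => hw' j) (Finset.mem_univ k)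
  have hc := h1 c (hb (Metric.mem_closedBall_self hr.le))
  have hcz := h1 (c + z) (hb (by simp [hzn]))
  rw [bary_add h] at hcz
  have h3 : |baryLin T k z| ≤ 1 := by
    rw [abs_le]; constructor <;> linarith [hc.1, hc.2, hcz.1, hcz.2]
  rw [hz, map_smul, smul_eq_mul, abs_mul, abs_of_pos (by positivity)] at h3
  have h5 : r / ‖y‖ * |baryLin T k y| = r * |baryLin T k y| / ‖y‖ := by ring
  rw [h5, div_le_one hy0] at h3
  rw [inv_mul_eq_div, le_div_iff₀ hr]
  linarith

theorem baryLin_pathCoord (h : AffineIndependent ℝ T) (i : Fin n) (x y : Pt n) :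
    pathCoord T i x - pathCoord T i y =
      ∑ k : Fin (n + 1), if (i : ℕ) < k then baryLin T k (x - y) else 0 := by
  unfold pathCoord
  rw [← Finset.sum_sub_distrib]
  refine Finset.sum_congr rfl fun k _ => ?_
  split_ifs
  · exact bary_sub h k x y
  · simp

/-- A path coordinate of `T` sums at most n + 1 barycentric coordinates, path coordinates of `t` are
2^m times as steep, and a barycentric coordinate of `t` is a difference of two consecutive ones: the
factors n + 1, 2^m and 2. -/
theorem abs_baryLin_fine_le (h : AffineIndependent ℝ T) (ht : t ∈ subdivision T m) {G : ℝ}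
    (hG : ∀ k y, |baryLin T k y| ≤ G * ‖y‖) (k : Fin (n + 1)) (y : Pt n) :
    |baryLin t k y| ≤ 2 * 2 ^ m * (n + 1) * G * ‖y‖ := by
  have h' := affineIndependent_of_mem_subdivision h ht
  obtain ⟨z, ρ, hz⟩ := isKuhn_of_mem_subdivision ht
  have hy0 : 0 ≤ G * ‖y‖ := (abs_nonneg _).trans (hG 0 y)
  have hpc : ∀ i : Fin n, |pathCoord T i y - pathCoord T i 0| ≤ (n + 1) * (G * ‖y‖) := by
    intro i
    rw [baryLin_pathCoord h, sub_zero]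
    refine (Finset.abs_sum_le_sum_abs _ _).trans ?_
    calc ∑ k : Fin (n + 1), |if (i : ℕ) < k then baryLin T k y else 0|
        ≤ ∑ k : Fin (n + 1), G * ‖y‖ := by
          refine Finset.sum_le_sum fun k _ => ?_
          split_ifs
          · exact hG k y
          · simpa using hy0
      _ = (n + 1) * (G * ‖y‖) := by simp
  have hpt : ∀ j : Fin n, |pathCoord t j y - pathCoord t j 0| ≤ 2 ^ m * ((n + 1) * (G * ‖y‖)) := by
    intro j
    obtain ⟨i, rfl⟩ := ρ.surjective j
    have e1 := isKuhn_pathCoord_eq h h' hz i y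
    have e2 := isKuhn_pathCoord_eq h h' hz i 0
    have : pathCoord t (ρ i) y - pathCoord t (ρ i) 0 =
        2 ^ m * (pathCoord T i y - pathCoord T i 0) := by linarith
    rw [this, abs_mul, abs_of_pos (by positivity : (0 : ℝ) < 2 ^ m)]
    exact mul_le_mul_of_nonneg_left (hpc i) (by positivity)
  have hps : ∀ j : ℕ, |pathSeq (fun i => pathCoord t i y) j - pathSeq (fun i => pathCoord t i 0) j| ≤
      2 ^ m * ((n + 1) * (G * ‖y‖)) := by
    intro j
    unfold pathSeq
    split_ifs
    · simp; positivity
    · exact hpt _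
    · simp; positivity
  have e : baryLin t k y = bary t k y - bary t k 0 := by rw [bary_sub h', sub_zero]
  rw [e, bary_eq_pathWeight h', bary_eq_pathWeight h', pathWeight, pathWeight]
  have h1 := abs_le.1 (hps k)
  have h2 := abs_le.1 (hps (k + 1))
  have h3 : 2 * 2 ^ m * (n + 1) * G * ‖y‖ = 2 * (2 ^ m * ((n + 1) * (G * ‖y‖))) := by ring
  rw [h3, abs_le]
  constructor <;> linarith [h1.1, h1.2, h2.1, h2.2]

/-- Two vertices of a Kuhn simplex differ by at most n edge vectors of `T`, each scaled by 2^(-m)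
and a sign. -/
theorem norm_fine_vertex_sub_le (ht : t ∈ subdivision T m) (k l : Fin (n + 1)) :
    ‖t k - t l‖ ≤ n * Metric.diam (hull T) / 2 ^ m := by
  obtain ⟨z, ρ, hz⟩ := isKuhn_of_mem_subdivision ht
  have e : t k - t l = ∑ i : Fin n, ((((if (ρ i : ℕ) < k then 1 else 0) : ℝ) -
      (if (ρ i : ℕ) < l then 1 else 0)) / 2 ^ m) • (T i.succ - T i.castSucc) := by
    rw [hz, hz]
    unfold pathPoint
    rw [add_sub_add_left_eq_sub, ← Finset.sum_sub_distrib]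
    refine Finset.sum_congr rfl fun i _ => ?_
    rw [← sub_smul]
    congr 1; ring
  rw [e]
  refine (norm_sum_le _ _).trans ?_
  have hd : ∀ i : Fin n, ‖T i.succ - T i.castSucc‖ ≤ Metric.diam (hull T) := fun i => by
    rw [← dist_eq_norm]
    exact Metric.dist_le_diam_of_mem (isCompact_hull T).isBounded (vertex_mem_hull _ _)
      (vertex_mem_hull _ _)
  calc ∑ i : Fin n, ‖((((if (ρ i : ℕ) < k then 1 else 0) : ℝ) -
      (if (ρ i : ℕ) < l then 1 else 0)) / 2 ^ m) • (T i.succ - T i.castSucc)‖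
      ≤ ∑ i : Fin n, Metric.diam (hull T) / 2 ^ m := by
        refine Finset.sum_le_sum fun i _ => ?_
        rw [norm_smul, norm_div, Real.norm_of_nonneg (by positivity : (0 : ℝ) ≤ 2 ^ m),
          div_mul_eq_mul_div]
        refine div_le_div_of_nonneg_right ?_ (by positivity)
        refine le_trans ?_ (hd i)
        refine mul_le_of_le_one_left (norm_nonneg _) ?_
        split_ifs <;> simp
    _ = n * Metric.diam (hull T) / 2 ^ m := by simp; ring

/-- This constant depends on the mesh. It serves qualitative regularity only and does not enter the
error bound. -/
theorem exists_fine_lipschitz (M : Finset (Simp n)) (m : ℕ) : ∃ L : ℝ, 0 ≤ L ∧ ∀ t ∈ fineMesh M m, ∀ k y,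
    |baryLin t k y| ≤ L * ‖y‖ := by
  have := finite_fineMesh M m
  choose L hL0 hL using fun t : Simp n => abs_baryLin_le_norm t
  refine ⟨∑ t ∈ this.toFinset, L t, Finset.sum_nonneg fun t _ => hL0 t, fun t ht k y => ?_⟩
  refine (hL t k y).trans (mul_le_mul_of_nonneg_right ?_ (norm_nonneg _))
  exact Finset.single_le_sum (f := L) (fun t _ => hL0 t) (this.mem_toFinset.2 ht)

namespace IsMacroMesh

variable (hM : IsMacroMesh Ω M)
include hM

theorem openHull_subset (hΩ : IsBoundedLipschitzDomain Ω) (hT : T ∈ M) : openHull T ⊆ Ω := by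
  rw [← hΩ.interior_closure]; exact interior_mono (hM.hull_subset_closure hT)

theorem fine_openHull_subset (hΩ : IsBoundedLipschitzDomain Ω) (ht : t ∈ fineMesh M m) :
    openHull t ⊆ Ω := by
  rw [← hΩ.interior_closure]; exact interior_mono (hM.fine_hull_subset ht)

/-- If the function were nonzero at `x` in the closure of `Ω`, every macro-coordinate positive at
`p` would be positive at `x`, because nonzero lattice coordinates are at least 2^(-m). Points `z` of
the segment close to `p` lie in `Ω` and then have the same vanishing coordinates as `x`. The
macro-elements containing `z` cover a neighbourhood of it, they also contain `x`, and translation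
from `z` to `x` shows that they cover a neighbourhood of `x`. Hence `x` is interior to the closure,
that is, in `Ω`. -/
theorem hat_eq_zero_off (hn : n ≤ 3) (hΩ : IsBoundedLipschitzDomain Ω) {p : Pt n}
    (hp : p ∈ dofs Ω M m) {x : Pt n} (hx : x ∉ Ω) : hat M m p x = 0 := by
  classical
  have hpv : p ∈ vertices M m := (Finset.mem_filter.1 hp).1
  have hpΩ : p ∈ Ω := (Finset.mem_filter.1 hp).2
  by_cases hxc : x ∈ closure Ω
  swap
  · exact hM.hat_eq_zero_of_notMem_closure hxc
  by_contra hne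
  apply hx
  have hxc' := hxc
  rw [hM.covers] at hxc'
  simp only [mem_iUnion] at hxc'
  obtain ⟨T, hT, hxT⟩ := hxc'
  have h := hM.nondegenerate T hT
  obtain ⟨T₀, hT₀, hp₀⟩ := mem_vertices_iff.1 hpv
  have hpT : p ∈ hull T := by
    by_contra hpT; exact hne (hM.hat_eq_zero_of_notMem hT hxT hpT)
  have hpl := hM.mem_lattice_of_mem_hull hT₀ hT hp₀ hpT
  rw [hM.hat_eq hn hT hpl hxT] at hne
  have hg : gauge' (relBary T m p x) < 1 := by
    by_contra hge
    exact hne (max_eq_left (by linarith))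
  have hpos : ∀ k, 0 < bary T k p → 0 < bary T k x := by
    intro k hk
    obtain ⟨a, ha⟩ := ((mem_lattice_iff h).1 hpl).2 k
    have ha1 : (1 : ℝ) ≤ a := by
      have : (0 : ℝ) < a := by rw [← ha]; positivity
      have h1 : (0 : ℤ) < a := by exact_mod_cast this
      exact_mod_cast h1
    have h2 := lt_of_le_of_lt (abs_le_gauge' (sum_relBary h m p x) k) hg
    rw [relBary, mul_sub, ha, abs_lt] at h2
    have h3 : 0 < 2 ^ m * bary T k x := by linarith [h2.1]
    exact pos_of_mul_pos_right h3 (by positivity)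
  -- a point `z` of `Ω` with the same carrier as `x`
  obtain ⟨τ, hτ0, hτ1, hz⟩ : ∃ τ : ℝ, 0 < τ ∧ τ < 1 ∧ p + τ • (x - p) ∈ Ω := by
    have hcont : Continuous (fun τ : ℝ => p + τ • (x - p)) := by fun_prop
    have h0 : (fun τ : ℝ => p + τ • (x - p)) 0 ∈ Ω := by simpa using hpΩ
    have hev : ∀ᶠ τ in 𝓝[>] (0 : ℝ), p + τ • (x - p) ∈ Ω :=
      (hcont.continuousAt.eventually (hΩ.1.mem_nhds h0)).filter_mono nhdsWithin_le_nhds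
    have hev2 : ∀ᶠ τ in 𝓝[>] (0 : ℝ), τ < 1 :=
      (gt_mem_nhds zero_lt_one : ∀ᶠ τ in 𝓝 (0 : ℝ), τ < 1).filter_mono nhdsWithin_le_nhds
    obtain ⟨τ, ⟨h1, h2⟩, h3⟩ := ((hev.and hev2).and self_mem_nhdsWithin).exists
    exact ⟨τ, h3, h2, h1⟩
  set z := p + τ • (x - p) with hzdef
  have hzT : ∀ k, bary T k z = (1 - τ) * bary T k p + τ * bary T k x := by
    intro k
    rw [hzdef, bary_add h, map_smul, smul_eq_mul, ← bary_sub h]; ring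
  have hp0 := (mem_hull_iff h).1 hpT
  have hx0 := (mem_hull_iff h).1 hxT
  have hzh : z ∈ hull T := (mem_hull_iff h).2 fun k => by
    rw [hzT]
    exact add_nonneg (mul_nonneg (by linarith) (hp0 k)) (mul_nonneg hτ0.le (hx0 k))
  have hcar : ∀ k, bary T k z = 0 ↔ bary T k x = 0 := by
    intro k
    rw [hzT]
    constructor
    · intro h0
      have h1 := mul_nonneg (by linarith : (0 : ℝ) ≤ 1 - τ) (hp0 k)
      have h2 := mul_nonneg hτ0.le (hx0 k)
      have h3 : τ * bary T k x = 0 := by linarith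
      exact (mul_eq_zero.1 h3).resolve_left hτ0.ne'
    · intro h0
      have h1 : bary T k p = 0 := by
        by_contra h2
        exact absurd h0 (hpos k (lt_of_le_of_ne (hp0 k) (Ne.symm h2))).ne'
      rw [h0, h1]; ring
  have hev : ∀ᶠ v in 𝓝 (0 : Pt n), z + v ∈ Ω ∧ (∀ T' ∈ M, z + v ∈ hull T' → z ∈ hull T') ∧
      ∀ T' ∈ M, ∀ k, 0 < bary T' k x → 0 < bary T' k (x + v) := by
    have hc : Continuous (fun v : Pt n => z + v) := by fun_prop
    have hc' : Continuous (fun v : Pt n => x + v) := by fun_prop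
    refine Eventually.and ?_ (Eventually.and ?_ ?_)
    · exact hc.continuousAt.eventually (hΩ.1.mem_nhds (by simpa using hz))
    · rw [Finset.eventually_all]
      intro T' hT'
      by_cases hzT' : z ∈ hull T'
      · exact Eventually.of_forall fun _ _ => hzT'
      · have : (hull T')ᶜ ∈ 𝓝 (z + 0) :=
          (isCompact_hull T').isClosed.isOpen_compl.mem_nhds (by simpa using hzT')
        filter_upwards [hc.continuousAt.eventually this] with v hv hv'
        exact absurd hv' hv
    · rw [Finset.eventually_all]
      intro T' hT'
      rw [eventually_all]
      intro k
      by_cases hk : 0 < bary T' k x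
      · have hcb := (bary_continuous (hM.nondegenerate T' hT') k).comp hc'
        have : ∀ᶠ v in 𝓝 (0 : Pt n), 0 < bary T' k (x + v) := by
          refine hcb.continuousAt.eventually (lt_mem_nhds ?_)
          simpa using hk
        filter_upwards [this] with v hv _ using hv
      · exact Eventually.of_forall fun _ h' => absurd h' hk
  rw [← hΩ.interior_closure, mem_interior_iff_mem_nhds]
  have : ∀ᶠ v in 𝓝 (0 : Pt n), x + v ∈ closure Ω := by
    filter_upwards [hev] with v hv
    have hzc := subset_closure (s := Ω) hv.1
    rw [hM.covers] at hzc
    simp only [mem_iUnion] at hzc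
    obtain ⟨T', hT', hzv⟩ := hzc
    have h' := hM.nondegenerate T' hT'
    have hzT' := hv.2.1 T' hT' hzv
    -- Coordinates positive at `x` stay positive for small `v`. Those that vanish at `x` vanish at
    -- `z` as well, so at x + v they equal the nonnegative coordinates of z + v.
    refine hM.hull_subset_closure hT' ((mem_hull_iff h').2 fun k' => ?_)
    have hface := hM.mem_face hT' hT hzT' hzh
    have hface' := hM.mem_face hT hT' hzh hzT'
    have hxT' : x ∈ hull T' := by
      have hzero : ∀ k, T k ∉ range T' → bary T k x = 0 := fun k hk =>
        (hcar k).1 (bary_eq_zero_of_mem_face h hface' hk)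
      rw [← sum_bary_smul h x]
      have e : ∀ f : Fin (n + 1) → Pt n, (∀ k, T k ∉ range T' → f k = 0) → ∑ k, f k =
          ∑ k ∈ Finset.univ.filter (fun k => T k ∈ range T'), f k := by
        intro f hf
        rw [Finset.sum_filter]
        refine Finset.sum_congr rfl fun k _ => ?_
        split_ifs with hk
        · rfl
        · exact hf k hk
      rw [e _ fun k hk => by rw [hzero k hk, zero_smul]]
      refine (convex_hull' T').sum_mem (fun k _ => hx0 k) ?_ ?_
      · rw [← sum_bary h x, Finset.sum_filter]
        refine Finset.sum_congr rfl fun k _ => ?_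
        split_ifs with hk
        · rfl
        · exact (hzero k hk).symm
      · intro k hk
        exact subset_convexHull ℝ _ (by simpa using hk)
    by_cases hk0 : 0 < bary T' k' x
    · exact (hv.2.2 T' hT' k' hk0).le
    · have hx0' : bary T' k' x = 0 :=
        le_antisymm (not_lt.1 hk0) ((mem_hull_iff h').1 hxT' k')
      have hz0 : bary T' k' z = 0 := by
        by_cases hk : T' k' ∈ range T
        · obtain ⟨k, hk⟩ := hk
          rw [bary_eq_of_mem_face h' h hface hk.symm, hcar,
            bary_eq_of_mem_face h h' (hM.mem_face hT hT' hxT hxT') hk, hx0']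
        · exact bary_eq_zero_of_mem_face h' hface hk
      have := (mem_hull_iff h').1 hzv k'
      rw [bary_add h', hz0] at this
      rw [bary_add h', hx0']
      exact this
  have h2 : Tendsto (fun y : Pt n => y - x) (𝓝 x) (𝓝 0) := by
    have : Continuous (fun y : Pt n => y - x) := by fun_prop
    simpa using this.tendsto x
  filter_upwards [h2.eventually this] with y hy
  simpa using hy

theorem hat_sub_le_on_fine (hn : n ≤ 3) {L : ℝ} (hL0 : 0 ≤ L) (ht : t ∈ fineMesh M m)
    (hL : ∀ k y, |baryLin t k y| ≤ L * ‖y‖) {p : Pt n} (hp : p ∈ vertices M m) {a b : Pt n}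
    (ha : a ∈ hull t) (hb : b ∈ hull t) : |hat M m p a - hat M m p b| ≤ L * ‖a - b‖ := by
  by_cases hpt : p ∈ range t
  · obtain ⟨k, rfl⟩ := hpt
    rw [hM.hat_vertex hn ht ha, hM.hat_vertex hn ht hb, bary_sub (hM.fine_affineIndependent ht)]
    exact hL k _
  · rw [hM.hat_eq_zero hn ht hp hpt ha, hM.hat_eq_zero hn ht hp hpt hb, sub_self, abs_zero]
    positivity

theorem continuousOn_hat_fine (hn : n ≤ 3) (ht : t ∈ fineMesh M m) {p : Pt n}
    (hp : p ∈ vertices M m) : ContinuousOn (hat M m p) (hull t) := by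
  by_cases hpt : p ∈ range t
  · obtain ⟨k, rfl⟩ := hpt
    exact (bary_continuous (hM.fine_affineIndependent ht) k).continuousOn.congr
      fun x hx => hM.hat_vertex hn ht hx k
  · exact continuousOn_const.congr fun x hx => hM.hat_eq_zero hn ht hp hpt hx

theorem closure_eq_iUnion_fine (m : ℕ) : closure Ω = ⋃ t : fineMesh M m, hull t.1 := by
  refine Subset.antisymm (fun x hx => ?_) (iUnion_subset fun t => hM.fine_hull_subset t.2)
  obtain ⟨t, ht, hxt⟩ := hM.exists_fine_mem (m := m) hx
  exact mem_iUnion.2 ⟨⟨t, ht⟩, hxt⟩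

theorem continuousOn_hat (hn : n ≤ 3) {p : Pt n} (hp : p ∈ vertices M m) :
    ContinuousOn (hat M m p) (closure Ω) := by
  have := (finite_fineMesh M m).to_subtype
  rw [hM.closure_eq_iUnion_fine m]
  exact (locallyFinite_of_finite _).continuousOn_iUnion
    (fun t => (isCompact_hull t.1).isClosed) (fun t => hM.continuousOn_hat_fine hn t.2 hp)

theorem continuous_hat (hn : n ≤ 3) (hΩ : IsBoundedLipschitzDomain Ω) {p : Pt n}
    (hp : p ∈ dofs Ω M m) : Continuous (hat M m p) := by
  classical
  have hpv : p ∈ vertices M m := (Finset.mem_filter.1 hp).1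
  have h1 := hM.continuousOn_hat hn hpv
  have h2 : ContinuousOn (hat M m p) Ωᶜ :=
    continuousOn_const.congr fun x hx => hM.hat_eq_zero_off hn hΩ hp hx
  have := h1.union_of_isClosed h2 isClosed_closure hΩ.1.isClosed_compl
  rw [← continuousOn_univ]
  convert this
  symm
  rw [eq_univ_iff_forall]
  intro x
  by_cases hx : x ∈ Ω
  · exact Or.inl (subset_closure hx)
  · exact Or.inr hx

theorem lipschitz_hat (hn : n ≤ 3) (hΩ : IsBoundedLipschitzDomain Ω) {p : Pt n}
    (hp : p ∈ dofs Ω M m) : ∃ L : NNReal, LipschitzWith L (hat M m p) := by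
  classical
  have hpv : p ∈ vertices M m := (Finset.mem_filter.1 hp).1
  obtain ⟨L, hL0, hL⟩ := exists_fine_lipschitz M m
  refine ⟨⟨L, hL0⟩, LipschitzWith.of_dist_le_mul fun x y => ?_⟩
  have := (finite_fineMesh M m).to_subtype
  rw [dist_comm, dist_comm x, Real.dist_eq, dist_eq_norm]
  -- The complement of `Ω`, where the function vanishes, serves as one more closed piece, since the
  -- segment may leave the domain.
  refine abs_sub_le_of_finite_closed_cover
    (F := fun o : Option (fineMesh M m) => o.elim Ωᶜ fun t => hull t.1) ?_
    (hM.continuous_hat hn hΩ hp).continuousOn ?_ ?_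
  · rintro (_ | t)
    · exact hΩ.1.isClosed_compl
    · exact (isCompact_hull t.1).isClosed
  · intro z _
    by_cases hz : z ∈ Ω
    · obtain ⟨t, ht, hzt⟩ := hM.exists_fine_mem (m := m) (subset_closure hz)
      exact mem_iUnion.2 ⟨some ⟨t, ht⟩, hzt⟩
    · exact mem_iUnion.2 ⟨none, hz⟩
  · rintro (_ | t) a ha b hb
    · rw [hM.hat_eq_zero_off hn hΩ hp ha, hM.hat_eq_zero_off hn hΩ hp hb, sub_self, abs_zero]
      exact mul_nonneg hL0 (norm_nonneg _)
    · exact hM.hat_sub_le_on_fine hn hL0 t.2 (hL t.1 t.2) hpv ha hb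

/-- For a vertex on the boundary the function is cut off to zero outside the closure of `Ω` and may
jump there, so only a local statement inside `Ω` holds for all vertices. -/
theorem locallyLipschitzOn_hat (hn : n ≤ 3) (hΩ : IsOpen Ω) {p : Pt n}
    (hp : p ∈ vertices M m) : LocallyLipschitzOn Ω (hat M m p) := by
  obtain ⟨L, hL0, hL⟩ := exists_fine_lipschitz M m
  have := (finite_fineMesh M m).to_subtype
  intro x hx
  obtain ⟨r, hr, hrs⟩ := Metric.mem_nhds_iff.1 (hΩ.mem_nhds hx)
  refine ⟨⟨L, hL0⟩, Metric.ball x r, mem_nhdsWithin_of_mem_nhds (Metric.ball_mem_nhds x hr),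
    LipschitzOnWith.of_dist_le_mul fun a ha b hb => ?_⟩
  rw [dist_comm, dist_comm a, Real.dist_eq, dist_eq_norm]
  have hseg : segment ℝ a b ⊆ closure Ω :=
    (((convex_ball x r).segment_subset ha hb).trans hrs).trans subset_closure
  refine abs_sub_le_of_finite_closed_cover (F := fun t : fineMesh M m => hull t.1)
    (fun t => (isCompact_hull t.1).isClosed) ((hM.continuousOn_hat hn hp).mono hseg) ?_ ?_
  · rw [← hM.closure_eq_iUnion_fine m]; exact hseg
  · intro t a ha b hb
    exact hM.hat_sub_le_on_fine hn hL0 t.2 (hL t.1 t.2) hp ha hb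

/-- Almost every point of `closure Ω` lies in the interior of a fine element. -/
theorem ae_exists_fine_openHull (m : ℕ) :
    ∀ᵐ x ∂(volume : Measure (Pt n)), x ∈ closure Ω → ∃ t ∈ fineMesh M m, x ∈ openHull t := by
  have hnull : volume (⋃ t ∈ fineMesh M m, frontier (hull t)) = 0 := by
    rw [measure_biUnion_null_iff (finite_fineMesh M m).countable]
    exact fun t _ => (convex_hull' t).addHaar_frontier volume
  filter_upwards [measure_eq_zero_iff_ae_notMem.1 hnull] with x hx hxc
  obtain ⟨t, ht, hxt⟩ := hM.exists_fine_mem (m := m) hxc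
  refine ⟨t, ht, ?_⟩
  by_contra hxo
  apply hx
  simp only [mem_iUnion]
  refine ⟨t, ht, ?_⟩
  rw [frontier, (isCompact_hull t).isClosed.closure_eq]
  exact ⟨hxt, hxo⟩

/-- Elements with a common interior point have the same vertices: at this point every vertex
function of one is nonzero, so its vertices belong to the other. They differ only by the numbering,
and counting all index maps is enough; disjointness is not needed. -/
theorem card_fine_openHull_le (hn : n ≤ 3) (x : Pt n) :
    open scoped Classical in
    ((finite_fineMesh M m).toFinset.filter (fun t => x ∈ openHull t)).card ≤
      (n + 1) ^ (n + 1) := by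
  classical
  set F := (finite_fineMesh M m).toFinset.filter (fun t => x ∈ openHull t) with hF
  rcases F.eq_empty_or_nonempty with h0 | ⟨t₀, ht₀⟩
  · rw [h0]; simp
  have hmem : ∀ t, t ∈ F ↔ t ∈ fineMesh M m ∧ x ∈ openHull t := fun t => by
    rw [hF, Finset.mem_filter, Set.Finite.mem_toFinset]
  have hsub : ∀ t ∈ F, ∃ σ : Fin (n + 1) → Fin (n + 1), t = t₀ ∘ σ := by
    intro t ht
    have h1 := (hmem t).1 ht
    have h2 := (hmem t₀).1 ht₀
    have : ∀ k, ∃ l, t₀ l = t k := by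
      intro k
      refine hM.mem_range_of_hat_ne_zero hn h2.1 (hM.fine_vertex_mem h1.1 k)
        (openHull_subset_hull _ h2.2) ?_
      rw [hM.hat_vertex hn h1.1 (openHull_subset_hull _ h1.2)]
      exact ((mem_openHull_iff (hM.fine_affineIndependent h1.1)).1 h1.2 k).ne'
    choose σ hσ using this
    exact ⟨σ, funext fun k => (hσ k).symm⟩
  have : F ⊆ Finset.univ.image (fun σ : Fin (n + 1) → Fin (n + 1) => t₀ ∘ σ) := by
    intro t ht
    obtain ⟨σ, rfl⟩ := hsub t ht
    exact Finset.mem_image_of_mem _ (Finset.mem_univ _)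
  refine (Finset.card_le_card this).trans (Finset.card_image_le.trans ?_)
  simp

end IsMacroMesh

end MeshAnalysis

/-! ### Convergence in L². -/

section SquareIntegrable

variable {X : Type*} [MeasurableSpace X] {μ : Measure X} {F G : ℕ → X → ℝ} {f g : X → ℝ}

/-- Convergence in `L²`. -/
def TendstoL2 (μ : Measure X) (F : ℕ → X → ℝ) (f : X → ℝ) : Prop :=
  (∀ j, MemLp (F j) 2 μ) ∧ MemLp f 2 μ ∧
    Tendsto (fun j => ∫ x, (F j x - f x) ^ 2 ∂μ) atTop (𝓝 0)

theorem inner_toLp_eq (hf : MemLp f 2 μ) (hg : MemLp g 2 μ) :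
    inner ℝ (hf.toLp f) (hg.toLp g) = ∫ x, f x * g x ∂μ := by
  rw [L2.inner_def]
  refine integral_congr_ae ?_
  filter_upwards [hf.coeFn_toLp, hg.coeFn_toLp] with x hx hy
  rw [hx, hy]; simp [mul_comm]

theorem norm_toLp_sq (hf : MemLp f 2 μ) : ‖hf.toLp f‖ ^ 2 = ∫ x, f x ^ 2 ∂μ := by
  rw [← real_inner_self_eq_norm_sq, inner_toLp_eq]
  congr 1; funext x; ring

theorem abs_integral_mul_le (hf : MemLp f 2 μ) (hg : MemLp g 2 μ) :
    |∫ x, f x * g x ∂μ| ≤ Real.sqrt (∫ x, f x ^ 2 ∂μ) * Real.sqrt (∫ x, g x ^ 2 ∂μ) := by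
  rw [← inner_toLp_eq hf hg, ← norm_toLp_sq hf, ← norm_toLp_sq hg,
    Real.sqrt_sq (norm_nonneg _), Real.sqrt_sq (norm_nonneg _)]
  exact abs_real_inner_le_norm _ _

theorem integral_add_sq_le (hf : MemLp f 2 μ) (hg : MemLp g 2 μ) :
    ∫ x, (f x + g x) ^ 2 ∂μ ≤ 2 * (∫ x, f x ^ 2 ∂μ) + 2 * ∫ x, g x ^ 2 ∂μ := by
  rw [← integral_const_mul, ← integral_const_mul,
    ← integral_add (hf.integrable_sq.const_mul 2) (hg.integrable_sq.const_mul 2)]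
  refine integral_mono (hf.add hg).integrable_sq
    ((hf.integrable_sq.const_mul 2).add (hg.integrable_sq.const_mul 2)) fun x => ?_
  simp only []
  nlinarith [sq_nonneg (f x - g x)]

namespace TendstoL2

/-- Limits of products and linear combinations are then those of the Hilbert space L². -/
theorem iff_toLp (hF : ∀ j, MemLp (F j) 2 μ) (hf : MemLp f 2 μ) :
    TendstoL2 μ F f ↔ Tendsto (fun j => (hF j).toLp (F j)) atTop (𝓝 (hf.toLp f)) := by
  have e : ∀ j, ∫ x, (F j x - f x) ^ 2 ∂μ = ‖(hF j).toLp (F j) - hf.toLp f‖ ^ 2 := fun j => by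
    rw [← MemLp.toLp_sub, norm_toLp_sq]; rfl
  rw [tendsto_iff_norm_sub_tendsto_zero, TendstoL2]
  simp only [e]
  constructor
  · rintro ⟨-, -, h⟩
    have := h.sqrt
    simpa [Real.sqrt_sq (norm_nonneg _)] using this
  · intro h
    refine ⟨hF, hf, ?_⟩
    simpa using h.pow 2

theorem integral_mul (h : TendstoL2 μ F f) (h' : TendstoL2 μ G g) :
    Tendsto (fun j => ∫ x, F j x * G j x ∂μ) atTop (𝓝 (∫ x, f x * g x ∂μ)) := by
  have h1 := (iff_toLp h.1 h.2.1).1 h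
  have h2 := (iff_toLp h'.1 h'.2.1).1 h'
  have := h1.inner (𝕜 := ℝ) h2
  simpa only [inner_toLp_eq] using this

theorem integral_sq (h : TendstoL2 μ F f) :
    Tendsto (fun j => ∫ x, F j x ^ 2 ∂μ) atTop (𝓝 (∫ x, f x ^ 2 ∂μ)) := by
  simpa only [← sq] using h.integral_mul h

theorem lincomb (h : TendstoL2 μ F f) (h' : TendstoL2 μ G g) (c c' : ℝ) :
    TendstoL2 μ (fun j x => c * F j x + c' * G j x) (fun x => c * f x + c' * g x) := by
  have h1 := (iff_toLp h.1 h.2.1).1 h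
  have h2 := (iff_toLp h'.1 h'.2.1).1 h'
  refine (iff_toLp (fun j => ((h.1 j).const_mul c).add ((h'.1 j).const_mul c'))
    ((h.2.1.const_mul c).add (h'.2.1.const_mul c'))).2 ?_
  have := (h1.const_smul c).add (h2.const_smul c')
  exact this

theorem sub (h : TendstoL2 μ F f) (h' : TendstoL2 μ G g) :
    TendstoL2 μ (fun j x => F j x - G j x) (fun x => f x - g x) := by
  convert h.lincomb h' 1 (-1) using 1 <;> funext <;> simp [sub_eq_add_neg]

theorem const (hf : MemLp f 2 μ) : TendstoL2 μ (fun _ => f) f :=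
  ⟨fun _ => hf, hf, by simp⟩

theorem mono {V U : Set X} {ν : Measure X} (hVU : V ⊆ U) (h : TendstoL2 (ν.restrict U) F f) :
    TendstoL2 (ν.restrict V) F f := by
  have hle := Measure.restrict_mono hVU (le_refl ν)
  refine ⟨fun j => (h.1 j).mono_measure hle, h.2.1.mono_measure hle, ?_⟩
  refine squeeze_zero (fun j => integral_nonneg fun x => sq_nonneg _) (fun j => ?_) h.2.2
  exact integral_mono_measure hle (Eventually.of_forall fun x => sq_nonneg _)
    ((h.1 j).sub h.2.1).integrable_sq

theorem congr {F' : ℕ → X → ℝ} {f' : X → ℝ} (h : TendstoL2 μ F f) (hF : ∀ j, F j =ᵐ[μ] F' j)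
    (hf : f =ᵐ[μ] f') : TendstoL2 μ F' f' := by
  refine ⟨fun j => (h.1 j).ae_eq (hF j), h.2.1.ae_eq hf, ?_⟩
  refine h.2.2.congr fun j => integral_congr_ae ?_
  filter_upwards [hF j, hf] with x h1 h2
  rw [h1, h2]

end TendstoL2

end SquareIntegrable

/-! ### The space H¹₀ as limits of test functions. -/

section H10

variable {n : ℕ} {Ω : Set (Pt n)} {v w : Pt n → ℝ}

theorem memLp_two_of_contDiff_of_bounded {U : Set (Pt n)} (hb : Bornology.IsBounded U)
    {w : Pt n → ℝ} (hw : Continuous w) : MemLp w 2 (volume.restrict U) := by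
  obtain ⟨R, hR⟩ := hb.subset_closedBall 0
  have : IsFiniteMeasure (volume.restrict (Metric.closedBall (0 : Pt n) R)) :=
    ⟨by simpa using (isCompact_closedBall (0 : Pt n) R).measure_lt_top⟩
  obtain ⟨C, hC⟩ := (isCompact_closedBall (0 : Pt n) R).exists_bound_of_continuousOn hw.continuousOn
  refine (MemLp.of_bound hw.aestronglyMeasurable C
    ((ae_restrict_iff' Metric.isClosed_closedBall.measurableSet).2
      (Eventually.of_forall hC))).mono_measure (Measure.restrict_mono hR le_rfl)

theorem sum_fin_one_eq (f : (Fin 1 → Fin n) → ℝ) : ∑ α, f α = ∑ a, f ![a] :=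
  Fintype.sum_equiv (Equiv.funUnique (Fin 1) (Fin n)) _ _ fun α => by
    congr 1; funext i; fin_cases i; rfl

theorem hSeminorm_one_sq (hΩ : IsOpen Ω) {g : Fin n → Pt n → ℝ}
    (hg : ∀ a, HasWeakDeriv Ω ![a] v (g a)) :
    hSeminorm 1 Ω v ^ 2 = ∑ a, ∫ x in Ω, g a x ^ 2 := by
  rw [hSeminorm, Real.sq_sqrt (Finset.sum_nonneg fun α _ => integral_nonneg fun x => sq_nonneg _),
    sum_fin_one_eq]
  refine Finset.sum_congr rfl fun a _ => integral_congr_ae ?_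
  filter_upwards [(hg a).weakDeriv_ae hΩ] with x hx
  rw [hx]

theorem hSeminorm_nonneg (k : ℕ) (Ω : Set (Pt n)) (v : Pt n → ℝ) : 0 ≤ hSeminorm k Ω v :=
  Real.sqrt_nonneg _

theorem h1Norm_sq (hΩ : IsOpen Ω) {g : Fin n → Pt n → ℝ}
    (hg : ∀ a, HasWeakDeriv Ω ![a] v (g a)) :
    h1Norm Ω v ^ 2 = (∫ x in Ω, v x ^ 2) + ∑ a, ∫ x in Ω, g a x ^ 2 := by
  rw [h1Norm, Real.sq_sqrt (add_nonneg (integral_nonneg fun x => sq_nonneg _) (sq_nonneg _)),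
    hSeminorm_one_sq hΩ hg]

theorem hasWeakDeriv_one_of_contDiff (hΩ : IsOpen Ω) {ϕ : Pt n → ℝ} (hϕ : ContDiff ℝ ∞ ϕ)
    (a : Fin n) : HasWeakDeriv Ω ![a] ϕ (partialDeriv ![a] ϕ) := by
  have h : LocallyLipschitz ϕ := (hϕ.of_le (by exact_mod_cast le_top)).locallyLipschitz
  have := hasWeakDeriv_of_locallyLipschitzOn hΩ (h.locallyLipschitzOn (s := Ω)) a
  simpa only [← partialDeriv_one] using this

theorem IsTestFunction.memLp {ϕ : Pt n → ℝ} (hϕ : IsTestFunction Ω ϕ) :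
    MemLp ϕ 2 (volume.restrict Ω) :=
  (hϕ.1.continuous.memLp_of_hasCompactSupport hϕ.2.1).restrict _

theorem IsTestFunction.partialDeriv {ϕ : Pt n → ℝ} (hϕ : IsTestFunction Ω ϕ) {k : ℕ}
    (α : Fin k → Fin n) : IsTestFunction Ω (partialDeriv α ϕ) :=
  ⟨contDiff_partialDeriv α hϕ.1,
    hϕ.2.1.mono' ((subset_tsupport _).trans (tsupport_partialDeriv_subset α ϕ)),
    (tsupport_partialDeriv_subset α ϕ).trans hϕ.2.2⟩

/-- The members of `H^1_0(Ω)` are the `H^1`-limits of sequences of test functions. -/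
theorem MemH10.exists_seq (hΩ : IsOpen Ω) (h : MemH10 Ω v) :
    ∃ (g : Fin n → Pt n → ℝ) (ϕ : ℕ → Pt n → ℝ), (∀ a, HasWeakDeriv Ω ![a] v (g a)) ∧
      (∀ j, IsTestFunction Ω (ϕ j)) ∧ TendstoL2 (volume.restrict Ω) ϕ v ∧
      ∀ a, TendstoL2 (volume.restrict Ω) (fun j => partialDeriv ![a] (ϕ j)) (g a) := by
  have hg : ∀ a : Fin n, ∃ g, HasWeakDeriv Ω ![a] v g ∧ MemLp g 2 (volume.restrict Ω) :=
    fun a => h.1.2 1 le_rfl ![a]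
  choose g hg hgL using hg
  have hϕ : ∀ j : ℕ, ∃ ϕ, IsTestFunction Ω ϕ ∧ h1Norm Ω (fun x => v x - ϕ x) < 1 / ((j : ℝ) + 1) :=
    fun j => h.2 _ (by positivity)
  choose ϕ hϕ hϕe using hϕ
  have hsq : ∀ j, h1Norm Ω (fun x => v x - ϕ j x) ^ 2 = (∫ x in Ω, (v x - ϕ j x) ^ 2) +
      ∑ a, ∫ x in Ω, (g a x - partialDeriv ![a] (ϕ j) x) ^ 2 := fun j =>
    h1Norm_sq hΩ fun a => (hg a).sub (hasWeakDeriv_one_of_contDiff hΩ (hϕ j).1 a)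
  have h0 : Tendsto (fun j => h1Norm Ω (fun x => v x - ϕ j x) ^ 2) atTop (𝓝 0) := by
    have : Tendsto (fun j => h1Norm Ω (fun x => v x - ϕ j x)) atTop (𝓝 0) :=
      squeeze_zero (fun j => Real.sqrt_nonneg _) (fun j => (hϕe j).le)
        tendsto_one_div_add_atTop_nhds_zero_nat
    simpa using this.pow 2
  simp only [hsq] at h0
  refine ⟨g, ϕ, hg, hϕ, ⟨fun j => (hϕ j).memLp, h.1.1, ?_⟩,
    fun a => ⟨fun j => ((hϕ j).partialDeriv _).memLp, hgL a, ?_⟩⟩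
  · refine squeeze_zero (fun j => integral_nonneg fun x => sq_nonneg _) (fun j => ?_) h0
    simp only [sub_sq_comm (ϕ j _)]
    have : 0 ≤ ∑ a, ∫ x in Ω, (g a x - partialDeriv ![a] (ϕ j) x) ^ 2 :=
      Finset.sum_nonneg fun a _ => integral_nonneg fun x => sq_nonneg _
    linarith
  · refine squeeze_zero (fun j => integral_nonneg fun x => sq_nonneg _) (fun j => ?_) h0
    simp only [sub_sq_comm (partialDeriv ![a] (ϕ j) _)]
    have h1 := Finset.single_le_sum
      (f := fun a => ∫ x in Ω, (g a x - partialDeriv ![a] (ϕ j) x) ^ 2)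
      (fun a _ => integral_nonneg fun x => sq_nonneg _) (Finset.mem_univ a)
    have h2 : 0 ≤ ∫ x in Ω, (v x - ϕ j x) ^ 2 := integral_nonneg fun x => sq_nonneg _
    linarith

theorem memSobolev_one_two (hv : MemLp v 2 (volume.restrict Ω))
    {g : Fin n → Pt n → ℝ} (hg : ∀ a, HasWeakDeriv Ω ![a] v (g a))
    (hgL : ∀ a, MemLp (g a) 2 (volume.restrict Ω)) : MemSobolev 1 2 Ω v := by
  refine ⟨hv, fun j hj α => ?_⟩
  obtain rfl | rfl : j = 0 ∨ j = 1 := by omega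
  · exact ⟨v, hasWeakDeriv_of_order_zero α
      (locallyIntegrableOn_of_locallyIntegrable_restrict (hv.locallyIntegrable (by norm_num))), hv⟩
  · have : α = ![α 0] := by funext i; fin_cases i; rfl
    rw [this]
    exact ⟨_, hg _, hgL _⟩

theorem memH10_of_seq (hΩ : IsOpen Ω) {g : Fin n → Pt n → ℝ} {ϕ : ℕ → Pt n → ℝ}
    (hg : ∀ a, HasWeakDeriv Ω ![a] v (g a)) (hϕ : ∀ j, IsTestFunction Ω (ϕ j))
    (h0 : TendstoL2 (volume.restrict Ω) ϕ v)
    (h1 : ∀ a, TendstoL2 (volume.restrict Ω) (fun j => partialDeriv ![a] (ϕ j)) (g a)) :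
    MemH10 Ω v := by
  refine ⟨memSobolev_one_two h0.2.1 hg fun a => (h1 a).2.1, fun ε hε => ?_⟩
  have hsq : ∀ j, h1Norm Ω (fun x => v x - ϕ j x) ^ 2 = (∫ x in Ω, (ϕ j x - v x) ^ 2) +
      ∑ a, ∫ x in Ω, (partialDeriv ![a] (ϕ j) x - g a x) ^ 2 := fun j => by
    rw [h1Norm_sq hΩ fun a => (hg a).sub (hasWeakDeriv_one_of_contDiff hΩ (hϕ j).1 a)]
    simp only [sub_sq_comm]
  have hlim : Tendsto (fun j => h1Norm Ω (fun x => v x - ϕ j x) ^ 2) atTop (𝓝 0) := by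
    simp only [hsq]
    simpa using h0.2.2.add (tendsto_finsetSum Finset.univ fun a _ => (h1 a).2.2)
  obtain ⟨j, hj⟩ := (hlim.eventually (gt_mem_nhds (by positivity : 0 < ε ^ 2))).exists
  exact ⟨ϕ j, hϕ j, lt_of_pow_lt_pow_left₀ 2 hε.le hj⟩

theorem IsTestFunction.lincomb {ϕ ψ : Pt n → ℝ} (hϕ : IsTestFunction Ω ϕ)
    (hψ : IsTestFunction Ω ψ) (c c' : ℝ) : IsTestFunction Ω (fun x => c * ϕ x + c' * ψ x) := by
  have hs : tsupport (fun x => c * ϕ x + c' * ψ x) ⊆ tsupport ϕ ∪ tsupport ψ := by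
    refine closure_minimal (fun x hx => ?_) ((isClosed_tsupport _).union (isClosed_tsupport _))
    by_contra hcon
    rw [mem_union, not_or] at hcon
    exact hx (by simp [image_eq_zero_of_notMem_tsupport hcon.1,
      image_eq_zero_of_notMem_tsupport hcon.2])
  exact ⟨(contDiff_const.mul hϕ.1).add (contDiff_const.mul hψ.1),
    (hϕ.2.1.union hψ.2.1).of_isClosed_subset (isClosed_tsupport _) hs,
    hs.trans (union_subset hϕ.2.2 hψ.2.2)⟩

theorem partialDeriv_one_lincomb {ϕ ψ : Pt n → ℝ} (hϕ : ContDiff ℝ ∞ ϕ) (hψ : ContDiff ℝ ∞ ψ)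
    (c c' : ℝ) (a : Fin n) (x : Pt n) : partialDeriv ![a] (fun x => c * ϕ x + c' * ψ x) x =
      c * partialDeriv ![a] ϕ x + c' * partialDeriv ![a] ψ x := by
  have h1 : DifferentiableAt ℝ ϕ x := (hϕ.differentiable (by simp)) x
  have h2 : DifferentiableAt ℝ ψ x := (hψ.differentiable (by simp)) x
  simp only [partialDeriv_one]
  rw [fderiv_fun_add (h1.const_mul c) (h2.const_mul c'), fderiv_const_mul h1, fderiv_const_mul h2]
  simp

theorem MemH10.lincomb (hΩ : IsOpen Ω) (hv : MemH10 Ω v) (hw : MemH10 Ω w) (c c' : ℝ) :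
    MemH10 Ω (fun x => c * v x + c' * w x) := by
  obtain ⟨g, ϕ, hg, hϕ, h0, h1⟩ := hv.exists_seq hΩ
  obtain ⟨g', ϕ', hg', hϕ', h0', h1'⟩ := hw.exists_seq hΩ
  refine memH10_of_seq hΩ (fun a => (hg a).lincomb (hg' a) c c')
    (fun j => (hϕ j).lincomb (hϕ' j) c c') (h0.lincomb h0' c c') fun a => ?_
  refine ((h1 a).lincomb (h1' a) c c').congr (fun j => ?_) (EventuallyEq.refl _ _)
  exact Eventually.of_forall fun x => (partialDeriv_one_lincomb (hϕ j).1 (hϕ' j).1 c c' a x).symm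

theorem memH10_zero (hΩ : IsOpen Ω) : MemH10 Ω (fun _ => 0) := by
  have ht : IsTestFunction Ω (fun _ : Pt n => (0 : ℝ)) :=
    ⟨contDiff_const, HasCompactSupport.zero, by simp [tsupport]⟩
  refine memH10_of_seq hΩ (fun a => hasWeakDeriv_zero Ω ![a]) (fun _ => ht)
    (TendstoL2.const MemLp.zero') fun a => ?_
  have e : partialDeriv ![a] (fun _ : Pt n => (0 : ℝ)) = fun _ => 0 := by
    funext x; rw [partialDeriv_one]; simp
  simpa only [e] using TendstoL2.const (f := fun _ : Pt n => (0 : ℝ)) MemLp.zero'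

theorem MemH10.sum (hΩ : IsOpen Ω) {ι : Type*} (s : Finset ι) {v : ι → Pt n → ℝ} (c : ι → ℝ)
    (h : ∀ i ∈ s, MemH10 Ω (v i)) : MemH10 Ω (fun x => ∑ i ∈ s, c i * v i x) := by
  classical
  induction s using Finset.induction_on with
  | empty => simpa using memH10_zero hΩ
  | insert i s his ih =>
    have := (h i (Finset.mem_insert_self _ _)).lincomb hΩ
      (ih fun j hj => h j (Finset.mem_insert_of_mem hj)) (c i) 1
    simpa only [Finset.sum_insert his, one_mul] using this

end H10

/-! ### Lipschitz functions in H¹₀ and Poincaré's inequality. -/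

section H10Lipschitz

variable {n : ℕ} {Ω : Set (Pt n)} {v w : Pt n → ℝ}

/-- `H^1_0(Ω)` is closed. -/
theorem memH10_of_tendsto (hΩ : IsOpen Ω) {w : ℕ → Pt n → ℝ} {h : ℕ → Fin n → Pt n → ℝ}
    {g : Fin n → Pt n → ℝ} (hw : ∀ j, MemH10 Ω (w j))
    (hh : ∀ j a, HasWeakDeriv Ω ![a] (w j) (h j a)) (hg : ∀ a, HasWeakDeriv Ω ![a] v (g a))
    (h0 : TendstoL2 (volume.restrict Ω) w v)
    (h1 : ∀ a, TendstoL2 (volume.restrict Ω) (fun j => h j a) (g a)) : MemH10 Ω v := by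
  -- A diagonal choice: one test function within 1/(j+1) of each member of the sequence, in value
  -- and in gradient.
  have key : ∀ j : ℕ, ∃ ϕ, IsTestFunction Ω ϕ ∧ (∫ x in Ω, (ϕ x - w j x) ^ 2) < 1 / ((j : ℝ) + 1) ∧
      ∀ a, ∫ x in Ω, (partialDeriv ![a] ϕ x - h j a x) ^ 2 < 1 / ((j : ℝ) + 1) := by
    intro j
    obtain ⟨g', ϕ, hg', hϕ, e0, e1⟩ := (hw j).exists_seq hΩ
    have hpos : (0 : ℝ) < 1 / ((j : ℝ) + 1) := by positivity
    have ev : ∀ᶠ i in atTop, (∫ x in Ω, (ϕ i x - w j x) ^ 2) < 1 / ((j : ℝ) + 1) ∧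
        ∀ a, ∫ x in Ω, (partialDeriv ![a] (ϕ i) x - g' a x) ^ 2 < 1 / ((j : ℝ) + 1) :=
      (e0.2.2.eventually (gt_mem_nhds hpos)).and
        (eventually_all.2 fun a => (e1 a).2.2.eventually (gt_mem_nhds hpos))
    obtain ⟨i, hi0, hi1⟩ := ev.exists
    refine ⟨ϕ i, hϕ i, hi0, fun a => ?_⟩
    refine lt_of_eq_of_lt (integral_congr_ae ?_) (hi1 a)
    filter_upwards [(hh j a).ae_unique hΩ (hg' a)] with x hx
    rw [hx]
  choose ϕ hϕ hϕ0 hϕ1 using key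
  have comb : ∀ {F G : ℕ → Pt n → ℝ} {f : Pt n → ℝ}, (∀ j, MemLp (F j) 2 (volume.restrict Ω)) →
      TendstoL2 (volume.restrict Ω) G f →
      (∀ j, ∫ x in Ω, (F j x - G j x) ^ 2 < 1 / ((j : ℝ) + 1)) →
      TendstoL2 (volume.restrict Ω) F f := by
    intro F G f hF hG hlt
    refine ⟨hF, hG.2.1, ?_⟩
    have hlim : Tendsto (fun j : ℕ => 2 * (1 / ((j : ℝ) + 1)) +
        2 * ∫ x in Ω, (G j x - f x) ^ 2) atTop (𝓝 0) := by
      simpa using (tendsto_one_div_add_atTop_nhds_zero_nat.const_mul 2).add (hG.2.2.const_mul 2)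
    refine squeeze_zero (fun j => integral_nonneg fun x => sq_nonneg _) (fun j => ?_) hlim
    have := integral_add_sq_le ((hF j).sub (hG.1 j)) ((hG.1 j).sub hG.2.1)
    simp only [Pi.sub_apply, sub_add_sub_cancel] at this
    linarith [hlt j]
  exact memH10_of_seq hΩ hg hϕ (comb (fun j => (hϕ j).memLp) h0 hϕ0)
    fun a => comb (fun j => ((hϕ j).partialDeriv _).memLp) (h1 a) fun j => hϕ1 j a

theorem LipschitzWith.memLp_fderiv_apply {L : NNReal} (hv : LipschitzWith L v)
    (hb : Bornology.IsBounded Ω) (a : Fin n) :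
    MemLp (fun x => fderiv ℝ v x (basisVec a)) 2 (volume.restrict Ω) := by
  have : IsFiniteMeasure (volume.restrict Ω) := ⟨by simpa using hb.measure_lt_top⟩
  refine MemLp.of_bound (measurable_fderiv_apply_const ℝ v _).aestronglyMeasurable L
    (Eventually.of_forall fun x => ?_)
  refine ((fderiv ℝ v x).le_opNorm _).trans ?_
  simpa using norm_fderiv_le_of_lipschitz ℝ hv (x₀ := x)

theorem LipschitzWith.hasWeakDeriv {L : NNReal} (hv : LipschitzWith L v) (hΩ : IsOpen Ω)
    (a : Fin n) : HasWeakDeriv Ω ![a] v (fun x => fderiv ℝ v x (basisVec a)) :=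
  hasWeakDeriv_of_locallyLipschitzOn hΩ (hv.locallyLipschitz.locallyLipschitzOn) a

/-- Where v x ≤ ε the truncation attains its minimum 0, so `fderiv` vanishes; at a kink on the level
ε this is its default value, so no exceptional set is needed. -/
theorem fderiv_max_sub_zero (hv : Continuous v) (ε : ℝ) (x : Pt n) :
    fderiv ℝ (fun y => max (v y - ε) 0) x = if ε < v x then fderiv ℝ v x else 0 := by
  split_ifs with h
  · have : (fun y => max (v y - ε) 0) =ᶠ[𝓝 x] fun y => v y - ε := by
      filter_upwards [hv.continuousAt.eventually (lt_mem_nhds h)] with y hy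
      exact max_eq_left (by linarith)
    rw [this.fderiv_eq, fderiv_sub_const]
  · refine IsLocalMin.fderiv_eq_zero (Eventually.of_forall fun y => ?_)
    simp only
    rw [max_eq_right (by linarith : v x - ε ≤ 0)]
    exact le_max_right _ _

/-- A nonnegative Lipschitz function that vanishes outside of the bounded open set `Ω` belongs to
`H^1_0(Ω)`. -/
theorem memH10_of_lipschitz (hΩ : IsOpen Ω) (hb : Bornology.IsBounded Ω) {L : NNReal}
    (hv : LipschitzWith L v) (h0 : ∀ x, 0 ≤ v x) (hoff : ∀ x, x ∉ Ω → v x = 0) : MemH10 Ω v := by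
  have hlipε : ∀ ε : ℝ, LipschitzWith L (fun y => max (v y - ε) 0) := fun ε => by
    have h1 : LipschitzWith L (fun y => v y - ε) := LipschitzWith.of_dist_le_mul fun x y => by
      simpa using hv.dist_le_mul x y
    exact h1.max_const 0
  have hfin : IsFiniteMeasure (volume.restrict Ω) := ⟨by simpa using hb.measure_lt_top⟩
  -- truncations have compact support in `Ω`
  have step1 : ∀ ε : ℝ, 0 < ε → MemH10 Ω (fun y => max (v y - ε) 0) := by
    intro ε hε
    obtain ⟨R, hR⟩ := hb.subset_ball 0
    -- Smoothing needs a convex set, so it takes place in a ball around `Ω`; radius at least 1 keeps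
    -- the ball nonempty.
    set U := Metric.ball (0 : Pt n) (max R 1) with hU
    have hΩU : Ω ⊆ U := hR.trans (Metric.ball_subset_ball (le_max_left _ _))
    have hUb : Bornology.IsBounded U := Metric.isBounded_ball
    obtain ⟨w, hw, hw1, -, hw3⟩ := exists_smooth_approx (U := U) Metric.isOpen_ball
      (convex_ball _ _) hUb
      ⟨0, Metric.mem_ball_self (lt_of_lt_of_le one_pos (le_max_right _ _))⟩
      (memLp_two_of_contDiff_of_bounded hUb (hlipε ε).continuous)
    -- The truncation vanishes outside of this compact subset of `Ω`, and the approximations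
    -- eventually live within distance `η` of it, so they are test functions of `Ω`.
    set S := {x | ε ≤ v x} with hS
    have hSΩ : S ⊆ Ω := fun x hx => by
      by_contra hxΩ
      have := hoff x hxΩ
      rw [hS, mem_ofPred_eq, this] at hx
      linarith
    have hSc : IsCompact S := Metric.isCompact_of_isClosed_isBounded
      (isClosed_le continuous_const hv.continuous) (hb.subset hSΩ)
    obtain ⟨η, hη, hηs⟩ := hSc.exists_cthickening_subset_open hΩ hSΩ
    obtain ⟨N, hN⟩ := eventually_atTop.1 (hw3 η hη)
    have hsupp : ∀ j, tsupport (w (j + N)) ⊆ Metric.cthickening η S := fun j => by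
      refine closure_minimal (fun x hx => ?_) Metric.isClosed_cthickening
      obtain ⟨y, -, hy, hxy⟩ := hN (j + N) (Nat.le_add_left _ _) x hx
      refine Metric.thickening_subset_cthickening _ _ (Metric.mem_thickening_iff.2 ⟨y, ?_, hxy⟩)
      by_contra hyS
      exact hy (max_eq_right (by rw [hS, mem_ofPred_eq, not_le] at hyS; linarith))
    have htest : ∀ j, IsTestFunction Ω (w (j + N)) := fun j =>
      ⟨hw _, hSc.cthickening.of_isClosed_subset (isClosed_tsupport _) (hsupp j),
        (hsupp j).trans hηs⟩
    have hmem := memLp_two_of_contDiff_of_bounded hUb (hlipε ε).continuous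
    refine memH10_of_seq hΩ (fun a => LipschitzWith.hasWeakDeriv (hlipε ε) hΩ a) htest ?_ fun a => ?_
    · refine TendstoL2.mono hΩU ⟨fun j => memLp_two_of_contDiff_of_bounded hUb (hw _).continuous,
        hmem, ?_⟩
      have := hw1 0 ![] _ (hasWeakDeriv_of_order_zero _
        (locallyIntegrableOn_of_locallyIntegrable_restrict (hmem.locallyIntegrable (by norm_num))))
        hmem
      simp only [partialDeriv_zero] at this
      exact this.comp (tendsto_add_atTop_nat N)
    · refine TendstoL2.mono hΩU ⟨fun j => memLp_two_of_contDiff_of_bounded hUb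
        (contDiff_partialDeriv _ (hw _)).continuous, LipschitzWith.memLp_fderiv_apply (hlipε ε) hUb a, ?_⟩
      exact (hw1 1 ![a] _ (LipschitzWith.hasWeakDeriv (hlipε ε) Metric.isOpen_ball a)
        (LipschitzWith.memLp_fderiv_apply (hlipε ε) hUb a)).comp (tendsto_add_atTop_nat N)
  set e : ℕ → ℝ := fun j => 1 / ((j : ℝ) + 1) with he
  have hepos : ∀ j, 0 < e j := fun j => by simp only [he]; positivity
  have helim : Tendsto e atTop (𝓝 0) := tendsto_one_div_add_atTop_nhds_zero_nat
  refine memH10_of_tendsto hΩ (fun j => step1 (e j) (hepos j))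
    (fun j a => LipschitzWith.hasWeakDeriv (hlipε (e j)) hΩ a) (fun a => LipschitzWith.hasWeakDeriv hv hΩ a) ?_ fun a => ?_
  · refine ⟨fun j => memLp_two_of_contDiff_of_bounded hb (hlipε _).continuous,
      memLp_two_of_contDiff_of_bounded hb hv.continuous, ?_⟩
    have hlim : Tendsto (fun j => e j ^ 2 * (volume.restrict Ω).real univ) atTop (𝓝 0) := by
      simpa using (helim.pow 2).mul_const _
    refine squeeze_zero (fun j => integral_nonneg fun x => sq_nonneg _) (fun j => ?_) hlim
    refine (integral_mono_of_nonneg (Eventually.of_forall fun x => sq_nonneg _)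
      (integrable_const (e j ^ 2)) (Eventually.of_forall fun x => ?_)).trans
      (le_of_eq (by rw [integral_const, smul_eq_mul, mul_comm]))
    have h1 := h0 x
    have h2 := (hepos j).le
    simp only
    rw [sq_le_sq, abs_of_nonneg h2, abs_le]
    constructor
    · linarith [le_max_left (v x - e j) 0]
    · linarith [max_le (by linarith : v x - e j ≤ v x) h1]
  · refine ⟨fun j => LipschitzWith.memLp_fderiv_apply (hlipε _) hb a,
      LipschitzWith.memLp_fderiv_apply hv hb a, ?_⟩
    -- Where v > 0 the gradient of the truncation equals that of `v` as soon as `e j` is below v x;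
    -- where v = 0 both vanish, since `v` has a minimum there.
    have := tendsto_integral_of_dominated_convergence (μ := volume.restrict Ω)
      (F := fun j x => (fderiv ℝ (fun y => max (v y - e j) 0) x (basisVec a) -
        fderiv ℝ v x (basisVec a)) ^ 2) (f := fun _ => 0)
      (fun x => (fderiv ℝ v x (basisVec a)) ^ 2) ?_ ?_ ?_ ?_
    · simpa using this
    · intro j
      exact (((measurable_fderiv_apply_const ℝ _ _).sub
        (measurable_fderiv_apply_const ℝ _ _)).pow_const 2).aestronglyMeasurable
    · exact (LipschitzWith.memLp_fderiv_apply hv hb a).integrable_sq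
    · refine fun j => Eventually.of_forall fun x => ?_
      rw [fderiv_max_sub_zero hv.continuous, Real.norm_of_nonneg (sq_nonneg _)]
      split_ifs
      · simpa using sq_nonneg _
      · simp
    · refine Eventually.of_forall fun x => ?_
      rcases (h0 x).eq_or_lt with hx | hx
      · have hz : fderiv ℝ v x = 0 :=
          IsLocalMin.fderiv_eq_zero (Eventually.of_forall fun y => by rw [← hx]; exact h0 y)
        simp [fderiv_max_sub_zero hv.continuous, hz]
      · refine tendsto_const_nhds.congr' ?_
        filter_upwards [helim.eventually (gt_mem_nhds hx)] with j hj
        rw [fderiv_max_sub_zero hv.continuous, if_pos hj]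
        simp

/-- The Poincaré inequality. -/
theorem integral_sq_le_of_isTestFunction (hΩ : IsOpen Ω) {ϕ : Pt n → ℝ} (hϕ : IsTestFunction Ω ϕ) {R : ℝ}
    (hR : ∀ x ∈ Ω, ‖x‖ ≤ R) (a : Fin n) :
    ∫ x in Ω, ϕ x ^ 2 ≤ 4 * R ^ 2 * ∫ x in Ω, partialDeriv ![a] ϕ x ^ 2 := by
  have hϕd : Differentiable ℝ ϕ := hϕ.1.differentiable (by simp)
  have hcd : Continuous (fun x => fderiv ℝ ϕ x (basisVec a)) :=
    (hϕ.1.continuous_fderiv (by simp)).clm_apply continuous_const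
  have hsd : HasCompactSupport (fun x => fderiv ℝ ϕ x (basisVec a)) := by
    have := hϕ.2.1.fderiv (𝕜 := ℝ)
    exact this.comp_left (g := fun l : Pt n →L[ℝ] ℝ => l (basisVec a)) (by simp)
  have hcont : Continuous ϕ := hϕ.1.continuous
  have hco : Continuous (fun x : Pt n => x a) := by fun_prop
  have hdco : ∀ x : Pt n, fderiv ℝ (fun x : Pt n => x a) x (basisVec a) = 1 := fun x => by
    have : (fun x : Pt n => x a) = (EuclideanSpace.proj a : Pt n →L[ℝ] ℝ) := rfl
    rw [this, ContinuousLinearMap.fderiv]; simp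
  have hdsq : ∀ x, fderiv ℝ (fun x => ϕ x ^ 2) x (basisVec a) =
      2 * (ϕ x * fderiv ℝ ϕ x (basisVec a)) := fun x => by
    rw [fderiv_fun_pow 2 (hϕd x)]; simp; ring
  -- Integration by parts against the coordinate function, whose derivative is 1: ∫ϕ² = -2∫ x_a ϕ
  -- ∂_a ϕ.
  have hparts := integral_mul_fderiv_eq_neg_fderiv_mul_of_integrable (μ := volume)
    (f := fun x => ϕ x ^ 2) (g := fun x : Pt n => x a) (v := basisVec a) ?_ ?_ ?_
    (fun x _ => (hϕd x).fun_pow 2) (fun x _ => (by fun_prop))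
  rotate_left
  · simp only [hdsq]
    refine Continuous.integrable_of_hasCompactSupport (by fun_prop) ?_
    exact (HasCompactSupport.mul_left (f := fun _ : Pt n => (2 : ℝ))
      (hϕ.2.1.mul_right)).mul_right
  · simp only [hdco, mul_one]
    exact Continuous.integrable_of_hasCompactSupport (hϕ.1.continuous.pow 2)
      (hϕ.2.1.comp_left (g := fun y : ℝ => y ^ 2) (by simp))
  · refine Continuous.integrable_of_hasCompactSupport (by fun_prop) ?_
    exact (hϕ.2.1.comp_left (g := fun y : ℝ => y ^ 2) (by simp)).mul_right
  simp only [hdco, hdsq, mul_one] at hparts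
  have hset : ∀ f : Pt n → ℝ, (∀ x, x ∉ Ω → f x = 0) → ∫ x in Ω, f x = ∫ x, f x := fun f hf =>
    setIntegral_eq_integral_of_forall_compl_eq_zero hf
  have hz : ∀ x, x ∉ Ω → ϕ x = 0 := fun x hx =>
    image_eq_zero_of_notMem_tsupport fun h => hx (hϕ.2.2 h)
  rw [← hset _ fun x hx => by simp [hz x hx], ← hset _ fun x hx => by simp [hz x hx]] at hparts
  set A := ∫ x in Ω, ϕ x ^ 2 with hA
  have hD := (hϕ.partialDeriv ![a]).memLp.integrable_sq
  -- Young's inequality 2|x_a ϕ ∂_aϕ| ≤ ϕ²/2 + 2R²(∂_aϕ)²; absorbing half of `A` doubles the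
  -- constant to 4R².
  have hbound : A ≤ (1 / 2) * A + 2 * R ^ 2 * ∫ x in Ω, partialDeriv ![a] ϕ x ^ 2 := by
    conv_lhs => rw [hparts]
    rw [hA, ← integral_neg, ← integral_const_mul, ← integral_const_mul,
      ← integral_add (hϕ.memLp.integrable_sq.const_mul _) (hD.const_mul _)]
    refine setIntegral_mono_on ?_ ((hϕ.memLp.integrable_sq.const_mul _).add (hD.const_mul _))
      hΩ.measurableSet fun x hx => ?_
    · refine Integrable.integrableOn (Continuous.integrable_of_hasCompactSupport (by fun_prop) ?_)
      exact ((HasCompactSupport.mul_left (f := fun _ : Pt n => (2 : ℝ))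
        (hϕ.2.1.mul_right)).mul_right).neg
    · have h1 : |x a| ≤ R := (by simpa using PiLp.norm_apply_le x a : ‖x a‖ ≤ ‖x‖).trans (hR x hx)
      have h2 : x a ^ 2 ≤ R ^ 2 := sq_le_sq' (abs_le.1 h1).1 (abs_le.1 h1).2
      rw [partialDeriv_one]
      set d := fderiv ℝ ϕ x (basisVec a)
      nlinarith [sq_nonneg (ϕ x + 2 * (d * x a)), mul_le_mul_of_nonneg_right h2 (sq_nonneg d)]
  linarith

theorem MemH10.poincare (hΩ : IsOpen Ω) (hv : MemH10 Ω v) {R : ℝ} (hR : ∀ x ∈ Ω, ‖x‖ ≤ R)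
    {a : Fin n} {g : Pt n → ℝ} (hg : HasWeakDeriv Ω ![a] v g) :
    ∫ x in Ω, v x ^ 2 ≤ 4 * R ^ 2 * ∫ x in Ω, g x ^ 2 := by
  obtain ⟨g', ϕ, hg', hϕ, h0, h1⟩ := hv.exists_seq hΩ
  have e : ∫ x in Ω, g x ^ 2 = ∫ x in Ω, g' a x ^ 2 := integral_congr_ae (by
    filter_upwards [hg.ae_unique hΩ (hg' a)] with x hx; rw [hx])
  rw [e]
  exact le_of_tendsto_of_tendsto' h0.integral_sq ((h1 a).integral_sq.const_mul _)
    fun j => integral_sq_le_of_isTestFunction hΩ (hϕ j) hR a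

end H10Lipschitz

/-! ### Boundedness, coercivity and bilinearity of the energy. -/

section Energy

variable {n : ℕ} {Ω : Set (Pt n)} {K : Pt n → Matrix (Fin n) (Fin n) ℝ} {μ : Measure (Pt n)}
  {ξ ζ : Fin n → Pt n → ℝ} {B lam : ℝ}

theorem energyForm_eq (hΩ : IsOpen Ω) {u v : Pt n → ℝ} (hξ : ∀ a, HasWeakDeriv Ω ![a] u (ξ a))
    (hζ : ∀ a, HasWeakDeriv Ω ![a] v (ζ a)) :
    energyForm K Ω u v = ∫ x in Ω, ∑ a, ∑ b, ξ a x * K x a b * ζ b x := by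
  refine integral_congr_ae ?_
  filter_upwards [eventually_all.2 fun a => (hξ a).weakDeriv_ae hΩ,
    eventually_all.2 fun a => (hζ a).weakDeriv_ae hΩ] with x h1 h2
  simp only [h1, h2]

theorem integrable_energy_term (hK : ∀ a b, AEStronglyMeasurable (fun x => K x a b) μ)
    (hB : ∀ᵐ x ∂μ, ∀ a b, |K x a b| ≤ B) {f g : Pt n → ℝ} (hf : MemLp f 2 μ) (hg : MemLp g 2 μ)
    (a b : Fin n) : Integrable (fun x => f x * K x a b * g x) μ := by
  have h := (hf.integrable_mul hg).mul_bdd (c := B) (hK a b)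
    (hB.mono fun x hx => by simpa using hx a b)
  refine h.congr (Eventually.of_forall fun x => ?_)
  simp only [Pi.mul_apply]; ring

theorem integrable_energy (hK : ∀ a b, AEStronglyMeasurable (fun x => K x a b) μ)
    (hB : ∀ᵐ x ∂μ, ∀ a b, |K x a b| ≤ B) (hξ : ∀ a, MemLp (ξ a) 2 μ) (hζ : ∀ a, MemLp (ζ a) 2 μ) :
    Integrable (fun x => ∑ a, ∑ b, ξ a x * K x a b * ζ b x) μ :=
  integrable_finsetSum _ fun a _ => integrable_finsetSum _ fun b _ =>
    integrable_energy_term hK hB (hξ a) (hζ b) a b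

theorem abs_energy_pointwise_le {k : Matrix (Fin n) (Fin n) ℝ} {B : ℝ} (hB : ∀ a b, |k a b| ≤ B)
    (p q : Fin n → ℝ) :
    |∑ a, ∑ b, p a * k a b * q b| ≤ B * ((∑ a, |p a|) * ∑ b, |q b|) := by
  rw [Finset.sum_mul_sum, Finset.mul_sum]
  refine (Finset.abs_sum_le_sum_abs _ _).trans (Finset.sum_le_sum fun a _ => ?_)
  rw [Finset.mul_sum]
  refine (Finset.abs_sum_le_sum_abs _ _).trans (Finset.sum_le_sum fun b _ => ?_)
  rw [abs_mul, abs_mul]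
  calc |p a| * |k a b| * |q b| = |k a b| * (|p a| * |q b|) := by ring
    _ ≤ _ := mul_le_mul_of_nonneg_right (hB a b) (by positivity)

/-- Each factor loses √n through (∑|ξ_a|)² ≤ n ∑ ξ_a². -/
theorem integral_sum_abs_mul_le (hξ : ∀ a, MemLp (ξ a) 2 μ) (hζ : ∀ a, MemLp (ζ a) 2 μ) :
    Integrable (fun x => (∑ a, |ξ a x|) * ∑ b, |ζ b x|) μ ∧
    ∫ x, (∑ a, |ξ a x|) * (∑ b, |ζ b x|) ∂μ ≤
      n * (Real.sqrt (∑ a, ∫ x, ξ a x ^ 2 ∂μ) * Real.sqrt (∑ a, ∫ x, ζ a x ^ 2 ∂μ)) := by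
  have hsum : ∀ {θ : Fin n → Pt n → ℝ}, (∀ a, MemLp (θ a) 2 μ) →
      MemLp (fun x => ∑ a, |θ a x|) 2 μ ∧
      ∫ x, (∑ a, |θ a x|) ^ 2 ∂μ ≤ n * ∑ a, ∫ x, θ a x ^ 2 ∂μ := by
    intro θ hθ
    have hm : MemLp (fun x => ∑ a, |θ a x|) 2 μ := memLp_finsetSum _ fun a _ => (hθ a).abs
    refine ⟨hm, ?_⟩
    rw [← integral_finsetSum _ fun a _ => (hθ a).integrable_sq, ← integral_const_mul]
    refine integral_mono hm.integrable_sq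
      ((integrable_finsetSum _ fun a _ => (hθ a).integrable_sq).const_mul _) fun x => ?_
    have := sq_sum_le_card_mul_sum_sq (s := Finset.univ) (f := fun a => |θ a x|)
    simpa using this
  obtain ⟨h1, h1'⟩ := hsum hξ
  obtain ⟨h2, h2'⟩ := hsum hζ
  refine ⟨h1.integrable_mul h2, (le_abs_self _).trans ((abs_integral_mul_le h1 h2).trans ?_)⟩
  have hn : (0 : ℝ) ≤ n := by positivity
  calc _ ≤ Real.sqrt (n * ∑ a, ∫ x, ξ a x ^ 2 ∂μ) * Real.sqrt (n * ∑ a, ∫ x, ζ a x ^ 2 ∂μ) :=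
        mul_le_mul (Real.sqrt_le_sqrt h1') (Real.sqrt_le_sqrt h2') (Real.sqrt_nonneg _)
          (Real.sqrt_nonneg _)
    _ = _ := by
        rw [Real.sqrt_mul hn, Real.sqrt_mul hn]
        have := Real.mul_self_sqrt hn
        linear_combination (Real.sqrt (∑ a, ∫ x, ξ a x ^ 2 ∂μ) *
          Real.sqrt (∑ a, ∫ x, ζ a x ^ 2 ∂μ)) * this

theorem abs_energy_le (hK : ∀ a b, AEStronglyMeasurable (fun x => K x a b) μ) (hB0 : 0 ≤ B)
    (hB : ∀ᵐ x ∂μ, ∀ a b, |K x a b| ≤ B) (hξ : ∀ a, MemLp (ξ a) 2 μ) (hζ : ∀ a, MemLp (ζ a) 2 μ) :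
    |∫ x, ∑ a, ∑ b, ξ a x * K x a b * ζ b x ∂μ| ≤
      n * B * (Real.sqrt (∑ a, ∫ x, ξ a x ^ 2 ∂μ) * Real.sqrt (∑ a, ∫ x, ζ a x ^ 2 ∂μ)) := by
  obtain ⟨h1, h2⟩ := integral_sum_abs_mul_le hξ hζ
  refine abs_integral_le_integral_abs.trans ?_
  calc _ ≤ ∫ x, B * ((∑ a, |ξ a x|) * ∑ b, |ζ b x|) ∂μ :=
        integral_mono_ae (integrable_energy hK hB hξ hζ).abs (h1.const_mul B)
          (hB.mono fun x hx => abs_energy_pointwise_le hx _ _)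
    _ = B * ∫ x, (∑ a, |ξ a x|) * (∑ b, |ζ b x|) ∂μ := integral_const_mul _ _
    _ ≤ B * _ := mul_le_mul_of_nonneg_left h2 hB0
    _ = _ := by ring

theorem le_energy (hK : ∀ a b, AEStronglyMeasurable (fun x => K x a b) μ)
    (hB : ∀ᵐ x ∂μ, ∀ a b, |K x a b| ≤ B)
    (hlam : ∀ᵐ x ∂μ, ∀ ξ : Fin n → ℝ, lam * (∑ a, ξ a ^ 2) ≤ ∑ a, ∑ b, ξ a * K x a b * ξ b)
    (hξ : ∀ a, MemLp (ξ a) 2 μ) :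
    lam * ∑ a, ∫ x, ξ a x ^ 2 ∂μ ≤ ∫ x, ∑ a, ∑ b, ξ a x * K x a b * ξ b x ∂μ := by
  rw [← integral_finsetSum _ fun a _ => (hξ a).integrable_sq, ← integral_const_mul]
  exact integral_mono_ae
    ((integrable_finsetSum _ fun a _ => (hξ a).integrable_sq).const_mul _)
    (integrable_energy hK hB hξ hξ) (hlam.mono fun x hx => hx _)

/-- Linearity of the energy in both arguments. -/
theorem energy_sum_sum (hK : ∀ a b, AEStronglyMeasurable (fun x => K x a b) μ)
    (hB : ∀ᵐ x ∂μ, ∀ a b, |K x a b| ≤ B) {ι κ : Type*} (s : Finset ι) (t : Finset κ)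
    (c : ι → ℝ) (d : κ → ℝ) {ξ : ι → Fin n → Pt n → ℝ} {ζ : κ → Fin n → Pt n → ℝ}
    (hξ : ∀ i ∈ s, ∀ a, MemLp (ξ i a) 2 μ) (hζ : ∀ j ∈ t, ∀ a, MemLp (ζ j a) 2 μ) :
    ∫ x, ∑ a, ∑ b, (∑ i ∈ s, c i * ξ i a x) * K x a b * (∑ j ∈ t, d j * ζ j b x) ∂μ =
      ∑ i ∈ s, ∑ j ∈ t, c i * d j * ∫ x, ∑ a, ∑ b, ξ i a x * K x a b * ζ j b x ∂μ := by
  have hint : ∀ i ∈ s, ∀ j ∈ t, Integrable (fun x => c i * d j *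
      ∑ a, ∑ b, ξ i a x * K x a b * ζ j b x) μ := fun i hi j hj =>
    (integrable_energy hK hB (hξ i hi) (hζ j hj)).const_mul _
  have e : ∀ x, ∑ a, ∑ b, (∑ i ∈ s, c i * ξ i a x) * K x a b * (∑ j ∈ t, d j * ζ j b x) =
      ∑ i ∈ s, ∑ j ∈ t, c i * d j * ∑ a, ∑ b, ξ i a x * K x a b * ζ j b x := by
    intro x
    have e1 : ∀ a b, (∑ i ∈ s, c i * ξ i a x) * K x a b * (∑ j ∈ t, d j * ζ j b x) =
        ∑ i ∈ s, ∑ j ∈ t, c i * d j * (ξ i a x * K x a b * ζ j b x) := fun a b => by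
      rw [Finset.sum_mul, Finset.sum_mul_sum]
      exact Finset.sum_congr rfl fun i _ => Finset.sum_congr rfl fun j _ => by ring
    simp only [e1]
    rw [Finset.sum_congr rfl fun a _ => Finset.sum_comm, Finset.sum_comm]
    refine Finset.sum_congr rfl fun i _ => ?_
    rw [Finset.sum_congr rfl fun a _ => Finset.sum_comm, Finset.sum_comm]
    simp only [Finset.mul_sum]
  simp only [e]
  rw [integral_finsetSum _ fun i hi => integrable_finsetSum _ fun j hj => hint i hi j hj]
  refine Finset.sum_congr rfl fun i hi => ?_
  rw [integral_finsetSum _ fun j hj => hint i hi j hj]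
  exact Finset.sum_congr rfl fun j hj => integral_const_mul _ _

theorem IsEllipticTensor.bound (h : IsEllipticTensor lam B Ω K) :
    ∀ᵐ x ∂(volume.restrict Ω), ∀ a b, |K x a b| ≤ B := h.mono fun _ hx => hx.2.1

theorem IsEllipticTensor.coercive (h : IsEllipticTensor lam B Ω K) :
    ∀ᵐ x ∂(volume.restrict Ω), ∀ ξ : Fin n → ℝ,
      lam * (∑ a, ξ a ^ 2) ≤ ∑ a, ∑ b, ξ a * K x a b * ξ b := h.mono fun _ hx => hx.2.2

theorem IsEllipticTensor.bound_nonneg (h : IsEllipticTensor lam B Ω K) (hΩ : IsOpen Ω)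
    (hne : Ω.Nonempty) (hn : 1 ≤ n) : 0 ≤ B := by
  have : (ae (volume.restrict Ω)).NeBot := by
    rw [ae_neBot, Ne, Measure.restrict_eq_zero]
    exact (hΩ.measure_pos volume hne).ne'
  obtain ⟨x, hx⟩ := h.bound.exists
  exact (abs_nonneg _).trans (hx ⟨0, hn⟩ ⟨0, hn⟩)

end Energy

/-! ### The finite element space and its nodal basis. -/

section FiniteElements

variable {n : ℕ} {t : Simp n} {Ω : Set (Pt n)} {M : Finset (Simp n)} {m : ℕ}

namespace IsMacroMesh

variable (hM : IsMacroMesh Ω M)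
include hM

theorem memH10_hat (hn : n ≤ 3) (hΩ : IsBoundedLipschitzDomain Ω) {p : Pt n}
    (hp : p ∈ dofs Ω M m) : MemH10 Ω (hat M m p) := by
  classical
  obtain ⟨L, hL⟩ := hM.lipschitz_hat hn hΩ hp
  refine memH10_of_lipschitz hΩ.1 hΩ.2.2.1 hL (fun x => ?_)
    fun x hx => hM.hat_eq_zero_off hn hΩ hp hx
  exact hM.hat_nonneg hn (Finset.mem_filter.1 hp).1 x

theorem memVh_sum (hn : n ≤ 3) (hΩ : IsBoundedLipschitzDomain Ω) (c : Pt n → ℝ) :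
    MemVh Ω M m (fun x => ∑ p ∈ dofs Ω M m, c p * hat M m p x) := by
  classical
  refine ⟨MemH10.sum hΩ.1 _ c fun p hp => hM.memH10_hat hn hΩ hp, ?_, fun x hx => ?_,
    fun t ht => ?_⟩
  · exact continuous_finsetSum _ fun p hp => continuous_const.mul (hM.continuous_hat hn hΩ hp)
  · exact Finset.sum_eq_zero fun p hp => by rw [hM.hat_eq_zero_off hn hΩ hp hx, mul_zero]
  · have hti := hM.fine_affineIndependent ht
    -- Giving coefficient 0 to vertices outside of `Ω` turns the sum over `dofs` into one over all
    -- vertices, which restricts to the element.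
    set d : Fin (n + 1) → ℝ := fun k => if t k ∈ Ω then c (t k) else 0 with hd
    refine ⟨(∑ k, d k • baryLin t k).toAffineMap + AffineMap.const ℝ _ (∑ k, d k * bary t k 0),
      fun x hx => ?_⟩
    have h1 := hM.sum_hat_eq hn ht hx (fun p => if p ∈ Ω then c p else 0)
    have h2 : ∑ p ∈ dofs Ω M m, c p * hat M m p x =
        ∑ p ∈ vertices M m, (if p ∈ Ω then c p else 0) * hat M m p x := by
      rw [dofs, Finset.sum_filter]
      exact Finset.sum_congr rfl fun p _ => by split_ifs <;> simp
    refine (h2.trans h1).trans ?_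
    simp only [AffineMap.coe_add, LinearMap.coe_toAffineMap, AffineMap.coe_const, Pi.add_apply,
      LinearMap.sum_apply, LinearMap.smul_apply, smul_eq_mul, Function.const_apply]
    rw [← Finset.sum_add_distrib]
    refine Finset.sum_congr rfl fun k _ => ?_
    have := bary_add hti k 0 x
    rw [zero_add] at this
    rw [this]; ring

theorem eq_sum_hat_of_memVh (hn : n ≤ 3) (hΩ : IsBoundedLipschitzDomain Ω) {v : Pt n → ℝ}
    (hv : MemVh Ω M m v) : v = fun x => ∑ p ∈ dofs Ω M m, v p * hat M m p x := by
  classical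
  funext x
  by_cases hx : x ∈ Ω
  · obtain ⟨t, ht, hxt⟩ := hM.exists_fine_mem (m := m) (subset_closure hx)
    obtain ⟨A, hA⟩ := hv.2.2.2 t ht
    rw [hA x hxt, affineMap_eq_sum_bary (hM.fine_affineIndependent ht)]
    have h2 : ∑ p ∈ dofs Ω M m, v p * hat M m p x = ∑ p ∈ vertices M m, v p * hat M m p x := by
      rw [dofs, Finset.sum_filter]
      refine Finset.sum_congr rfl fun p _ => ?_
      split_ifs with hp
      · rfl
      · rw [hv.2.2.1 p hp, zero_mul]
    rw [h2, hM.sum_hat_eq hn ht hxt]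
    exact Finset.sum_congr rfl fun k _ => by rw [← hA _ (vertex_mem_hull t k), mul_comm]
  · rw [hv.2.2.1 x hx]
    exact (Finset.sum_eq_zero fun p hp => by
      rw [hM.hat_eq_zero_off hn hΩ hp hx, mul_zero]).symm

theorem vertices_subset_closure {p : Pt n} (hp : p ∈ vertices M m) : p ∈ closure Ω := by
  obtain ⟨T, hT, hpT⟩ := mem_vertices_iff.1 hp
  exact hM.hull_subset_closure hT ((mem_lattice_iff (hM.nondegenerate T hT)).1 hpT).1

/-- A vertex that lies in a fine element is a vertex of this element. -/
theorem mem_range_of_mem_hull (hn : n ≤ 3) (ht : t ∈ fineMesh M m) {p : Pt n}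
    (hp : p ∈ vertices M m) (hpt : p ∈ hull t) : p ∈ range t :=
  hM.mem_range_of_hat_ne_zero hn ht hp hpt (by rw [hM.hat_self hn hp]; norm_num)

theorem hat_eq_zero_of_ne (hn : n ≤ 3) {p q : Pt n} (hp : p ∈ vertices M m)
    (hq : q ∈ vertices M m) (hpq : q ≠ p) : hat M m q p = 0 := by
  obtain ⟨t, ht, hpt⟩ := hM.exists_fine_mem (m := m) (hM.vertices_subset_closure hp)
  obtain ⟨k, rfl⟩ := hM.mem_range_of_mem_hull hn ht hp hpt
  by_cases hqt : q ∈ range t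
  · obtain ⟨l, rfl⟩ := hqt
    rw [hM.hat_vertex hn ht hpt, bary_vertex (hM.fine_affineIndependent ht),
      if_neg (fun h => hpq (by rw [h]))]
  · exact hM.hat_eq_zero hn ht hq hqt hpt

theorem sum_hat_dofs (hn : n ≤ 3) {p : Pt n} (hp : p ∈ dofs Ω M m) (c : Pt n → ℝ) :
    ∑ q ∈ dofs Ω M m, c q * hat M m q p = c p := by
  classical
  have hp' := (Finset.mem_filter.1 hp).1
  rw [Finset.sum_eq_single_of_mem p hp fun q hq hqp => by
    rw [hM.hat_eq_zero_of_ne hn hp' (Finset.mem_filter.1 hq).1 hqp, mul_zero],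
    hM.hat_self hn hp', mul_one]

/-- The pointwise gradient of a vertex function inside of a fine element. -/
theorem fderiv_hat_vertex (hn : n ≤ 3) (ht : t ∈ fineMesh M m) {x : Pt n} (hx : x ∈ openHull t)
    (k : Fin (n + 1)) (y : Pt n) : fderiv ℝ (hat M m (t k)) x y = baryLin t k y := by
  have hti := hM.fine_affineIndependent ht
  have h1 : hat M m (t k) =ᶠ[𝓝 x] fun z => bary t k 0 + (baryLin t k).toContinuousLinearMap z := by
    filter_upwards [(isOpen_openHull t).mem_nhds hx] with z hz
    rw [hM.hat_vertex hn ht (openHull_subset_hull t hz), LinearMap.coe_toContinuousLinearMap',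
      ← bary_add hti, zero_add]
  rw [h1.fderiv_eq, fderiv_const_add, ContinuousLinearMap.fderiv]
  rfl

theorem fderiv_hat_eq_zero (hn : n ≤ 3) (ht : t ∈ fineMesh M m) {x : Pt n} (hx : x ∈ openHull t)
    {p : Pt n} (hp : p ∈ vertices M m) (hpt : p ∉ range t) : fderiv ℝ (hat M m p) x = 0 := by
  have h1 : hat M m p =ᶠ[𝓝 x] fun _ => 0 := by
    filter_upwards [(isOpen_openHull t).mem_nhds hx] with z hz
    exact hM.hat_eq_zero hn ht hp hpt (openHull_subset_hull t hz)
  rw [h1.fderiv_eq]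
  simp

theorem hasWeakDeriv_hat (hn : n ≤ 3) (hΩ : IsOpen Ω) {p : Pt n}
    (hp : p ∈ vertices M m) (a : Fin n) :
    HasWeakDeriv Ω ![a] (hat M m p) (fun x => fderiv ℝ (hat M m p) x (basisVec a)) :=
  hasWeakDeriv_of_locallyLipschitzOn hΩ (hM.locallyLipschitzOn_hat hn hΩ hp) a

theorem memLp_fderiv_hat (hn : n ≤ 3) (hΩ : IsOpen Ω) (hb : Bornology.IsBounded Ω) {p : Pt n}
    (hp : p ∈ vertices M m) (a : Fin n) :
    MemLp (fun x => fderiv ℝ (hat M m p) x (basisVec a)) 2 (volume.restrict Ω) := by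
  have : IsFiniteMeasure (volume.restrict Ω) := ⟨by simpa using hb.measure_lt_top⟩
  obtain ⟨L, hL0, hL⟩ := exists_fine_lipschitz M m
  refine MemLp.of_bound (measurable_fderiv_apply_const ℝ _ _).aestronglyMeasurable L ?_
  filter_upwards [ae_restrict_of_ae (hM.ae_exists_fine_openHull m), ae_restrict_mem hΩ.measurableSet]
    with x hx hxΩ
  obtain ⟨t, ht, hxt⟩ := hx (subset_closure hxΩ)
  by_cases hpt : p ∈ range t
  · obtain ⟨k, rfl⟩ := hpt
    rw [hM.fderiv_hat_vertex hn ht hxt]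
    simpa using hL t ht k (basisVec a)
  · rw [hM.fderiv_hat_eq_zero hn ht hxt hp hpt]
    simpa using hL0

theorem hasWeakDeriv_sum_hat (hn : n ≤ 3) (hΩ : IsOpen Ω) (c : Pt n → ℝ) (a : Fin n) :
    HasWeakDeriv Ω ![a] (fun x => ∑ p ∈ dofs Ω M m, c p * hat M m p x)
      (fun x => ∑ p ∈ dofs Ω M m, c p * fderiv ℝ (hat M m p) x (basisVec a)) := by
  classical
  exact HasWeakDeriv.sum _ c fun p hp =>
    hM.hasWeakDeriv_hat hn hΩ (Finset.mem_filter.1 hp).1 a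

end IsMacroMesh

end FiniteElements

/-! ### Integrals along paths and dilations of star-shaped sets. -/

section PathIntegrals

variable {n : ℕ} {S : Set (Pt n)} {a : Pt n} {d : ℝ}

theorem integrable_sq_of_bounded {X : Type*} [TopologicalSpace X] [MeasurableSpace X]
    [OpensMeasurableSpace X] {μ : Measure X} {S K : Set X} (hSK : S ⊆ K) (hK : IsCompact K)
    (hKm : MeasurableSet K) (hμ : μ K ≠ ⊤) {f : X → ℝ} (hf : Continuous f) :
    IntegrableOn f S μ := by
  obtain ⟨C, hC⟩ := hK.exists_bound_of_continuousOn hf.continuousOn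
  refine IntegrableOn.mono_set ?_ hSK
  refine Measure.integrableOn_of_bounded (M := C) hμ hf.measurable.aestronglyMeasurable ?_
  exact (ae_restrict_iff' hKm).2 (Eventually.of_forall hC)

theorem integrableOn_of_continuous {S : Set (Pt n)} (hb : Bornology.IsBounded S) {f : Pt n → ℝ}
    (hf : Continuous f) : IntegrableOn f S := by
  have := (memLp_two_of_contDiff_of_bounded hb hf)
  have hfin : IsFiniteMeasure (volume.restrict S) := ⟨by simpa using hb.measure_lt_top⟩
  exact this.integrable (by norm_num)

theorem sq_intervalIntegral_le {f : ℝ → ℝ} (hf : Continuous f) {α β : ℝ} (h : α ≤ β) :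
    (∫ σ in α..β, f σ) ^ 2 ≤ (β - α) * ∫ σ in Ioc α β, f σ ^ 2 := by
  have hfin : IsFiniteMeasure (volume.restrict (Ioc α β)) := ⟨by simp⟩
  have hm : MemLp f 2 (volume.restrict (Ioc α β)) := by
    rw [memLp_two_iff_integrable_sq hf.aestronglyMeasurable]
    exact ((hf.pow 2).integrableOn_Icc (a := α) (b := β)).mono_set Ioc_subset_Icc_self
  have h1 : MemLp (fun _ : ℝ => (1 : ℝ)) 2 (volume.restrict (Ioc α β)) := memLp_const 1
  have := abs_integral_mul_le hm h1
  rw [intervalIntegral.integral_of_le h]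
  simp only [mul_one, one_pow, integral_const, smul_eq_mul, measureReal_restrict_apply_univ,
    Real.volume_real_Ioc_of_le h] at this
  rw [← sq_abs]
  calc _ ≤ (Real.sqrt (∫ σ in Ioc α β, f σ ^ 2) * Real.sqrt (β - α)) ^ 2 :=
        pow_le_pow_left₀ (abs_nonneg _) this 2
    _ = _ := by
        rw [mul_pow, Real.sq_sqrt (integral_nonneg fun x => sq_nonneg _),
          Real.sq_sqrt (by linarith), mul_comm]

/-- Minkowski's inequality for integrals, in the form of a uniform bound along a path. -/
theorem integral_sq_path_le (hb : Bornology.IsBounded S)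
    {F : ℝ → Pt n → ℝ} (hF : Continuous (fun z : ℝ × Pt n => F z.1 z.2)) {α β : ℝ} (h : α ≤ β)
    {A : ℝ} (hA : ∀ σ ∈ Ioc α β, ∫ x in S, F σ x ^ 2 ≤ A) :
    ∫ x in S, (∫ σ in α..β, F σ x) ^ 2 ≤ (β - α) ^ 2 * A := by
  have hFx : ∀ x, Continuous fun σ => F σ x := fun x => hF.comp (by fun_prop : Continuous fun σ => (σ, x))
  obtain ⟨R, hR⟩ := hb.subset_closedBall 0
  have hprod : Integrable (fun z : Pt n × ℝ => F z.2 z.1 ^ 2)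
      ((volume.restrict S).prod (volume.restrict (Ioc α β))) := by
    rw [Measure.prod_restrict]
    have hK : IsCompact (Metric.closedBall (0 : Pt n) R ×ˢ Icc α β) :=
      (isCompact_closedBall _ _).prod isCompact_Icc
    refine integrable_sq_of_bounded (Set.prod_mono hR Ioc_subset_Icc_self) hK hK.measurableSet
      hK.measure_lt_top.ne ?_
    exact (hF.comp continuous_swap).pow 2
  have hcont : Continuous fun x => ∫ σ in α..β, F σ x :=
    intervalIntegral.continuous_parametric_intervalIntegral_of_continuous'
      (f := fun x σ => F σ x) (hF.comp continuous_swap) α β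
  calc ∫ x in S, (∫ σ in α..β, F σ x) ^ 2
      ≤ ∫ x in S, (β - α) * ∫ σ in Ioc α β, F σ x ^ 2 :=
        integral_mono (integrableOn_of_continuous hb (hcont.pow 2)) (hprod.integral_prod_left.const_mul _)
          fun x => sq_intervalIntegral_le (hFx x) h
    _ = (β - α) * ∫ σ in Ioc α β, ∫ x in S, F σ x ^ 2 := by
        rw [integral_const_mul]
        congr 1
        exact integral_integral_swap hprod
    _ ≤ (β - α) * ∫ σ in Ioc α β, A := by
        refine mul_le_mul_of_nonneg_left ?_ (by linarith)
        exact setIntegral_mono_on hprod.integral_prod_right (integrable_const A) measurableSet_Ioc hA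
    _ = _ := by
        rw [setIntegral_const, Real.volume_real_Ioc_of_le h, smul_eq_mul]; ring

/-- Star-shapedness with respect to a point `a` that need not belong to the set. -/
def StarAt (a : Pt n) (S : Set (Pt n)) : Prop :=
  ∀ x ∈ S, ∀ σ : ℝ, 0 < σ → σ ≤ 1 → a + σ • (x - a) ∈ S

/-- The image of `S` under the dilation with centre `a` and factor `s`. -/
def dilate (a : Pt n) (s : ℝ) (S : Set (Pt n)) : Set (Pt n) := {y | a + s⁻¹ • (y - a) ∈ S}

theorem measurableSet_dilate (hS : MeasurableSet S) (s : ℝ) : MeasurableSet (dilate a s S) :=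
  (by fun_prop : Continuous fun y : Pt n => a + s⁻¹ • (y - a)).measurable hS

theorem dilate_subset (hst : StarAt a S) {s : ℝ} (hs : 0 < s) (hs1 : s ≤ 1) : dilate a s S ⊆ S := by
  intro y hy
  have := hst _ hy s hs hs1
  rwa [add_sub_cancel_left, smul_smul, mul_inv_cancel₀ hs.ne', one_smul, add_sub_cancel] at this

theorem starAt_dilate (hst : StarAt a S) (s : ℝ) : StarAt a (dilate a s S) := by
  intro y hy σ hσ hσ1
  have := hst _ hy σ hσ hσ1
  change a + s⁻¹ • (a + σ • (y - a) - a) ∈ S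
  rw [add_sub_cancel_left] at this ⊢
  rwa [smul_comm]

theorem norm_sub_le_of_mem_dilate {s : ℝ} (hs : 0 < s) (hd : ∀ x ∈ S, ‖x - a‖ ≤ d) {y : Pt n}
    (hy : y ∈ dilate a s S) : ‖y - a‖ ≤ s * d := by
  have := hd _ hy
  rwa [add_sub_cancel_left, norm_smul, norm_inv, Real.norm_of_nonneg hs.le,
    inv_mul_le_iff₀ hs] at this

theorem integral_comp_dilation (f : Pt n → ℝ) (a : Pt n) {s : ℝ} (hs : 0 < s) :
    ∫ x, f (a + s • (x - a)) = (s ^ n)⁻¹ * ∫ y, f y := by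
  have h1 : ∫ x, f (a + s • (x - a)) = ∫ z, f (a + s • z) :=
    integral_sub_right_eq_self (fun z => f (a + s • z)) a
  have h2 := Measure.integral_comp_smul_of_nonneg volume (fun z : Pt n => f (a + z)) s (hR := hs.le)
  rw [h1, h2, finrank_euclideanSpace, Fintype.card_fin, smul_eq_mul,
    integral_add_left_eq_self f a]

theorem setIntegral_dilate (hS : MeasurableSet S) (f : Pt n → ℝ) {s : ℝ} (hs : 0 < s) :
    ∫ y in dilate a s S, f y = s ^ n * ∫ x in S, f (a + s • (x - a)) := by
  rw [← integral_indicator hS, ← integral_indicator (measurableSet_dilate hS s)]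
  have := integral_comp_dilation ((dilate a s S).indicator f) a hs
  rw [eq_inv_mul_iff_mul_eq₀ (by positivity)] at this
  rw [← this]
  congr 2
  funext x
  by_cases hx : x ∈ S
  · rw [indicator_of_mem hx, indicator_of_mem]
    change a + s⁻¹ • (a + s • (x - a) - a) ∈ S
    rwa [add_sub_cancel_left, smul_smul, inv_mul_cancel₀ hs.ne', one_smul, add_sub_cancel]
  · rw [indicator_of_notMem hx, indicator_of_notMem]
    change a + s⁻¹ • (a + s • (x - a) - a) ∉ S
    rwa [add_sub_cancel_left, smul_smul, inv_mul_cancel₀ hs.ne', one_smul, add_sub_cancel]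

/-- The change of variables costs s^(-n), and star-shapedness keeps the dilated set inside. In the
estimates below, powers of the path parameter have to compensate this loss. -/
theorem setIntegral_comp_dilation_le (hb : Bornology.IsBounded S) (hS : MeasurableSet S)
    (hst : StarAt a S) {f : Pt n → ℝ} (hf : Continuous f) (h0 : ∀ x, 0 ≤ f x) {s : ℝ} (hs : 0 < s)
    (hs1 : s ≤ 1) : ∫ x in S, f (a + s • (x - a)) ≤ (s ^ n)⁻¹ * ∫ x in S, f x := by
  have h1 := setIntegral_dilate (a := a) hS f hs
  rw [le_inv_mul_iff₀ (by positivity), ← h1]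
  exact setIntegral_mono_set (integrableOn_of_continuous hb hf) (Eventually.of_forall h0)
    (dilate_subset hst hs hs1).eventuallyLE

end PathIntegrals

/-! ### Taylor remainders and dilates for smooth functions. -/

section Smooth

variable {n : ℕ} {S : Set (Pt n)} {a : Pt n} {d : ℝ} {w : Pt n → ℝ}

/-- The square of the length of the gradient. -/
noncomputable def gradSq (w : Pt n → ℝ) (x : Pt n) : ℝ := ∑ b, partialDeriv ![b] w x ^ 2

/-- The square of the Frobenius norm of the Hessian. -/
noncomputable def hessSq (w : Pt n → ℝ) (x : Pt n) : ℝ :=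
  ∑ b, ∑ c, partialDeriv ![b, c] w x ^ 2

theorem gradSq_nonneg (w : Pt n → ℝ) (x : Pt n) : 0 ≤ gradSq w x :=
  Finset.sum_nonneg fun _ _ => sq_nonneg _

theorem hessSq_nonneg (w : Pt n → ℝ) (x : Pt n) : 0 ≤ hessSq w x :=
  Finset.sum_nonneg fun _ _ => Finset.sum_nonneg fun _ _ => sq_nonneg _

theorem continuous_gradSq (hw : ContDiff ℝ ∞ w) : Continuous (gradSq w) :=
  continuous_finsetSum _ fun _ _ => (contDiff_partialDeriv _ hw).continuous.pow 2

theorem continuous_hessSq (hw : ContDiff ℝ ∞ w) : Continuous (hessSq w) :=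
  continuous_finsetSum _ fun _ _ => continuous_finsetSum _ fun _ _ =>
    (contDiff_partialDeriv _ hw).continuous.pow 2

theorem sum_smul_basisVec (z : Pt n) : ∑ b, z b • basisVec b = z := by
  ext i; simp [Finset.sum_apply, Pi.single_apply, basisVec]

theorem linear_eq_sum (A : Pt n →L[ℝ] ℝ) (z : Pt n) : A z = ∑ b, z b * A (basisVec b) := by
  conv_lhs => rw [← sum_smul_basisVec z]
  simp [map_sum]

theorem sum_sq_eq_norm_sq (z : Pt n) : ∑ b, z b ^ 2 = ‖z‖ ^ 2 := (EuclideanSpace.real_norm_sq_eq z).symm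

theorem sq_fderiv_le (w : Pt n → ℝ) (x z : Pt n) :
    (fderiv ℝ w x z) ^ 2 ≤ ‖z‖ ^ 2 * gradSq w x := by
  rw [linear_eq_sum, ← sum_sq_eq_norm_sq, gradSq]
  simp only [partialDeriv_one]
  exact Finset.sum_mul_sq_le_sq_mul_sq _ _ _

theorem sq_hessian_le (w : Pt n → ℝ) (x z : Pt n) :
    (fderiv ℝ (fderiv ℝ w) x z z) ^ 2 ≤ ‖z‖ ^ 4 * hessSq w x := by
  have e : fderiv ℝ (fderiv ℝ w) x z z =
      ∑ b, z b * ∑ c, z c * fderiv ℝ (fderiv ℝ w) x (basisVec b) (basisVec c) := by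
    have h1 := linear_eq_sum ((fderiv ℝ (fderiv ℝ w) x).flip z) z
    simp only [ContinuousLinearMap.flip_apply] at h1
    rw [h1]
    exact Finset.sum_congr rfl fun b _ => by rw [linear_eq_sum _ z]
  rw [e, hessSq]
  simp only [partialDeriv_two]
  refine (Finset.sum_mul_sq_le_sq_mul_sq _ _ _).trans ?_
  rw [sum_sq_eq_norm_sq, show ‖z‖ ^ 4 = ‖z‖ ^ 2 * ‖z‖ ^ 2 by ring, mul_assoc]
  refine mul_le_mul_of_nonneg_left ?_ (sq_nonneg _)
  rw [Finset.mul_sum]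
  refine Finset.sum_le_sum fun b _ => ?_
  rw [← sum_sq_eq_norm_sq]
  exact Finset.sum_mul_sq_le_sq_mul_sq _ _ _

/-- Taylor's formula at `x`, evaluated at the centre `a` of a star-shaped set. -/
theorem taylor_remainder_eq (hw : ContDiff ℝ ∞ w) (a x : Pt n) :
    ∫ σ in (0 : ℝ)..1, 2 * σ ^ 3 * fderiv ℝ (fderiv ℝ w) (a + σ ^ 2 • (x - a)) (x - a) (x - a) =
      w a - w x - fderiv ℝ w x (a - x) := by
  set z := x - a with hz
  have hw1 : ContDiff ℝ 2 w := contDiff_infty.1 hw 2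
  have hd : Differentiable ℝ w := hw1.differentiable (by norm_num)
  have hd2 : Differentiable ℝ (fderiv ℝ w) :=
    (hw1.fderiv_right (m := 1) (by norm_num)).differentiable (by norm_num)
  have hc2 : Continuous (fderiv ℝ (fderiv ℝ w)) :=
    (hw1.fderiv_right (m := 1) (by norm_num)).continuous_fderiv (by norm_num)
  -- The quadratic parametrisation raises the weight to σ³. Its square σ⁶ beats the loss σ^(-2n) of
  -- the dilation for n ≤ 3; with the parameter σ itself, σ² would not suffice against σ^(-3).
  have hp : ∀ σ : ℝ, HasDerivAt (fun σ : ℝ => a + σ ^ 2 • z) ((2 * σ) • z) σ := fun σ => by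
    have := ((hasDerivAt_pow 2 σ).smul_const z).const_add a
    simpa using this
  have h1 : ∀ σ : ℝ, HasDerivAt (fun σ : ℝ => w (a + σ ^ 2 • z))
      (fderiv ℝ w (a + σ ^ 2 • z) ((2 * σ) • z)) σ := fun σ =>
    (hd (a + σ ^ 2 • z)).hasFDerivAt.comp_hasDerivAt σ (hp σ)
  have h2 : ∀ σ : ℝ, HasDerivAt (fun σ : ℝ => fderiv ℝ w (a + σ ^ 2 • z) z)
      (fderiv ℝ (fderiv ℝ w) (a + σ ^ 2 • z) ((2 * σ) • z) z) σ := fun σ => by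
    have := (hd2 (a + σ ^ 2 • z)).hasFDerivAt.comp_hasDerivAt σ (hp σ)
    exact this.clm_apply (hasDerivAt_const σ z) |>.congr_deriv (by simp)
  have h3 : ∀ σ : ℝ, HasDerivAt
      (fun σ : ℝ => σ ^ 2 * fderiv ℝ w (a + σ ^ 2 • z) z - w (a + σ ^ 2 • z))
      (2 * σ ^ 3 * fderiv ℝ (fderiv ℝ w) (a + σ ^ 2 • z) z z) σ := fun σ => by
    refine (((hasDerivAt_pow 2 σ).mul (h2 σ)).sub (h1 σ)).congr_deriv ?_
    simp only [map_smul, _root_.smul_apply, smul_eq_mul]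
    ring
  rw [intervalIntegral.integral_eq_sub_of_hasDerivAt (fun σ _ => h3 σ)]
  · have e1 : a + (1 : ℝ) ^ 2 • z = x := by rw [hz]; simp
    have e2 : fderiv ℝ w x (a - x) = - fderiv ℝ w x z := by rw [hz, ← map_neg, neg_sub]
    rw [e1, e2]
    simp
    ring
  · exact (Continuous.mul (by fun_prop) (((hc2.comp (by fun_prop)).clm_apply
      continuous_const).clm_apply continuous_const)).intervalIntegrable _ _

/-- The `L²` bound of the Taylor remainder on a star-shaped set, in at most three dimensions. -/
theorem integral_sq_taylor_le (hn : n ≤ 3) (hb : Bornology.IsBounded S) (hS : MeasurableSet S)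
    (hst : StarAt a S) (hd : ∀ x ∈ S, ‖x - a‖ ≤ d) (hw : ContDiff ℝ ∞ w) :
    ∫ x in S, (w a - w x - fderiv ℝ w x (a - x)) ^ 2 ≤ 4 * d ^ 4 * ∫ x in S, hessSq w x := by
  have hw1 : ContDiff ℝ 2 w := contDiff_infty.1 hw 2
  have hc2 : Continuous (fderiv ℝ (fderiv ℝ w)) :=
    (hw1.fderiv_right (m := 1) (by norm_num)).continuous_fderiv (by norm_num)
  have hcF : Continuous (fun z : ℝ × Pt n =>
      2 * z.1 ^ 3 * fderiv ℝ (fderiv ℝ w) (a + z.1 ^ 2 • (z.2 - a)) (z.2 - a) (z.2 - a)) := by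
    refine Continuous.mul (by fun_prop) (((hc2.comp ?_).clm_apply ?_).clm_apply ?_) <;> fun_prop
  have := integral_sq_path_le hb (F := fun σ x =>
    2 * σ ^ 3 * fderiv ℝ (fderiv ℝ w) (a + σ ^ 2 • (x - a)) (x - a) (x - a)) hcF
    (α := 0) (β := 1) zero_le_one (A := 4 * d ^ 4 * ∫ x in S, hessSq w x) ?_
  · simpa only [taylor_remainder_eq hw, sub_zero, one_pow, one_mul] using this
  intro σ hσ
  have hcH := continuous_hessSq hw
  have hcH' : Continuous fun x : Pt n => hessSq w (a + σ ^ 2 • (x - a)) := hcH.comp (by fun_prop)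
  calc _ ≤ ∫ x in S, 4 * σ ^ 6 * d ^ 4 * hessSq w (a + σ ^ 2 • (x - a)) := by
        refine setIntegral_mono_on (integrableOn_of_continuous hb ?_)
          ((integrableOn_of_continuous hb hcH').const_mul _) hS fun x hx => ?_
        · exact (hcF.comp (by fun_prop : Continuous fun x : Pt n => (σ, x))).pow 2
        · have h1 := sq_hessian_le w (a + σ ^ 2 • (x - a)) (x - a)
          have h2 : ‖x - a‖ ^ 4 ≤ d ^ 4 := pow_le_pow_left₀ (norm_nonneg _) (hd x hx) 4
          have h3 := mul_le_mul_of_nonneg_right h2 (hessSq_nonneg w (a + σ ^ 2 • (x - a)))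
          have h4 : 0 ≤ 4 * σ ^ 6 := by positivity
          nlinarith [mul_le_mul_of_nonneg_left (h1.trans h3) h4]
    _ = 4 * σ ^ 6 * d ^ 4 * ∫ x in S, hessSq w (a + σ ^ 2 • (x - a)) := integral_const_mul _ _
    _ ≤ 4 * σ ^ 6 * d ^ 4 * (((σ ^ 2) ^ n)⁻¹ * ∫ x in S, hessSq w x) := by
        refine mul_le_mul_of_nonneg_left ?_ (by positivity)
        exact setIntegral_comp_dilation_le hb hS hst hcH (hessSq_nonneg w) (pow_pos hσ.1 2)
          (pow_le_one₀ hσ.1.le hσ.2)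
    -- The bracket is σ^(6-2n), at most 1 because n ≤ 3.
    _ = (σ ^ 6 * ((σ ^ 2) ^ n)⁻¹) * (4 * d ^ 4 * ∫ x in S, hessSq w x) := by ring
    _ ≤ 1 * _ := by
        refine mul_le_mul_of_nonneg_right ?_
          (mul_nonneg (by positivity) (integral_nonneg fun x => hessSq_nonneg w x))
        rw [← pow_mul, ← div_eq_mul_inv, div_le_one (pow_pos hσ.1 _)]
        exact pow_le_pow_of_le_one hσ.1.le hσ.2 (by omega)
    _ = _ := one_mul _

/-- The `L²` norm on a small dilate, in at most three dimensions. -/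
theorem integral_sq_dilate_le (hn : n ≤ 3) (hb : Bornology.IsBounded S) (hS : MeasurableSet S)
    (hst : StarAt a S) (hd : ∀ x ∈ S, ‖x - a‖ ≤ d) (hw : ContDiff ℝ ∞ w) {s : ℝ} (hs : 0 < s)
    (hs1 : s ≤ 1) :
    s ^ 2 * ∫ x in dilate a s S, w x ^ 2 ≤ s ^ n * Real.sqrt s *
      (2 * (∫ x in S, w x ^ 2) + 32 * d ^ 2 * ∫ x in S, gradSq w x) := by
  -- The path x ↦ a + σ⁴(x - a) runs from factor s = θ⁴ to 1. Squared derivative and dilation loss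
  -- give σ⁶σ^(-4n) ≤ θ^(-6), and multiplication by s² = θ⁸ leaves θ² = √s.
  set θ := Real.sqrt (Real.sqrt s) with hθdef
  have hθ : 0 < θ := Real.sqrt_pos.2 (Real.sqrt_pos.2 hs)
  have hθ2 : θ ^ 2 = Real.sqrt s := Real.sq_sqrt (Real.sqrt_nonneg _)
  have hθ4 : θ ^ 4 = s := by
    rw [show θ ^ 4 = (θ ^ 2) ^ 2 by ring, hθ2, Real.sq_sqrt hs.le]
  have hθ1 : θ ≤ 1 := by
    rw [hθdef, Real.sqrt_le_one, Real.sqrt_le_one]; exact hs1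
  have hd1 : Differentiable ℝ w := hw.differentiable (by simp)
  have hc1 : Continuous (fderiv ℝ w) := hw.continuous_fderiv (by simp)
  have hcF : Continuous (fun z : ℝ × Pt n =>
      4 * z.1 ^ 3 * fderiv ℝ w (a + z.1 ^ 4 • (z.2 - a)) (z.2 - a)) := by
    refine Continuous.mul (by fun_prop) ((hc1.comp ?_).clm_apply ?_) <;> fun_prop
  have hftc : ∀ x, ∫ σ in θ..1, 4 * σ ^ 3 * fderiv ℝ w (a + σ ^ 4 • (x - a)) (x - a) =
      w x - w (a + s • (x - a)) := by
    intro x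
    have hp : ∀ σ : ℝ, HasDerivAt (fun σ : ℝ => a + σ ^ 4 • (x - a)) ((4 * σ ^ 3) • (x - a)) σ :=
      fun σ => by
        have := ((hasDerivAt_pow 4 σ).smul_const (x - a)).const_add a
        simpa using this
    have h1 : ∀ σ : ℝ, HasDerivAt (fun σ : ℝ => w (a + σ ^ 4 • (x - a)))
        (4 * σ ^ 3 * fderiv ℝ w (a + σ ^ 4 • (x - a)) (x - a)) σ := fun σ => by
      refine ((hd1 (a + σ ^ 4 • (x - a))).hasFDerivAt.comp_hasDerivAt σ (hp σ)).congr_deriv ?_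
      rw [map_smul, smul_eq_mul]
    rw [intervalIntegral.integral_eq_sub_of_hasDerivAt (fun σ _ => h1 σ)]
    · rw [hθ4]; simp
    · exact (hcF.comp (by fun_prop : Continuous fun σ : ℝ => (σ, x))).intervalIntegrable _ _
  have hG0 : 0 ≤ ∫ x in S, gradSq w x := integral_nonneg fun x => gradSq_nonneg w x
  have hpath := integral_sq_path_le hb
    (F := fun σ x => 4 * σ ^ 3 * fderiv ℝ w (a + σ ^ 4 • (x - a)) (x - a)) hcF hθ1
    (A := 16 * d ^ 2 * (θ ^ 6)⁻¹ * ∫ x in S, gradSq w x) ?_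
  rotate_left
  · intro σ hσ
    have hσ0 : 0 < σ := hθ.trans hσ.1
    have hcG := continuous_gradSq hw
    have hcG' : Continuous fun x : Pt n => gradSq w (a + σ ^ 4 • (x - a)) := hcG.comp (by fun_prop)
    calc _ ≤ ∫ x in S, 16 * σ ^ 6 * d ^ 2 * gradSq w (a + σ ^ 4 • (x - a)) := by
          refine setIntegral_mono_on (integrableOn_of_continuous hb ?_)
            ((integrableOn_of_continuous hb hcG').const_mul _) hS fun x hx => ?_
          · exact (hcF.comp (by fun_prop : Continuous fun x : Pt n => (σ, x))).pow 2
          · have h1 := sq_fderiv_le w (a + σ ^ 4 • (x - a)) (x - a)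
            have h2 : ‖x - a‖ ^ 2 ≤ d ^ 2 := pow_le_pow_left₀ (norm_nonneg _) (hd x hx) 2
            have h3 := mul_le_mul_of_nonneg_right h2 (gradSq_nonneg w (a + σ ^ 4 • (x - a)))
            have h4 : 0 ≤ 16 * σ ^ 6 := by positivity
            nlinarith [mul_le_mul_of_nonneg_left (h1.trans h3) h4]
      _ = 16 * σ ^ 6 * d ^ 2 * ∫ x in S, gradSq w (a + σ ^ 4 • (x - a)) := integral_const_mul _ _
      _ ≤ 16 * σ ^ 6 * d ^ 2 * (((σ ^ 4) ^ n)⁻¹ * ∫ x in S, gradSq w x) := by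
          refine mul_le_mul_of_nonneg_left ?_ (by positivity)
          exact setIntegral_comp_dilation_le hb hS hst hcG (gradSq_nonneg w) (pow_pos hσ0 4)
            (pow_le_one₀ hσ0.le hσ.2)
      _ = (σ ^ 6 * ((σ ^ 4) ^ n)⁻¹) * (16 * d ^ 2 * ∫ x in S, gradSq w x) := by ring
      _ ≤ (θ ^ 6)⁻¹ * (16 * d ^ 2 * ∫ x in S, gradSq w x) := by
          refine mul_le_mul_of_nonneg_right ?_ (by positivity)
          rw [← pow_mul, ← div_eq_mul_inv, div_le_iff₀ (by positivity), inv_mul_eq_div,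
            le_div_iff₀ (by positivity)]
          calc σ ^ 6 * θ ^ 6 ≤ σ ^ 6 * σ ^ 6 := by
                gcongr; exact hσ.1.le
            _ = σ ^ 12 := by ring
            _ ≤ σ ^ (4 * n) := pow_le_pow_of_le_one hσ0.le hσ.2 (by omega)
      _ = _ := by ring
  simp only [hftc] at hpath
  have hcs : Continuous fun x : Pt n => w (a + s • (x - a)) := hw.continuous.comp (by fun_prop)
  have hkey : ∫ x in S, w (a + s • (x - a)) ^ 2 ≤ 2 * (∫ x in S, w x ^ 2) +
      2 * (16 * d ^ 2 * (θ ^ 6)⁻¹ * ∫ x in S, gradSq w x) := by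
    have h1 := integral_add_sq_le (μ := volume.restrict S) (f := w)
      (g := fun x => -(w x - w (a + s • (x - a))))
      (memLp_two_of_contDiff_of_bounded hb hw.continuous)
      (memLp_two_of_contDiff_of_bounded hb (hw.continuous.sub hcs).neg)
    have e : ∀ x, w x + -(w x - w (a + s • (x - a))) = w (a + s • (x - a)) := fun x => by ring
    simp only [e, neg_sq] at h1
    have h2 : (1 - θ) ^ 2 ≤ 1 := pow_le_one₀ (by linarith) (by linarith)
    have h3 := hpath.trans (mul_le_of_le_one_left (by positivity) h2)
    linarith
  rw [setIntegral_dilate hS _ hs]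
  have hW : 0 ≤ ∫ x in S, w x ^ 2 := integral_nonneg fun x => sq_nonneg _
  have e8 : s ^ 2 = θ ^ 8 := by rw [← hθ4]; ring
  calc s ^ 2 * (s ^ n * ∫ x in S, w (a + s • (x - a)) ^ 2)
      ≤ s ^ 2 * (s ^ n * (2 * (∫ x in S, w x ^ 2) +
        2 * (16 * d ^ 2 * (θ ^ 6)⁻¹ * ∫ x in S, gradSq w x))) := by gcongr
    _ = s ^ n * (θ ^ 2 * (θ ^ 6 * (2 * ∫ x in S, w x ^ 2) +
          32 * d ^ 2 * ∫ x in S, gradSq w x)) := by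
        rw [e8]; field_simp; ring
    _ ≤ s ^ n * (θ ^ 2 * (1 * (2 * ∫ x in S, w x ^ 2) + 32 * d ^ 2 * ∫ x in S, gradSq w x)) := by
        gcongr
        exact pow_le_one₀ hθ.le hθ1
    _ = _ := by rw [hθ2]; ring

end Smooth

/-! ### Nodal values of H² functions on one simplex. -/

section NodalValues

variable {n : ℕ} {S : Set (Pt n)} {a : Pt n} {d : ℝ} {w : Pt n → ℝ}

theorem tendstoL2_const_fun {X : Type*} [MeasurableSpace X] {μ : Measure X} [IsFiniteMeasure μ]
    {c : ℕ → ℝ} {c' : ℝ} (h : Tendsto c atTop (𝓝 c')) :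
    TendstoL2 μ (fun j (_ : X) => c j) (fun _ => c') := by
  refine ⟨fun j => memLp_const _, memLp_const _, ?_⟩
  simp only [integral_const, smul_eq_mul]
  have : Tendsto (fun j => μ.real univ * (c j - c') ^ 2) atTop (𝓝 (μ.real univ * (c' - c') ^ 2)) :=
    ((h.sub_const c').pow 2).const_mul _
  simpa using this

theorem gradSq_partialDeriv_le (hw : ContDiff ℝ ∞ w) (b : Fin n) (x : Pt n) :
    gradSq (partialDeriv ![b] w) x ≤ hessSq w x := by
  unfold gradSq hessSq
  refine Finset.sum_le_sum fun c _ => ?_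
  have e : partialDeriv ![c] (partialDeriv ![b] w) x = partialDeriv ![c, b] w x := by
    rw [partialDeriv_succ ![c, b] hw, partialDeriv_one]; rfl
  rw [e]
  exact Finset.single_le_sum (f := fun b => partialDeriv ![c, b] w x ^ 2)
    (fun _ _ => sq_nonneg _) (Finset.mem_univ b)

theorem dilate_one (a : Pt n) (S : Set (Pt n)) : dilate a 1 S = S := by
  ext y; simp [dilate]

theorem integral_sq_partialDeriv_dilate_le (hn : n ≤ 3) (hb : Bornology.IsBounded S)
    (hS : MeasurableSet S) (hst : StarAt a S) (hd : ∀ x ∈ S, ‖x - a‖ ≤ d) (hw : ContDiff ℝ ∞ w)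
    {A : ℝ} (hA1 : ∫ x in S, gradSq w x ≤ A) (hA2 : ∫ x in S, hessSq w x ≤ A)
    {s : ℝ} (hs : 0 < s) (hs1 : s ≤ 1) (b : Fin n) :
    s ^ 2 * ∫ x in dilate a s S, partialDeriv ![b] w x ^ 2 ≤
      (2 + 32 * d ^ 2) * A * (s ^ n * Real.sqrt s) := by
  have hwb := contDiff_partialDeriv ![b] hw
  refine (integral_sq_dilate_le hn hb hS hst hd hwb hs hs1).trans ?_
  have h1 : ∫ x in S, partialDeriv ![b] w x ^ 2 ≤ A := le_trans
    (integral_mono (integrableOn_of_continuous hb (hwb.continuous.pow 2))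
      (integrableOn_of_continuous hb (continuous_gradSq hw)) fun x =>
      Finset.single_le_sum (f := fun b => partialDeriv ![b] w x ^ 2)
        (fun _ _ => sq_nonneg _) (Finset.mem_univ b)) hA1
  have h2 : ∫ x in S, gradSq (partialDeriv ![b] w) x ≤ A := le_trans
    (integral_mono (integrableOn_of_continuous hb (continuous_gradSq hwb))
      (integrableOn_of_continuous hb (continuous_hessSq hw)) fun x =>
      gradSq_partialDeriv_le hw b x) hA2
  have h3 : 0 ≤ s ^ n * Real.sqrt s := by positivity
  calc _ ≤ s ^ n * Real.sqrt s * (2 * A + 32 * d ^ 2 * A) := by gcongr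
    _ = _ := by ring

/-- Taylor's formula on the dilate, of radius sd, contributes s⁴ ≤ s^n √s, and the linear term is
controlled by the gradient bound on dilates. Relative to the volume s^n the deviation from w(a)
tends to 0, with a constant depending on `w` only through the H² bound `A`, so the estimate survives
L² limits. -/
theorem integral_sq_sub_dilate_le (hn : n ≤ 3) (hb : Bornology.IsBounded S)
    (hS : MeasurableSet S) (hst : StarAt a S) (hd : ∀ x ∈ S, ‖x - a‖ ≤ d) (hw : ContDiff ℝ ∞ w)
    {A : ℝ} (hA1 : ∫ x in S, gradSq w x ≤ A) (hA2 : ∫ x in S, hessSq w x ≤ A)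
    {s : ℝ} (hs : 0 < s) (hs1 : s ≤ 1) :
    ∫ x in dilate a s S, (w x - w a) ^ 2 ≤
      (8 * d ^ 4 + 2 * d ^ 2 * (n * (2 + 32 * d ^ 2))) * A * (s ^ n * Real.sqrt s) := by
  have hc1 : Continuous (fderiv ℝ w) := hw.continuous_fderiv (by simp)
  have hsub := dilate_subset hst hs hs1
  have hbD : Bornology.IsBounded (dilate a s S) := hb.subset hsub
  have hmD := measurableSet_dilate (a := a) hS s
  have hA0 : 0 ≤ A := (integral_nonneg fun x => hessSq_nonneg w x).trans hA2
  have hdD : ∀ y ∈ dilate a s S, ‖y - a‖ ≤ s * d := fun y hy => norm_sub_le_of_mem_dilate hs hd hy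
  have hcD : Continuous fun x => fderiv ℝ w x (a - x) := hc1.clm_apply (by fun_prop)
  have hss : s ≤ Real.sqrt s := by
    conv_lhs => rw [← Real.sq_sqrt hs.le]
    exact pow_le_of_le_one (Real.sqrt_nonneg _) (Real.sqrt_le_one.2 hs1) (by norm_num)
  have h1 := integral_sq_taylor_le hn hbD hmD (starAt_dilate hst s) hdD hw
  have h2 : ∫ x in dilate a s S, hessSq w x ≤ A :=
    (setIntegral_mono_set (integrableOn_of_continuous hb (continuous_hessSq hw))
      (Eventually.of_forall (hessSq_nonneg w)) hsub.eventuallyLE).trans hA2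
  have h3 : ∫ x in dilate a s S, (fderiv ℝ w x (a - x)) ^ 2 ≤
      d ^ 2 * (n * ((2 + 32 * d ^ 2) * A * (s ^ n * Real.sqrt s))) := by
    calc _ ≤ ∫ x in dilate a s S, (s * d) ^ 2 * gradSq w x := by
          refine setIntegral_mono_on (integrableOn_of_continuous hbD (hcD.pow 2))
            ((integrableOn_of_continuous hbD (continuous_gradSq hw)).const_mul _) hmD fun x hx => ?_
          refine (sq_fderiv_le w x _).trans ?_
          rw [norm_sub_rev]
          exact mul_le_mul_of_nonneg_right (pow_le_pow_left₀ (norm_nonneg _) (hdD x hx) 2)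
            (gradSq_nonneg w x)
      _ = d ^ 2 * ∑ b, s ^ 2 * ∫ x in dilate a s S, partialDeriv ![b] w x ^ 2 := by
          rw [integral_const_mul, ← Finset.mul_sum, ← integral_finsetSum]
          · unfold gradSq; ring
          · exact fun b _ => integrableOn_of_continuous hbD
              ((contDiff_partialDeriv _ hw).continuous.pow 2)
      _ ≤ d ^ 2 * ∑ b : Fin n, (2 + 32 * d ^ 2) * A * (s ^ n * Real.sqrt s) := by
          refine mul_le_mul_of_nonneg_left (Finset.sum_le_sum fun b _ => ?_) (sq_nonneg _)
          exact integral_sq_partialDeriv_dilate_le hn hb hS hst hd hw hA1 hA2 hs hs1 b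
      _ = _ := by simp
  have h4 := integral_add_sq_le (μ := volume.restrict (dilate a s S))
    (f := fun x => w a - w x - fderiv ℝ w x (a - x)) (g := fun x => fderiv ℝ w x (a - x))
    (memLp_two_of_contDiff_of_bounded hbD
      ((continuous_const.sub hw.continuous).sub hcD))
    (memLp_two_of_contDiff_of_bounded hbD hcD)
  have e : ∀ x, (w a - w x - fderiv ℝ w x (a - x) + fderiv ℝ w x (a - x)) ^ 2 = (w x - w a) ^ 2 :=
    fun x => by ring
  simp only [e] at h4
  have h5 : (s * d) ^ 4 * ∫ x in dilate a s S, hessSq w x ≤ d ^ 4 * A * (s ^ n * Real.sqrt s) := by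
    calc _ ≤ (s * d) ^ 4 * A := by gcongr
      _ = d ^ 4 * A * (s ^ 3 * s) := by ring
      _ ≤ d ^ 4 * A * (s ^ n * Real.sqrt s) := by
          have := pow_le_pow_of_le_one hs.le hs1 hn
          gcongr
  calc _ ≤ _ := h4
    _ ≤ 2 * (4 * (d ^ 4 * A * (s ^ n * Real.sqrt s))) +
        2 * (d ^ 2 * (n * ((2 + 32 * d ^ 2) * A * (s ^ n * Real.sqrt s)))) := by
        linarith
    _ = _ := by ring

theorem starAt_openHull {t : Simp n} (h : AffineIndependent ℝ t) (k : Fin (n + 1)) :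
    StarAt (t k) (openHull t) := by
  intro x hx σ hσ hσ1
  rw [mem_openHull_iff h] at hx ⊢
  intro l
  have e : bary t l (t k + σ • (x - t k)) = (1 - σ) * bary t l (t k) + σ * bary t l x := by
    rw [bary_add h, map_smul, smul_eq_mul, ← bary_sub h]; ring
  rw [e, bary_vertex h]
  have := mul_pos hσ (hx l)
  split_ifs <;> nlinarith

theorem norm_sub_vertex_le {t : Simp n} {d : ℝ} (hd : ∀ k l, ‖t k - t l‖ ≤ d)
    (k : Fin (n + 1)) {x : Pt n} (hx : x ∈ hull t) : ‖x - t k‖ ≤ d := by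
  have : hull t ⊆ Metric.closedBall (t k) d := by
    refine convexHull_min ?_ (convex_closedBall _ _)
    rintro _ ⟨l, rfl⟩
    simpa [dist_eq_norm] using hd l k
  simpa [dist_eq_norm] using this hx

/-- The gradient of the nodal interpolant of a smooth function on a simplex. -/
theorem integral_sq_grad_interpolation_le (hn : n ≤ 3) {t : Simp n} (h : AffineIndependent ℝ t)
    {d G : ℝ} (hd : ∀ k l, ‖t k - t l‖ ≤ d) (hG : ∀ k y, |baryLin t k y| ≤ G * ‖y‖)
    (hw : ContDiff ℝ ∞ w) (b : Fin n) :
    ∫ x in openHull t, (partialDeriv ![b] w x - ∑ k, w (t k) * baryLin t k (basisVec b)) ^ 2 ≤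
      4 * (n + 1) ^ 2 * (G ^ 2 * d ^ 4) * ∫ x in openHull t, hessSq w x := by
  have hb : Bornology.IsBounded (openHull t) := (isCompact_hull t).isBounded.subset (openHull_subset_hull t)
  have hc1 : Continuous (fderiv ℝ w) := hw.continuous_fderiv (by simp)
  set R : Fin (n + 1) → Pt n → ℝ := fun k x => w (t k) - w x - fderiv ℝ w x (t k - x) with hR
  have hRc : ∀ k, Continuous (R k) := fun k =>
    (continuous_const.sub hw.continuous).sub (hc1.clm_apply (by fun_prop))
  -- Interpolation reproduces affine functions: after subtracting the Taylor polynomial of `w` at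
  -- `x`, only the remainders at the vertices are left.
  have hid : ∀ x, ∑ k, w (t k) * baryLin t k (basisVec b) - partialDeriv ![b] w x =
      ∑ k, R k x * baryLin t k (basisVec b) := by
    intro x
    have e1 : fderiv ℝ w x (basisVec b) = ∑ k, baryLin t k (basisVec b) * fderiv ℝ w x (t k) := by
      conv_lhs => rw [← sum_baryLin_smul h (basisVec b)]
      simp [map_sum]
    have e2 := sum_baryLin h (basisVec b)
    have e3 : ∑ k, R k x * baryLin t k (basisVec b) = ∑ k, w (t k) * baryLin t k (basisVec b) -
        ∑ k, baryLin t k (basisVec b) * fderiv ℝ w x (t k) -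
        (w x - fderiv ℝ w x x) * ∑ k, baryLin t k (basisVec b) := by
      rw [Finset.mul_sum, ← Finset.sum_sub_distrib, ← Finset.sum_sub_distrib]
      refine Finset.sum_congr rfl fun k _ => ?_
      simp only [hR, map_sub]; ring
    rw [e3, e2, partialDeriv_one, e1]; ring
  have hGb : ∀ k, baryLin t k (basisVec b) ^ 2 ≤ G ^ 2 := fun k => by
    have := hG k (basisVec b)
    simp only [basisVec, PiLp.norm_single, norm_one, mul_one] at this
    exact sq_le_sq' (abs_le.1 this).1 (abs_le.1 this).2
  calc _ ≤ ∫ x in openHull t, (n + 1) * G ^ 2 * ∑ k, R k x ^ 2 := by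
        refine integral_mono (integrableOn_of_continuous hb
          (((contDiff_partialDeriv _ hw).continuous.sub continuous_const).pow 2))
          (integrableOn_of_continuous hb (continuous_const.mul
            (continuous_finsetSum _ fun k _ => (hRc k).pow 2))) fun x => ?_
        simp only
        rw [← neg_sub, neg_sq, hid]
        calc _ ≤ (Finset.univ : Finset (Fin (n + 1))).card *
              ∑ k, (R k x * baryLin t k (basisVec b)) ^ 2 := sq_sum_le_card_mul_sum_sq
          _ ≤ (n + 1) * ∑ k, R k x ^ 2 * G ^ 2 := by
              rw [Finset.card_univ, Fintype.card_fin]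
              push_cast
              refine mul_le_mul_of_nonneg_left (Finset.sum_le_sum fun k _ => ?_) (by positivity)
              rw [mul_pow]
              exact mul_le_mul_of_nonneg_left (hGb k) (sq_nonneg _)
          _ = _ := by rw [← Finset.sum_mul]; ring
    _ = (n + 1) * G ^ 2 * ∑ k, ∫ x in openHull t, R k x ^ 2 := by
        rw [integral_const_mul, integral_finsetSum]
        exact fun k _ => integrableOn_of_continuous hb ((hRc k).pow 2)
    _ ≤ (n + 1) * G ^ 2 * ∑ k : Fin (n + 1), 4 * d ^ 4 * ∫ x in openHull t, hessSq w x := by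
        refine mul_le_mul_of_nonneg_left (Finset.sum_le_sum fun k _ => ?_) (by positivity)
        exact integral_sq_taylor_le hn hb (isOpen_openHull t).measurableSet (starAt_openHull h k)
          (fun x hx => norm_sub_vertex_le hd k (openHull_subset_hull t hx)) hw
    _ = _ := by
        rw [Finset.sum_const, Finset.card_univ, Fintype.card_fin, nsmul_eq_mul]; push_cast; ring

/-- The nodal values of an `H²` function on a simplex: they approximate the function near the
vertices, and determine an interpolant. -/
theorem exists_nodal_values (hn : n ≤ 3) {t : Simp n} (h : AffineIndependent ℝ t)
    {d G : ℝ} (hd : ∀ k l, ‖t k - t l‖ ≤ d) (hG : ∀ k y, |baryLin t k y| ≤ G * ‖y‖)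
    {u : Pt n → ℝ} {g : Fin n → Pt n → ℝ} {H : Fin n → Fin n → Pt n → ℝ}
    (hu : MemLp u 2 (volume.restrict (openHull t)))
    (hg : ∀ b, HasWeakDeriv (openHull t) ![b] u (g b))
    (hgL : ∀ b, MemLp (g b) 2 (volume.restrict (openHull t)))
    (hH : ∀ b c, HasWeakDeriv (openHull t) ![b, c] u (H b c))
    (hHL : ∀ b c, MemLp (H b c) 2 (volume.restrict (openHull t))) :
    ∃ U : Fin (n + 1) → ℝ,
      (∀ b, ∫ x in openHull t, (g b x - ∑ k, U k * baryLin t k (basisVec b)) ^ 2 ≤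
        4 * (n + 1) ^ 2 * (G ^ 2 * d ^ 4) * ∑ b, ∑ c, ∫ x in openHull t, H b c x ^ 2) ∧
      ∀ k, ∃ C, ∀ s, 0 < s → s ≤ 1 →
        (∫ x in dilate (t k) s (openHull t), (u x - U k) ^ 2 ≤ C * (s ^ n * Real.sqrt s)) ∧
        ∀ b, s ^ 2 * ∫ x in dilate (t k) s (openHull t), g b x ^ 2 ≤
          C * (s ^ n * Real.sqrt s) := by
  set S := openHull t with hS
  have hSm : MeasurableSet S := (isOpen_openHull t).measurableSet
  have hb : Bornology.IsBounded S := (isCompact_hull t).isBounded.subset (openHull_subset_hull t)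
  have hfin : IsFiniteMeasure (volume.restrict S) := ⟨by simpa using hb.measure_lt_top⟩
  have hdS : ∀ k, ∀ x ∈ S, ‖x - t k‖ ≤ d := fun k x hx =>
    norm_sub_vertex_le hd k (openHull_subset_hull t hx)
  have hne := openHull_nonempty h
  obtain ⟨w, hw, hwlim, -, -⟩ := exists_smooth_approx (isOpen_openHull t) (convex_openHull t) hb hne hu
  have L0 : TendstoL2 (volume.restrict S) w u := by
    refine ⟨fun j => memLp_two_of_contDiff_of_bounded hb (hw j).continuous, hu, ?_⟩
    have := hwlim 0 ![] u (hasWeakDeriv_of_order_zero _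
      (locallyIntegrableOn_of_locallyIntegrable_restrict (hu.locallyIntegrable (by norm_num)))) hu
    simpa only [partialDeriv_zero] using this
  have L1 : ∀ b, TendstoL2 (volume.restrict S) (fun j => partialDeriv ![b] (w j)) (g b) := fun b =>
    ⟨fun j => memLp_two_of_contDiff_of_bounded hb (contDiff_partialDeriv _ (hw j)).continuous,
      hgL b, hwlim 1 _ _ (hg b) (hgL b)⟩
  have L2 : ∀ b c, TendstoL2 (volume.restrict S) (fun j => partialDeriv ![b, c] (w j)) (H b c) :=
    fun b c => ⟨fun j => memLp_two_of_contDiff_of_bounded hb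
      (contDiff_partialDeriv _ (hw j)).continuous, hHL b c, hwlim 2 _ _ (hH b c) (hHL b c)⟩
  have T1 : Tendsto (fun j => ∫ x in S, gradSq (w j) x) atTop (𝓝 (∑ b, ∫ x in S, g b x ^ 2)) := by
    have := tendsto_finsetSum Finset.univ fun b _ => (L1 b).integral_sq
    refine this.congr fun j => ?_
    unfold gradSq
    rw [integral_finsetSum]
    exact fun b _ => integrableOn_of_continuous hb ((contDiff_partialDeriv _ (hw j)).continuous.pow 2)
  have T2 : Tendsto (fun j => ∫ x in S, hessSq (w j) x) atTop
      (𝓝 (∑ b, ∑ c, ∫ x in S, H b c x ^ 2)) := by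
    have := tendsto_finsetSum Finset.univ fun b _ =>
      tendsto_finsetSum Finset.univ fun c _ => (L2 b c).integral_sq
    refine this.congr fun j => ?_
    have hi : ∀ b c, IntegrableOn (fun x => partialDeriv ![b, c] (w j) x ^ 2) S := fun b c =>
      integrableOn_of_continuous hb ((contDiff_partialDeriv _ (hw j)).continuous.pow 2)
    unfold hessSq
    rw [integral_finsetSum _ fun b _ => integrable_finsetSum _ fun c _ => hi b c]
    exact Finset.sum_congr rfl fun b _ => (integral_finsetSum _ fun c _ => hi b c).symm
  obtain ⟨A0, hA0⟩ := L0.integral_sq.bddAbove_range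
  obtain ⟨A1, hA1⟩ := T1.bddAbove_range
  obtain ⟨A2, hA2⟩ := T2.bddAbove_range
  -- Convergent sequences of norms are bounded, so all approximations share one bound and hence the
  -- constants of the dilate estimates.
  set A := max A1 A2 with hA
  have hA1' : ∀ j, ∫ x in S, gradSq (w j) x ≤ A := fun j =>
    (hA1 (mem_range_self j)).trans (le_max_left _ _)
  have hA2' : ∀ j, ∫ x in S, hessSq (w j) x ≤ A := fun j =>
    (hA2 (mem_range_self j)).trans (le_max_right _ _)
  set C1 := (8 * d ^ 4 + 2 * d ^ 2 * (n * (2 + 32 * d ^ 2))) * A with hC1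
  have E1 : ∀ j k s, 0 < s → s ≤ 1 → ∫ x in dilate (t k) s S, (w j x - w j (t k)) ^ 2 ≤
      C1 * (s ^ n * Real.sqrt s) := fun j k s hs hs1 =>
    integral_sq_sub_dilate_le hn hb hSm (starAt_openHull h k) (hdS k) (hw j) (hA1' j) (hA2' j) hs hs1
  have hvol : 0 < volume.real S :=
    ENNReal.toReal_pos ((isOpen_openHull t).measure_pos volume hne).ne' hb.measure_lt_top.ne
  -- The constant w_j(t k) is compared with w_j in L² on the whole simplex, the case s = 1. This
  -- bounds the vertex values by the H² norm.
  have hbd : ∀ j, (fun k => w j (t k)) ∈ Metric.closedBall (0 : Fin (n + 1) → ℝ)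
      (Real.sqrt ((2 * C1 + 2 * A0) / volume.real S)) := by
    intro j
    rw [mem_closedBall_zero_iff, pi_norm_le_iff_of_nonneg (Real.sqrt_nonneg _)]
    intro k
    rw [Real.norm_eq_abs]
    apply Real.abs_le_sqrt
    rw [le_div_iff₀ hvol]
    have h1 := E1 j k 1 one_pos le_rfl
    rw [dilate_one] at h1
    have h2 := integral_add_sq_le (μ := volume.restrict S) (f := fun x => w j (t k) - w j x)
      (g := w j) (memLp_two_of_contDiff_of_bounded hb (continuous_const.sub (hw j).continuous))
      (L0.1 j)
    simp only [sub_add_cancel, integral_const, smul_eq_mul, measureReal_restrict_apply_univ] at h2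
    simp only [sub_sq_comm (w j (t k))] at h2
    have h3 : ∫ x in S, w j x ^ 2 ≤ A0 := hA0 (mem_range_self j)
    simp at h1
    linarith
  -- The nodal values of `u` are defined as subsequential limits. Their independence of the choice
  -- follows later from the uniqueness of cone values.
  obtain ⟨U, -, φ, hφ, hU⟩ := tendsto_subseq_of_bounded Metric.isBounded_closedBall hbd
  have hUk : ∀ k, Tendsto (fun j => w (φ j) (t k)) atTop (𝓝 (U k)) := fun k =>
    (tendsto_pi_nhds.1 hU) k
  have sub : ∀ {F : ℕ → Pt n → ℝ} {f : Pt n → ℝ}, TendstoL2 (volume.restrict S) F f →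
      TendstoL2 (volume.restrict S) (fun j => F (φ j)) f := fun hF =>
    ⟨fun j => hF.1 _, hF.2.1, hF.2.2.comp hφ.tendsto_atTop⟩
  refine ⟨U, fun b => ?_, fun k => ⟨max C1 ((2 + 32 * d ^ 2) * A), fun s hs hs1 => ⟨?_, fun b => ?_⟩⟩⟩
  · have hc : Tendsto (fun j => ∑ k, w (φ j) (t k) * baryLin t k (basisVec b)) atTop
        (𝓝 (∑ k, U k * baryLin t k (basisVec b))) :=
      tendsto_finsetSum _ fun k _ => (hUk k).mul_const _
    have h1 := ((sub (L1 b)).sub (tendstoL2_const_fun hc)).integral_sq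
    exact le_of_tendsto_of_tendsto' h1 ((T2.comp hφ.tendsto_atTop).const_mul _) fun j =>
      integral_sq_grad_interpolation_le hn h hd hG (hw (φ j)) b
  · have h1 := (((sub L0).sub (tendstoL2_const_fun (hUk k))).mono
      (dilate_subset (starAt_openHull h k) hs hs1)).integral_sq
    refine le_of_tendsto' h1 fun j => (E1 (φ j) k s hs hs1).trans ?_
    exact mul_le_mul_of_nonneg_right (le_max_left _ _) (by positivity)
  · have h1 := ((L1 b).mono (dilate_subset (starAt_openHull h k) hs hs1)).integral_sq
    refine le_of_tendsto' (h1.const_mul (s ^ 2)) fun j =>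
      (integral_sq_partialDeriv_dilate_le hn hb hSm (starAt_openHull h k) (hdS k) (hw j) (hA1' j)
        (hA2' j) hs hs1 b).trans ?_
    exact mul_le_mul_of_nonneg_right (le_max_right _ _) (by positivity)

end NodalValues

/-! ### Values at a point seen along cones. -/

section LocalValues

variable {n : ℕ} {Ω : Set (Pt n)} {u : Pt n → ℝ} {p : Pt n}

theorem TendstoL2.comp_add_left {F : ℕ → Pt n → ℝ} {f : Pt n → ℝ} (h : TendstoL2 volume F f)
    (c : Pt n) : TendstoL2 volume (fun j x => F j (c + x)) (fun x => f (c + x)) := by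
  have hmp := measurePreserving_add_left (volume : Measure (Pt n)) c
  refine ⟨fun j => (h.1 j).comp_measurePreserving hmp, h.2.1.comp_measurePreserving hmp, ?_⟩
  refine h.2.2.congr fun j => ?_
  exact (integral_add_left_eq_self (fun x => (F j x - f x) ^ 2) c).symm

theorem TendstoL2.restrict {F : ℕ → Pt n → ℝ} {f : Pt n → ℝ} (h : TendstoL2 volume F f)
    (W : Set (Pt n)) : TendstoL2 (volume.restrict W) F f := by
  rw [← Measure.restrict_univ (μ := volume)] at h
  exact h.mono (subset_univ W)

theorem setIntegral_comp_add_le {W V : Set (Pt n)} (hW : MeasurableSet W) (hV : MeasurableSet V)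
    {f : Pt n → ℝ} (h0 : ∀ x, 0 ≤ f x) (hf : IntegrableOn f V) {c : Pt n}
    (hWV : ∀ w ∈ W, c + w ∈ V) : ∫ w in W, f (c + w) ≤ ∫ x in V, f x := by
  rw [← integral_indicator hW, ← integral_indicator hV,
    ← integral_add_left_eq_self (V.indicator f) c]
  refine integral_mono_of_nonneg (Eventually.of_forall fun w => indicator_nonneg (fun _ _ => h0 _) w)
    ((hf.integrable_indicator hV).comp_add_left c) (Eventually.of_forall fun w => ?_)
  by_cases hw : w ∈ W
  · simp only
    rw [indicator_of_mem hw, indicator_of_mem (hWV w hw)]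
  · simp only
    rw [indicator_of_notMem hw]
    exact indicator_nonneg (fun _ _ => h0 _) _

/-- The difference of two translates. -/
theorem integral_sq_translate_sub_le {W V : Set (Pt n)} (hW : MeasurableSet W)
    (hWb : Bornology.IsBounded W) (hV : MeasurableSet V) (hVb : Bornology.IsBounded V)
    {ϕ : Pt n → ℝ} (hϕ : ContDiff ℝ ∞ ϕ) {x y : Pt n}
    (hWV : ∀ w ∈ W, ∀ τ : ℝ, 0 ≤ τ → τ ≤ 1 → y + τ • (x - y) + w ∈ V) :
    ∫ w in W, (ϕ (x + w) - ϕ (y + w)) ^ 2 ≤ ‖x - y‖ ^ 2 * ∫ z in V, gradSq ϕ z := by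
  have hd1 : Differentiable ℝ ϕ := hϕ.differentiable (by simp)
  have hc1 : Continuous (fderiv ℝ ϕ) := hϕ.continuous_fderiv (by simp)
  have hcF : Continuous (fun z : ℝ × Pt n =>
      fderiv ℝ ϕ (y + z.1 • (x - y) + z.2) (x - y)) :=
    (hc1.comp (by fun_prop)).clm_apply continuous_const
  have hftc : ∀ w, ∫ τ in (0 : ℝ)..1, fderiv ℝ ϕ (y + τ • (x - y) + w) (x - y) =
      ϕ (x + w) - ϕ (y + w) := by
    intro w
    have hp : ∀ τ : ℝ, HasDerivAt (fun τ : ℝ => y + τ • (x - y) + w) (x - y) τ := fun τ => by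
      have := (((hasDerivAt_id τ).smul_const (x - y)).const_add y).add_const w
      simpa using this
    rw [intervalIntegral.integral_eq_sub_of_hasDerivAt (fun τ _ =>
      (hd1 (y + τ • (x - y) + w)).hasFDerivAt.comp_hasDerivAt τ (hp τ))]
    · simp
    · exact (hcF.comp (by fun_prop : Continuous fun τ : ℝ => (τ, w))).intervalIntegrable _ _
  have := integral_sq_path_le hWb (F := fun τ w => fderiv ℝ ϕ (y + τ • (x - y) + w) (x - y)) hcF
    zero_le_one (A := ‖x - y‖ ^ 2 * ∫ z in V, gradSq ϕ z) fun τ hτ => ?_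
  · simpa only [hftc, sub_zero, one_pow, one_mul] using this
  have hcG : Continuous fun w => gradSq ϕ (y + τ • (x - y) + w) :=
    (continuous_gradSq hϕ).comp (by fun_prop)
  calc _ ≤ ∫ w in W, ‖x - y‖ ^ 2 * gradSq ϕ (y + τ • (x - y) + w) :=
        integral_mono (integrableOn_of_continuous hWb
          ((hcF.comp (by fun_prop : Continuous fun w : Pt n => (τ, w))).pow 2))
          ((integrableOn_of_continuous hWb hcG).const_mul _) fun w => sq_fderiv_le ϕ _ _
    _ = ‖x - y‖ ^ 2 * ∫ w in W, gradSq ϕ (y + τ • (x - y) + w) := integral_const_mul _ _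
    _ ≤ _ := by
        refine mul_le_mul_of_nonneg_left ?_ (sq_nonneg _)
        exact setIntegral_comp_add_le hW hV (gradSq_nonneg ϕ)
          (integrableOn_of_continuous hVb (continuous_gradSq hϕ))
          fun w hw => hWV w hw τ hτ.1.le hτ.2

/-- `c` is the value of `v` at `p`, seen from a cone with apex `p`. -/
def IsConeValue (v : Pt n → ℝ) (p : Pt n) (c : ℝ) : Prop :=
  ∃ (a : Pt n) (ρ C s₀ : ℝ), 0 < ρ ∧ 0 < s₀ ∧ ∀ s, 0 < s → s ≤ s₀ →
    ∫ w in Metric.ball 0 (s * ρ), (v (p + s • a + w) - c) ^ 2 ≤ C * (s ^ n * Real.sqrt s)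

/-- Zero boundary values enter here: the extension by zero is a limit of test functions on the whole
space, so translates may be compared along segments that leave `Ω`, while only the gradient inside
`Ω` counts. -/
theorem MemH10.integral_sq_translate_sub_le (hΩ : IsOpen Ω) (hu : MemH10 Ω u)
    {g : Fin n → Pt n → ℝ} (hg : ∀ b, HasWeakDeriv Ω ![b] u (g b))
    {W V : Set (Pt n)} (hW : MeasurableSet W) (hWb : Bornology.IsBounded W) (hV : MeasurableSet V)
    (hVb : Bornology.IsBounded V) {x y : Pt n}
    (hWV : ∀ w ∈ W, ∀ τ : ℝ, 0 ≤ τ → τ ≤ 1 → y + τ • (x - y) + w ∈ V) :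
    MemLp (Ω.indicator u) 2 volume ∧
    ∫ w in W, (Ω.indicator u (x + w) - Ω.indicator u (y + w)) ^ 2 ≤
      ‖x - y‖ ^ 2 * ∑ b, ∫ z in Ω ∩ V, g b z ^ 2 := by
  obtain ⟨g', ϕ, hg', hϕ, h0, h1⟩ := hu.exists_seq hΩ
  have hz : ∀ j x, x ∉ Ω → ϕ j x = 0 := fun j x hx =>
    image_eq_zero_of_notMem_tsupport fun h => hx ((hϕ j).2.2 h)
  have hL : TendstoL2 volume ϕ (Ω.indicator u) := by
    refine ⟨fun j => (hϕ j).1.continuous.memLp_of_hasCompactSupport (hϕ j).2.1,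
      (memLp_indicator_iff_restrict hΩ.measurableSet).2 h0.2.1, ?_⟩
    refine h0.2.2.congr fun j => ?_
    rw [← setIntegral_eq_integral_of_forall_compl_eq_zero (s := Ω)
      (f := fun x => (ϕ j x - Ω.indicator u x) ^ 2)]
    · exact setIntegral_congr_fun hΩ.measurableSet fun x hx => by
        simp only [indicator_of_mem hx]
    · intro x hx
      simp [hz j x hx, indicator_of_notMem hx]
  refine ⟨hL.2.1, ?_⟩
  have hlim := (((hL.comp_add_left x).sub (hL.comp_add_left y)).restrict W).integral_sq
  have hlim2 : Tendsto (fun j => ∑ b, ∫ z in Ω ∩ V, partialDeriv ![b] (ϕ j) z ^ 2) atTop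
      (𝓝 (∑ b, ∫ z in Ω ∩ V, g b z ^ 2)) := by
    refine tendsto_finsetSum _ fun b _ => ?_
    have h2 := ((h1 b).mono (V := Ω ∩ V) inter_subset_left).integral_sq
    have e : ∫ z in Ω ∩ V, g b z ^ 2 = ∫ z in Ω ∩ V, g' b z ^ 2 := integral_congr_ae (by
      filter_upwards [ae_restrict_of_ae_restrict_of_subset inter_subset_left
        ((hg b).ae_unique hΩ (hg' b))] with x hx
      rw [hx])
    rwa [e]
  refine le_of_tendsto_of_tendsto' hlim (hlim2.const_mul _) fun j => ?_
  refine (SurrogateFEM.integral_sq_translate_sub_le hW hWb hV hVb (hϕ j).1 hWV).trans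
    (le_of_eq ?_)
  congr 1
  rw [← integral_finsetSum]
  · rw [← integral_indicator hV, ← integral_indicator (hΩ.measurableSet.inter hV)]
    congr 1
    funext z
    by_cases hzV : z ∈ V
    · by_cases hzΩ : z ∈ Ω
      · rw [indicator_of_mem hzV, indicator_of_mem (show z ∈ Ω ∩ V from ⟨hzΩ, hzV⟩)]; rfl
      · rw [indicator_of_mem hzV, indicator_of_notMem (fun h : z ∈ Ω ∩ V => hzΩ h.1)]
        refine Finset.sum_eq_zero fun b _ => ?_
        rw [image_eq_zero_of_notMem_tsupport fun h => hzΩ (((hϕ j).partialDeriv ![b]).2.2 h)]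
        norm_num
    · rw [indicator_of_notMem hzV, indicator_of_notMem (fun h : z ∈ Ω ∩ V => hzV h.2)]
  · exact fun b _ => (((h1 b).mono (V := Ω ∩ V) inter_subset_left).1 j).integrable_sq

/-- On balls of radius sr about p + sa and p + sa' the function is close to `c` and to `c'` in mean
square, and the two translates differ by at most s²‖a - a'‖² times the gradient integral near `p`.
All three terms are O(s^n √s) while the balls have volume of order s^n; division and s → 0 give c =
c'. This yields continuity across elements and zero boundary values without a trace theorem. -/
theorem IsConeValue.eq (hΩ : IsOpen Ω) (hu : MemH10 Ω u)
    {g : Fin n → Pt n → ℝ} (hg : ∀ b, HasWeakDeriv Ω ![b] u (g b))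
    (hsmall : ∀ R : ℝ, ∃ C s₀ : ℝ, 0 < s₀ ∧ ∀ s, 0 < s → s ≤ s₀ →
      s ^ 2 * ∑ b, ∫ z in Ω ∩ Metric.ball p (s * R), g b z ^ 2 ≤ C * (s ^ n * Real.sqrt s))
    {c c' : ℝ} (hc : IsConeValue (Ω.indicator u) p c) (hc' : IsConeValue (Ω.indicator u) p c') :
    c = c' := by
  obtain ⟨a, ρ, C, s₀, hρ, hs₀, h⟩ := hc
  obtain ⟨a', ρ', C', s₀', hρ', hs₀', h'⟩ := hc'
  set r := min ρ ρ' with hr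
  have hr0 : 0 < r := lt_min hρ hρ'
  set R := ‖a‖ + ‖a'‖ + r with hR
  obtain ⟨C'', s₁, hs₁, h''⟩ := hsmall R
  set v := Ω.indicator u with hv
  set σ := min (min s₀ s₀') s₁ with hσ
  have hσ0 : 0 < σ := lt_min (lt_min hs₀ hs₀') hs₁
  set A := volume.real (Metric.ball (0 : Pt n) r) with hA
  have hA0 : 0 < A := ENNReal.toReal_pos (Metric.measure_ball_pos _ _ hr0).ne'
    measure_ball_lt_top.ne
  have key : ∀ s, 0 < s → s ≤ σ → A * (c - c') ^ 2 ≤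
      (3 * C + 3 * C' + 3 * ‖a - a'‖ ^ 2 * C'') * Real.sqrt s := by
    intro s hs hsσ
    set W := Metric.ball (0 : Pt n) (s * r) with hW
    have hWV : ∀ w ∈ W, ∀ τ : ℝ, 0 ≤ τ → τ ≤ 1 →
        (p + s • a') + τ • ((p + s • a) - (p + s • a')) + w ∈ Metric.ball p (s * R) := by
      intro w hw τ hτ0 hτ1
      rw [hW, mem_ball_zero_iff] at hw
      have e : (p + s • a') + τ • ((p + s • a) - (p + s • a')) + w - p =
          s • ((1 - τ) • a' + τ • a) + w := by module
      rw [Metric.mem_ball, dist_eq_norm, e]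
      have e1 : ‖(1 - τ) • a' + τ • a‖ ≤ ‖a'‖ + ‖a‖ := by
        refine (norm_add_le _ _).trans (add_le_add ?_ ?_)
        · rw [norm_smul, Real.norm_of_nonneg (by linarith)]
          exact mul_le_of_le_one_left (norm_nonneg _) (by linarith)
        · rw [norm_smul, Real.norm_of_nonneg hτ0]
          exact mul_le_of_le_one_left (norm_nonneg _) hτ1
      calc _ ≤ ‖s • ((1 - τ) • a' + τ • a)‖ + ‖w‖ := norm_add_le _ _
        _ < s * (‖a'‖ + ‖a‖) + s * r := by
            rw [norm_smul, Real.norm_of_nonneg hs.le]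
            exact add_lt_add_of_le_of_lt (mul_le_mul_of_nonneg_left e1 hs.le) hw
        _ = _ := by rw [hR]; ring
    obtain ⟨hvL, htr⟩ := hu.integral_sq_translate_sub_le hΩ hg (W := W)
      (V := Metric.ball p (s * R)) Metric.isOpen_ball.measurableSet Metric.isBounded_ball
      Metric.isOpen_ball.measurableSet Metric.isBounded_ball hWV
    have e1 : p + s • a - (p + s • a') = s • (a - a') := by module
    rw [e1, norm_smul, Real.norm_of_nonneg hs.le, mul_pow] at htr
    have h3 := h'' s hs (hsσ.trans (min_le_right _ _))
    have hfin : ∀ X : ℝ, IsFiniteMeasure (volume.restrict (Metric.ball (0 : Pt n) X)) := fun X =>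
      ⟨by simpa using measure_ball_lt_top⟩
    have hvx : ∀ y : Pt n, MemLp (fun w => v (y + w)) 2 volume := fun y =>
      hvL.comp_measurePreserving (measurePreserving_add_left volume y)
    have cut : ∀ (y : Pt n) (k ρ'' : ℝ), r ≤ ρ'' → ∫ w in W, (v (y + w) - k) ^ 2 ≤
        ∫ w in Metric.ball 0 (s * ρ''), (v (y + w) - k) ^ 2 := by
      intro y k ρ'' hk
      have := hfin (s * ρ'')
      refine setIntegral_mono_set ?_ (Eventually.of_forall fun w => sq_nonneg _)
        (Metric.ball_subset_ball (by gcongr)).eventuallyLE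
      exact (((hvx y).restrict _).sub (memLp_const k)).integrable_sq
    have h1 := (cut (p + s • a) c ρ (min_le_left _ _)).trans
      (h s hs (hsσ.trans ((min_le_left _ _).trans (min_le_left _ _))))
    have h2 := (cut (p + s • a') c' ρ' (min_le_right _ _)).trans
      (h' s hs (hsσ.trans ((min_le_left _ _).trans (min_le_right _ _))))
    have := hfin (s * r)
    have m1 : MemLp (fun w => v (p + s • a + w) - c) 2 (volume.restrict W) :=
      ((hvx _).restrict _).sub (memLp_const c)
    have m2 : MemLp (fun w => v (p + s • a' + w) - c') 2 (volume.restrict W) :=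
      ((hvx _).restrict _).sub (memLp_const c')
    have m3 : MemLp (fun w => v (p + s • a + w) - v (p + s • a' + w)) 2 (volume.restrict W) :=
      ((hvx _).restrict _).sub ((hvx _).restrict _)
    have hvolW : ∫ w in W, (c - c') ^ 2 = s ^ n * A * (c - c') ^ 2 := by
      rw [setIntegral_const, smul_eq_mul, hW, hA]
      congr 1
      have := Measure.addHaar_ball_mul_of_pos (volume : Measure (Pt n)) 0 hs r
      rw [Measure.real, this, ENNReal.toReal_mul, Measure.real, finrank_euclideanSpace,
        Fintype.card_fin, ENNReal.toReal_ofReal (by positivity)]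
    have hle : ∫ w in W, (c - c') ^ 2 ≤ 3 * (∫ w in W, (v (p + s • a + w) - c) ^ 2) +
        3 * (∫ w in W, (v (p + s • a' + w) - c') ^ 2) +
        3 * ∫ w in W, (v (p + s • a + w) - v (p + s • a' + w)) ^ 2 := by
      rw [← (integral_lincomb₃ m1.integrable_sq m2.integrable_sq m3.integrable_sq 3 3 3).2]
      refine integral_mono (integrable_const _)
        (integral_lincomb₃ m1.integrable_sq m2.integrable_sq m3.integrable_sq 3 3 3).1 fun w => ?_
      simp only
      set X := v (p + s • a + w)
      set Y := v (p + s • a' + w)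
      nlinarith [sq_nonneg ((X - c) + (Y - c')), sq_nonneg ((X - c) + (X - Y)),
        sq_nonneg ((Y - c') - (X - Y))]
    rw [hvolW] at hle
    have h4 : s ^ 2 * ‖a - a'‖ ^ 2 * ∑ b, ∫ z in Ω ∩ Metric.ball p (s * R), g b z ^ 2 ≤
        ‖a - a'‖ ^ 2 * (C'' * (s ^ n * Real.sqrt s)) := by
      rw [mul_comm (s ^ 2), mul_assoc]
      exact mul_le_mul_of_nonneg_left h3 (sq_nonneg _)
    have hsn : 0 < s ^ n := pow_pos hs n
    refine le_of_mul_le_mul_left ?_ hsn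
    linarith
  have hlim : Tendsto (fun s : ℝ => (3 * C + 3 * C' + 3 * ‖a - a'‖ ^ 2 * C'') * Real.sqrt s)
      (𝓝[>] 0) (𝓝 0) := by
    have : Tendsto (fun s : ℝ => (3 * C + 3 * C' + 3 * ‖a - a'‖ ^ 2 * C'') * Real.sqrt s)
      (𝓝 0) (𝓝 ((3 * C + 3 * C' + 3 * ‖a - a'‖ ^ 2 * C'') * Real.sqrt 0)) :=
      (Real.continuous_sqrt.tendsto 0).const_mul _
    rw [Real.sqrt_zero, mul_zero] at this
    exact this.mono_left nhdsWithin_le_nhds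
  have h0 : A * (c - c') ^ 2 ≤ 0 := by
    refine ge_of_tendsto hlim ?_
    filter_upwards [Ioc_mem_nhdsGT hσ0] with s hs
    exact key s hs.1 hs.2
  have h1 : (c - c') ^ 2 ≤ 0 := by
    by_contra hcon
    rw [not_le] at hcon
    linarith [mul_pos hA0 hcon]
  have : c - c' = 0 := by
    have := le_antisymm h1 (sq_nonneg _)
    exact pow_eq_zero_iff (by norm_num) |>.1 this
  linarith

/-- A function has the cone value `0` at the points where a cone outside of `Ω` starts. -/
theorem isConeValue_zero (hΩ : IsBoundedLipschitzDomain Ω) (hp : p ∈ closure Ω) (hpΩ : p ∉ Ω) :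
    IsConeValue (Ω.indicator u) p 0 := by
  obtain ⟨e, ρ₁, ρ₂, he, h1, h2, hcone⟩ := hΩ.exterior_cone (p := p)
    (by rw [hΩ.1.frontier_eq]; exact ⟨hp, hpΩ⟩)
  refine ⟨-e, ρ₁, 0, ρ₂, h1, h2, fun s hs hs2 => ?_⟩
  rw [zero_mul]
  refine le_of_eq ?_
  rw [setIntegral_congr_fun (g := fun _ => 0) Metric.isOpen_ball.measurableSet, integral_zero]
  intro w hw
  rw [mem_ball_zero_iff] at hw
  have : p + s • (-e) + w ∉ Ω := by
    have := hcone s hs hs2 (s⁻¹ • w) (by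
      rw [norm_smul, norm_inv, Real.norm_of_nonneg hs.le, inv_mul_le_iff₀ hs]; exact hw.le)
    convert this using 2
    rw [smul_sub, smul_smul, mul_inv_cancel₀ hs.ne']; module
  change (Ω.indicator u (p + s • -e + w) - 0) ^ 2 = 0
  rw [indicator_of_notMem this]
  norm_num

/-- A ball inside of the element, scaled towards the vertex, stays in the dilates of the element. -/
theorem isConeValue_vertex {t : Simp n} (h : AffineIndependent ℝ t) (htΩ : openHull t ⊆ Ω)
    (hu : MemLp u 2 (volume.restrict (openHull t))) (k : Fin (n + 1)) {c C : ℝ}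
    (hC : ∀ s, 0 < s → s ≤ 1 →
      ∫ x in dilate (t k) s (openHull t), (u x - c) ^ 2 ≤ C * (s ^ n * Real.sqrt s)) :
    IsConeValue (Ω.indicator u) (t k) c := by
  obtain ⟨z, hz⟩ := openHull_nonempty h
  obtain ⟨ρ, hρ, hρt⟩ := Metric.isOpen_iff.1 (isOpen_openHull t) z hz
  refine ⟨z - t k, ρ, C, 1, hρ, one_pos, fun s hs hs1 => (le_trans ?_ (hC s hs hs1))⟩
  have hsub := dilate_subset (starAt_openHull h k) hs hs1
  have hmD := measurableSet_dilate (a := t k) (isOpen_openHull t).measurableSet s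
  have hb : Bornology.IsBounded (dilate (t k) s (openHull t)) :=
    (isCompact_hull t).isBounded.subset (hsub.trans (openHull_subset_hull t))
  have hfin : IsFiniteMeasure (volume.restrict (dilate (t k) s (openHull t))) :=
    ⟨by simpa using hb.measure_lt_top⟩
  have e : ∫ x in dilate (t k) s (openHull t), (u x - c) ^ 2 =
      ∫ x in dilate (t k) s (openHull t), (Ω.indicator u x - c) ^ 2 :=
    setIntegral_congr_fun hmD fun x hx => by simp only [indicator_of_mem (htΩ (hsub hx))]
  rw [e]
  refine setIntegral_comp_add_le (f := fun x => (Ω.indicator u x - c) ^ 2)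
    Metric.isOpen_ball.measurableSet hmD (fun x => sq_nonneg _) ?_ fun w hw => ?_
  · have m1 : MemLp (Ω.indicator u) 2 (volume.restrict (dilate (t k) s (openHull t))) :=
      (hu.mono_measure (Measure.restrict_mono hsub le_rfl)).ae_eq
        ((ae_restrict_iff' hmD).2 (Eventually.of_forall fun x hx => by
          rw [indicator_of_mem (htΩ (hsub hx))]))
    exact (m1.sub (memLp_const c)).integrable_sq
  · rw [mem_ball_zero_iff] at hw
    apply hρt
    have e : t k + s⁻¹ • (t k + s • (z - t k) + w - t k) - z = s⁻¹ • w := by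
      rw [show t k + s • (z - t k) + w - t k = s • (z - t k) + w by abel, smul_add, smul_smul,
        inv_mul_cancel₀ hs.ne']
      module
    rw [Metric.mem_ball, dist_eq_norm, e, norm_smul, norm_inv, Real.norm_of_nonneg hs.le,
      inv_mul_lt_iff₀ hs]
    exact hw

end LocalValues

/-! ### The nodal interpolant and its first order error. -/

section Interpolation

variable {n : ℕ} {t : Simp n} {Ω : Set (Pt n)} {M : Finset (Simp n)} {m : ℕ} {u : Pt n → ℝ}

theorem setIntegral_le_sum {ι : Type*} (s : Finset ι) {A : Set (Pt n)} {B : ι → Set (Pt n)}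
    (hA : MeasurableSet A) (hB : ∀ i ∈ s, MeasurableSet (B i)) {f : Pt n → ℝ} (h0 : ∀ x, 0 ≤ f x)
    (hf : ∀ i ∈ s, IntegrableOn f (B i)) (hcov : ∀ᵐ x, x ∈ A → ∃ i ∈ s, x ∈ B i) :
    ∫ x in A, f x ≤ ∑ i ∈ s, ∫ x in B i, f x := by
  have e : ∑ i ∈ s, ∫ x in B i, f x = ∫ x, ∑ i ∈ s, (B i).indicator f x := by
    rw [integral_finsetSum _ fun i hi => (hf i hi).integrable_indicator (hB i hi)]
    exact Finset.sum_congr rfl fun i hi => (integral_indicator (hB i hi)).symm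
  rw [e, ← integral_indicator hA]
  refine integral_mono_of_nonneg (Eventually.of_forall fun x => indicator_nonneg (fun _ _ => h0 _) x)
    (integrable_finsetSum _ fun i hi => (hf i hi).integrable_indicator (hB i hi)) ?_
  filter_upwards [hcov] with x hx
  by_cases hxA : x ∈ A
  · obtain ⟨i, hi, hxi⟩ := hx hxA
    rw [indicator_of_mem hxA]
    have := Finset.single_le_sum (f := fun i => (B i).indicator f x)
      (fun i _ => indicator_nonneg (fun _ _ => h0 _) x) hi
    simpa only [indicator_of_mem hxi] using this
  · rw [indicator_of_notMem hxA]
    exact Finset.sum_nonneg fun i _ => indicator_nonneg (fun _ _ => h0 _) x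

/-- A family of sets with bounded overlap. -/
theorem sum_setIntegral_le {ι : Type*} (s : Finset ι) {A : Set (Pt n)} {B : ι → Set (Pt n)}
    (hA : MeasurableSet A) (hB : ∀ i ∈ s, MeasurableSet (B i)) (hBA : ∀ i ∈ s, B i ⊆ A)
    {f : Pt n → ℝ} (h0 : ∀ x, 0 ≤ f x) (hf : IntegrableOn f A) {N : ℝ}
    (hN : ∀ x ∈ A, ∑ i ∈ s, (B i).indicator (fun _ => (1 : ℝ)) x ≤ N) :
    ∑ i ∈ s, ∫ x in B i, f x ≤ N * ∫ x in A, f x := by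
  have hfi : ∀ i ∈ s, Integrable ((B i).indicator f) := fun i hi =>
    (hf.mono_set (hBA i hi)).integrable_indicator (hB i hi)
  have e : ∑ i ∈ s, ∫ x in B i, f x = ∫ x, ∑ i ∈ s, (B i).indicator f x := by
    rw [integral_finsetSum _ hfi]
    exact Finset.sum_congr rfl fun i hi => (integral_indicator (hB i hi)).symm
  rw [e, ← integral_indicator hA, ← integral_const_mul]
  refine integral_mono (integrable_finsetSum _ hfi) ((hf.integrable_indicator hA).const_mul N)
    fun x => ?_
  simp only
  by_cases hxA : x ∈ A
  · rw [indicator_of_mem hxA]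
    calc _ = (∑ i ∈ s, (B i).indicator (fun _ => (1 : ℝ)) x) * f x := by
          rw [Finset.sum_mul]
          refine Finset.sum_congr rfl fun i _ => ?_
          by_cases hx : x ∈ B i <;> simp [hx]
      _ ≤ _ := mul_le_mul_of_nonneg_right (hN x hxA) (h0 x)
  · rw [indicator_of_notMem hxA, mul_zero]
    exact (Finset.sum_eq_zero fun i hi => indicator_of_notMem (fun h => hxA (hBA i hi h)) _).le

/-- Only the face opposite to t k is moved by the dilation. Within distance sR of t k the coordinate
of this vertex differs from 1 by at most GsR, so the factor s(GR + 1) suffices. -/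
theorem mem_dilate_of_norm_lt (h : AffineIndependent ℝ t) {G : ℝ} (hG0 : 0 ≤ G)
    (hG : ∀ k y, |baryLin t k y| ≤ G * ‖y‖) (k : Fin (n + 1)) {s R : ℝ} (hs : 0 < s) (hR : 0 ≤ R)
    {x : Pt n} (hx : x ∈ openHull t) (hxR : ‖x - t k‖ < s * R) :
    x ∈ dilate (t k) (s * (G * R + 1)) (openHull t) := by
  change t k + (s * (G * R + 1))⁻¹ • (x - t k) ∈ openHull t
  rw [mem_openHull_iff h] at hx ⊢
  have hpos : 0 < s * (G * R + 1) := by positivity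
  intro l
  rw [bary_add h, map_smul, smul_eq_mul, bary_vertex h]
  have hl := hx l
  have e : baryLin t l (x - t k) = bary t l x - if l = k then 1 else 0 := by
    rw [← bary_sub h, bary_vertex h]
  by_cases hlk : l = k
  · rw [if_pos hlk]
    have h1 := (hG l (x - t k)).trans (mul_le_mul_of_nonneg_left hxR.le hG0)
    have h2 : |(s * (G * R + 1))⁻¹ * baryLin t l (x - t k)| < 1 := by
      rw [abs_mul, abs_of_pos (inv_pos.2 hpos), inv_mul_lt_iff₀ hpos, mul_one]
      nlinarith
    linarith [(abs_lt.1 h2).1]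
  · rw [if_neg hlk] at e ⊢
    rw [zero_add, e, sub_zero]
    exact mul_pos (inv_pos.2 hpos) hl

namespace IsMacroMesh

variable (hM : IsMacroMesh Ω M)
include hM

/-- A small ball about `p` meets only elements that have `p` as a vertex, and in each of them it is
contained in a dilate with a factor proportional to s. The elementwise bounds on dilates therefore
add up to the bound required for uniqueness of cone values. -/
theorem integral_sq_small_ball (hn : n ≤ 3) (hΩ : IsOpen Ω) {p : Pt n} (hp : p ∈ vertices M m)
    {g : Fin n → Pt n → ℝ} (hgL : ∀ b, MemLp (g b) 2 (volume.restrict Ω))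
    (htΩ : ∀ t ∈ fineMesh M m, openHull t ⊆ Ω)
    (hC : ∀ t ∈ fineMesh M m, ∀ k, ∃ C, ∀ s, 0 < s → s ≤ 1 → ∀ b,
      s ^ 2 * ∫ x in dilate (t k) s (openHull t), g b x ^ 2 ≤ C * (s ^ n * Real.sqrt s)) (R : ℝ) :
    ∃ C s₀ : ℝ, 0 < s₀ ∧ ∀ s, 0 < s → s ≤ s₀ →
      s ^ 2 * ∑ b, ∫ z in Ω ∩ Metric.ball p (s * R), g b z ^ 2 ≤ C * (s ^ n * Real.sqrt s) := by
  classical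
  choose! C hC using hC
  obtain ⟨G, hG0, hG⟩ := exists_fine_lipschitz M m
  set F := (finite_fineMesh M m).toFinset with hF
  have hFm : ∀ t, t ∈ F ↔ t ∈ fineMesh M m := fun t => Set.Finite.mem_toFinset _
  set Q := G * |R| + 1 with hQ
  have hQ1 : 1 ≤ Q := by rw [hQ]; have := mul_nonneg hG0 (abs_nonneg R); linarith
  have hQ0 : 0 < Q := by linarith
  -- the elements that do not touch `p` keep a distance
  obtain ⟨r, hr, hrt⟩ : ∃ r > 0, ∀ t ∈ F, p ∉ range t → Disjoint (Metric.ball p r) (hull t) := by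
    have : ∀ t ∈ F, ∃ r > 0, p ∉ range t → Disjoint (Metric.ball p r) (hull t) := by
      intro t ht
      by_cases hpt : p ∈ range t
      · exact ⟨1, one_pos, fun h => absurd hpt h⟩
      · have hph : p ∈ (hull t)ᶜ := fun h =>
          hpt (hM.mem_range_of_mem_hull hn ((hFm t).1 ht) hp h)
        obtain ⟨r, hr, hsub⟩ := Metric.isOpen_iff.1 (isCompact_hull t).isClosed.isOpen_compl p hph
        exact ⟨r, hr, fun _ => disjoint_left.2 fun x hx hxt => hsub hx hxt⟩
    choose! r hr hrd using this
    rcases F.eq_empty_or_nonempty with hE | hE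
    · exact ⟨1, one_pos, fun t ht => absurd ht (by rw [hE]; simp)⟩
    · refine ⟨F.inf' hE r, (Finset.lt_inf'_iff hE).2 fun t ht => hr t ht, fun t ht hpt => ?_⟩
      exact (hrd t ht hpt).mono_left (Metric.ball_subset_ball (Finset.inf'_le _ ht))
  set κ : Simp n → Fin (n + 1) := fun t => if h : p ∈ range t then h.choose else 0 with hκ
  have hκp : ∀ t, p ∈ range t → t (κ t) = p := fun t h => by
    simp only [hκ, dif_pos h]; exact h.choose_spec
  set F' := F.filter (fun t => p ∈ range t) with hF'
  have hF'm : ∀ t ∈ F', t ∈ fineMesh M m ∧ p ∈ range t := fun t ht =>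
    ⟨(hFm t).1 (Finset.mem_filter.1 ht).1, (Finset.mem_filter.1 ht).2⟩
  refine ⟨Q ^ n * Real.sqrt Q * ∑ t ∈ F', n * |C t (κ t)|, min (r / (|R| + 1)) Q⁻¹,
    lt_min (by positivity) (inv_pos.2 hQ0), fun s hs hs0 => ?_⟩
  have hsr : s * R < r := by
    have h1 : s ≤ r / (|R| + 1) := hs0.trans (min_le_left _ _)
    rw [le_div_iff₀ (by positivity)] at h1
    nlinarith [le_abs_self R]
  have hsQ : s * Q ≤ 1 := by
    have h1 : s ≤ Q⁻¹ := hs0.trans (min_le_right _ _)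
    calc s * Q ≤ Q⁻¹ * Q := by gcongr
      _ = 1 := inv_mul_cancel₀ hQ0.ne'
  have hsQ0 : 0 < s * Q := by positivity
  have hsub : ∀ t ∈ F', dilate p (s * Q) (openHull t) ⊆ Ω := fun t ht => by
    obtain ⟨h1, h2⟩ := hF'm t ht
    have := dilate_subset (starAt_openHull (hM.fine_affineIndependent h1) (κ t)) hsQ0 hsQ
    rw [hκp t h2] at this
    exact this.trans (htΩ t h1)
  have hb : ∀ b, s ^ 2 * ∫ z in Ω ∩ Metric.ball p (s * R), g b z ^ 2 ≤
      ∑ t ∈ F', |C t (κ t)| * ((s * Q) ^ n * Real.sqrt (s * Q)) := by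
    intro b
    have h1 := setIntegral_le_sum F' (A := Ω ∩ Metric.ball p (s * R))
      (B := fun t => dilate p (s * Q) (openHull t)) (f := fun z => g b z ^ 2)
      (hΩ.measurableSet.inter Metric.isOpen_ball.measurableSet)
      (fun t _ => measurableSet_dilate (isOpen_openHull t).measurableSet _) (fun x => sq_nonneg _)
      (fun t ht => (hgL b).integrable_sq.mono_measure (Measure.restrict_mono (hsub t ht) le_rfl)) ?_
    · calc _ ≤ s ^ 2 * ∑ t ∈ F', ∫ x in dilate p (s * Q) (openHull t), g b x ^ 2 := by gcongr
        _ = ∑ t ∈ F', s ^ 2 * ∫ x in dilate p (s * Q) (openHull t), g b x ^ 2 := Finset.mul_sum _ _ _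
        _ ≤ _ := by
            refine Finset.sum_le_sum fun t ht => ?_
            obtain ⟨h1, h2⟩ := hF'm t ht
            have h3 := hC t h1 (κ t) (s * Q) hsQ0 hsQ b
            rw [hκp t h2] at h3
            have h4 : 0 ≤ ∫ x in dilate p (s * Q) (openHull t), g b x ^ 2 :=
              integral_nonneg fun x => sq_nonneg _
            have h5 : s ^ 2 ≤ (s * Q) ^ 2 := by
              gcongr; nlinarith
            calc _ ≤ (s * Q) ^ 2 * ∫ x in dilate p (s * Q) (openHull t), g b x ^ 2 := by gcongr
              _ ≤ _ := h3
              _ ≤ _ := by gcongr; exact le_abs_self _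
    · filter_upwards [hM.ae_exists_fine_openHull m] with x hx hxA
      obtain ⟨t, ht, hxt⟩ := hx (subset_closure hxA.1)
      have hpt : p ∈ range t := by
        by_contra hpt
        refine disjoint_left.1 (hrt t ((hFm t).2 ht) hpt) ?_ (openHull_subset_hull t hxt)
        exact Metric.ball_subset_ball hsr.le hxA.2
      refine ⟨t, Finset.mem_filter.2 ⟨(hFm t).2 ht, hpt⟩, ?_⟩
      have := mem_dilate_of_norm_lt (hM.fine_affineIndependent ht) hG0 (hG t ht) (κ t) hs
        (abs_nonneg R) hxt (by
          rw [hκp t hpt, ← dist_eq_norm]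
          exact lt_of_lt_of_le hxA.2 (by gcongr; exact le_abs_self R))
      rwa [hκp t hpt] at this
  rw [Finset.mul_sum]
  calc _ ≤ ∑ b : Fin n, ∑ t ∈ F', |C t (κ t)| * ((s * Q) ^ n * Real.sqrt (s * Q)) :=
        Finset.sum_le_sum fun b _ => hb b
    _ = _ := by
        rw [Finset.sum_const, Finset.card_univ, Fintype.card_fin, nsmul_eq_mul, ← Finset.sum_mul,
          ← Finset.mul_sum, Real.sqrt_mul hs.le, mul_pow]
        ring

/-- The nodal interpolant of a function in `H² ∩ H^1_0`. -/
theorem exists_interpolant (hn : n ≤ 3) (hΩ : IsBoundedLipschitzDomain Ω) (hu : MemH10 Ω u)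
    {g : Fin n → Pt n → ℝ} {H : Fin n → Fin n → Pt n → ℝ}
    (hg : ∀ b, HasWeakDeriv Ω ![b] u (g b)) (hgL : ∀ b, MemLp (g b) 2 (volume.restrict Ω))
    (hH : ∀ b c, HasWeakDeriv Ω ![b, c] u (H b c))
    (hHL : ∀ b c, MemLp (H b c) 2 (volume.restrict Ω)) {d G : Simp n → ℝ} {E : ℝ} (hE : 0 ≤ E)
    (hd : ∀ t ∈ fineMesh M m, ∀ k l, ‖t k - t l‖ ≤ d t)
    (hG : ∀ t ∈ fineMesh M m, ∀ k y, |baryLin t k y| ≤ G t * ‖y‖)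
    (hGd : ∀ t ∈ fineMesh M m, G t ^ 2 * d t ^ 4 ≤ E) :
    ∃ c : Pt n → ℝ, ∀ b, ∫ x in Ω, (g b x -
      ∑ p ∈ dofs Ω M m, c p * fderiv ℝ (hat M m p) x (basisVec b)) ^ 2 ≤
        4 * (n + 1) ^ 2 * ((n + 1) ^ (n + 1)) * E * ∑ b, ∑ c, ∫ x in Ω, H b c x ^ 2 := by
  classical
  have htΩ : ∀ t ∈ fineMesh M m, openHull t ⊆ Ω := fun t ht => hM.fine_openHull_subset hΩ ht
  have mono : ∀ {f : Pt n → ℝ}, MemLp f 2 (volume.restrict Ω) → ∀ t ∈ fineMesh M m,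
      MemLp f 2 (volume.restrict (openHull t)) := fun hf t ht =>
    hf.mono_measure (Measure.restrict_mono (htΩ t ht) le_rfl)
  have hex := fun t (ht : t ∈ fineMesh M m) =>
    exists_nodal_values hn (hM.fine_affineIndependent ht) (hd t ht) (hG t ht) (mono hu.1.1 t ht)
      (fun b => (hg b).mono (htΩ t ht)) (fun b => mono (hgL b) t ht)
      (fun b c => (hH b c).mono (htΩ t ht)) (fun b c => mono (hHL b c) t ht)
  choose! U hU1 hU2 using hex
  have hcone : ∀ t ∈ fineMesh M m, ∀ k, IsConeValue (Ω.indicator u) (t k) (U t k) := by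
    intro t ht k
    obtain ⟨C, hC⟩ := hU2 t ht k
    exact isConeValue_vertex (hM.fine_affineIndependent ht) (htΩ t ht) (mono hu.1.1 t ht) k
      fun s hs hs1 => (hC s hs hs1).1
  have hsmall : ∀ p ∈ vertices M m, ∀ R : ℝ, ∃ C s₀ : ℝ, 0 < s₀ ∧ ∀ s, 0 < s → s ≤ s₀ →
      s ^ 2 * ∑ b, ∫ z in Ω ∩ Metric.ball p (s * R), g b z ^ 2 ≤ C * (s ^ n * Real.sqrt s) :=
    fun p hp R => hM.integral_sq_small_ball hn hΩ.1 hp hgL htΩ (fun t ht k => by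
      obtain ⟨C, hC⟩ := hU2 t ht k
      exact ⟨C, fun s hs hs1 => (hC s hs hs1).2⟩) R
  -- One value per vertex, taken from any element that contains it; by uniqueness it equals the
  -- value `U t k` of every other element.
  obtain ⟨c, hc⟩ : ∃ c : Pt n → ℝ, ∀ p ∈ vertices M m, IsConeValue (Ω.indicator u) p (c p) := by
    have : ∀ p ∈ vertices M m, ∃ c, IsConeValue (Ω.indicator u) p c := by
      intro p hp
      obtain ⟨t, ht, hpt⟩ := hM.exists_fine_mem (m := m) (hM.vertices_subset_closure hp)
      obtain ⟨k, rfl⟩ := hM.mem_range_of_mem_hull hn ht hp hpt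
      exact ⟨_, hcone t ht k⟩
    choose! c hc using this
    exact ⟨c, hc⟩
  refine ⟨c, fun b => ?_⟩
  set I : Pt n → ℝ := fun x => g b x -
    ∑ p ∈ dofs Ω M m, c p * fderiv ℝ (hat M m p) x (basisVec b) with hI
  have hIL : MemLp I 2 (volume.restrict Ω) := (hgL b).sub (memLp_finsetSum _ fun p hp =>
    (hM.memLp_fderiv_hat hn hΩ.1 hΩ.2.2.1 (Finset.mem_filter.1 hp).1 b).const_mul _)
  set F := (finite_fineMesh M m).toFinset with hF
  have hFm : ∀ t, t ∈ F ↔ t ∈ fineMesh M m := fun t => Set.Finite.mem_toFinset _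
  have hgrad : ∀ t ∈ fineMesh M m, ∀ x ∈ openHull t,
      ∑ p ∈ dofs Ω M m, c p * fderiv ℝ (hat M m p) x (basisVec b) =
        ∑ k, U t k * baryLin t k (basisVec b) := by
    intro t ht x hx
    have hti := hM.fine_affineIndependent ht
    have h1 : ∑ p ∈ dofs Ω M m, c p * fderiv ℝ (hat M m p) x (basisVec b) =
        ∑ p ∈ Finset.univ.image t, c p * fderiv ℝ (hat M m p) x (basisVec b) := by
      have hl : ∑ p ∈ dofs Ω M m, c p * fderiv ℝ (hat M m p) x (basisVec b) =
          ∑ p ∈ vertices M m, c p * fderiv ℝ (hat M m p) x (basisVec b) := by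
        rw [dofs, Finset.sum_filter]
        refine Finset.sum_congr rfl fun p hp => ?_
        split_ifs with hpΩ
        · rfl
        -- At a boundary vertex the exterior cone gives the value 0, so dropping these vertices does
        -- not change the interpolant.
        · have : c p = 0 := IsConeValue.eq hΩ.1 hu hg (hsmall p hp) (hc p hp)
            (isConeValue_zero hΩ (hM.vertices_subset_closure hp) hpΩ)
          rw [this, zero_mul]
      rw [hl]
      refine (Finset.sum_subset (fun p hp => ?_) fun p hp hpt => ?_).symm
      · obtain ⟨k, -, rfl⟩ := Finset.mem_image.1 hp
        exact hM.fine_vertex_mem ht k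
      · rw [hM.fderiv_hat_eq_zero hn ht hx hp (by simpa using hpt)]
        simp
    rw [h1, Finset.sum_image hti.injective.injOn]
    refine Finset.sum_congr rfl fun k _ => ?_
    rw [hM.fderiv_hat_vertex hn ht hx, IsConeValue.eq hΩ.1 hu hg
      (hsmall _ (hM.fine_vertex_mem ht k)) (hc _ (hM.fine_vertex_mem ht k)) (hcone t ht k)]
  have hH2 : IntegrableOn (fun x => ∑ b, ∑ c, H b c x ^ 2) Ω :=
    integrable_finsetSum _ fun b _ => integrable_finsetSum _ fun c _ => (hHL b c).integrable_sq
  have hHint : ∀ A ⊆ Ω, ∑ b, ∑ c, ∫ x in A, H b c x ^ 2 = ∫ x in A, ∑ b, ∑ c, H b c x ^ 2 := by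
    intro A hA
    have hi : ∀ b c, Integrable (fun x => H b c x ^ 2) (volume.restrict A) := fun b c =>
      (hHL b c).integrable_sq.mono_measure (Measure.restrict_mono hA le_rfl)
    rw [integral_finsetSum _ fun b _ => integrable_finsetSum _ fun c _ => hi b c]
    exact Finset.sum_congr rfl fun b _ => (integral_finsetSum _ fun c _ => hi b c).symm
  calc ∫ x in Ω, I x ^ 2 ≤ ∑ t ∈ F, ∫ x in openHull t, I x ^ 2 := by
        refine setIntegral_le_sum F hΩ.1.measurableSet
          (fun t _ => (isOpen_openHull t).measurableSet) (fun x => sq_nonneg _)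
          (fun t ht => (mono hIL t ((hFm t).1 ht)).integrable_sq) ?_
        filter_upwards [hM.ae_exists_fine_openHull m] with x hx hxΩ
        obtain ⟨t, ht, hxt⟩ := hx (subset_closure hxΩ)
        exact ⟨t, (hFm t).2 ht, hxt⟩
    _ ≤ ∑ t ∈ F, 4 * (n + 1) ^ 2 * E * ∫ x in openHull t, ∑ b, ∑ c, H b c x ^ 2 := by
        refine Finset.sum_le_sum fun t ht => ?_
        have ht' := (hFm t).1 ht
        rw [setIntegral_congr_fun (isOpen_openHull t).measurableSet
          (fun x hx => by simp only [hI, hgrad t ht' x hx] : EqOn (fun x => I x ^ 2)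
            (fun x => (g b x - ∑ k, U t k * baryLin t k (basisVec b)) ^ 2) (openHull t))]
        refine (hU1 t ht' b).trans ?_
        rw [hHint _ (htΩ t ht')]
        refine mul_le_mul_of_nonneg_right ?_ (integral_nonneg fun x =>
          Finset.sum_nonneg fun _ _ => Finset.sum_nonneg fun _ _ => sq_nonneg _)
        exact mul_le_mul_of_nonneg_left (hGd t ht') (by positivity)
    _ = 4 * (n + 1) ^ 2 * E * ∑ t ∈ F, ∫ x in openHull t, ∑ b, ∑ c, H b c x ^ 2 :=
        (Finset.mul_sum _ _ _).symm
    -- Bounded overlap of the open fine elements replaces disjointness.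
    _ ≤ 4 * (n + 1) ^ 2 * E * (((n + 1) ^ (n + 1) : ℕ) * ∫ x in Ω, ∑ b, ∑ c, H b c x ^ 2) := by
        refine mul_le_mul_of_nonneg_left ?_ (by positivity)
        refine sum_setIntegral_le F hΩ.1.measurableSet
          (fun t _ => (isOpen_openHull t).measurableSet) (fun t ht => htΩ t ((hFm t).1 ht))
          (fun x => Finset.sum_nonneg fun _ _ => Finset.sum_nonneg fun _ _ => sq_nonneg _) hH2
          fun x _ => ?_
        have := hM.card_fine_openHull_le (m := m) hn x
        simp only [indicator_apply, Finset.sum_boole]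
        exact_mod_cast this
    _ = _ := by
        rw [hHint Ω subset_rfl]; push_cast; ring

end IsMacroMesh

end Interpolation

/-! ### Translation invariance of interior vertex functions and the stencil domains. -/

section Stencil

variable {n : ℕ} {T t : Simp n} {Ω : Set (Pt n)} {M : Finset (Simp n)} {m : ℕ}
  {K : Pt n → Matrix (Fin n) (Fin n) ℝ}

/-- The vertex functions of the interior lattice points of `T`, shifted to the origin. -/
noncomputable def refBump (T : Simp n) (m : ℕ) (y : Pt n) : ℝ :=
  max 0 (1 - gauge' (fun k => 2 ^ m * baryLin T k y))

theorem abs_baryLin_lt_of_refBump_ne_zero (h : AffineIndependent ℝ T) {y : Pt n}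
    (hy : refBump T m y ≠ 0) (k : Fin (n + 1)) : |2 ^ m * baryLin T k y| < 1 := by
  have hg : gauge' (fun k => 2 ^ m * baryLin T k y) < 1 := by
    by_contra hge
    exact hy (max_eq_left (by linarith))
  refine lt_of_le_of_lt ?_ hg
  refine abs_le_gauge' (μ := fun k => 2 ^ m * baryLin T k y) ?_ k
  rw [← Finset.mul_sum, sum_baryLin h, mul_zero]

theorem one_le_bary_of_mem_intLattice (h : AffineIndependent ℝ T) {p : Pt n}
    (hp : p ∈ intLattice T m) (k : Fin (n + 1)) : 1 ≤ 2 ^ m * bary T k p := by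
  obtain ⟨a, ha⟩ := ((mem_lattice_iff h).1 hp.1).2 k
  have h0 := (mem_openHull_iff h).1 hp.2 k
  rw [ha]
  have : (0 : ℝ) < a := by rw [← ha]; positivity
  have h1 : (0 : ℤ) < a := by exact_mod_cast this
  exact_mod_cast h1

/-- All coordinates of an interior lattice point are at least 2^(-m), and a point of the support
changes them by strictly less. -/
theorem add_mem_openHull_of_refBump (h : AffineIndependent ℝ T) {p y : Pt n}
    (hp : p ∈ intLattice T m) (hy : refBump T m y ≠ 0) : p + y ∈ openHull T := by
  rw [mem_openHull_iff h]
  intro k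
  have h1 := one_le_bary_of_mem_intLattice h hp k
  have h2 := (abs_lt.1 (abs_baryLin_lt_of_refBump_ne_zero h hy k)).1
  rw [bary_add h]
  have : 0 < 2 ^ m * (bary T k p + baryLin T k y) := by linarith
  exact pos_of_mul_pos_right this (by positivity)

theorem exists_of_mem_translations (h : AffineIndependent ℝ T) {δ : Pt n}
    (hδ : δ ∈ translations T m) : ∃ p ∈ intLattice T m,
      gauge' (fun k => 2 ^ m * baryLin T k δ) ≤ 1 ∧ ∀ k, |2 ^ m * baryLin T k δ| ≤ 1 ∧
        ∃ z : ℤ, 2 ^ m * baryLin T k δ = z := by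
  obtain ⟨t, ht, k, l, hk, rfl⟩ := hδ
  have hti := affineIndependent_of_mem_subdivision h ht
  have h1 := gauge'_relBary_vertex h (isKuhn_of_mem_subdivision ht) (vertex_mem_hull t l) k
  have e : relBary T m (t k) (t l) = fun i => 2 ^ m * baryLin T i (t l - t k) :=
    funext fun i => relBary_eq_baryLin h m _ _ i
  rw [e] at h1
  have h2 := (mem_hull_iff hti).1 (vertex_mem_hull t l) k
  have h3 : gauge' (fun i => 2 ^ m * baryLin T i (t l - t k)) ≤ 1 := by rw [h1]; linarith
  refine ⟨t k, hk, h3, fun i => ⟨le_trans ?_ h3, ?_⟩⟩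
  · refine abs_le_gauge' (μ := fun i => 2 ^ m * baryLin T i (t l - t k)) ?_ i
    rw [← Finset.mul_sum, sum_baryLin h, mul_zero]
  · obtain ⟨a, ha⟩ := ((mem_lattice_iff h).1 (vertex_mem_lattice h ht l)).2 i
    obtain ⟨b, hb⟩ := ((mem_lattice_iff h).1 (vertex_mem_lattice h ht k)).2 i
    refine ⟨a - b, ?_⟩
    rw [← bary_sub h, mul_sub, ha, hb]; push_cast; ring

theorem add_mem_lattice_of_mem_translations (h : AffineIndependent ℝ T) {δ p : Pt n}
    (hδ : δ ∈ translations T m) (hp : p ∈ intLattice T m) : p + δ ∈ lattice T m := by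
  obtain ⟨-, -, -, hδ2⟩ := exists_of_mem_translations h hδ
  rw [mem_lattice_iff h, mem_hull_iff h]
  refine ⟨fun k => ?_, fun k => ?_⟩
  · have h1 := one_le_bary_of_mem_intLattice h hp k
    have h2 := (abs_le.1 (hδ2 k).1).1
    rw [bary_add h]
    have : 0 ≤ 2 ^ m * (bary T k p + baryLin T k δ) := by linarith
    exact nonneg_of_mul_nonneg_right this (by positivity)
  · obtain ⟨a, ha⟩ := ((mem_lattice_iff h).1 hp.1).2 k
    obtain ⟨z, hz⟩ := (hδ2 k).2
    exact ⟨a + z, by rw [bary_add h, mul_add, ha, hz]; push_cast; ring⟩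

/-- The set where two vertex functions are both nonzero. -/
def overlap (M : Finset (Simp n)) (m : ℕ) (p q : Pt n) : Set (Pt n) :=
  {x | hat M m p x ≠ 0 ∧ hat M m q x ≠ 0}

/-- A vertex that does not lie on the boundary of a macro-element lies inside of one. -/
theorem exists_mem_intLattice {p : Pt n} (hp : p ∈ vertices M m) (hpb : p ∉ bdryVertices M m) :
    ∃ T ∈ M, p ∈ intLattice T m := by
  obtain ⟨T, hT, hpT⟩ := mem_vertices_iff.1 hp
  refine ⟨T, hT, hpT, ?_⟩
  by_contra hcon
  exact hpb ⟨T, hT, hpT, hcon⟩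

namespace IsMacroMesh

variable (hM : IsMacroMesh Ω M)
include hM

theorem hat_eq_refBump (hn : n ≤ 3) (hT : T ∈ M) {p x : Pt n} (hp : p ∈ lattice T m)
    (hx : x ∈ hull T) : hat M m p x = refBump T m (x - p) := by
  rw [hM.hat_eq hn hT hp hx, refBump]
  congr 3
  funext k
  exact relBary_eq_baryLin (hM.nondegenerate T hT) m p x k

/-- Inside `T` this is the gauge formula. Outside both sides vanish: the bump stays inside `T`, and
no other macro-element contains the interior point `p`. -/
theorem hat_eq_refBump_of_int (hn : n ≤ 3) (hT : T ∈ M) {p : Pt n} (hp : p ∈ intLattice T m)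
    (x : Pt n) : hat M m p x = refBump T m (x - p) := by
  have h := hM.nondegenerate T hT
  by_cases hx : x ∈ hull T
  · exact hM.hat_eq_refBump hn hT hp.1 hx
  · have h1 : refBump T m (x - p) = 0 := by
      by_contra hne
      have := add_mem_openHull_of_refBump h hp hne
      rw [add_sub_cancel] at this
      exact hx (openHull_subset_hull T this)
    rw [h1]
    by_cases hxc : x ∈ closure Ω
    · rw [hM.covers] at hxc
      simp only [mem_iUnion] at hxc
      obtain ⟨T', hT', hxT'⟩ := hxc
      refine hM.hat_eq_zero_of_notMem hT' hxT' fun hpT' => ?_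
      rw [hM.eq_of_mem_openHull hT hT' hp.2 hpT'] at hx
      exact hx hxT'
    · exact hM.hat_eq_zero_of_notMem_closure hxc

theorem refHat_eq (hn : n ≤ 3) (hT : T ∈ M) (hne : (intLattice T m).Nonempty) :
    refHat M m T = refBump T m := by
  funext y
  rw [refHat, dif_pos hne, hM.hat_eq_refBump_of_int hn hT hne.choose_spec, add_sub_cancel_right]

theorem intLattice_subset_dofs (hΩ : IsBoundedLipschitzDomain Ω) (hT : T ∈ M) {p : Pt n}
    (hp : p ∈ intLattice T m) : p ∈ dofs Ω M m := by
  classical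
  exact Finset.mem_filter.2 ⟨mem_vertices_iff.2 ⟨T, hT, hp.1⟩, hM.openHull_subset hΩ hT hp.2⟩

theorem lipschitz_refBump (hn : n ≤ 3) (hΩ : IsBoundedLipschitzDomain Ω) (hT : T ∈ M)
    (hne : (intLattice T m).Nonempty) : ∃ L, LipschitzWith L (refBump T m) := by
  obtain ⟨p, hp⟩ := hne
  obtain ⟨L, hL⟩ := hM.lipschitz_hat hn hΩ (hM.intLattice_subset_dofs hΩ hT hp)
  refine ⟨L, LipschitzWith.of_dist_le_mul fun x y => ?_⟩
  have := hL.dist_le_mul (x + p) (y + p)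
  rwa [hM.hat_eq_refBump_of_int hn hT hp, hM.hat_eq_refBump_of_int hn hT hp,
    add_sub_cancel_right, add_sub_cancel_right, dist_add_right] at this

theorem eq_of_mem_intLattice (hT : T ∈ M) {T' : Simp n} (hT' : T' ∈ M) {p : Pt n}
    (hp : p ∈ intLattice T m) (hp' : p ∈ lattice T' m) : T = T' :=
  hM.eq_of_mem_openHull hT hT' hp.2 ((mem_lattice_iff (hM.nondegenerate T' hT')).1 hp').1

/-- Two vertices with overlapping vertex functions, one of them inside of `T`, are vertices of an
element of the subdivision of `T`. -/
theorem exists_fine_of_overlap (hn : n ≤ 3) (hT : T ∈ M) {p q x : Pt n} (hp : p ∈ vertices M m)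
    (hq : q ∈ vertices M m) (hpq : p ∈ intLattice T m ∨ q ∈ intLattice T m)
    (hx : x ∈ overlap M m p q) : ∃ t ∈ subdivision T m, p ∈ range t ∧ q ∈ range t := by
  have hxc : x ∈ closure Ω := by
    by_contra hxc
    exact hx.1 (hM.hat_eq_zero_of_notMem_closure hxc)
  obtain ⟨t, ht, hxt⟩ := hM.exists_fine_mem (m := m) hxc
  have h1 := hM.mem_range_of_hat_ne_zero hn ht hp hxt hx.1
  have h2 := hM.mem_range_of_hat_ne_zero hn ht hq hxt hx.2
  obtain ⟨T', hT', htT'⟩ := mem_fineMesh_iff.1 ht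
  have hl : ∀ k, t k ∈ lattice T' m := vertex_mem_lattice (hM.nondegenerate T' hT') htT'
  have hTT' : T = T' := by
    rcases hpq with h | h
    · obtain ⟨k, rfl⟩ := h1
      exact hM.eq_of_mem_intLattice hT hT' h (hl k)
    · obtain ⟨k, rfl⟩ := h2
      exact hM.eq_of_mem_intLattice hT hT' h (hl k)
  subst hTT'
  exact ⟨t, htT', h1, h2⟩

/-- The midpoint of `p` and `p - δ` has gauge distance at most 1/2 from both, so both vertex
functions are nonzero there, and the two vertices belong to a common element. -/
theorem neg_mem_translations (hn : n ≤ 3) (hT : T ∈ M) {δ : Pt n} (hδ : δ ∈ translations T m) :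
    -δ ∈ translations T m := by
  have h := hM.nondegenerate T hT
  obtain ⟨p, hp, hg, hδ2⟩ := exists_of_mem_translations h hδ
  have hg' : gauge' (fun k => 2 ^ m * baryLin T k (-δ)) ≤ 1 := by
    have : (fun k => 2 ^ m * baryLin T k (-δ)) = fun k => -(2 ^ m * baryLin T k δ) := by
      funext k; rw [map_neg]; ring
    rw [this, gauge'_neg]; exact hg
  -- the vertex `p - δ`
  have hq : p - δ ∈ lattice T m := by
    rw [mem_lattice_iff h, mem_hull_iff h]
    refine ⟨fun k => ?_, fun k => ?_⟩
    · have h1 := one_le_bary_of_mem_intLattice h hp k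
      have h2 := (abs_le.1 (hδ2 k).1).2
      rw [sub_eq_add_neg, bary_add h, map_neg]
      have : 0 ≤ 2 ^ m * (bary T k p + -baryLin T k δ) := by linarith
      exact nonneg_of_mul_nonneg_right this (by positivity)
    · obtain ⟨a, ha⟩ := ((mem_lattice_iff h).1 hp.1).2 k
      obtain ⟨z, hz⟩ := (hδ2 k).2
      exact ⟨a - z, by rw [sub_eq_add_neg, bary_add h, map_neg, mul_add, ha, mul_neg, hz]; push_cast; ring⟩
  -- Translations have gauge at most 1, and halving makes it strictly less than 1, which is where
  -- the bump is positive.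
  have half : ∀ v : Pt n, gauge' (fun k => 2 ^ m * baryLin T k v) ≤ 1 →
      refBump T m ((1 / 2 : ℝ) • v) ≠ 0 := by
    intro v hv
    have e : (fun k => 2 ^ m * baryLin T k ((1 / 2 : ℝ) • v)) =
        fun k => (1 / 2 : ℝ) * (2 ^ m * baryLin T k v) := by
      funext k; rw [map_smul, smul_eq_mul]; ring
    rw [refBump, e, gauge'_smul _ (by norm_num)]
    have : 0 < 1 - 1 / 2 * gauge' (fun k => 2 ^ m * baryLin T k v) := by linarith
    rw [max_eq_right this.le]
    exact this.ne'
  have hx : p + (1 / 2 : ℝ) • (-δ) ∈ overlap M m p (p - δ) := by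
    have hxT := add_mem_openHull_of_refBump h hp (half _ hg')
    refine ⟨?_, ?_⟩
    · rw [hM.hat_eq_refBump_of_int hn hT hp, add_sub_cancel_left]
      exact half _ hg'
    · rw [hM.hat_eq_refBump hn hT hq (openHull_subset_hull T hxT)]
      have : p + (1 / 2 : ℝ) • (-δ) - (p - δ) = (1 / 2 : ℝ) • δ := by module
      rw [this]
      exact half _ hg
  obtain ⟨t, ht, ⟨k, hk⟩, ⟨l, hl⟩⟩ := hM.exists_fine_of_overlap hn hT
    (mem_vertices_iff.2 ⟨T, hT, hp.1⟩) (mem_vertices_iff.2 ⟨T, hT, hq⟩) (Or.inl hp) hx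
  exact ⟨t, ht, k, l, by rw [hk]; exact hp, by rw [hk, hl]; abel⟩

theorem sub_mem_translations_of_overlap (hn : n ≤ 3) (hT : T ∈ M) {p q x : Pt n}
    (hp : p ∈ vertices M m) (hq : q ∈ vertices M m) (hpq : p ∈ intLattice T m ∨ q ∈ intLattice T m)
    (hx : x ∈ overlap M m p q) : q - p ∈ translations T m := by
  obtain ⟨t, ht, ⟨k, rfl⟩, ⟨l, rfl⟩⟩ := hM.exists_fine_of_overlap hn hT hp hq hpq hx
  rcases hpq with h | h
  · exact ⟨t, ht, k, l, h, rfl⟩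
  · rw [← neg_sub]
    exact hM.neg_mem_translations hn hT ⟨t, ht, l, k, h, rfl⟩

theorem mem_lattice_of_translation (hn : n ≤ 3) (hT : T ∈ M) {p q : Pt n}
    (hpq : p ∈ intLattice T m ∨ q ∈ intLattice T m) (hδ : q - p ∈ translations T m) :
    p ∈ lattice T m ∧ q ∈ lattice T m := by
  have h := hM.nondegenerate T hT
  rcases hpq with hp | hq
  · have := add_mem_lattice_of_mem_translations h hδ hp
    rw [add_sub_cancel] at this
    exact ⟨hp.1, this⟩
  · have := add_mem_lattice_of_mem_translations h (hM.neg_mem_translations hn hT hδ) hq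
    rw [neg_sub, add_sub_cancel] at this
    exact ⟨this, hq.1⟩

theorem add_mem_openHull_of_stencilSupport (hn : n ≤ 3) (hT : T ∈ M) {p q y : Pt n}
    (hpq : p ∈ intLattice T m ∨ q ∈ intLattice T m)
    (hy : y ∈ stencilSupport M m T (q - p)) : p + y ∈ openHull T := by
  have h := hM.nondegenerate T hT
  have hne : (intLattice T m).Nonempty := hpq.elim (fun h => ⟨_, h⟩) fun h => ⟨_, h⟩
  rw [stencilSupport, mem_ofPred_eq, refHatShift, hM.refHat_eq hn hT hne] at hy
  rcases hpq with hp | hq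
  · exact add_mem_openHull_of_refBump h hp hy.1
  · have := add_mem_openHull_of_refBump h hq hy.2
    rwa [show q + (y - (q - p)) = p + y by abel] at this

theorem mem_overlap_iff (hn : n ≤ 3) (hT : T ∈ M) {p q x : Pt n}
    (hpq : p ∈ intLattice T m ∨ q ∈ intLattice T m) (hδ : q - p ∈ translations T m) :
    x ∈ overlap M m p q ↔ x - p ∈ stencilSupport M m T (q - p) := by
  have h := hM.nondegenerate T hT
  have hne : (intLattice T m).Nonempty := hpq.elim (fun h => ⟨_, h⟩) fun h => ⟨_, h⟩
  obtain ⟨hpl, hql⟩ := hM.mem_lattice_of_translation hn hT hpq hδ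
  have key : x ∈ openHull T → (x ∈ overlap M m p q ↔ x - p ∈ stencilSupport M m T (q - p)) := by
    intro hx
    rw [stencilSupport, mem_ofPred_eq, refHatShift, hM.refHat_eq hn hT hne, overlap, mem_ofPred_eq,
      hM.hat_eq_refBump hn hT hpl (openHull_subset_hull T hx),
      hM.hat_eq_refBump hn hT hql (openHull_subset_hull T hx),
      show x - p - (q - p) = x - q by abel]
  refine ⟨fun hx => (key ?_).1 hx, fun hx => (key ?_).2 hx⟩
  · rcases hpq with hp | hq
    · have h1 := hx.1
      rw [hM.hat_eq_refBump_of_int hn hT hp] at h1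
      simpa using add_mem_openHull_of_refBump h hp h1
    · have h1 := hx.2
      rw [hM.hat_eq_refBump_of_int hn hT hq] at h1
      simpa using add_mem_openHull_of_refBump h hq h1
  · simpa using hM.add_mem_openHull_of_stencilSupport hn hT hpq hx

theorem overlap_subset_openHull (hn : n ≤ 3) (hT : T ∈ M) {p q : Pt n}
    (hpq : p ∈ intLattice T m ∨ q ∈ intLattice T m) (hδ : q - p ∈ translations T m) :
    overlap M m p q ⊆ openHull T := fun x hx => by
  simpa using hM.add_mem_openHull_of_stencilSupport hn hT hpq
    ((hM.mem_overlap_iff hn hT hpq hδ).1 hx)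

/-- If only `q` is interior, `p` may lie on the boundary of `T` and outside of `T_δ`. Moving
slightly from `p` towards an interior lattice point `z` leads into `T_δ`, since both z + y and p + y
are inside of `T`. -/
theorem mem_closure_stencilDomain (hn : n ≤ 3) (hT : T ∈ M) {p q : Pt n}
    (hpq : p ∈ intLattice T m ∨ q ∈ intLattice T m) (hδ : q - p ∈ translations T m) :
    p ∈ closure (stencilDomain M m T (q - p)) := by
  have h := hM.nondegenerate T hT
  obtain ⟨z, hz, -, -⟩ := exists_of_mem_translations h hδ
  have hpl := (hM.mem_lattice_of_translation hn hT hpq hδ).1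
  have hpT := ((mem_lattice_iff h).1 hpl).1
  have hseg : ∀ ε : ℝ, 0 < ε → ε ≤ 1 → p + ε • (z - p) ∈ stencilDomain M m T (q - p) := by
    intro ε h0 h1
    have comb : ∀ {x y : Pt n}, x ∈ hull T → y ∈ openHull T → x + ε • (y - x) ∈ openHull T := by
      intro x y hx hy
      rw [mem_openHull_iff h] at hy ⊢
      rw [mem_hull_iff h] at hx
      intro k
      rw [bary_add h, map_smul, smul_eq_mul, ← bary_sub h]
      nlinarith [hx k, mul_pos h0 (hy k)]
    refine ⟨comb hpT hz.2, fun y hy => ?_⟩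
    have e : p + ε • (z - p) + y = (p + y) + ε • ((z + y) - (p + y)) := by module
    rw [e]
    refine comb (openHull_subset_hull T (hM.add_mem_openHull_of_stencilSupport hn hT hpq hy)) ?_
    refine add_mem_openHull_of_refBump h hz ?_
    rw [stencilSupport, mem_ofPred_eq, hM.refHat_eq hn hT ⟨z, hz⟩] at hy
    exact hy.1
  have hlim : Tendsto (fun ε : ℝ => p + ε • (z - p)) (𝓝[>] 0) (𝓝 p) := by
    have : Continuous fun ε : ℝ => p + ε • (z - p) := by fun_prop
    have h1 := this.tendsto 0
    simp only [zero_smul, add_zero] at h1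
    exact h1.mono_left nhdsWithin_le_nhds
  refine mem_closure_of_tendsto hlim ?_
  filter_upwards [Ioc_mem_nhdsGT (zero_lt_one' ℝ)] with ε hε
  exact hseg ε hε.1 hε.2

theorem isOpen_stencilSupport (hn : n ≤ 3) (hΩ : IsBoundedLipschitzDomain Ω) (hT : T ∈ M)
    (hne : (intLattice T m).Nonempty) (δ : Pt n) : IsOpen (stencilSupport M m T δ) := by
  obtain ⟨L, hL⟩ := hM.lipschitz_refBump (m := m) hn hΩ hT hne
  have hc := hL.continuous
  rw [stencilSupport]
  simp only [refHatShift, hM.refHat_eq hn hT hne]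
  exact (isOpen_ne_fun hc continuous_const).inter
    (isOpen_ne_fun (hc.comp (continuous_id.sub continuous_const)) continuous_const)

/-- `x + y` lies inside of `T` for `x` in the closure of `T_δ` and `y` in `Ω_δ`. -/
theorem add_mem_openHull_of_mem_closure (hn : n ≤ 3) (hΩ : IsBoundedLipschitzDomain Ω) (hT : T ∈ M)
    (hne : (intLattice T m).Nonempty) {δ x y : Pt n}
    (hx : x ∈ closure (stencilDomain M m T δ)) (hy : y ∈ stencilSupport M m T δ) :
    x + y ∈ openHull T := by
  have hopen := hM.isOpen_stencilSupport hn hΩ hT hne δ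
  have h1 : ∀ z ∈ stencilSupport M m T δ, x + z ∈ hull T := by
    intro z hz
    have hc : Continuous fun w : Pt n => w + z := by fun_prop
    have := hc.closure_preimage_subset (hull T)
    have hsub : stencilDomain M m T δ ⊆ (fun w : Pt n => w + z) ⁻¹' hull T :=
      fun w hw => openHull_subset_hull T (hw.2 z hz)
    have h2 := this (closure_mono hsub hx)
    rwa [(isCompact_hull T).isClosed.closure_eq] at h2
  -- The closure only gives x + y in the closed simplex; as `Ω_δ` is open, its translate is an open
  -- subset and hence lies in the interior.
  rw [openHull, mem_interior]
  refine ⟨(fun z => x + z) '' stencilSupport M m T δ, ?_, ?_, ⟨y, hy, rfl⟩⟩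
  · rintro _ ⟨z, hz, rfl⟩
    exact h1 z hz
  · exact (Homeomorph.addLeft x).isOpenMap _ hopen

end IsMacroMesh

end Stencil

/-! ### Stiffness entries as values of stencil functions. -/

section StencilStiffness

variable {n : ℕ} {T t : Simp n} {Ω : Set (Pt n)} {M : Finset (Simp n)} {m : ℕ}
  {K : Pt n → Matrix (Fin n) (Fin n) ℝ}

namespace IsMacroMesh

variable (hM : IsMacroMesh Ω M)
include hM

theorem fderiv_hat_eq_refBump (hn : n ≤ 3) (hT : T ∈ M) {p x : Pt n} (hp : p ∈ lattice T m)
    (hx : x ∈ openHull T) : fderiv ℝ (hat M m p) x = fderiv ℝ (refBump T m) (x - p) := by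
  have h1 : hat M m p =ᶠ[𝓝 x] fun z => refBump T m (z - p) := by
    filter_upwards [(isOpen_openHull T).mem_nhds hx] with z hz
    exact hM.hat_eq_refBump hn hT hp (openHull_subset_hull T hz)
  rw [h1.fderiv_eq, fderiv_comp_sub]

theorem stencil_eq (hn : n ≤ 3) (hΩ : IsBoundedLipschitzDomain Ω) (hT : T ∈ M)
    (hne : (intLattice T m).Nonempty) (δ x : Pt n) :
    stencil K M m T δ x = ∫ y in stencilSupport M m T δ, ∑ a, ∑ b,
      fderiv ℝ (refBump T m) (y - δ) (basisVec a) * K (x + y) a b *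
        fderiv ℝ (refBump T m) y (basisVec b) := by
  obtain ⟨L, hL⟩ := hM.lipschitz_refBump (m := m) hn hΩ hT hne
  have e : refHatShift M m T δ = fun y => refBump T m (y - δ) := by
    funext y; rw [refHatShift, hM.refHat_eq hn hT hne]
  have hL' : LipschitzWith L (refHatShift M m T δ) := by
    refine LipschitzWith.of_dist_le_mul fun y z => ?_
    rw [e]
    simpa using hL.dist_le_mul (y - δ) (z - δ)
  have hopen := hM.isOpen_stencilSupport hn hΩ hT hne δ
  rw [stencil, energyForm_eq hopen (fun a => LipschitzWith.hasWeakDeriv hL' hopen a)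
    (fun b => LipschitzWith.hasWeakDeriv (by rw [hM.refHat_eq hn hT hne]; exact hL) hopen b)]
  simp only [e, hM.refHat_eq hn hT hne, fderiv_comp_sub]

/-- Integrals over `Ω_δ` as integrals over the overlap of the supports of two vertex functions. -/
theorem setIntegral_stencilSupport (hn : n ≤ 3) (hT : T ∈ M) {p q : Pt n}
    (hpq : p ∈ intLattice T m ∨ q ∈ intLattice T m) (hδ : q - p ∈ translations T m)
    (hmeas : MeasurableSet (overlap M m p q))
    (f : (Pt n →L[ℝ] ℝ) → (Pt n →L[ℝ] ℝ) → Pt n → ℝ) :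
    ∫ y in stencilSupport M m T (q - p), f (fderiv ℝ (refBump T m) (y - (q - p)))
        (fderiv ℝ (refBump T m) y) (p + y) =
      ∫ x in overlap M m p q, f (fderiv ℝ (hat M m q) x) (fderiv ℝ (hat M m p) x) x := by
  obtain ⟨hpl, hql⟩ := hM.mem_lattice_of_translation hn hT hpq hδ
  rw [← (measurePreserving_sub_right volume p).setIntegral_preimage_emb
    (MeasurableEquiv.subRight p).measurableEmbedding]
  have e : (fun x => x - p) ⁻¹' stencilSupport M m T (q - p) = overlap M m p q :=
    ext fun x => (hM.mem_overlap_iff hn hT hpq hδ).symm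
  rw [e]
  refine setIntegral_congr_fun hmeas fun x hx => ?_
  have hxT := hM.overlap_subset_openHull hn hT hpq hδ hx
  rw [hM.fderiv_hat_eq_refBump hn hT hpl hxT, hM.fderiv_hat_eq_refBump hn hT hql hxT,
    show x - p - (q - p) = x - q by abel, add_sub_cancel]

theorem isOpen_overlap (hn : n ≤ 3) (hΩ : IsBoundedLipschitzDomain Ω) {p q : Pt n}
    (hp : p ∈ dofs Ω M m) (hq : q ∈ dofs Ω M m) : IsOpen (overlap M m p q) :=
  (isOpen_ne_fun (hM.continuous_hat hn hΩ hp) continuous_const).inter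
    (isOpen_ne_fun (hM.continuous_hat hn hΩ hq) continuous_const)

theorem overlap_subset (hn : n ≤ 3) (hΩ : IsBoundedLipschitzDomain Ω) {p q : Pt n}
    (hp : p ∈ dofs Ω M m) : overlap M m p q ⊆ Ω := fun x hx => by
  by_contra h
  exact hx.1 (hM.hat_eq_zero_off hn hΩ hp h)

/-- A zero of a nonnegative function is a minimum, so `fderiv` vanishes there, also by default at a
kink. Energy integrals thus reduce exactly to the overlap of the supports. -/
theorem fderiv_hat_of_eq_zero (hn : n ≤ 3) {p x : Pt n} (hp : p ∈ vertices M m)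
    (hx : hat M m p x = 0) : fderiv ℝ (hat M m p) x = 0 :=
  IsLocalMin.fderiv_eq_zero (Eventually.of_forall fun y => by rw [hx]; exact hM.hat_nonneg hn hp y)

theorem stiffness_eq_integral (hn : n ≤ 3) (hΩ : IsOpen Ω) {p q : Pt n}
    (hp : p ∈ vertices M m) (hq : q ∈ vertices M m) :
    stiffness Ω K M m p q = ∫ x in Ω, ∑ a, ∑ b, fderiv ℝ (hat M m q) x (basisVec a) *
      K x a b * fderiv ℝ (hat M m p) x (basisVec b) := by
  rw [stiffness, energyForm_eq hΩ (hM.hasWeakDeriv_hat hn hΩ hq) (hM.hasWeakDeriv_hat hn hΩ hp)]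

theorem stiffness_eq_overlap (hn : n ≤ 3) (hΩ : IsBoundedLipschitzDomain Ω) {p q : Pt n}
    (hp : p ∈ dofs Ω M m) (hq : q ∈ dofs Ω M m) :
    stiffness Ω K M m p q = ∫ x in overlap M m p q, ∑ a, ∑ b,
      fderiv ℝ (hat M m q) x (basisVec a) * K x a b * fderiv ℝ (hat M m p) x (basisVec b) := by
  classical
  have hp' := (Finset.mem_filter.1 hp).1
  have hq' := (Finset.mem_filter.1 hq).1
  rw [hM.stiffness_eq_integral hn hΩ.1 hp' hq']
  refine setIntegral_eq_of_subset_of_forall_sdiff_eq_zero hΩ.1.measurableSet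
    (hM.overlap_subset hn hΩ hp) fun x hx => ?_
  by_cases h : hat M m p x = 0
  · rw [hM.fderiv_hat_of_eq_zero hn hp' h]; simp
  · have h2 : hat M m q x = 0 := by
      by_contra h2
      exact hx.2 ⟨h, h2⟩
    rw [hM.fderiv_hat_of_eq_zero hn hq' h2]; simp

/-- Shifting by `p` carries the overlap of the two supports to `Ω_δ` and the two vertex functions to
the reference bump and its translate. -/
theorem stiffness_eq_stencil (hn : n ≤ 3) (hΩ : IsBoundedLipschitzDomain Ω) (hT : T ∈ M)
    {p q : Pt n} (hp : p ∈ dofs Ω M m) (hq : q ∈ dofs Ω M m)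
    (hpq : p ∈ intLattice T m ∨ q ∈ intLattice T m) (hδ : q - p ∈ translations T m) :
    stiffness Ω K M m p q = stencil K M m T (q - p) p := by
  have hne : (intLattice T m).Nonempty := hpq.elim (fun h => ⟨_, h⟩) fun h => ⟨_, h⟩
  rw [hM.stiffness_eq_overlap hn hΩ hp hq, hM.stencil_eq hn hΩ hT hne]
  exact (hM.setIntegral_stencilSupport hn hT hpq hδ (hM.isOpen_overlap hn hΩ hp hq).measurableSet
    fun A A' x => ∑ a, ∑ b, A (basisVec a) * K x a b * A' (basisVec b)).symm

theorem stiffness_eq_zero (hn : n ≤ 3) (hΩ : IsBoundedLipschitzDomain Ω) (hT : T ∈ M)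
    {p q : Pt n} (hp : p ∈ dofs Ω M m) (hq : q ∈ dofs Ω M m)
    (hpq : p ∈ intLattice T m ∨ q ∈ intLattice T m) (hδ : q - p ∉ translations T m) :
    stiffness Ω K M m p q = 0 := by
  classical
  have : overlap M m p q = ∅ := eq_empty_of_forall_notMem fun x hx =>
    hδ (hM.sub_mem_translations_of_overlap hn hT (Finset.mem_filter.1 hp).1
      (Finset.mem_filter.1 hq).1 hpq hx)
  rw [hM.stiffness_eq_overlap hn hΩ hp hq, this]
  simp

theorem stiffness_symm (hn : n ≤ 3) (hΩ : IsOpen Ω) {lam B : ℝ} (hK : IsEllipticTensor lam B Ω K)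
    {p q : Pt n} (hp : p ∈ vertices M m) (hq : q ∈ vertices M m) :
    stiffness Ω K M m p q = stiffness Ω K M m q p := by
  rw [hM.stiffness_eq_integral hn hΩ hp hq, hM.stiffness_eq_integral hn hΩ hq hp]
  refine integral_congr_ae (hK.mono fun x hx => ?_)
  simp only
  rw [Finset.sum_comm]
  refine Finset.sum_congr rfl fun a _ => Finset.sum_congr rfl fun b _ => ?_
  rw [hx.1.apply a b]; ring

end IsMacroMesh

end StencilStiffness

/-! ### Polynomial approximation of averaged coefficients. -/

section PolynomialApproximation

variable {n : ℕ}

theorem iteratedDeriv_line {w : Pt n → ℝ} (hw : ContDiff ℝ ∞ w) (z v : Pt n) (k : ℕ) (s : ℝ) :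
    iteratedDeriv k (fun s : ℝ => w (z + s • v)) s =
      ∑ α : Fin k → Fin n, (∏ i, v (α i)) * partialDeriv α w (z + s • v) := by
  have hshift : ContDiff ℝ ∞ fun y => w (z + y) := hw.comp (contDiff_const.add contDiff_id)
  have h1 := ((ContinuousLinearMap.id ℝ ℝ).smulRight v).iteratedFDeriv_comp_right
    hshift s (i := k) (by exact_mod_cast le_top)
  have e : (fun y => w (z + y)) ∘ ((ContinuousLinearMap.id ℝ ℝ).smulRight v) =
      fun s : ℝ => w (z + s • v) := by
    funext s; simp
  rw [e] at h1
  rw [iteratedDeriv_eq_iteratedFDeriv, h1, ContinuousMultilinearMap.compContinuousLinearMap_apply,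
    iteratedFDeriv_comp_add_left]
  simp only [ContinuousLinearMap.smulRight_apply, ContinuousLinearMap.id_apply, one_smul]
  conv_lhs => rw [← sum_smul_basisVec v]
  rw [ContinuousMultilinearMap.map_sum]
  refine Finset.sum_congr rfl fun α _ => ?_
  rw [ContinuousMultilinearMap.map_smul_univ, smul_eq_mul, sum_smul_basisVec]
  rfl

/-- Taylor's formula along a segment. -/
theorem abs_sub_taylor_le {w : Pt n → ℝ} (hw : ContDiff ℝ ∞ w) {z v : Pt n} {r : ℕ} {L : ℝ}
    (hL : ∀ s ∈ Icc (0 : ℝ) 1, ∀ α : Fin (r + 1) → Fin n, |partialDeriv α w (z + s • v)| ≤ L) :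
    |w (z + v) - ∑ k ∈ Finset.range (r + 1), ((k.factorial : ℝ))⁻¹ *
      ∑ α : Fin k → Fin n, (∏ i, v (α i)) * partialDeriv α w z| ≤
      L * (∑ a, |v a|) ^ (r + 1) := by
  have hf : ContDiff ℝ ∞ fun s : ℝ => w (z + s • v) := by fun_prop
  have hf' : ContDiff ℝ ((r : WithTop ℕ∞) + 1) fun s : ℝ => w (z + s • v) :=
    hf.of_le (by exact_mod_cast le_top)
  obtain ⟨s, hs, h⟩ := taylor_mean_remainder_lagrange_iteratedDeriv (n := r)
    (zero_ne_one' ℝ) hf'.contDiffOn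
  rw [uIcc_of_le zero_le_one] at h
  rw [uIoo_of_le zero_le_one] at hs
  have e : taylorWithinEval (fun s : ℝ => w (z + s • v)) r (Icc 0 1) 0 1 =
      ∑ k ∈ Finset.range (r + 1), ((k.factorial : ℝ))⁻¹ *
        ∑ α : Fin k → Fin n, (∏ i, v (α i)) * partialDeriv α w z := by
    rw [taylor_within_apply]
    refine Finset.sum_congr rfl fun k _ => ?_
    rw [iteratedDerivWithin_eq_iteratedDeriv (uniqueDiffOn_Icc zero_lt_one)
      (hf.contDiffAt.of_le (by exact_mod_cast le_top)) (by simp), iteratedDeriv_line hw]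
    simp
  rw [e, iteratedDeriv_line hw] at h
  simp only [one_smul] at h
  rw [h]
  have hL0 : ∀ α : Fin (r + 1) → Fin n, |(∏ i, v (α i)) * partialDeriv α w (z + s • v)| ≤
      (∏ i, |v (α i)|) * L := fun α => by
    rw [abs_mul, Finset.abs_prod]
    exact mul_le_mul_of_nonneg_left (hL s (Ioo_subset_Icc_self hs) α)
      (Finset.prod_nonneg fun _ _ => abs_nonneg _)
  have h2 : |∑ α : Fin (r + 1) → Fin n, (∏ i, v (α i)) * partialDeriv α w (z + s • v)| ≤
      L * (∑ a, |v a|) ^ (r + 1) := by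
    refine (Finset.abs_sum_le_sum_abs _ _).trans ((Finset.sum_le_sum fun α _ => hL0 α).trans ?_)
    rw [← Finset.sum_mul, mul_comm, Finset.sum_pow', Fintype.piFinset_univ]
  rw [sub_zero, one_pow, mul_one, abs_div, Nat.abs_cast]
  exact (div_le_self (abs_nonneg _) (Nat.one_le_cast.2 (Nat.factorial_pos _))).trans h2

/-- Lebesgue's argument: P g - g = P(g - p) - (g - p) for every polynomial p in the range. The
approximation is only needed up to every η > 0, since coefficients with weak derivatives are treated
by smoothing. -/
theorem IsPolyProjection.abs_sub_le {q : ℕ} {c : ℝ} {S : Set (Pt n)}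
    {P : (Pt n → ℝ) → (Pt n → ℝ)} (hP : IsPolyProjection q c S P) {g : Pt n → ℝ}
    (hg : ContinuousOn g S) {E : ℝ} (hE : 0 ≤ E)
    (hp : ∀ η : ℝ, 0 < η → ∃ p : MvPolynomial (Fin n) ℝ, p.totalDegree ≤ q ∧
      ∀ x ∈ S, |g x - MvPolynomial.eval (fun a => x a) p| ≤ E + η) {x : Pt n} (hx : x ∈ S) :
    |P g x - g x| ≤ (|c| + 1) * E := by
  have hc : 0 < |c| + 1 := by positivity
  refine le_of_forall_pos_le_add fun ε hε => ?_
  obtain ⟨p, hpd, hpb⟩ := hp (ε / (|c| + 1)) (by positivity)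
  have hcont : Continuous fun x : Pt n => MvPolynomial.eval (fun a => x a) p :=
    (MvPolynomial.continuous_eval p).comp (by fun_prop)
  have hsub : ContinuousOn (fun y => g y - MvPolynomial.eval (fun a => y a) p) S :=
    hg.sub hcont.continuousOn
  have h1 := hP.map_add _ _ hsub hcont.continuousOn x hx
  simp only [sub_add_cancel] at h1
  have h2 := hP.bound _ hsub _ hpb x hx
  have h3 := hP.proj p hpd x hx
  have h4 : c * (E + ε / (|c| + 1)) ≤ |c| * (E + ε / (|c| + 1)) :=
    mul_le_mul_of_nonneg_right (le_abs_self c) (by positivity)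
  have e : (|c| + 1) * E + ε = |c| * (E + ε / (|c| + 1)) + (E + ε / (|c| + 1)) := by
    field_simp
  rw [e, show P g x - g x = P (fun y => g y - MvPolynomial.eval (fun a => y a) p) x -
    (g x - MvPolynomial.eval (fun a => x a) p) by
      rw [show P g x = P (fun y => g y) x from rfl, h1, h3]; ring]
  exact (abs_sub _ _).trans (add_le_add (h2.trans h4) (hpb x hx))

/-- Functions `x ↦ ∫_D k(x + y) G(y) dy` are continuous and, up to the Taylor remainder of `k`,
polynomials. -/
theorem exists_poly_approx_integral {V D X : Set (Pt n)} (hV : IsOpen V) (hVc : Convex ℝ V)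
    (hVb : Bornology.IsBounded V) (hD : MeasurableSet D) {d L B : ℝ} {r : ℕ} (hL0 : 0 ≤ L)
    (hd : ∀ x ∈ X, ∀ x' ∈ X, ‖x - x'‖ ≤ d) (hXD : ∀ x ∈ X, ∀ y ∈ D, x + y ∈ V)
    {κ G : Pt n → ℝ} (hκ : MemLp κ 2 (volume.restrict V)) (hG : Measurable G)
    (hB : ∀ y, |G y| ≤ B)
    (hL : ∀ α : Fin (r + 1) → Fin n, ∃ g, HasWeakDeriv V α κ g ∧
      ∀ᵐ x ∂(volume.restrict V), |g x| ≤ L) :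
    (∀ x ∈ X, IntegrableOn (fun y => κ (x + y) * G y) D) ∧
    ContinuousOn (fun x => ∫ y in D, κ (x + y) * G y) X ∧
    ∀ η : ℝ, 0 < η → ∃ p : MvPolynomial (Fin n) ℝ, p.totalDegree ≤ r ∧
      ∀ x ∈ X, |(∫ y in D, κ (x + y) * G y) - MvPolynomial.eval (fun a => x a) p| ≤
        (n * d) ^ (r + 1) * L * (∫ y in D, |G y|) + η := by
  rcases X.eq_empty_or_nonempty with rfl | ⟨c, hc⟩
  · exact ⟨fun x hx => hx.elim, continuousOn_empty _, fun η _ => ⟨0, by simp, fun x hx => hx.elim⟩⟩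
  rcases D.eq_empty_or_nonempty with rfl | ⟨y₀, hy₀⟩
  · refine ⟨by simp, by simpa using continuousOn_const, fun η hη => ⟨0, by simp, fun x _ => ?_⟩⟩
    simpa using hη.le
  have hVne : V.Nonempty := ⟨_, hXD c hc y₀ hy₀⟩
  have hDb : Bornology.IsBounded D := by
    have : D ⊆ (fun z => z - c) '' V := fun y hy => ⟨c + y, hXD c hc y hy, by simp⟩
    refine Bornology.IsBounded.subset ?_ this
    obtain ⟨R, hR⟩ := hVb.exists_norm_le
    exact isBounded_iff_forall_norm_le.2 ⟨R + ‖c‖, by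
      rintro _ ⟨z, hz, rfl⟩
      exact (norm_sub_le _ _).trans (add_le_add (hR z hz) le_rfl)⟩
  have hDfin : IsFiniteMeasure (volume.restrict D) := ⟨by simpa using hDb.measure_lt_top⟩
  have hVfin : IsFiniteMeasure (volume.restrict V) := ⟨by simpa using hVb.measure_lt_top⟩
  have hB0 : 0 ≤ B := (abs_nonneg _).trans (hB 0)
  have hGint : IntegrableOn G D := Integrable.of_bound hG.aestronglyMeasurable B
    (Eventually.of_forall hB)
  have hκint : IntegrableOn κ V := hκ.integrable (by norm_num)
  -- products with `G` of translates
  have hmul : ∀ {f : Pt n → ℝ}, IntegrableOn f V → ∀ x ∈ X,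
      IntegrableOn (fun y => f (x + y)) D ∧ IntegrableOn (fun y => f (x + y) * G y) D := by
    intro f hf x hx
    have h1 : IntegrableOn (fun y => f (x + y)) D := by
      have h2 : IntegrableOn (fun y => V.indicator f (x + y)) D :=
        ((hf.integrable_indicator hV.measurableSet).comp_add_left x).integrableOn
      exact h2.congr_fun (fun y hy => indicator_of_mem (hXD x hx y hy) f) hD
    exact ⟨h1, h1.mul_bdd hG.aestronglyMeasurable (Eventually.of_forall hB)⟩
  obtain ⟨w, hw, hw2, hwb, -⟩ := exists_smooth_approx hV hVc hVb hVne hκ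
  have hwV : ∀ j, MemLp (w j) 2 (volume.restrict V) := fun j =>
    memLp_two_of_contDiff_of_bounded hVb (hw j).continuous
  have hwint : ∀ j, IntegrableOn (w j) V := fun j => (hwV j).integrable (by norm_num)
  -- By |G| ≤ B and the Cauchy–Schwarz inequality on `V` this bounds the effect of smoothing `κ`,
  -- uniformly in `x`. Uniformity gives continuity of the limit and lets the smoothing error be
  -- absorbed in `η`.
  set e : ℕ → ℝ := fun j => B * (Real.sqrt (∫ x in V, (w j x - κ x) ^ 2) *
    Real.sqrt (∫ x in V, (1 : ℝ) ^ 2)) with he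
  have he0 : Tendsto e atTop (𝓝 0) := by
    have h1 := hw2 0 ![] κ (hasWeakDeriv_of_order_zero _
      (locallyIntegrableOn_of_locallyIntegrable_restrict (hκ.locallyIntegrable (by norm_num)))) hκ
    simp only [partialDeriv_zero] at h1
    have h2 := ((Real.continuous_sqrt.tendsto 0).comp h1)
    rw [Real.sqrt_zero] at h2
    have h3 := (h2.mul_const (Real.sqrt (∫ x in V, (1 : ℝ) ^ 2))).const_mul B
    rwa [zero_mul, mul_zero] at h3
  have hdiff : ∀ j, ∀ x ∈ X,
      |(∫ y in D, κ (x + y) * G y) - ∫ y in D, w j (x + y) * G y| ≤ e j := by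
    intro j x hx
    rw [abs_sub_comm, ← integral_sub (hmul (hwint j) x hx).2 (hmul hκint x hx).2]
    have hsub : IntegrableOn (fun z => |w j z - κ z|) V := ((hwint j).sub hκint).abs
    calc _ ≤ ∫ y in D, |w j (x + y) * G y - κ (x + y) * G y| := abs_integral_le_integral_abs
      _ ≤ ∫ y in D, B * |w j (x + y) - κ (x + y)| := by
          refine integral_mono_of_nonneg (Eventually.of_forall fun _ => abs_nonneg _)
            ((hmul hsub x hx).1.const_mul B) (Eventually.of_forall fun y => ?_)
          simp only
          rw [← sub_mul, abs_mul, mul_comm]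
          exact mul_le_mul_of_nonneg_right (hB y) (abs_nonneg _)
      _ = B * ∫ y in D, |w j (x + y) - κ (x + y)| := integral_const_mul _ _
      _ ≤ B * ∫ z in V, |w j z - κ z| := mul_le_mul_of_nonneg_left
          (setIntegral_comp_add_le (f := fun z => |w j z - κ z|) hD hV.measurableSet
            (fun _ => abs_nonneg _) hsub (hXD x hx)) hB0
      _ ≤ _ := by
          refine mul_le_mul_of_nonneg_left ?_ hB0
          have h := abs_integral_mul_le ((hwV j).sub hκ).abs (memLp_const (1 : ℝ))
          simp only [mul_one, Pi.abs_apply, Pi.sub_apply, sq_abs] at h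
          exact (le_abs_self _).trans h
  have hcont : ∀ j, ContinuousOn (fun x => ∫ y in D, w j (x + y) * G y) X := by
    intro j
    obtain ⟨Cw, hCw⟩ := (hVb.isCompact_closure).exists_bound_of_continuousOn
      (hw j).continuous.continuousOn
    refine continuousOn_of_dominated (bound := fun _ => Cw * B)
      (fun x hx => (hmul (hwint j) x hx).2.aestronglyMeasurable) (fun x hx => ?_)
      (integrable_const _) (Eventually.of_forall fun y => ?_)
    · filter_upwards [ae_restrict_mem hD] with y hy
      rw [norm_mul]
      have h1 := hCw _ (subset_closure (hXD x hx y hy))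
      exact mul_le_mul h1 (hB y) (norm_nonneg _) ((norm_nonneg _).trans h1)
    · exact (((hw j).continuous.comp (continuous_id.add continuous_const)).mul
        continuous_const).continuousOn
  refine ⟨fun x hx => (hmul hκint x hx).2, ?_, fun η hη => ?_⟩
  · refine TendstoUniformlyOn.continuousOn (F := fun j x => ∫ y in D, w j (x + y) * G y)
      (p := atTop) ?_ (Frequently.of_forall hcont)
    rw [Metric.tendstoUniformlyOn_iff]
    intro ε hε
    filter_upwards [he0.eventually (gt_mem_nhds hε)] with j hj x hx
    exact (hdiff j x hx).trans_lt hj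
  · obtain ⟨j, hj⟩ := (he0.eventually (gt_mem_nhds hη)).exists
    -- Averaging preserves L^∞ bounds, so the smooth approximation satisfies the same derivative
    -- bound `L` everywhere in `V`.
    have hwL : ∀ α : Fin (r + 1) → Fin n, ∀ z ∈ V, |partialDeriv α (w j) z| ≤ L := by
      intro α z hz
      obtain ⟨g, hg, hgL⟩ := hL α
      exact hwb _ α g L hg hgL j z hz
    set b : ∀ k : ℕ, (Fin k → Fin n) → ℝ := fun k α =>
      ∫ y in D, partialDeriv α (w j) (c + y) * G y with hb
    have hbint : ∀ (k : ℕ) (α : Fin k → Fin n),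
        IntegrableOn (fun y => partialDeriv α (w j) (c + y) * G y) D := fun k α =>
      (hmul ((memLp_two_of_contDiff_of_bounded hVb
        (contDiff_partialDeriv α (hw j)).continuous).integrable (by norm_num)) c hc).2
    -- The polynomial is the Taylor polynomial of w_j(· + y) about the fixed point `c`, integrated
    -- over `y` against `G`. Convexity of `V` keeps the segments from c + y to x + y inside.
    refine ⟨∑ k ∈ Finset.range (r + 1), ∑ α : Fin k → Fin n,
      MvPolynomial.C ((k.factorial : ℝ)⁻¹ * b k α) *
        ∏ i, (MvPolynomial.X (α i) - MvPolynomial.C (c (α i))), ?_, fun x hx => ?_⟩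
    · refine MvPolynomial.totalDegree_finsetSum_le fun k hk => ?_
      refine MvPolynomial.totalDegree_finsetSum_le fun α _ => ?_
      refine (MvPolynomial.totalDegree_mul _ _).trans ?_
      rw [MvPolynomial.totalDegree_C, zero_add]
      refine (MvPolynomial.totalDegree_finsetProd _ _).trans ?_
      refine (Finset.sum_le_sum (g := fun _ => 1) fun i _ =>
        (MvPolynomial.totalDegree_sub_C_le _ _).trans_eq (MvPolynomial.totalDegree_X _)).trans ?_
      simpa using Nat.lt_succ_iff.1 (Finset.mem_range.1 hk)
    · have hv : ∑ a, |(x - c) a| ≤ n * d := by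
        refine (Finset.sum_le_sum fun a _ => (PiLp.norm_apply_le (x - c) a).trans
          (hd x hx c hc)).trans_eq ?_
        simp
      have hd0 : 0 ≤ ∑ a, |(x - c) a| := Finset.sum_nonneg fun _ _ => abs_nonneg _
      have hp : MvPolynomial.eval (fun a => x a) (∑ k ∈ Finset.range (r + 1),
          ∑ α : Fin k → Fin n, MvPolynomial.C ((k.factorial : ℝ)⁻¹ * b k α) *
            ∏ i, (MvPolynomial.X (α i) - MvPolynomial.C (c (α i)))) =
          ∫ y in D, (∑ k ∈ Finset.range (r + 1), ((k.factorial : ℝ))⁻¹ *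
            ∑ α : Fin k → Fin n, (∏ i, (x - c) (α i)) * partialDeriv α (w j) (c + y)) * G y := by
        have e1 : ∀ y, (∑ k ∈ Finset.range (r + 1), ((k.factorial : ℝ))⁻¹ *
            ∑ α : Fin k → Fin n, (∏ i, (x - c) (α i)) * partialDeriv α (w j) (c + y)) * G y =
            ∑ k ∈ Finset.range (r + 1), ∑ α : Fin k → Fin n,
              (((k.factorial : ℝ))⁻¹ * ∏ i, (x - c) (α i)) *
                (partialDeriv α (w j) (c + y) * G y) := fun y => by
          simp only [Finset.sum_mul, Finset.mul_sum]
          exact Finset.sum_congr rfl fun k _ => Finset.sum_congr rfl fun α _ => by ring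
        simp only [e1]
        rw [integral_finsetSum _ fun k _ => integrable_finsetSum _ fun α _ =>
          (hbint k α).const_mul _, map_sum]
        refine Finset.sum_congr rfl fun k _ => ?_
        rw [integral_finsetSum _ fun α _ => (hbint k α).const_mul _, map_sum]
        refine Finset.sum_congr rfl fun α _ => ?_
        rw [integral_const_mul, map_mul, MvPolynomial.eval_C, map_prod]
        simp only [map_sub, MvPolynomial.eval_X, MvPolynomial.eval_C, hb, PiLp.sub_apply]
        ring
      have hmain : |(∫ y in D, w j (x + y) * G y) - MvPolynomial.eval (fun a => x a)
          (∑ k ∈ Finset.range (r + 1), ∑ α : Fin k → Fin n,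
            MvPolynomial.C ((k.factorial : ℝ)⁻¹ * b k α) *
              ∏ i, (MvPolynomial.X (α i) - MvPolynomial.C (c (α i))))| ≤
          (n * d) ^ (r + 1) * L * ∫ y in D, |G y| := by
        have hTint : IntegrableOn (fun y => (∑ k ∈ Finset.range (r + 1), ((k.factorial : ℝ))⁻¹ *
            ∑ α : Fin k → Fin n, (∏ i, (x - c) (α i)) * partialDeriv α (w j) (c + y)) * G y) D := by
          simp only [Finset.sum_mul, Finset.mul_sum, mul_assoc]
          exact integrable_finsetSum _ fun k _ => integrable_finsetSum _ fun α _ =>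
            ((hbint k α).const_mul _).const_mul _
        rw [hp, ← integral_sub (hmul (hwint j) x hx).2 hTint, ← integral_const_mul]
        refine abs_integral_le_integral_abs.trans ?_
        refine integral_mono_of_nonneg (Eventually.of_forall fun _ => abs_nonneg _)
          (hGint.abs.const_mul _) ?_
        filter_upwards [ae_restrict_mem hD] with y hy
        rw [← sub_mul, abs_mul]
        refine mul_le_mul_of_nonneg_right ?_ (abs_nonneg _)
        have h := abs_sub_taylor_le (hw j) (z := c + y) (v := x - c) (r := r) (L := L) ?_
        · rw [show c + y + (x - c) = x + y by abel] at h
          refine h.trans ?_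
          rw [mul_comm]
          exact mul_le_mul_of_nonneg_right (pow_le_pow_left₀ hd0 hv _) hL0
        · intro s hs α
          refine hwL α _ ?_
          have := hVc (hXD c hc y hy) (hXD x hx y hy) (sub_nonneg.2 hs.2) hs.1 (by ring)
          convert this using 1
          module
      calc _ ≤ _ := abs_sub_le _ (∫ y in D, w j (x + y) * G y) _
        _ ≤ η + _ := add_le_add ((hdiff j x hx).trans hj.le) hmain
        _ = _ := add_comm _ _

end PolynomialApproximation

/-! ### The error of projected stencil functions. -/

section StencilError

variable {n : ℕ} {T t : Simp n} {Ω : Set (Pt n)} {M : Finset (Simp n)} {m : ℕ}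
  {K : Pt n → Matrix (Fin n) (Fin n) ℝ}

theorem tensorSeminorm_nonneg (k : ℕ) : 0 ≤ tensorSeminorm k Ω K :=
  Real.iSup_nonneg fun _ => Real.iSup_nonneg fun _ => Real.iSup_nonneg fun _ =>
    ENNReal.toReal_nonneg

theorem exists_hasWeakDeriv_le_tensorSeminorm (hΩ : IsOpen Ω) {k : ℕ}
    (hK : ∀ a b, MemSobolev k ⊤ Ω (fun x => K x a b)) (a b : Fin n) (α : Fin k → Fin n) :
    ∃ g, HasWeakDeriv Ω α (fun x => K x a b) g ∧
      ∀ᵐ x ∂(volume.restrict Ω), |g x| ≤ tensorSeminorm k Ω K := by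
  obtain ⟨g, hg, hgL⟩ := (hK a b).2 k le_rfl α
  refine ⟨g, hg, ?_⟩
  have hae := hg.weakDeriv_ae hΩ
  have h1 : (eLpNorm (weakDeriv Ω α (fun x => K x a b)) ⊤ (volume.restrict Ω)).toReal ≤
      tensorSeminorm k Ω K := by
    refine le_trans ?_ (le_ciSup (f := fun a => ⨆ b : Fin n, ⨆ α : Fin k → Fin n,
      (eLpNorm (weakDeriv Ω α (fun x => K x a b)) ⊤ (volume.restrict Ω)).toReal)
      (Set.finite_range _).bddAbove a)
    refine le_trans ?_ (le_ciSup (f := fun b => ⨆ α : Fin k → Fin n,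
      (eLpNorm (weakDeriv Ω α (fun x => K x a b)) ⊤ (volume.restrict Ω)).toReal)
      (Set.finite_range _).bddAbove b)
    exact le_ciSup (f := fun α : Fin k → Fin n =>
      (eLpNorm (weakDeriv Ω α (fun x => K x a b)) ⊤ (volume.restrict Ω)).toReal)
      (Set.finite_range _).bddAbove α
  rw [eLpNorm_congr_ae hae] at h1
  filter_upwards [ae_le_eLpNormEssSup (f := g) (μ := volume.restrict Ω)] with x hx
  rw [← eLpNorm_exponent_top] at hx
  have := ENNReal.toReal_mono hgL.2.ne hx
  simp only [toReal_enorm, Real.norm_eq_abs] at this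
  exact this.trans h1

namespace IsMacroMesh

variable (hM : IsMacroMesh Ω M)
include hM

/-- The error of a projected stencil function. -/
theorem abs_proj_stencil_sub_le (hn : n ≤ 3) (hΩ : IsBoundedLipschitzDomain Ω) {r q : ℕ}
    (hrq : r ≤ q) (hK : ∀ a b, MemSobolev (r + 1) ⊤ Ω (fun x => K x a b)) (hT : T ∈ M)
    {p p' : Pt n} (hp : p ∈ dofs Ω M m) (hp' : p' ∈ dofs Ω M m)
    (hpq : p ∈ intLattice T m ∨ p' ∈ intLattice T m) (hδ : p' - p ∈ translations T m)
    {cP : ℝ} {P : (Pt n → ℝ) → (Pt n → ℝ)}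
    (hP : IsPolyProjection q cP (closure (stencilDomain M m T (p' - p))) P) :
    |P (stencil K M m T (p' - p)) p - stencil K M m T (p' - p) p| ≤
      (|cP| + 1) * ((n * Metric.diam (hull T)) ^ (r + 1) * tensorSeminorm (r + 1) Ω K *
        ∫ x in overlap M m p p', (∑ a, |fderiv ℝ (hat M m p') x (basisVec a)|) *
          ∑ b, |fderiv ℝ (hat M m p) x (basisVec b)|) := by
  have hne : (intLattice T m).Nonempty := hpq.elim (fun h => ⟨_, h⟩) fun h => ⟨_, h⟩
  have hΩo := hΩ.1
  set δ := p' - p with hδdef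
  set ψ := refBump T m with hψ
  obtain ⟨Lψ, hLψ⟩ := hM.lipschitz_refBump (m := m) hn hΩ hT hne
  set d := Metric.diam (hull T) with hd
  set LK := tensorSeminorm (r + 1) Ω K with hLK
  have hLK0 : 0 ≤ LK := tensorSeminorm_nonneg _
  set D := stencilSupport M m T δ with hD
  have hDm : MeasurableSet D := (hM.isOpen_stencilSupport hn hΩ hT hne δ).measurableSet
  set X := closure (stencilDomain M m T δ) with hX
  have hbd : Bornology.IsBounded (hull T) := (isCompact_hull T).isBounded
  have hXT : X ⊆ hull T := closure_minimal (fun x hx => openHull_subset_hull T hx.1)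
    (isCompact_hull T).isClosed
  have hVb : Bornology.IsBounded (openHull T) := hbd.subset (openHull_subset_hull T)
  have hVΩ : openHull T ⊆ Ω := hM.openHull_subset hΩ hT
  have hVfin : IsFiniteMeasure (volume.restrict (openHull T)) :=
    ⟨by simpa using hVb.measure_lt_top⟩
  set G : Fin n → Fin n → Pt n → ℝ := fun a b y =>
    fderiv ℝ ψ (y - δ) (basisVec a) * fderiv ℝ ψ y (basisVec b) with hG
  have hψm : ∀ a, Measurable fun y => fderiv ℝ ψ y (basisVec a) := fun a =>
    measurable_fderiv_apply_const ℝ ψ _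
  have hψb : ∀ a y, |fderiv ℝ ψ y (basisVec a)| ≤ Lψ := fun a y => by
    refine ((fderiv ℝ ψ y).le_opNorm _).trans ?_
    simpa using norm_fderiv_le_of_lipschitz ℝ hLψ (x₀ := y)
  have hGm : ∀ a b, Measurable (G a b) := fun a b =>
    ((hψm a).comp (measurable_id.sub_const δ)).mul (hψm b)
  have hGb : ∀ a b y, |G a b y| ≤ Lψ * Lψ := fun a b y => by
    rw [hG, abs_mul]
    exact mul_le_mul (hψb a _) (hψb b _) (abs_nonneg _) Lψ.2
  -- The stencil function is a sum over the entries of K of integrals of K_ab(x + y) against the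
  -- fixed weight `G a b`; the domain of `x` has diameter at most that of `T`.
  have key := fun a b => exists_poly_approx_integral (r := r) (d := d) (L := LK) (V := openHull T)
    (D := D) (X := X) (κ := fun x => K x a b) (isOpen_openHull T) (convex_openHull T)
    hVb hDm hLK0
    (fun x hx x' hx' => by rw [← dist_eq_norm]; exact Metric.dist_le_diam_of_mem hbd (hXT hx) (hXT hx'))
    (fun x hx y hy => hM.add_mem_openHull_of_mem_closure hn hΩ hT hne hx hy)
    (((hK a b).1.mono_measure (Measure.restrict_mono hVΩ le_rfl)).mono_exponent le_top)
    (hGm a b) (hGb a b) fun α => by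
      obtain ⟨g, hg, hgL⟩ := exists_hasWeakDeriv_le_tensorSeminorm hΩo hK a b α
      exact ⟨g, hg.mono hVΩ, ae_restrict_of_ae_restrict_of_subset hVΩ hgL⟩
  have hst : ∀ x ∈ X, stencil K M m T δ x =
      ∑ a, ∑ b, ∫ y in D, K (x + y) a b * G a b y := by
    intro x hx
    rw [hM.stencil_eq hn hΩ hT hne]
    have e : ∀ y, ∑ a, ∑ b, fderiv ℝ ψ (y - δ) (basisVec a) * K (x + y) a b *
        fderiv ℝ ψ y (basisVec b) = ∑ a, ∑ b, K (x + y) a b * G a b y := fun y =>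
      Finset.sum_congr rfl fun a _ => Finset.sum_congr rfl fun b _ => by
        simp only [hG]; ring
    simp only [hψ] at e ⊢
    simp only [e]
    rw [integral_finsetSum _ fun a _ => integrable_finsetSum _ fun b _ => (key a b).1 x hx]
    exact Finset.sum_congr rfl fun a _ => integral_finsetSum _ fun b _ => (key a b).1 x hx
  have hcont : ContinuousOn (stencil K M m T δ) X :=
    (continuousOn_finsetSum _ fun a _ => continuousOn_finsetSum _ fun b _ =>
      (key a b).2.1).congr hst
  have hGint : ∀ a b, IntegrableOn (fun y => |G a b y|) D := by
    have hDb : volume D < ⊤ := by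
      have hDT : D ⊆ (fun y => p + y) ⁻¹' openHull T := fun y hy =>
        hM.add_mem_openHull_of_stencilSupport hn hT hpq hy
      refine (measure_mono hDT).trans_lt ?_
      rw [measure_preimage_add]
      exact hVb.measure_lt_top
    have : IsFiniteMeasure (volume.restrict D) := ⟨by simpa using hDb⟩
    exact fun a b => (Integrable.of_bound (hGm a b).aestronglyMeasurable (Lψ * Lψ : ℝ)
      (Eventually.of_forall (hGb a b))).abs
  -- The total mass of the weights is kept as an integral of gradients over the overlap, to be
  -- combined later with the gradients of the discrete functions at the same points.
  have hI : ∑ a, ∑ b, ∫ y in D, |G a b y| =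
      ∫ x in overlap M m p p', (∑ a, |fderiv ℝ (hat M m p') x (basisVec a)|) *
          ∑ b, |fderiv ℝ (hat M m p) x (basisVec b)| := by
    rw [← hM.setIntegral_stencilSupport hn hT hpq hδ
      (hM.isOpen_overlap hn hΩ hp hp').measurableSet
      fun A A' _ => (∑ a, |A (basisVec a)|) * ∑ b, |A' (basisVec b)|]
    simp only [Finset.sum_mul_sum, ← abs_mul]
    rw [integral_finsetSum _ fun a _ => integrable_finsetSum _ fun b _ => hGint a b]
    exact Finset.sum_congr rfl fun a _ => (integral_finsetSum _ fun b _ => hGint a b).symm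
  rw [← hI]
  refine hP.abs_sub_le hcont ?_ ?_ (hM.mem_closure_stencilDomain hn hT hpq hδ)
  · have h0 : 0 ≤ d := Metric.diam_nonneg
    have : 0 ≤ ∑ a, ∑ b, ∫ y in D, |G a b y| := Finset.sum_nonneg fun a _ =>
      Finset.sum_nonneg fun b _ => integral_nonneg fun y => abs_nonneg _
    positivity
  · intro η hη
    -- The tolerance is shared among the n² entries of K; the 1 keeps the denominator positive.
    have hη' : 0 < η / (n * n + 1) := by positivity
    choose pol hdeg hpol using fun a b => (key a b).2.2 _ hη'
    refine ⟨∑ a, ∑ b, pol a b, ?_, fun x hx => ?_⟩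
    · exact MvPolynomial.totalDegree_finsetSum_le fun a _ =>
        MvPolynomial.totalDegree_finsetSum_le fun b _ => (hdeg a b).trans hrq
    · rw [hst x hx]
      simp only [map_sum]
      rw [← Finset.sum_sub_distrib]
      simp only [← Finset.sum_sub_distrib]
      refine (Finset.abs_sum_le_sum_abs _ _).trans ((Finset.sum_le_sum fun a _ =>
        (Finset.abs_sum_le_sum_abs _ _).trans (Finset.sum_le_sum fun b _ => hpol a b x hx)).trans ?_)
      simp only [Finset.sum_add_distrib, ← Finset.mul_sum, Finset.sum_const, Finset.card_univ,
        Fintype.card_fin, nsmul_eq_mul]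
      refine add_le_add le_rfl ?_
      rw [← mul_assoc, mul_div_assoc', div_le_iff₀ (by positivity)]
      nlinarith

end IsMacroMesh

end StencilError

/-! ### Errors and symmetry of the surrogate entries. -/

section SurrogateEntries

variable {n : ℕ} {T t : Simp n} {Ω : Set (Pt n)} {M : Finset (Simp n)} {m : ℕ}
  {K : Pt n → Matrix (Fin n) (Fin n) ℝ}

theorem diam_le_meshSize (hT : T ∈ M) : Metric.diam (hull T) ≤ meshSize M :=
  le_ciSup (f := fun T : M => Metric.diam (hull T.1)) (Set.finite_range _).bddAbove ⟨T, hT⟩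

theorem meshSize_nonneg : 0 ≤ meshSize M := Real.iSup_nonneg fun _ => Metric.diam_nonneg

theorem diam_hull_pos (h : AffineIndependent ℝ T) (hn : 1 ≤ n) : 0 < Metric.diam (hull T) := by
  have h01 : T 0 ≠ T (Fin.last n) := fun e => by
    have := congrArg Fin.val (h.injective e)
    simp at this
    omega
  exact (dist_pos.2 h01).trans_le (Metric.dist_le_diam_of_mem (isCompact_hull T).isBounded
    (vertex_mem_hull T _) (vertex_mem_hull T _))

namespace IsMacroMesh

variable (hM : IsMacroMesh Ω M)
include hM

/-- Diameters and gradient bounds of the fine elements of a shape regular mesh. -/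
theorem exists_fine_size_bounds (hn1 : 1 ≤ n) {κ : ℝ} (hκ : ShapeRegular κ M) (m : ℕ) :
    ∃ d G : Simp n → ℝ, ∀ t ∈ fineMesh M m, 0 ≤ G t ∧ (∀ k l, ‖t k - t l‖ ≤ d t) ∧
      (∀ k y, |baryLin t k y| ≤ G t * ‖y‖) ∧ G t * d t = 2 * n * (n + 1) * κ ∧
      d t ≤ n * ((1 / 2) ^ m * meshSize M) := by
  have : ∀ t : Simp n, ∃ d G : ℝ, t ∈ fineMesh M m → 0 ≤ G ∧ (∀ k l, ‖t k - t l‖ ≤ d) ∧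
      (∀ k y, |baryLin t k y| ≤ G * ‖y‖) ∧ G * d = 2 * n * (n + 1) * κ ∧
      d ≤ n * ((1 / 2) ^ m * meshSize M) := by
    intro t
    by_cases ht : t ∈ fineMesh M m
    · obtain ⟨T, hT, htT⟩ := mem_fineMesh_iff.1 ht
      have h := hM.nondegenerate T hT
      have hD := diam_hull_pos h hn1
      obtain ⟨c, hc⟩ := hκ.2 T hT
      have hr : 0 < Metric.diam (hull T) / κ := div_pos hD hκ.1
      -- The diameter scales like 2^(-m) diam T and the gradients like 2^m κ / diam T, so their
      -- product depends on the shape parameter only.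
      refine ⟨n * Metric.diam (hull T) / 2 ^ m,
        2 * 2 ^ m * (n + 1) * (Metric.diam (hull T) / κ)⁻¹, fun _ =>
        ⟨by positivity, norm_fine_vertex_sub_le htT, abs_baryLin_fine_le h htT
          (abs_baryLin_le_of_closedBall h hr hc), ?_, ?_⟩⟩
      · field_simp
      · have h1 : n * Metric.diam (hull T) / 2 ^ m = n * ((1 / 2) ^ m * Metric.diam (hull T)) := by
          rw [one_div, inv_pow]; ring
        rw [h1]
        have := diam_le_meshSize hT
        gcongr
    · exact ⟨0, 0, fun h => (ht h).elim⟩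
  choose d G h using this
  exact ⟨d, G, h⟩

/-- The off-diagonal surrogate entry that belongs to a translation of `T`. -/
theorem surrogateOffDiag_eq_proj (hn : n ≤ 3) (hT : T ∈ M) {p q : Pt n}
    (hpq : p ∈ intLattice T m ∨ q ∈ intLattice T m) (hδ : q - p ∈ translations T m)
    (P : Simp n → Pt n → (Pt n → ℝ) → (Pt n → ℝ)) :
    surrogateOffDiag Ω K M m P p q = P T (q - p) (stencil K M m T (q - p)) p := by
  classical
  have hl := hM.mem_lattice_of_translation hn hT hpq hδ
  have hnb : ¬(p ∈ bdryVertices M m ∧ q ∈ bdryVertices M m) := by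
    have key : ∀ {x : Pt n}, x ∈ intLattice T m → x ∉ bdryVertices M m := by
      rintro x hx ⟨T', hT', hx1, hx2⟩
      rw [← hM.eq_of_mem_intLattice hT hT' hx hx1] at hx2
      exact hx2 hx.2
    rintro ⟨h1, h2⟩
    exact hpq.elim (fun h => key h h1) fun h => key h h2
  rw [surrogateOffDiag, if_neg hnb, Finset.sum_eq_single_of_mem T hT, if_pos ⟨hpq, hδ⟩]
  intro T' hT' hne
  rw [if_neg]
  rintro ⟨h1, -⟩
  rcases h1 with h1 | h1
  · exact hne (hM.eq_of_mem_intLattice hT' hT h1 hl.1)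
  · exact hne (hM.eq_of_mem_intLattice hT' hT h1 hl.2)

/-- Pairs on macro-boundaries are exact, translations of a macro-element give a projection error,
and for all other pairs both entries vanish. The case x = y is included, where `surrogateOffDiag` is
only a formal value. -/
theorem abs_surrogateOffDiag_sub_le (hn : n ≤ 3) (hΩ : IsBoundedLipschitzDomain Ω)
    {r q : ℕ} (hrq : r ≤ q) (hK : ∀ a b, MemSobolev (r + 1) ⊤ Ω (fun x => K x a b))
    {cP : ℝ} {P : Simp n → Pt n → (Pt n → ℝ) → (Pt n → ℝ)}
    (hP : IsProjectionFamily q cP K M m P) {x y : Pt n} (hx : x ∈ dofs Ω M m)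
    (hy : y ∈ dofs Ω M m) :
    |surrogateOffDiag Ω K M m P x y - stiffness Ω K M m x y| ≤
      (|cP| + 1) * ((n * meshSize M) ^ (r + 1) * tensorSeminorm (r + 1) Ω K *
        ∫ z in overlap M m x y, (∑ a, |fderiv ℝ (hat M m y) z (basisVec a)|) *
          ∑ b, |fderiv ℝ (hat M m x) z (basisVec b)|) := by
  classical
  have hI : 0 ≤ ∫ z in overlap M m x y, (∑ a, |fderiv ℝ (hat M m y) z (basisVec a)|) *
      ∑ b, |fderiv ℝ (hat M m x) z (basisVec b)| := integral_nonneg fun z => by positivity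
  have hLK : 0 ≤ tensorSeminorm (r + 1) Ω K := tensorSeminorm_nonneg _
  have hH := meshSize_nonneg (M := M)
  have h0 : 0 ≤ (|cP| + 1) * ((n * meshSize M) ^ (r + 1) * tensorSeminorm (r + 1) Ω K *
        ∫ z in overlap M m x y, (∑ a, |fderiv ℝ (hat M m y) z (basisVec a)|) *
          ∑ b, |fderiv ℝ (hat M m x) z (basisVec b)|) := by positivity
  by_cases hb : x ∈ bdryVertices M m ∧ y ∈ bdryVertices M m
  · rw [surrogateOffDiag, if_pos hb, sub_self, abs_zero]
    exact h0
  · have : ∃ T ∈ M, x ∈ intLattice T m ∨ y ∈ intLattice T m := by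
      by_cases h1 : x ∈ bdryVertices M m
      · obtain ⟨T, hT, h⟩ := exists_mem_intLattice (Finset.mem_filter.1 hy).1 fun h2 => hb ⟨h1, h2⟩
        exact ⟨T, hT, Or.inr h⟩
      · obtain ⟨T, hT, h⟩ := exists_mem_intLattice (Finset.mem_filter.1 hx).1 h1
        exact ⟨T, hT, Or.inl h⟩
    by_cases hex : ∃ T ∈ M, (x ∈ intLattice T m ∨ y ∈ intLattice T m) ∧ y - x ∈ translations T m
    · obtain ⟨T, hT, hxy, hδ⟩ := hex
      rw [hM.surrogateOffDiag_eq_proj hn hT hxy hδ, hM.stiffness_eq_stencil hn hΩ hT hx hy hxy hδ]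
      refine (hM.abs_proj_stencil_sub_le hn hΩ hrq hK hT hx hy hxy hδ (hP T hT _ hδ).1).trans ?_
      have := diam_le_meshSize hT
      have := Metric.diam_nonneg (s := hull T)
      gcongr
    · obtain ⟨T, hT, hxy⟩ := this
      rw [hM.stiffness_eq_zero hn hΩ hT hx hy hxy fun h => hex ⟨T, hT, hxy, h⟩, surrogateOffDiag,
        if_neg hb, Finset.sum_eq_zero fun T hT => if_neg fun h => hex ⟨T, hT, h⟩, sub_zero, abs_zero]
      exact h0

/-- The relation between the projections for `δ` and `-δ` is exactly symmetry of the projected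
entries; the true ones are symmetric because K is. -/
theorem surrogateOffDiag_symm (hn : n ≤ 3) (hΩ : IsOpen Ω)
    {lam B : ℝ} (hell : IsEllipticTensor lam B Ω K) {q : ℕ}
    {cP : ℝ} {P : Simp n → Pt n → (Pt n → ℝ) → (Pt n → ℝ)}
    (hP : IsProjectionFamily q cP K M m P) {x y : Pt n} (hx : x ∈ vertices M m)
    (hy : y ∈ vertices M m) :
    surrogateOffDiag Ω K M m P x y = surrogateOffDiag Ω K M m P y x := by
  classical
  by_cases hb : x ∈ bdryVertices M m ∧ y ∈ bdryVertices M m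
  · rw [surrogateOffDiag, if_pos hb, surrogateOffDiag, if_pos hb.symm,
      hM.stiffness_symm hn hΩ hell hx hy]
  · rw [surrogateOffDiag, if_neg hb, surrogateOffDiag, if_neg fun h => hb h.symm]
    refine Finset.sum_congr rfl fun T hT => ?_
    have hiff : y - x ∈ translations T m ↔ x - y ∈ translations T m := by
      constructor <;> intro h <;> rw [← neg_sub] <;> exact hM.neg_mem_translations hn hT h
    by_cases hc : (x ∈ intLattice T m ∨ y ∈ intLattice T m) ∧ y - x ∈ translations T m
    · rw [if_pos hc, if_pos ⟨hc.1.symm, hiff.1 hc.2⟩,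
        (hP T hT _ hc.2).2 x (hM.mem_closure_stencilDomain hn hT hc.1 hc.2), neg_sub,
        add_sub_cancel]
    · rw [if_neg hc, if_neg fun h => hc ⟨h.1.symm, hiff.2 h.2⟩]

/-- The gradient of a linear combination of vertex functions inside of a fine element. -/
theorem sum_fderiv_hat (hn : n ≤ 3) (ht : t ∈ fineMesh M m) {x : Pt n} (hx : x ∈ openHull t)
    (c : Pt n → ℝ) (y : Pt n) :
    ∑ p ∈ vertices M m, c p * fderiv ℝ (hat M m p) x y = ∑ k, c (t k) * baryLin t k y := by
  classical
  have hti := hM.fine_affineIndependent ht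
  have hsub : Finset.univ.image t ⊆ vertices M m := fun p hp => by
    obtain ⟨k, -, rfl⟩ := Finset.mem_image.1 hp
    exact hM.fine_vertex_mem ht k
  rw [← Finset.sum_subset hsub fun p hp hpt => by
    rw [hM.fderiv_hat_eq_zero hn ht hx hp (by simpa using hpt)]; simp,
    Finset.sum_image hti.injective.injOn]
  exact Finset.sum_congr rfl fun k _ => by rw [hM.fderiv_hat_vertex hn ht hx]

theorem sum_dofs_fderiv_hat (hn : n ≤ 3) (ht : t ∈ fineMesh M m) {x : Pt n} (hx : x ∈ openHull t)
    {c : Pt n → ℝ} (hc : ∀ p ∈ vertices M m, p ∉ Ω → c p = 0) (y : Pt n) :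
    ∑ p ∈ dofs Ω M m, c p * fderiv ℝ (hat M m p) x y = ∑ k, c (t k) * baryLin t k y := by
  classical
  rw [← hM.sum_fderiv_hat hn ht hx c y, dofs, Finset.sum_filter]
  refine Finset.sum_congr rfl fun p hp => ?_
  split_ifs with hpΩ
  · rfl
  · rw [hc p hp hpΩ, zero_mul]

/-- Differences of nodal values are bounded by the gradient. -/
theorem abs_nodal_sub_le (hn : n ≤ 3) (ht : t ∈ fineMesh M m) {x : Pt n} (hx : x ∈ openHull t)
    (c : Pt n → ℝ) {d : ℝ} (hd : ∀ k l, ‖t k - t l‖ ≤ d) {p q : Pt n} (hp : p ∈ dofs Ω M m)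
    (hq : q ∈ dofs Ω M m) (hpt : p ∈ range t) (hqt : q ∈ range t) :
    |c p - c q| ≤ d * ∑ a, |∑ p ∈ dofs Ω M m, c p * fderiv ℝ (hat M m p) x (basisVec a)| := by
  classical
  have hti := hM.fine_affineIndependent ht
  obtain ⟨k, rfl⟩ := hpt
  obtain ⟨l, rfl⟩ := hqt
  set A : Pt n →L[ℝ] ℝ := ∑ p ∈ dofs Ω M m, c p • fderiv ℝ (hat M m p) x with hA
  have hAy : ∀ y, A y = ∑ p ∈ dofs Ω M m, c p * fderiv ℝ (hat M m p) x y := fun y => by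
    simp [hA]
  -- The gradient is constant on the element, so the difference of nodal values is its value on an
  -- edge. Off `Ω` the coefficients are first replaced by 0, which changes nothing at `p` and `q`.
  have h1 : c (t k) - c (t l) = A (t k - t l) := by
    have h2 := hM.sum_dofs_fderiv_hat hn ht hx (c := fun p => if p ∈ Ω then c p else 0)
      (fun p _ hpΩ => if_neg hpΩ) (t k - t l)
    have h3 : ∑ p ∈ dofs Ω M m, (if p ∈ Ω then c p else 0) *
        fderiv ℝ (hat M m p) x (t k - t l) = A (t k - t l) := by
      rw [hAy]
      exact Finset.sum_congr rfl fun p hp => by rw [if_pos (Finset.mem_filter.1 hp).2]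
    rw [← h3, h2]
    simp only [← bary_sub hti, bary_vertex hti, mul_sub, Finset.sum_sub_distrib, mul_ite, mul_one,
      mul_zero, Finset.sum_ite_eq', Finset.mem_univ, if_true]
    rw [if_pos (Finset.mem_filter.1 hp).2, if_pos (Finset.mem_filter.1 hq).2]
  rw [h1, linear_eq_sum, Finset.mul_sum]
  refine (Finset.abs_sum_le_sum_abs _ _).trans (Finset.sum_le_sum fun a _ => ?_)
  rw [abs_mul, hAy]
  exact mul_le_mul_of_nonneg_right ((PiLp.norm_apply_le (t k - t l) a).trans (hd k l))
    (abs_nonneg _)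

end IsMacroMesh

end SurrogateEntries

/-! ### The surrogate form as a perturbation of the energy. -/

section Perturbation

variable {n : ℕ} {T t : Simp n} {Ω : Set (Pt n)} {M : Finset (Simp n)} {m : ℕ}
  {K : Pt n → Matrix (Fin n) (Fin n) ℝ}

/-- The gradient of the finite element function with the nodal values `v`. -/
noncomputable def nodalGrad (Ω : Set (Pt n)) (M : Finset (Simp n)) (m : ℕ) (v : Pt n → ℝ)
    (a : Fin n) (x : Pt n) : ℝ :=
  ∑ p ∈ dofs Ω M m, v p * fderiv ℝ (hat M m p) x (basisVec a)

namespace IsMacroMesh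

variable (hM : IsMacroMesh Ω M)
include hM

theorem memLp_nodalGrad (hn : n ≤ 3) (hΩ : IsBoundedLipschitzDomain Ω) (v : Pt n → ℝ)
    (a : Fin n) : MemLp (nodalGrad Ω M m v a) 2 (volume.restrict Ω) := by
  classical
  exact memLp_finsetSum _ fun p hp =>
    (hM.memLp_fderiv_hat hn hΩ.1 hΩ.2.2.1 (Finset.mem_filter.1 hp).1 a).const_mul _

/-- At each point at most `(n + 1)²` pairs of vertex functions overlap. -/
theorem sum_indicator_overlap_le (hn : n ≤ 3) {x : Pt n} (hx : x ∈ Ω) :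
    ∑ i ∈ dofs Ω M m ×ˢ dofs Ω M m, (overlap M m i.1 i.2).indicator (fun _ => (1 : ℝ)) x ≤
      (n + 1) ^ 2 := by
  classical
  obtain ⟨t, ht, hxt⟩ := hM.exists_fine_mem (m := m) (subset_closure hx)
  have hR : ∀ i ∈ dofs Ω M m ×ˢ dofs Ω M m, i ∉ Finset.univ.image t ×ˢ Finset.univ.image t →
      (overlap M m i.1 i.2).indicator (fun _ => (1 : ℝ)) x = 0 := by
    intro i hi hit
    refine indicator_of_notMem (fun hxi => hit ?_) _
    have hi' := Finset.mem_product.1 hi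
    have h1 := hM.mem_range_of_hat_ne_zero hn ht (Finset.mem_filter.1 hi'.1).1 hxt hxi.1
    have h2 := hM.mem_range_of_hat_ne_zero hn ht (Finset.mem_filter.1 hi'.2).1 hxt hxi.2
    exact Finset.mem_product.2 ⟨by simpa using h1, by simpa using h2⟩
  have hcard : (Finset.univ.image t).card ≤ n + 1 := by
    simpa using Finset.card_image_le (s := Finset.univ) (f := t)
  calc _ ≤ ∑ i ∈ Finset.univ.image t ×ˢ Finset.univ.image t, (1 : ℝ) := by
        rw [← Finset.sum_filter_add_sum_filter_not _
          (fun i => i ∈ Finset.univ.image t ×ˢ Finset.univ.image t),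
          Finset.sum_eq_zero fun i hi => hR i (Finset.mem_filter.1 hi).1 (Finset.mem_filter.1 hi).2,
          add_zero]
        refine (Finset.sum_le_sum fun i _ => indicator_le_self' (fun _ _ => zero_le_one) x).trans ?_
        exact Finset.sum_le_sum_of_subset_of_nonneg
          (fun i hi => (Finset.mem_filter.1 hi).2) fun _ _ _ => zero_le_one
    _ = ((Finset.univ.image t).card : ℝ) ^ 2 := by
        rw [Finset.sum_const, Finset.card_product, nsmul_eq_mul]
        push_cast; ring
    _ ≤ _ := by
        have : ((Finset.univ.image t).card : ℝ) ≤ n + 1 := by exact_mod_cast hcard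
        gcongr

/-- Pointwise on the overlap: each nodal difference costs one diameter times a discrete gradient,
and each ∑|∂_aφ| is at most nG. The powers of the mesh width cancel, as n·G·d = 2n²(n+1)κ. -/
theorem abs_nodal_mul_overlap_le (hn1 : 1 ≤ n) (hn : n ≤ 3) (hΩ : IsBoundedLipschitzDomain Ω)
    {κ : ℝ} (hκ : ShapeRegular κ M) (v w : Pt n → ℝ) {p q : Pt n} (hp : p ∈ dofs Ω M m)
    (hq : q ∈ dofs Ω M m) :
    (|v q - v p| * |w p - w q|) *
      ∫ x in overlap M m p q, (∑ a, |fderiv ℝ (hat M m q) x (basisVec a)|) *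
        ∑ b, |fderiv ℝ (hat M m p) x (basisVec b)| ≤
      (2 * n ^ 2 * (n + 1) * κ) ^ 2 * ∫ x in overlap M m p q,
        (∑ a, |nodalGrad Ω M m v a x|) * ∑ b, |nodalGrad Ω M m w b x| := by
  classical
  obtain ⟨d, G, hdG⟩ := hM.exists_fine_size_bounds hn1 hκ m
  have hsub := hM.overlap_subset hn hΩ hp (q := q)
  rw [← integral_const_mul, ← integral_const_mul]
  refine integral_mono_of_nonneg (Eventually.of_forall fun x => by positivity)
    (((integral_sum_abs_mul_le (fun a => hM.memLp_nodalGrad hn hΩ v a)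
      fun a => hM.memLp_nodalGrad hn hΩ w a).1.const_mul _).mono_measure
        (Measure.restrict_mono hsub le_rfl)) ?_
  filter_upwards [ae_restrict_of_ae (hM.ae_exists_fine_openHull m),
    ae_restrict_mem (hM.isOpen_overlap hn hΩ hp hq).measurableSet] with x hx hxo
  obtain ⟨t, ht, hxt⟩ := hx (subset_closure (hsub hxo))
  obtain ⟨hG0, hd, hG, hGd, -⟩ := hdG t ht
  have hpt := hM.mem_range_of_hat_ne_zero hn ht (Finset.mem_filter.1 hp).1
    (openHull_subset_hull t hxt) hxo.1
  have hqt := hM.mem_range_of_hat_ne_zero hn ht (Finset.mem_filter.1 hq).1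
    (openHull_subset_hull t hxt) hxo.2
  have h1 := hM.abs_nodal_sub_le hn ht hxt v hd hq hp hqt hpt
  have h2 := hM.abs_nodal_sub_le hn ht hxt w hd hp hq hpt hqt
  have hgrad : ∀ {z : Pt n}, z ∈ range t →
      ∑ a, |fderiv ℝ (hat M m z) x (basisVec a)| ≤ n * G t := by
    rintro _ ⟨k, rfl⟩
    refine (Finset.sum_le_sum (g := fun _ => G t) fun a _ => ?_).trans_eq (by simp)
    rw [hM.fderiv_hat_vertex hn ht hxt]
    simpa using hG k (basisVec a)
  have hS : ∀ v, 0 ≤ ∑ a, |nodalGrad Ω M m v a x| := fun v =>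
    Finset.sum_nonneg fun _ _ => abs_nonneg _
  change |v q - v p| ≤ d t * ∑ a, |nodalGrad Ω M m v a x| at h1
  change |w p - w q| ≤ d t * ∑ a, |nodalGrad Ω M m w a x| at h2
  have h3 := mul_le_mul h1 h2 (abs_nonneg _) ((abs_nonneg _).trans h1)
  have h4 := mul_le_mul (hgrad hqt) (hgrad hpt) (Finset.sum_nonneg fun _ _ => abs_nonneg _)
    (by positivity)
  refine (mul_le_mul h3 h4 (mul_nonneg (Finset.sum_nonneg fun _ _ => abs_nonneg _)
    (Finset.sum_nonneg fun _ _ => abs_nonneg _)) ((by positivity : (0 : ℝ) ≤ _).trans h3)).trans_eq ?_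
  have e : (2 * (n : ℝ) ^ 2 * (n + 1) * κ) = n * (G t * d t) := by rw [hGd]; ring
  simp only [e]
  ring

/-- The weighted sum of the differences of nodal values is bounded by the energy norms. -/
theorem sum_nodal_mul_overlap_le (hn1 : 1 ≤ n) (hn : n ≤ 3) (hΩ : IsBoundedLipschitzDomain Ω)
    {κ : ℝ} (hκ : ShapeRegular κ M) (v w : Pt n → ℝ) :
    ∑ p ∈ dofs Ω M m, ∑ q ∈ dofs Ω M m, (|v q - v p| * |w p - w q|) *
      ∫ x in overlap M m p q, (∑ a, |fderiv ℝ (hat M m q) x (basisVec a)|) *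
        ∑ b, |fderiv ℝ (hat M m p) x (basisVec b)| ≤
      (2 * n ^ 2 * (n + 1) * κ) ^ 2 * ((n + 1) ^ 2 * (n *
        (Real.sqrt (∑ a, ∫ x in Ω, nodalGrad Ω M m v a x ^ 2) *
          Real.sqrt (∑ a, ∫ x in Ω, nodalGrad Ω M m w a x ^ 2)))) := by
  obtain ⟨hint, hle⟩ := integral_sum_abs_mul_le (fun a => hM.memLp_nodalGrad (m := m) hn hΩ v a)
      fun a => hM.memLp_nodalGrad (m := m) hn hΩ w a
  have h := sum_setIntegral_le (dofs Ω M m ×ˢ dofs Ω M m) (A := Ω)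
    (B := fun i => overlap M m i.1 i.2) (N := ((n : ℝ) + 1) ^ 2) hΩ.1.measurableSet
    (fun i hi => (hM.isOpen_overlap hn hΩ (Finset.mem_product.1 hi).1
      (Finset.mem_product.1 hi).2).measurableSet)
    (fun i hi => hM.overlap_subset hn hΩ (Finset.mem_product.1 hi).1)
    (fun x => by positivity) hint (fun x hx => hM.sum_indicator_overlap_le hn hx)
  rw [Finset.sum_product] at h
  calc _ ≤ ∑ p ∈ dofs Ω M m, ∑ q ∈ dofs Ω M m, (2 * n ^ 2 * (n + 1) * κ) ^ 2 *
        ∫ x in overlap M m p q,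
          (∑ a, |nodalGrad Ω M m v a x|) * ∑ b, |nodalGrad Ω M m w b x| :=
        Finset.sum_le_sum fun p hp => Finset.sum_le_sum fun q hq =>
          hM.abs_nodal_mul_overlap_le hn1 hn hΩ hκ v w hp hq
    _ = (2 * n ^ 2 * (n + 1) * κ) ^ 2 * ∑ p ∈ dofs Ω M m, ∑ q ∈ dofs Ω M m,
        ∫ x in overlap M m p q,
          (∑ a, |nodalGrad Ω M m v a x|) * ∑ b, |nodalGrad Ω M m w b x| := by
        simp only [Finset.mul_sum]
    _ ≤ _ := mul_le_mul_of_nonneg_left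
        (h.trans (mul_le_mul_of_nonneg_left hle (by positivity))) (by positivity)

theorem sum_stiffness (hn : n ≤ 3) (hΩ : IsBoundedLipschitzDomain Ω) {lam B : ℝ}
    (hKm : ∀ a b, AEStronglyMeasurable (fun x => K x a b) (volume.restrict Ω))
    (hell : IsEllipticTensor lam B Ω K) (s : Finset (Pt n)) (hs : s ⊆ vertices M m)
    (c : Pt n → ℝ) (s' : Finset (Pt n)) (hs' : s' ⊆ vertices M m) (c' : Pt n → ℝ) :
    ∑ p ∈ s', ∑ q ∈ s, stiffness Ω K M m p q * c q * c' p =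
      ∫ x in Ω, ∑ a, ∑ b, (∑ q ∈ s, c q * fderiv ℝ (hat M m q) x (basisVec a)) * K x a b *
        ∑ p ∈ s', c' p * fderiv ℝ (hat M m p) x (basisVec b) := by
  rw [energy_sum_sum hKm hell.bound s s' c c'
    (fun q hq a => hM.memLp_fderiv_hat hn hΩ.1 hΩ.2.2.1 (hs hq) a)
    (fun p hp a => hM.memLp_fderiv_hat hn hΩ.1 hΩ.2.2.1 (hs' hp) a), Finset.sum_comm]
  refine Finset.sum_congr rfl fun q hq => Finset.sum_congr rfl fun p hp => ?_
  rw [hM.stiffness_eq_integral hn hΩ.1 (hs' hp) (hs hq)]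
  ring

/-- The stiffness matrix, extended to all vertices, has zero row sums. -/
theorem sum_stiffness_row (hn : n ≤ 3) (hΩ : IsBoundedLipschitzDomain Ω) {lam B : ℝ}
    (hKm : ∀ a b, AEStronglyMeasurable (fun x => K x a b) (volume.restrict Ω))
    (hell : IsEllipticTensor lam B Ω K) {p : Pt n} (hp : p ∈ vertices M m) :
    ∑ q ∈ vertices M m, stiffness Ω K M m p q = 0 := by
  have h := hM.sum_stiffness hn hΩ hKm hell (vertices M m) subset_rfl (fun _ => 1) {p}
    (by simpa using hp) fun _ => 1
  rw [Finset.sum_singleton] at h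
  simp only [mul_one] at h
  rw [h]
  refine (integral_congr_ae ?_).trans (integral_zero _ _)
  filter_upwards [ae_restrict_of_ae (hM.ae_exists_fine_openHull m),
    ae_restrict_mem hΩ.1.measurableSet] with x hx hxΩ
  obtain ⟨t, ht, hxt⟩ := hx (subset_closure hxΩ)
  refine Finset.sum_eq_zero fun a _ => Finset.sum_eq_zero fun b _ => ?_
  rw [hM.sum_fderiv_hat hn ht hxt (fun _ => 1)]
  simp [sum_baryLin (hM.fine_affineIndependent ht)]

/-- Since both matrices have zero row sums, the diagonal of their difference is minus the sum of its
off-diagonal entries, and the row acts on the differences v q - v p. -/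
theorem surrogateForm_eq (hn : n ≤ 3) (hΩ : IsBoundedLipschitzDomain Ω) {lam B : ℝ}
    (hKm : ∀ a b, AEStronglyMeasurable (fun x => K x a b) (volume.restrict Ω))
    (hell : IsEllipticTensor lam B Ω K) (P : Simp n → Pt n → (Pt n → ℝ) → (Pt n → ℝ))
    (v w : Pt n → ℝ) :
    surrogateForm Ω K M m P v w =
      (∫ x in Ω, ∑ a, ∑ b, nodalGrad Ω M m v a x * K x a b * nodalGrad Ω M m w b x) +
      ∑ p ∈ dofs Ω M m, ∑ q ∈ dofs Ω M m,
        (surrogateOffDiag Ω K M m P p q - stiffness Ω K M m p q) * (v q - v p) * w p := by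
  classical
  have hsub : dofs Ω M m ⊆ vertices M m := Finset.filter_subset _ _
  have h1 := hM.sum_stiffness hn hΩ hKm hell (dofs Ω M m) hsub v (dofs Ω M m) hsub w
  simp only [nodalGrad]
  rw [← h1, surrogateForm, ← Finset.sum_add_distrib]
  refine Finset.sum_congr rfl fun p hp => ?_
  have hp' := hsub hp
  set D : Pt n → ℝ := fun q => surrogateOffDiag Ω K M m P p q - stiffness Ω K M m p q with hD
  -- The term q = p may be included on the right: `surrogateOffDiag` at (p, p) minus `D p` is just
  -- the true diagonal entry, so the formal diagonal value never matters.
  have hdiag : surrogate Ω K M m P p p = surrogateOffDiag Ω K M m P p p -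
      ∑ q ∈ dofs Ω M m, D q := by
    have h0 := hM.sum_stiffness_row hn hΩ hKm hell hp'
    rw [← Finset.add_sum_erase _ _ hp'] at h0
    have h2 : ∑ q ∈ dofs Ω M m, D q = D p + ∑ y ∈ (vertices M m).erase p, if y ∈ Ω then D y else 0 := by
      rw [dofs, Finset.sum_filter, ← Finset.add_sum_erase _ _ hp',
        if_pos (Finset.mem_filter.1 hp).2]
    -- Columns of boundary vertices carry the true entries in the row sum, so they do not contribute
    -- to the difference.
    have h3 : ∑ y ∈ (vertices M m).erase p,
        (if y ∈ Ω then surrogateOffDiag Ω K M m P p y else stiffness Ω K M m p y) =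
        (∑ y ∈ (vertices M m).erase p, if y ∈ Ω then D y else 0) +
          ∑ y ∈ (vertices M m).erase p, stiffness Ω K M m p y := by
      rw [← Finset.sum_add_distrib]
      refine Finset.sum_congr rfl fun y _ => ?_
      split_ifs
      · simp [hD]
      · simp
    rw [surrogate, if_pos rfl, h3, h2]
    simp only [hD]
    linear_combination -h0
  have hrow : ∀ q, surrogate Ω K M m P p q =
      surrogateOffDiag Ω K M m P p q - if q = p then ∑ q ∈ dofs Ω M m, D q else 0 := by
    intro q
    split_ifs with hqp
    · rw [hqp, hdiag]
    · rw [surrogate, if_neg fun h => hqp h.symm, sub_zero]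
  have e : ∀ q, surrogate Ω K M m P p q * v q * w p = stiffness Ω K M m p q * v q * w p +
      (D q * v q * w p - if q = p then (∑ q ∈ dofs Ω M m, D q) * v p * w p else 0) := by
    intro q
    rw [hrow]
    split_ifs with hqp
    · rw [hqp]; simp only [hD]; ring
    · simp only [hD]; ring
  rw [Finset.sum_congr rfl fun q _ => e q, Finset.sum_add_distrib, Finset.sum_sub_distrib,
    Finset.sum_ite_eq', if_pos hp, Finset.sum_mul, Finset.sum_mul, ← Finset.sum_sub_distrib]
  congr 1
  exact Finset.sum_congr rfl fun q _ => by simp only [hD]; ring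

/-- The surrogate form differs from the true one by a term of the order of the stencil errors. -/
theorem abs_surrogateForm_sub_le (hn1 : 1 ≤ n) (hn : n ≤ 3) (hΩ : IsBoundedLipschitzDomain Ω)
    {κ : ℝ} (hκ : ShapeRegular κ M) {r q : ℕ} (hrq : r ≤ q)
    (hK : ∀ a b, MemSobolev (r + 1) ⊤ Ω (fun x => K x a b)) {lam B : ℝ}
    (hell : IsEllipticTensor lam B Ω K) {cP : ℝ}
    {P : Simp n → Pt n → (Pt n → ℝ) → (Pt n → ℝ)} (hP : IsProjectionFamily q cP K M m P)
    (v w : Pt n → ℝ) :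
    |surrogateForm Ω K M m P v w -
      ∫ x in Ω, ∑ a, ∑ b, nodalGrad Ω M m v a x * K x a b * nodalGrad Ω M m w b x| ≤
      (|cP| + 1) * n ^ (r + 1) * (2 * n ^ 2 * (n + 1) * κ) ^ 2 * (n + 1) ^ 2 * n *
        (meshSize M ^ (r + 1) * tensorSeminorm (r + 1) Ω K) *
        (Real.sqrt (∑ a, ∫ x in Ω, nodalGrad Ω M m v a x ^ 2) *
          Real.sqrt (∑ a, ∫ x in Ω, nodalGrad Ω M m w a x ^ 2)) := by
  classical
  have hsub : dofs Ω M m ⊆ vertices M m := Finset.filter_subset _ _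
  have hLK : 0 ≤ tensorSeminorm (r + 1) Ω K := tensorSeminorm_nonneg _
  have hH := meshSize_nonneg (M := M)
  set D : Pt n → Pt n → ℝ := fun x y =>
    surrogateOffDiag Ω K M m P x y - stiffness Ω K M m x y with hD
  have hDs : ∀ x ∈ dofs Ω M m, ∀ y ∈ dofs Ω M m, D x y = D y x := fun x hx y hy => by
    simp only [hD]
    rw [hM.surrogateOffDiag_symm hn hΩ.1 hell hP (hsub hx) (hsub hy),
      hM.stiffness_symm hn hΩ.1 hell (hsub hx) (hsub hy)]
  -- Exchanging x and y and averaging produces differences of `w` as well. Only with differences in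
  -- both arguments can the sum be bounded by the product of the two gradients.
  have hsymm : ∑ x ∈ dofs Ω M m, ∑ y ∈ dofs Ω M m, D x y * (v y - v x) * w x =
      1 / 2 * ∑ x ∈ dofs Ω M m, ∑ y ∈ dofs Ω M m, D x y * ((v y - v x) * (w x - w y)) := by
    have h1 : ∑ x ∈ dofs Ω M m, ∑ y ∈ dofs Ω M m, D x y * (v y - v x) * w x =
        ∑ x ∈ dofs Ω M m, ∑ y ∈ dofs Ω M m, -(D x y * (v y - v x) * w y) := by
      rw [Finset.sum_comm]
      refine Finset.sum_congr rfl fun x hx => Finset.sum_congr rfl fun y hy => ?_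
      rw [hDs y hy x hx]; ring
    have h2 : ∑ x ∈ dofs Ω M m, ∑ y ∈ dofs Ω M m, D x y * ((v y - v x) * (w x - w y)) =
        (∑ x ∈ dofs Ω M m, ∑ y ∈ dofs Ω M m, D x y * (v y - v x) * w x) +
        ∑ x ∈ dofs Ω M m, ∑ y ∈ dofs Ω M m, -(D x y * (v y - v x) * w y) := by
      simp only [← Finset.sum_add_distrib]
      exact Finset.sum_congr rfl fun x _ => Finset.sum_congr rfl fun y _ => by ring
    rw [h2, ← h1]; ring
  rw [hM.surrogateForm_eq hn hΩ (fun a b => (hK a b).1.aestronglyMeasurable) hell P v w,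
    add_sub_cancel_left]
  change |∑ x ∈ dofs Ω M m, ∑ y ∈ dofs Ω M m, D x y * (v y - v x) * w x| ≤ _
  rw [hsymm]
  set Q : ℝ := (|cP| + 1) * ((n * meshSize M) ^ (r + 1) * tensorSeminorm (r + 1) Ω K) with hQ
  have hQ0 : 0 ≤ Q := by positivity
  have hsum := hM.sum_nodal_mul_overlap_le (m := m) hn1 hn hΩ hκ v w
  have hle : |∑ x ∈ dofs Ω M m, ∑ y ∈ dofs Ω M m, D x y * ((v y - v x) * (w x - w y))| ≤
      Q * ∑ x ∈ dofs Ω M m, ∑ y ∈ dofs Ω M m, (|v y - v x| * |w x - w y|) *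
        ∫ z in overlap M m x y, (∑ a, |fderiv ℝ (hat M m y) z (basisVec a)|) *
          ∑ b, |fderiv ℝ (hat M m x) z (basisVec b)| := by
    rw [Finset.mul_sum]
    refine (Finset.abs_sum_le_sum_abs _ _).trans (Finset.sum_le_sum fun x hx => ?_)
    rw [Finset.mul_sum]
    refine (Finset.abs_sum_le_sum_abs _ _).trans (Finset.sum_le_sum fun y hy => ?_)
    rw [abs_mul, abs_mul]
    refine (mul_le_mul_of_nonneg_right (hM.abs_surrogateOffDiag_sub_le hn hΩ hrq hK hP hx hy)
      (by positivity)).trans_eq ?_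
    rw [hQ]; ring
  have h0 := hle.trans (mul_le_mul_of_nonneg_left hsum hQ0)
  rw [abs_mul, abs_of_pos (by norm_num : (0 : ℝ) < 1 / 2)]
  have habs := abs_nonneg
    (∑ x ∈ dofs Ω M m, ∑ y ∈ dofs Ω M m, D x y * ((v y - v x) * (w x - w y)))
  -- The factor ½ is dropped.
  refine (mul_le_of_le_one_left habs (by norm_num)).trans (h0.trans_eq ?_)
  rw [hQ, mul_pow]; ring

end IsMacroMesh

end Perturbation

/-! ### Coercivity, solvability and Strang's lemma. -/

section Convergence

variable {n : ℕ} {T t : Simp n} {Ω : Set (Pt n)} {M : Finset (Simp n)} {m : ℕ}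
  {K : Pt n → Matrix (Fin n) (Fin n) ℝ} {P : Simp n → Pt n → (Pt n → ℝ) → (Pt n → ℝ)}
  {f u v w : Pt n → ℝ} {lam B ε : ℝ}

/-- The `L²`-norm of a vector field. -/
noncomputable def gradNorm (Ω : Set (Pt n)) (ξ : Fin n → Pt n → ℝ) : ℝ :=
  Real.sqrt (∑ a, ∫ x in Ω, ξ a x ^ 2)

theorem gradNorm_nonneg (ξ : Fin n → Pt n → ℝ) : 0 ≤ gradNorm Ω ξ := Real.sqrt_nonneg _

theorem gradNorm_sq (ξ : Fin n → Pt n → ℝ) : gradNorm Ω ξ ^ 2 = ∑ a, ∫ x in Ω, ξ a x ^ 2 :=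
  Real.sq_sqrt (Finset.sum_nonneg fun _ _ => integral_nonneg fun _ => sq_nonneg _)

theorem gradNorm_add_le {ξ ζ : Fin n → Pt n → ℝ} (hξ : ∀ a, MemLp (ξ a) 2 (volume.restrict Ω))
    (hζ : ∀ a, MemLp (ζ a) 2 (volume.restrict Ω)) :
    gradNorm Ω (fun a x => ξ a x + ζ a x) ≤ 2 * (gradNorm Ω ξ + gradNorm Ω ζ) := by
  have h1 := gradNorm_nonneg (Ω := Ω) ξ
  have h2 := gradNorm_nonneg (Ω := Ω) ζ
  refine abs_le_of_sq_le_sq' ?_ (by positivity) |>.2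
  have h : gradNorm Ω (fun a x => ξ a x + ζ a x) ^ 2 ≤ 2 * gradNorm Ω ξ ^ 2 + 2 * gradNorm Ω ζ ^ 2 := by
    rw [gradNorm_sq, gradNorm_sq, gradNorm_sq, Finset.mul_sum, Finset.mul_sum,
      ← Finset.sum_add_distrib]
    exact Finset.sum_le_sum fun a _ => integral_add_sq_le (hξ a) (hζ a)
  nlinarith [mul_nonneg h1 h2]

theorem hSeminorm_two_sq (Ω : Set (Pt n)) (v : Pt n → ℝ) :
    hSeminorm 2 Ω v ^ 2 = ∑ b, ∑ c, ∫ x in Ω, weakDeriv Ω ![b, c] v x ^ 2 := by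
  rw [hSeminorm, Real.sq_sqrt (Finset.sum_nonneg fun α _ => integral_nonneg fun x => sq_nonneg _),
    ← Fintype.sum_prod_type' fun b c => ∫ x in Ω, weakDeriv Ω ![b, c] v x ^ 2]
  exact Fintype.sum_equiv (finTwoArrowEquiv (Fin n)) _ _ fun α => by
    congr 1; funext x; congr 2; funext i; fin_cases i <;> rfl

theorem nodalGrad_sub (v w : Pt n → ℝ) (a : Fin n) (x : Pt n) :
    nodalGrad Ω M m (fun p => v p - w p) a x = nodalGrad Ω M m v a x - nodalGrad Ω M m w a x := by
  simp only [nodalGrad, sub_mul, Finset.sum_sub_distrib]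

theorem surrogateForm_sub_left (v v' w : Pt n → ℝ) :
    surrogateForm Ω K M m P (fun p => v p - v' p) w =
      surrogateForm Ω K M m P v w - surrogateForm Ω K M m P v' w := by
  simp only [surrogateForm, mul_sub, sub_mul, Finset.sum_sub_distrib]

theorem surrogateForm_congr_right {w w' : Pt n → ℝ} (h : ∀ p ∈ dofs Ω M m, w p = w' p)
    (v : Pt n → ℝ) : surrogateForm Ω K M m P v w = surrogateForm Ω K M m P v w' :=
  Finset.sum_congr rfl fun p hp => by simp only [h p hp]

namespace IsMacroMesh

variable (hM : IsMacroMesh Ω M)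
include hM

/-- A finite element function with vanishing gradient vanishes. -/
theorem nodal_eq_zero (hn1 : 1 ≤ n) (hn : n ≤ 3) (hΩ : IsBoundedLipschitzDomain Ω)
    (h : gradNorm Ω (nodalGrad Ω M m v) = 0) {p : Pt n} (hp : p ∈ dofs Ω M m) : v p = 0 := by
  classical
  set V : Pt n → ℝ := fun x => ∑ p ∈ dofs Ω M m, v p * hat M m p x with hV
  have hVh := hM.memVh_sum (m := m) hn hΩ v
  obtain ⟨R, hR⟩ := hΩ.2.2.1.exists_norm_le
  have hgrad := hM.hasWeakDeriv_sum_hat (m := m) hn hΩ.1 v ⟨0, hn1⟩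
  have hpoin := hVh.1.poincare hΩ.1 hR hgrad
  have hz : ∫ x in Ω, nodalGrad Ω M m v ⟨0, hn1⟩ x ^ 2 = 0 := by
    have h2 := gradNorm_sq (Ω := Ω) (nodalGrad Ω M m v)
    rw [h, zero_pow two_ne_zero] at h2
    exact (Finset.sum_eq_zero_iff_of_nonneg fun a _ => integral_nonneg fun x => sq_nonneg _).1
      h2.symm _ (Finset.mem_univ _)
  simp only [nodalGrad] at hz
  rw [hz, mul_zero] at hpoin
  have h0 : ∫ x in Ω, V x ^ 2 = 0 := le_antisymm hpoin (integral_nonneg fun x => sq_nonneg _)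
  rw [integral_eq_zero_iff_of_nonneg (fun x => sq_nonneg _) hVh.1.1.1.integrable_sq] at h0
  have hae : V =ᵐ[volume.restrict Ω] fun _ => 0 := h0.mono fun x hx => by
    simpa using hx
  -- Poincaré's inequality only gives zero almost everywhere; continuity makes it pointwise, in
  -- particular at the vertices.
  have hEq := Measure.eqOn_open_of_ae_eq hae hΩ.1 hVh.2.1.continuousOn continuousOn_const
  have := hEq (Finset.mem_filter.1 hp).2
  exact (hM.sum_hat_dofs hn hp v).symm.trans this

/-- Coercivity of a small perturbation of the energy. -/
theorem surrogateForm_coercive (hn : n ≤ 3) (hΩ : IsBoundedLipschitzDomain Ω)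
    (hKm : ∀ a b, AEStronglyMeasurable (fun x => K x a b) (volume.restrict Ω))
    (hell : IsEllipticTensor lam B Ω K) (hε : ε ≤ lam / 2)
    (hpert : ∀ v w, |surrogateForm Ω K M m P v w -
      ∫ x in Ω, ∑ a, ∑ b, nodalGrad Ω M m v a x * K x a b * nodalGrad Ω M m w b x| ≤
      ε * (gradNorm Ω (nodalGrad Ω M m v) * gradNorm Ω (nodalGrad Ω M m w))) (v : Pt n → ℝ) :
    lam / 2 * gradNorm Ω (nodalGrad Ω M m v) ^ 2 ≤ surrogateForm Ω K M m P v v := by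
  have h1 := le_energy hKm hell.bound hell.coercive fun a => hM.memLp_nodalGrad (m := m) hn hΩ v a
  rw [← gradNorm_sq] at h1
  have h2 := (abs_le.1 (hpert v v)).1
  have h3 := mul_le_mul_of_nonneg_right hε (sq_nonneg (gradNorm Ω (nodalGrad Ω M m v)))
  nlinarith

/-- In nodal coordinates this is a square linear system, and coercivity makes its matrix injective.
Uniqueness follows by testing with the difference of two solutions. -/
theorem existsUnique_surrogateSolution (hn1 : 1 ≤ n) (hn : n ≤ 3)
    (hΩ : IsBoundedLipschitzDomain Ω) (hlam : 0 < lam)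
    (hco : ∀ v, lam / 2 * gradNorm Ω (nodalGrad Ω M m v) ^ 2 ≤ surrogateForm Ω K M m P v v)
    (hf : MemLp f 2 (volume.restrict Ω)) : ∃! ut, IsSurrogateSolution Ω K M m P f ut := by
  classical
  have hzero : ∀ v, surrogateForm Ω K M m P v v = 0 → ∀ p ∈ dofs Ω M m, v p = 0 := by
    intro v hv p hp
    refine hM.nodal_eq_zero hn1 hn hΩ ?_ hp
    have h1 := hco v
    rw [hv] at h1
    have h2 := sq_nonneg (gradNorm Ω (nodalGrad Ω M m v))
    exact pow_eq_zero_iff two_ne_zero |>.1 (by nlinarith)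
  -- the linear system
  let ext : (dofs Ω M m → ℝ) → Pt n → ℝ := fun c p => if h : p ∈ dofs Ω M m then c ⟨p, h⟩ else 0
  have hext : ∀ c (p : dofs Ω M m), ext c p = c p := fun c p => dif_pos p.2
  let S : (dofs Ω M m → ℝ) →ₗ[ℝ] (dofs Ω M m → ℝ) :=
    Matrix.toLin' (Matrix.of fun p q : dofs Ω M m => surrogate Ω K M m P p.1 q.1)
  have hS : ∀ c p, S c p = ∑ q ∈ dofs Ω M m, surrogate Ω K M m P p.1 q * ext c q := by
    intro c p
    rw [← Finset.sum_coe_sort]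
    simp only [S, Matrix.toLin'_apply, Matrix.mulVec, dotProduct, Matrix.of_apply, hext]
  have hform : ∀ c w, surrogateForm Ω K M m P (ext c) w =
      ∑ p ∈ dofs Ω M m, ext (S c) p * w p := by
    intro c w
    refine Finset.sum_congr rfl fun p hp => ?_
    rw [← Finset.sum_mul, hext (S c) ⟨p, hp⟩, hS]
  have hinj : Function.Injective S := by
    rw [injective_iff_map_eq_zero]
    intro c hc
    have : surrogateForm Ω K M m P (ext c) (ext c) = 0 := by
      rw [hform, hc]
      exact Finset.sum_eq_zero fun p hp => by rw [hext 0 ⟨p, hp⟩]; simp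
    funext p
    rw [← hext c p]
    exact hzero _ this p p.2
  obtain ⟨c, hc⟩ := (LinearMap.injective_iff_surjective.1 hinj)
    fun p => ∫ x in Ω, f x * hat M m p.1 x
  have hnodal : ∀ c : Pt n → ℝ, ∀ p ∈ dofs Ω M m,
      ∑ q ∈ dofs Ω M m, c q * hat M m q p = c p := fun c p hp => hM.sum_hat_dofs hn hp c
  have hleft : ∀ {v v' : Pt n → ℝ}, (∀ p ∈ dofs Ω M m, v p = v' p) → ∀ w,
      surrogateForm Ω K M m P v w = surrogateForm Ω K M m P v' w := fun h w =>
    Finset.sum_congr rfl fun p _ => Finset.sum_congr rfl fun q hq => by simp only [h q hq]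
  have hsol : ∀ c' : Pt n → ℝ, surrogateForm Ω K M m P (ext c)
      (fun x => ∑ p ∈ dofs Ω M m, c' p * hat M m p x) =
      ∫ x in Ω, f x * ∑ p ∈ dofs Ω M m, c' p * hat M m p x := by
    intro c'
    have hint : ∀ p ∈ dofs Ω M m, Integrable (fun x => c' p * (f x * hat M m p x))
        (volume.restrict Ω) := fun p hp =>
      (hf.integrable_mul (hM.memH10_hat hn hΩ hp).1.1).const_mul _
    have e : ∀ x, f x * ∑ p ∈ dofs Ω M m, c' p * hat M m p x =
        ∑ p ∈ dofs Ω M m, c' p * (f x * hat M m p x) := fun x => by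
      rw [Finset.mul_sum]
      exact Finset.sum_congr rfl fun p _ => by ring
    simp only [e]
    rw [integral_finsetSum _ hint, hform, hc]
    refine Finset.sum_congr rfl fun p hp => ?_
    rw [hnodal c' p hp, integral_const_mul, mul_comm]
    congr 1
    exact hext (fun p => ∫ x in Ω, f x * hat M m p.1 x) ⟨p, hp⟩
  refine ⟨fun x => ∑ p ∈ dofs Ω M m, ext c p * hat M m p x, ⟨hM.memVh_sum hn hΩ _, fun v hv => ?_⟩,
    fun ut hut => ?_⟩
  · rw [hleft (hnodal (ext c)), hM.eq_sum_hat_of_memVh hn hΩ hv]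
    exact hsol v
  · set W : Pt n → ℝ := fun x => ∑ p ∈ dofs Ω M m, (ut p - ext c p) * hat M m p x with hW
    have h1 := hut.2 W (hM.memVh_sum hn hΩ _)
    have h2 : surrogateForm Ω K M m P (ext c) W = ∫ x in Ω, f x * W x :=
      hsol fun p => ut p - ext c p
    have h3 : surrogateForm Ω K M m P (fun p => ut p - ext c p) (fun p => ut p - ext c p) = 0 := by
      rw [← surrogateForm_congr_right (w := W) fun p hp => hnodal (fun p => ut p - ext c p) p hp,
        surrogateForm_sub_left, h1, h2, sub_self]
    have h4 := hzero _ h3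
    rw [hM.eq_sum_hat_of_memVh hn hΩ hut.1]
    funext x
    exact Finset.sum_congr rfl fun p hp => by rw [sub_eq_zero.1 (h4 p hp)]

/-- Strang's lemma. -/
theorem gradNorm_sub_surrogateSolution_le (hn : n ≤ 3) (hΩ : IsBoundedLipschitzDomain Ω)
    (hlam : 0 < lam) (hB : 0 ≤ B)
    (hKm : ∀ a b, AEStronglyMeasurable (fun x => K x a b) (volume.restrict Ω))
    (hell : IsEllipticTensor lam B Ω K) (hε0 : 0 ≤ ε) (hε : ε ≤ lam / 2)
    (hpert : ∀ v w, |surrogateForm Ω K M m P v w -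
      ∫ x in Ω, ∑ a, ∑ b, nodalGrad Ω M m v a x * K x a b * nodalGrad Ω M m w b x| ≤
      ε * (gradNorm Ω (nodalGrad Ω M m v) * gradNorm Ω (nodalGrad Ω M m w)))
    (hu : IsWeakSolution Ω K f u) {g : Fin n → Pt n → ℝ} (hg : ∀ a, HasWeakDeriv Ω ![a] u (g a))
    (hgL : ∀ a, MemLp (g a) 2 (volume.restrict Ω)) {ut : Pt n → ℝ}
    (hut : IsSurrogateSolution Ω K M m P f ut) (c : Pt n → ℝ) {η : ℝ}
    (hη : gradNorm Ω (fun a x => g a x - nodalGrad Ω M m c a x) ≤ η) :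
    gradNorm Ω (fun a x => g a x - nodalGrad Ω M m ut a x) ≤
      2 * (η + 2 / lam * (n * B * η + ε * (2 * (gradNorm Ω g + η)))) := by
  classical
  have hN := fun v a => hM.memLp_nodalGrad (m := m) hn hΩ v a
  have hρL : ∀ a, MemLp (fun x => g a x - nodalGrad Ω M m c a x) 2 (volume.restrict Ω) :=
    fun a => (hgL a).sub (hN c a)
  have hη0 : 0 ≤ η := (gradNorm_nonneg _).trans hη
  set e : Pt n → ℝ := fun p => ut p - c p with he
  set E : Pt n → ℝ := fun x => ∑ p ∈ dofs Ω M m, e p * hat M m p x with hE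
  have hEV : MemVh Ω M m E := hM.memVh_sum hn hΩ e
  have hEe : ∀ p ∈ dofs Ω M m, E p = e p := fun p hp => hM.sum_hat_dofs hn hp e
  set N := gradNorm Ω (nodalGrad Ω M m e) with hNe
  have hN0 : 0 ≤ N := gradNorm_nonneg _
  -- Both problems have the same right-hand side F, and `E` is admissible in both: ã(ũ, e) = F(e) =
  -- a(u, e).
  have hweak : surrogateForm Ω K M m P ut e =
      ∫ x in Ω, ∑ a, ∑ b, g a x * K x a b * nodalGrad Ω M m e b x := by
    rw [← surrogateForm_congr_right hEe, hut.2 E hEV, ← hu.2 E hEV.1,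
      energyForm_eq hΩ.1 hg (hM.hasWeakDeriv_sum_hat hn hΩ.1 e)]
    rfl
  have hsplit : (∫ x in Ω, ∑ a, ∑ b, g a x * K x a b * nodalGrad Ω M m e b x) -
      ∫ x in Ω, ∑ a, ∑ b, nodalGrad Ω M m c a x * K x a b * nodalGrad Ω M m e b x =
      ∫ x in Ω, ∑ a, ∑ b, (g a x - nodalGrad Ω M m c a x) * K x a b * nodalGrad Ω M m e b x := by
    rw [← integral_sub (integrable_energy hKm hell.bound hgL (hN e))
      (integrable_energy hKm hell.bound (hN c) (hN e))]
    refine integral_congr_ae (Eventually.of_forall fun x => ?_)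
    simp only [← Finset.sum_sub_distrib, sub_mul]
  have h1 : |∫ x in Ω, ∑ a, ∑ b, (g a x - nodalGrad Ω M m c a x) * K x a b *
      nodalGrad Ω M m e b x| ≤ n * B * (η * N) := by
    refine (abs_energy_le hKm hB hell.bound hρL (hN e)).trans ?_
    refine mul_le_mul_of_nonneg_left (mul_le_mul_of_nonneg_right hη hN0) (by positivity)
  -- The consistency error involves the gradient of the interpolant, which is traded for that of `u`
  -- and the approximation error.
  have hNc : gradNorm Ω (nodalGrad Ω M m c) ≤ 2 * (gradNorm Ω g + η) := by
    have h := gradNorm_add_le (ζ := fun a x => -(g a x - nodalGrad Ω M m c a x)) hgL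
      fun a => (hρL a).neg
    have e1 : (fun (a : Fin n) x => g a x + -(g a x - nodalGrad Ω M m c a x)) =
        nodalGrad Ω M m c := by
      funext a x; ring
    have e2 : gradNorm Ω (fun a x => -(g a x - nodalGrad Ω M m c a x)) =
        gradNorm Ω (fun a x => g a x - nodalGrad Ω M m c a x) := by
      simp only [gradNorm, neg_sq]
    rw [e1, e2] at h
    linarith
  have h2 := hpert c e
  have hco := hM.surrogateForm_coercive hn hΩ hKm hell hε hpert e
  have hee : surrogateForm Ω K M m P e e =
      surrogateForm Ω K M m P ut e - surrogateForm Ω K M m P c e := surrogateForm_sub_left _ _ _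
  have hX : ε * (gradNorm Ω (nodalGrad Ω M m c) * N) ≤ ε * (2 * (gradNorm Ω g + η)) * N := by
    rw [mul_assoc]
    exact mul_le_mul_of_nonneg_left (mul_le_mul_of_nonneg_right hNc hN0) hε0
  have hmain : lam / 2 * N ^ 2 ≤ (n * B * η + ε * (2 * (gradNorm Ω g + η))) * N := by
    have h3 := (abs_le.1 h1).2
    have h4 := (abs_le.1 h2).1
    have h5 : lam / 2 * N ^ 2 ≤ n * B * (η * N) + ε * (gradNorm Ω (nodalGrad Ω M m c) * N) := by
      linarith
    linarith
  -- Coercivity at e = ũ - c gives a quadratic inequality in `N`; it is divided by `N`, the case N =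
  -- 0 being trivial.
  have hNle : N ≤ 2 / lam * (n * B * η + ε * (2 * (gradNorm Ω g + η))) := by
    rcases hN0.eq_or_lt with h0 | h0
    · rw [← h0]
      have := gradNorm_nonneg (Ω := Ω) g
      positivity
    · have : lam / 2 * N ≤ n * B * η + ε * (2 * (gradNorm Ω g + η)) := by
        refine le_of_mul_le_mul_right ?_ h0
        linarith
      calc N = 2 / lam * (lam / 2 * N) := by field_simp
        _ ≤ _ := mul_le_mul_of_nonneg_left this (by positivity)
  have h := gradNorm_add_le (ζ := fun a x => -(nodalGrad Ω M m e a x)) hρL fun a => (hN e a).neg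
  have e1 : (fun (a : Fin n) x => g a x - nodalGrad Ω M m c a x + -(nodalGrad Ω M m e a x)) =
      fun a x => g a x - nodalGrad Ω M m ut a x := by
    funext a x
    rw [he, nodalGrad_sub]; ring
  have e2 : gradNorm Ω (fun a x => -(nodalGrad Ω M m e a x)) = N := by
    rw [hNe]
    simp only [gradNorm, neg_sq]
  rw [e1, e2] at h
  refine h.trans ?_
  gcongr

/-- The error of a surrogate solution in the `H¹`-norm, by its gradient. -/
theorem h1Norm_sub_le (hn1 : 1 ≤ n) (hn : n ≤ 3) (hΩ : IsBoundedLipschitzDomain Ω) {R : ℝ}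
    (hR : ∀ x ∈ Ω, ‖x‖ ≤ R) (hu : MemH10 Ω u) {g : Fin n → Pt n → ℝ}
    (hg : ∀ a, HasWeakDeriv Ω ![a] u (g a)) {ut : Pt n → ℝ} (hut : MemVh Ω M m ut) :
    h1Norm Ω (fun x => u x - ut x) ≤ Real.sqrt (4 * R ^ 2 + 1) *
      gradNorm Ω (fun a x => g a x - nodalGrad Ω M m ut a x) := by
  have hd : ∀ a, HasWeakDeriv Ω ![a] (fun x => u x - ut x)
      (fun x => g a x - nodalGrad Ω M m ut a x) := by
    intro a
    have h0 := hM.hasWeakDeriv_sum_hat (m := m) hn hΩ.1 ut a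
    rw [← hM.eq_sum_hat_of_memVh hn hΩ hut] at h0
    have h := (hg a).lincomb h0 1 (-1)
    simp only [one_mul, neg_one_mul, ← sub_eq_add_neg] at h
    exact h
  have hH : MemH10 Ω (fun x => u x - ut x) := by
    simpa only [one_mul, neg_one_mul, ← sub_eq_add_neg] using hu.lincomb hΩ.1 hut.1 1 (-1)
  have h1 := hH.poincare hΩ.1 hR (hd ⟨0, hn1⟩)
  have h2 : ∫ x in Ω, (g ⟨0, hn1⟩ x - nodalGrad Ω M m ut ⟨0, hn1⟩ x) ^ 2 ≤
      gradNorm Ω (fun a x => g a x - nodalGrad Ω M m ut a x) ^ 2 := by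
    rw [gradNorm_sq]
    exact Finset.single_le_sum
      (f := fun a => ∫ x in Ω, (g a x - nodalGrad Ω M m ut a x) ^ 2)
      (fun a _ => integral_nonneg fun x => sq_nonneg _) (Finset.mem_univ _)
  have h3 := h1Norm_sq hΩ.1 hd
  rw [← gradNorm_sq] at h3
  refine abs_le_of_sq_le_sq' ?_ (mul_nonneg (Real.sqrt_nonneg _) (gradNorm_nonneg _)) |>.2
  rw [h3, mul_pow, Real.sq_sqrt (by positivity)]
  nlinarith [mul_le_mul_of_nonneg_left h2 (by positivity : 0 ≤ 4 * R ^ 2)]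

/-- The finite element functions approximate functions of `H² ∩ H¹₀` to first order. -/
theorem exists_gradNorm_sub_le (hn1 : 1 ≤ n) (hn : n ≤ 3) (hΩ : IsBoundedLipschitzDomain Ω)
    {κ : ℝ} (hκ : ShapeRegular κ M) (hu : MemH10 Ω u) (hu2 : MemSobolev 2 2 Ω u)
    {g : Fin n → Pt n → ℝ} (hg : ∀ a, HasWeakDeriv Ω ![a] u (g a))
    (hgL : ∀ a, MemLp (g a) 2 (volume.restrict Ω)) :
    ∃ c : Pt n → ℝ, gradNorm Ω (fun a x => g a x - nodalGrad Ω M m c a x) ≤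
      Real.sqrt (n * (4 * (n + 1) ^ 2 * (n + 1) ^ (n + 1))) * (2 * n ^ 2 * (n + 1) * |κ|) *
        ((1 / 2) ^ m * meshSize M * hSeminorm 2 Ω u) := by
  obtain ⟨d, G, hdG⟩ := hM.exists_fine_size_bounds hn1 hκ m
  have hH : ∀ b c, HasWeakDeriv Ω ![b, c] u (weakDeriv Ω ![b, c] u) ∧
      MemLp (weakDeriv Ω ![b, c] u) 2 (volume.restrict Ω) := by
    intro b c
    obtain ⟨H, h1, h2⟩ := hu2.2 2 le_rfl ![b, c]
    exact ⟨weakDeriv_spec ⟨H, h1⟩, h2.ae_eq (h1.weakDeriv_ae hΩ.1).symm⟩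
  -- The interpolation bound needs G²d⁴ = (Gd·d)², where Gd is fixed by shape regularity and d is at
  -- most n times the fine mesh size.
  set s : ℝ := 2 * n ^ 2 * (n + 1) * |κ| * ((1 / 2) ^ m * meshSize M) with hs
  have hs0 : 0 ≤ s := by
    have := meshSize_nonneg (M := M)
    positivity
  obtain ⟨c, hc⟩ := hM.exists_interpolant (m := m) hn hΩ hu hg hgL (fun b c => (hH b c).1)
    (fun b c => (hH b c).2) (sq_nonneg s) (fun t ht => (hdG t ht).2.1) (fun t ht => (hdG t ht).2.2.1)
    (fun t ht => by
      obtain ⟨-, hd, -, hGd, hdh⟩ := hdG t ht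
      have hd0 : 0 ≤ d t := (norm_nonneg _).trans (hd 0 0)
      have h1 : G t ^ 2 * d t ^ 4 = (G t * d t * d t) ^ 2 := by ring
      rw [h1, hGd]
      have h2 : 0 ≤ 2 * (n : ℝ) * (n + 1) * κ * d t := by
        have := hκ.1
        positivity
      refine pow_le_pow_left₀ h2 ?_ 2
      rw [hs, abs_of_pos hκ.1]
      refine (mul_le_mul_of_nonneg_left hdh (by have := hκ.1; positivity)).trans_eq ?_
      ring)
  refine ⟨c, abs_le_of_sq_le_sq' ?_ ?_ |>.2⟩
  · rw [gradNorm_sq]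
    refine (Finset.sum_le_sum fun b _ => hc b).trans_eq ?_
    rw [Finset.sum_const, Finset.card_univ, Fintype.card_fin, nsmul_eq_mul, ← hSeminorm_two_sq,
      mul_pow (Real.sqrt _ * _), mul_pow (Real.sqrt _), Real.sq_sqrt (by positivity), hs]
    ring
  · have := meshSize_nonneg (M := M)
    have := hSeminorm_nonneg 2 Ω u
    positivity

end IsMacroMesh

end Convergence

/-! ### Bookkeeping of constants. -/

section Constants

variable {lam B C₁ C₂ H k h₂ u₁ ε η s N : ℝ}

/-- H ≤ 1 reduces H^(r+1) to H, and the second bound on H makes C₁kH at most λ/2; the added 1 covers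
a vanishing denominator. -/
theorem perturbation_le_half {r : ℕ} (hC₁ : 0 ≤ C₁)
    (hH0 : 0 ≤ H) (hk : 0 ≤ k) (hH : H ≤ min 1 (lam / (2 * (C₁ * k + 1)))) :
    C₁ * (H ^ (r + 1) * k) ≤ lam / 2 := by
  have h1 : H ^ (r + 1) ≤ H :=
    pow_le_of_le_one hH0 (hH.trans (min_le_left _ _)) (Nat.succ_ne_zero r)
  have h2 : H * (2 * (C₁ * k + 1)) ≤ lam :=
    (le_div_iff₀ (by positivity)).1 (hH.trans (min_le_right _ _))
  have h3 : C₁ * (H ^ (r + 1) * k) ≤ C₁ * (H * k) := by gcongr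
  linarith

/-- The constants in Strang's lemma, for a perturbation `ε` and a best approximation error `η`. -/
theorem strang_bound_le {r : ℕ} (hlam : 0 < lam) (hB : 0 ≤ B) (hC₂ : 0 ≤ C₂) (hC₁ : 0 ≤ C₁)
    (hεle : ε ≤ lam / 2) (hη : η = C₂ * h₂) (hε : ε = C₁ * (H ^ (r + 1) * k))
    (hh₂ : 0 ≤ h₂) (hHk : 0 ≤ H ^ (r + 1) * k) (hu₁ : 0 ≤ u₁) (hs : 0 ≤ s) {n : ℕ} :
    s * (2 * (η + 2 / lam * (n * B * η + ε * (2 * (u₁ + η))))) ≤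
      (s * (2 * ((3 + 2 / lam * (n * |B|)) * C₂)) + s * (2 * (2 / lam * (2 * C₁))) + 1) *
        (h₂ + H ^ (r + 1) * k * u₁) := by
  have hη0 : 0 ≤ η := by rw [hη]; positivity
  -- The mixed term εη is absorbed with ε ≤ λ/2, so that no product of the two error contributions
  -- remains; this turns the leading constant 1 into 3.
  have h3 : 2 / lam * (ε * (2 * η)) ≤ 2 * η := by
    have : 2 / lam * (ε * (2 * η)) ≤ 2 / lam * (lam / 2 * (2 * η)) := by gcongr
    refine this.trans_eq ?_
    field_simp
  have h4 : 2 * (η + 2 / lam * (n * B * η + ε * (2 * (u₁ + η)))) ≤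
      2 * ((3 + 2 / lam * (n * |B|)) * C₂) * h₂ +
        2 * (2 / lam * (2 * C₁)) * (H ^ (r + 1) * k * u₁) := by
    have e1 : 2 * (η + 2 / lam * (n * B * η + ε * (2 * (u₁ + η)))) =
        2 * (η + 2 / lam * (n * B * η)) + 2 * (2 / lam * (ε * (2 * η))) +
          2 * (2 / lam * (ε * (2 * u₁))) := by ring
    have e2 : 2 * ((3 + 2 / lam * (n * |B|)) * C₂) * h₂ =
        2 * (η + 2 / lam * (n * B * η)) + 2 * (2 * η) := by rw [abs_of_nonneg hB, hη]; ring
    have e3 : 2 * (2 / lam * (2 * C₁)) * (H ^ (r + 1) * k * u₁) =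
        2 * (2 / lam * (ε * (2 * u₁))) := by rw [hε]; ring
    rw [e1, e2, e3]
    linarith
  have h5 : 0 ≤ H ^ (r + 1) * k * u₁ := mul_nonneg hHk hu₁
  have hD₁ : 0 ≤ s * (2 * ((3 + 2 / lam * (n * |B|)) * C₂)) := by positivity
  have hD₂ : 0 ≤ s * (2 * (2 / lam * (2 * C₁))) := by positivity
  refine (mul_le_mul_of_nonneg_left h4 hs).trans ?_
  have h6 := mul_nonneg hD₁ h5
  have h7 := mul_nonneg hD₂ hh₂
  nlinarith

end Constants

end SurrogateFEM

/-! ### The error estimate. -/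

theorem mainTheorem1 (n : ℕ) (hn1 : 1 ≤ n) (hn3 : n ≤ 3)
    (Ω : Set (Pt n)) (hΩ : IsBoundedLipschitzDomain Ω)
    (q r : ℕ) (hrq : r ≤ q)
    (κ cP lam B : ℝ) (hlam : 0 < lam) :
    ∃ C : ℝ, 0 < C ∧
      ∀ K : Pt n → Matrix (Fin n) (Fin n) ℝ,
        (∀ a b, MemSobolev (r + 1) ⊤ Ω (fun x => K x a b)) →
        IsEllipticTensor lam B Ω K →
        ∃ H₀ : ℝ, 0 < H₀ ∧
          ∀ (M : Finset (Simp n)) (m : ℕ) (P : Simp n → Pt n → (Pt n → ℝ) → (Pt n → ℝ))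
            (f : Pt n → ℝ),
            IsMacroMesh Ω M → ShapeRegular κ M → meshSize M ≤ H₀ →
            IsProjectionFamily q cP K M m P →
            MemLp f 2 (volume.restrict Ω) →
            (∃! ut, IsSurrogateSolution Ω K M m P f ut) ∧
            ∀ u ut : Pt n → ℝ, IsWeakSolution Ω K f u → MemSobolev 2 2 Ω u →
              IsSurrogateSolution Ω K M m P f ut →
              h1Norm Ω (fun x => u x - ut x) ≤
                C * ((1 / 2) ^ m * meshSize M * hSeminorm 2 Ω u +
                  meshSize M ^ (r + 1) * tensorSeminorm (r + 1) Ω K * hSeminorm 1 Ω u) := by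
  obtain ⟨R, hR⟩ := hΩ.2.2.1.exists_norm_le
  set C₁ : ℝ := (|cP| + 1) * n ^ (r + 1) * (2 * n ^ 2 * (n + 1) * κ) ^ 2 * (n + 1) ^ 2 * n with hC₁
  set C₂ : ℝ := Real.sqrt (n * (4 * (n + 1) ^ 2 * (n + 1) ^ (n + 1))) *
    (2 * n ^ 2 * (n + 1) * |κ|) with hC₂
  have hC₁0 : 0 ≤ C₁ := by positivity
  have hC₂0 : 0 ≤ C₂ := by positivity
  -- The tensor enters this constant only through λ and B, the domain only through its radius R in
  -- Poincaré's inequality. The final 1 guarantees positivity.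
  refine ⟨Real.sqrt (4 * R ^ 2 + 1) * (2 * ((3 + 2 / lam * (n * |B|)) * C₂)) +
    Real.sqrt (4 * R ^ 2 + 1) * (2 * (2 / lam * (2 * C₁))) + 1, by positivity, fun K hK hell => ?_⟩
  have hB : 0 ≤ B := hell.bound_nonneg hΩ.1 hΩ.2.1.nonempty hn1
  have hKm : ∀ a b, AEStronglyMeasurable (fun x => K x a b) (volume.restrict Ω) := fun a b =>
    (hK a b).1.aestronglyMeasurable
  set k := tensorSeminorm (r + 1) Ω K with hk
  have hk0 : 0 ≤ k := tensorSeminorm_nonneg _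
  -- The threshold depends on K through its seminorm `k`: it makes the relative perturbation at most
  -- half of the coercivity constant.
  refine ⟨min 1 (lam / (2 * (C₁ * k + 1))), by positivity, fun M m P f hM hκ hH hP hf => ?_⟩
  have hH0 : 0 ≤ meshSize M := meshSize_nonneg
  set ε : ℝ := C₁ * (meshSize M ^ (r + 1) * k) with hε
  have hε0 : 0 ≤ ε := by positivity
  have hεle : ε ≤ lam / 2 := perturbation_le_half hC₁0 hH0 hk0 hH
  have hpert : ∀ v w, |surrogateForm Ω K M m P v w -
      ∫ x in Ω, ∑ a, ∑ b, nodalGrad Ω M m v a x * K x a b * nodalGrad Ω M m w b x| ≤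
      ε * (gradNorm Ω (nodalGrad Ω M m v) * gradNorm Ω (nodalGrad Ω M m w)) := fun v w =>
    hM.abs_surrogateForm_sub_le hn1 hn3 hΩ hκ hrq hK hell hP v w
  refine ⟨hM.existsUnique_surrogateSolution hn1 hn3 hΩ hlam
    (hM.surrogateForm_coercive hn3 hΩ hKm hell hεle hpert) hf, fun u ut hu hu2 hut => ?_⟩
  choose g hg hgL using fun a => hu.1.1.2 1 le_rfl ![a]
  have hg1 : gradNorm Ω g = hSeminorm 1 Ω u := by
    rw [← Real.sqrt_sq (gradNorm_nonneg g), gradNorm_sq, ← hSeminorm_one_sq hΩ.1 hg,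
      Real.sqrt_sq (hSeminorm_nonneg _ _ _)]
  obtain ⟨c, hc⟩ := hM.exists_gradNorm_sub_le (m := m) hn1 hn3 hΩ hκ hu.1 hu2 hg hgL
  set h₂ : ℝ := (1 / 2) ^ m * meshSize M * hSeminorm 2 Ω u with hh₂
  have hh₂0 : 0 ≤ h₂ := by
    have := hSeminorm_nonneg 2 Ω u
    positivity
  have hu1 := hSeminorm_nonneg 1 Ω u
  set η := C₂ * h₂ with hη
  have h1 := hM.gradNorm_sub_surrogateSolution_le hn3 hΩ hlam hB hKm hell hε0 hεle hpert hu hg hgL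
    hut c hc
  rw [hg1] at h1
  have h2 := hM.h1Norm_sub_le hn1 hn3 hΩ hR hu.1 hg hut.1
  exact (h2.trans (mul_le_mul_of_nonneg_left h1 (Real.sqrt_nonneg _))).trans
    (strang_bound_le hlam hB hC₂0 hC₁0 hεle hη hε hh₂0 (by positivity) hu1 (Real.sqrt_nonneg _))
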